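/- Let $\{e_t\}_{t\in\mathbb Z}$ be independent (not necessarily identically distributed) real random variables with mean $0$ and variance $\sigma^2$, and let $\{x_t\}_{t\in\mathbb Z}$ be a (weakly) stationary process with $$x_t+\sum_{i=1}^{\infty}a_i x_{t-i}=e_t\quad\text{a.s.},\qquad t\in\mathbb Z .$$ Assume: (K.1)(b) $A(z)=1+\sum_{i\ge1}a_iz^i\ne0$ for all complex $|z|\le1$, and $\sum_{i\ge1}i^{1/2}|a_i|<\infty$; (K.2) there are $\alpha,\delta,C_0>0$ such that the distribution functions $F_t$ of $e_t$ satisfy $|F_t(u)-F_t(v)|\le C_0|u-v|^{\alpha}$ for all $t$ and all $|u-v|<\delta$; (K.3) $\sup_tE|e_t|^s<\infty$ for $s=1,2,\dots$; (K.4) $K_n$ are integers with $C_l\le K_n^{2+\delta_1}/n\le C_u$ for all large $n$, for some $\delta_1,C_l,C_u>0$; (K.5) $a_i\ne0$ for infinitely many $i$. Let $\{y_t\}$ be an independent copy of $\{x_t\}$. Put $N=n-K_n$, $\mathbf x_j(k)=(x_j,\dots,x_{j-k+1})'$, $\mathbf y_n(k)=(y_n,\dots,y_{n+1-k})'$, $\hat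 R_n(k)=N^{-1}\sum_{j=K_n}^{n-1}\mathbf x_j(k)\mathbf x_j'(k)$, $$\hat{\mathbf a}_n(k)=-\hat R_n^{-1}(k)\,\frac1N\sum_{j=K_n}^{n-1}\mathbf x_j(k)x_{j+1},\qquad \hat y_{n+1}(k)=-\mathbf y_n'(k)\hat{\mathbf a}_n(k),$$ $$\hat\sigma_k^2=\frac1N\sum_{t=K_n}^{n-1}\bigl(x_{t+1}+\mathbf x_t'(k)\hat{\mathbf a}_n(k)\bigr)^2,\qquad \tilde\sigma_k^2=\frac{N}{N-k}\hat\sigma_k^2 .$$ Let $\mathbf a(k)=(a_1(k),\dots,a_k(k))'$ minimize $E(x_{k+1}+\mathbf x_k'(k)\mathbf c)^2$ over $\mathbf c\in\mathbb R^k$, set $a_i(k)=0$ for $i>k$, and let $$L_n(k)=\frac kN\sigma^2+\sum_{i,j\ge1}(a_i-a_i(k))(a_j-a_j(k))\,E(x_ix_j).$$ Let $k_n^*$ be a minimizer of $L_n(k)$ over $1\le k\le K_n$. Let $\hat k_n$ be a measurable function of $x_1,\dots,x_n$ which, for all large $n$, almost surely minimizes over $1\le k\le K_n$ one fixed criterion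 among $$S_n(k)=(N+2k)\hat\sigma_k^2,\quad \mathrm{AIC}(k)=\log\hat\sigma_k^2+\frac{2k}{n},\quad \mathrm{FPE}(k)=\frac{n+k}{n-k}\hat\sigma_k^2,$$ $$S_p(k)=\Bigl(1+\frac{k}{N-k-1}\Bigr)\tilde\sigma_k^2,\quad C_p(k)=N\hat\sigma_k^2-(N-2k)s_n^2,$$ where in $C_p$ either $s_n^2=\tilde\sigma_{K_n}^2$ or $s_n^2=\hat\sigma_{K_n}^2$. Then $E(y_{n+1}-\hat y_{n+1}(\hat k_n))^2<\infty$ for all large $n$, and $$\lim_{n\to\infty}\frac{E\bigl(y_{n+1}-\hat y_{n+1}(\hat k_n)\bigr)^2-\sigma^2}{L_n(k_n^*)}=1 .$$ -/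

import Mathlib

open MeasureTheory ProbabilityTheory Filter Topology
open scoped Matrix

noncomputable section

namespace InfAR

/-! ### The time series model -/

section Model

variable {Ω : Type*} [MeasurableSpace Ω]

/-- `e` is a sequence of independent (not necessarily identically distributed) random variables
with mean zero and variance `σ ^ 2`. -/
structure IsNoise (μ : Measure Ω) (σ : ℝ) (e : ℤ → Ω → ℝ) : Prop where
  measurable : ∀ t, Measurable (e t)
  indep : iIndepFun e μ
  memLp : ∀ t, MemLp (e t) 2 μ
  mean : ∀ t, ∫ ω, e t ω ∂μ = 0
  variance : ∀ t, variance (e t) μ = σ ^ 2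

/-- `x` is a weakly (second order) stationary process. -/
structure IsStationary (μ : Measure Ω) (x : ℤ → Ω → ℝ) : Prop where
  measurable : ∀ t, Measurable (x t)
  memLp : ∀ t, MemLp (x t) 2 μ
  mean : ∀ t, ∫ ω, x t ω ∂μ = ∫ ω, x 0 ω ∂μ
  covariance : ∀ t h, covariance (x t) (x (t + h)) μ = covariance (x 0) (x h) μ

/-- The infinite-order autoregression `x_t + ∑_{i ≥ 1} a_i x_{t-i} = e_t` (almost surely, for
every integer `t`).  Only the values `a 1, a 2, …` are used. -/
def IsAutoregression (μ : Measure Ω) (a : ℕ → ℝ) (x e : ℤ → Ω → ℝ) : Prop :=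
  ∀ t : ℤ, ∀ᵐ ω ∂μ,
    HasSum (fun i : ℕ => a (i + 1) * x (t - ((i : ℤ) + 1)) ω) (e t ω - x t ω)

/-- `A(z) = 1 + a_1 z + a_2 z ^ 2 + ⋯` -/
def arSeries (a : ℕ → ℝ) (z : ℂ) : ℂ := 1 + ∑' i : ℕ, (a (i + 1) : ℂ) * z ^ (i + 1)

/-- The distribution functions of the `e_t` are locally Hölder continuous, uniformly in `t`. -/
def UniformHolderCDF (μ : Measure Ω) (e : ℤ → Ω → ℝ) : Prop :=
  ∃ α δ C₀ : ℝ, 0 < α ∧ 0 < δ ∧ 0 < C₀ ∧ ∀ (t : ℤ) (u v : ℝ), |u - v| < δ →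
    |cdf (μ.map (e t)) u - cdf (μ.map (e t)) v| ≤ C₀ * |u - v| ^ α

/-- `sup_t E |e_t| ^ s < ∞` for `s = 1, 2, …` -/
def UniformMoments (μ : Measure Ω) (e : ℤ → Ω → ℝ) : Prop :=
  ∀ s : ℕ, 1 ≤ s → ∃ C : ℝ, ∀ t : ℤ,
    Integrable (fun ω => |e t ω| ^ s) μ ∧ ∫ ω, |e t ω| ^ s ∂μ ≤ C

/-- The process `y` is an independent copy of the process `x`. -/
def IsIndepCopy (μ : Measure Ω) (x y : ℤ → Ω → ℝ) : Prop :=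
  IdentDistrib (fun ω t => y t ω) (fun ω t => x t ω) μ μ ∧
    IndepFun (fun ω t => x t ω) (fun ω t => y t ω) μ

end Model

/-- `C_l ≤ K_n ^ (2 + δ₁) / n ≤ C_u` for some positive `δ₁`, `C_l`, `C_u` and all large `n`. -/
def OrderGrowth (K : ℕ → ℕ) : Prop :=
  ∃ δ₁ Cl Cu : ℝ, 0 < δ₁ ∧ 0 < Cl ∧ 0 < Cu ∧ ∀ᶠ n : ℕ in atTop,
    Cl ≤ (K n : ℝ) ^ (2 + δ₁) / n ∧ (K n : ℝ) ^ (2 + δ₁) / n ≤ Cu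

/-! ### Estimators, as functions of a path `x : ℤ → ℝ`

Throughout, `K` is the maximal order for sample size `n`, `k` is the order of the fitted model, and
`N = n - K`.  For `k ≤ K < n`, only the observations `x 1, …, x n` enter. -/

/-- `(x_j, x_{j-1}, …, x_{j-k+1})` -/
def lagVec (x : ℤ → ℝ) (j : ℤ) (k : ℕ) : Fin k → ℝ := fun i => x (j - (i : ℕ))

/-- `N⁻¹ ∑_{j=K}^{n-1} x_j(k) x_j(k)'` -/
def Rhat (x : ℤ → ℝ) (K n k : ℕ) : Matrix (Fin k) (Fin k) ℝ :=
  (((n - K : ℕ) : ℝ)⁻¹) • ∑ j ∈ Finset.Ico K n, Matrix.vecMulVec (lagVec x j k) (lagVec x j k)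

/-- The least squares coefficients:
`- Rhat a = N⁻¹ ∑_{j=K}^{n-1} x_j(k) x_{j+1}`, solved for `a`. -/
def ahat (x : ℤ → ℝ) (K n k : ℕ) : Fin k → ℝ :=
  -((Rhat x K n k)⁻¹ *ᵥ
    ((((n - K : ℕ) : ℝ)⁻¹) • ∑ j ∈ Finset.Ico K n, x ((j : ℤ) + 1) • lagVec x j k))

/-- The predictor of `y_{n+1}` with coefficients estimated from `x_1, …, x_n`. -/
def predictor (x y : ℤ → ℝ) (K n k : ℕ) : ℝ := -(lagVec y n k ⬝ᵥ ahat x K n k)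

/-- Residual variance `N⁻¹ ∑_{t=K}^{n-1} (x_{t+1} + ahat_1 x_t + ⋯ + ahat_k x_{t+1-k}) ^ 2` -/
def residVar (x : ℤ → ℝ) (K n k : ℕ) : ℝ :=
  ((n - K : ℕ) : ℝ)⁻¹ *
    ∑ t ∈ Finset.Ico K n, (x ((t : ℤ) + 1) + ahat x K n k ⬝ᵥ lagVec x t k) ^ 2

/-- Residual variance corrected for degrees of freedom, `N / (N - k)` times `residVar`. -/
def residVarAdj (x : ℤ → ℝ) (K n k : ℕ) : ℝ :=
  ((n - K : ℕ) : ℝ) / (((n - K : ℕ) : ℝ) - k) * residVar x K n k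

/-- The order selection criteria.  `Cp` uses the corrected residual variance of the largest model
(as Mallows does), `CpUnadj` the uncorrected one. -/
inductive Criterion
  | S
  | AIC
  | FPE
  | Sp
  | Cp
  | CpUnadj

/-- Value of a criterion at the order `k`. -/
def Criterion.value (x : ℤ → ℝ) (K n k : ℕ) : Criterion → ℝ
  | .S => (((n - K : ℕ) : ℝ) + 2 * k) * residVar x K n k
  | .AIC => Real.log (residVar x K n k) + 2 * k / n
  | .FPE => (((n : ℝ) + k) / ((n : ℝ) - k)) * residVar x K n k
  | .Sp => (1 + (k : ℝ) / (((n - K : ℕ) : ℝ) - k - 1)) * residVarAdj x K n k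
  | .Cp => ((n - K : ℕ) : ℝ) * residVar x K n k
      - (((n - K : ℕ) : ℝ) - 2 * k) * residVarAdj x K n K
  | .CpUnadj => ((n - K : ℕ) : ℝ) * residVar x K n k
      - (((n - K : ℕ) : ℝ) - 2 * k) * residVar x K n K

/-- `k` minimizes `f` over `{1, …, K}`. -/
def IsArgmin (f : ℕ → ℝ) (K k : ℕ) : Prop :=
  k ∈ Finset.Icc 1 K ∧ ∀ l ∈ Finset.Icc 1 K, f k ≤ f l

/-! ### The population quantities -/

section Population

variable {Ω : Type*} [MeasurableSpace Ω]

/-- `m_k(c) = E (x_{k+1} + x_k(k)' c) ^ 2` -/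
def predErr (μ : Measure Ω) (x : ℤ → Ω → ℝ) (k : ℕ) (c : Fin k → ℝ) : ℝ :=
  ∫ ω, (x ((k : ℤ) + 1) ω + lagVec (fun t => x t ω) k k ⬝ᵥ c) ^ 2 ∂μ

/-- `a(k)`, the minimizer of `m_k`. -/
def bestCoef (μ : Measure Ω) (x : ℤ → Ω → ℝ) (k : ℕ) : Fin k → ℝ :=
  Classical.epsilon fun c => ∀ c' : Fin k → ℝ, predErr μ x k c ≤ predErr μ x k c'

/-- `a - a(k)` as an infinite vector; the entry with index `i` is `a_{i+1} - a_{i+1}(k)`, where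
`a_{i+1}(k) = 0` for `i + 1 > k`. -/
def coefDiff (μ : Measure Ω) (a : ℕ → ℝ) (x : ℤ → Ω → ℝ) (k : ℕ) (i : ℕ) : ℝ :=
  a (i + 1) - if h : i < k then bestCoef μ x k ⟨i, h⟩ else 0

/-- `‖d‖_R ^ 2 = ∑_{i,j ≥ 1} d_i d_j E (x_i x_j)`; the entry `d_{i+1}` is `d i`. -/
def normRSq (μ : Measure Ω) (x : ℤ → Ω → ℝ) (d : ℕ → ℝ) : ℝ :=
  ∑' i : ℕ, ∑' j : ℕ, d i * d j * ∫ ω, x ((i : ℤ) + 1) ω * x ((j : ℤ) + 1) ω ∂μ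

/-- `L_n(k) = (k / N) σ ^ 2 + ‖a - a(k)‖_R ^ 2` with `N = n - K`. -/
def L (μ : Measure Ω) (σ : ℝ) (a : ℕ → ℝ) (x : ℤ → Ω → ℝ) (K n k : ℕ) : ℝ :=
  (k : ℝ) / ((n - K : ℕ) : ℝ) * σ ^ 2 + normRSq μ x (coefDiff μ a x k)

end Population

end InfAR

end

/-! Write N = n − K_n and D(k) = N L_n(k) (`scaledLoss`). Conditioning on the sample turns the mean
squared error of predicting the independent copy into the expectation of `predErr` at the estimated
coefficients (`lintegral_predictor_sq`). It remains to compare the mean of N(predErr(â(k̂)) − σ²)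
with min D.

At a fixed order k, predErr(â(k)) − σ² is the squared bias plus the estimation error measured in the
covariance matrix R. Up to bias terms the latter is N⁻² S'R⁻¹S with S the score vector, and S'R⁻¹S
concentrates at Nkσ² (`score_quadratic_bound`). Least squares lowers the residual sum of squares by
N⁻¹ times the same form. Hence N(predErr(â(k)) − σ²) and Nσ̂²_k + 2kσ² − ∑e² both equal D(k) up to a
fluctuation (`fluctuation_spec`) whose L^q norm is O(√D + εD) with ε → 0 (`moment_fluctuation`).
Each criterion amounts to Nσ̂²_k + 2kσ² with an error of the same size (`criterion_transform`,
`moment_selectionError`), so its minimizer nearly minimizes D. Uniformity in k comes from high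
moments: D(k) ≥ kσ² makes the part of the errors above ηD(k), summed over all k ≤ K_n, bounded in
mean (`integral_excessSum_le`). Since infinitely many a_i are nonzero, min D → ∞
(`exists_scaledLoss_ge`), and bounded quantities are negligible.

All this takes place where the empirical autocovariances are close to the true ones (`goodEvent`);
the complement is smaller than any prescribed power of n. There a polynomial moment bound for
predErr(â) suffices (`integral_bad_le`). It is not obvious, because the empirical covariance matrix
may be almost singular. Hölder continuity of the distribution functions bounds small ball
probabilities, and a grid argument shows that near collinearity of the regressors is improbable
(`exists_collinear_bound`, `exists_predErr_moment`).

The moment bounds rest on two facts. A weighted Wiener lemma makes x a moving average of the noise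
with ∑ √(i+1)|b_i| < ∞ (`exists_summable_inverse`, `exists_causal`). Sums ∑ ψ(e_s) g_s with g_s
determined by the past obey a Burkholder type inequality (`exists_martingale_bound`), and every
fluctuation is decomposed into such sums. The weight √i also makes √(k+1) times the bias bounded
(`exists_bias_bound`). -/

namespace InfAR

/-! ### Inverses of power series with weighted absolutely summable coefficients -/

section Wiener

open scoped ENNReal
open PowerSeries

/-- The weighted norm `∑ √(m + 1) |f_m|` of a power series. -/
noncomputable def wnorm (f : PowerSeries ℂ) : ℝ≥0∞ :=
  ∑' m : ℕ, ENNReal.ofReal (√((m : ℝ) + 1)) * ‖coeff m f‖ₑ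

lemma ennreal_tsum_antidiagonal (F : ℕ × ℕ → ℝ≥0∞) :
    ∑' m : ℕ, ∑ p ∈ Finset.HasAntidiagonal.antidiagonal m, F p = ∑' i, ∑' j, F (i, j) := by
  rw [← ENNReal.tsum_prod, ← Finset.HasAntidiagonal.sigmaAntidiagonalEquivProd.tsum_eq F, ENNReal.tsum_sigma']
  refine tsum_congr fun m => ?_
  rw [← Finset.tsum_subtype]
  rfl

/-- Submultiplicativity of the weight is what makes `wnorm` an algebra norm; it comes from i + j + 1
≤ (i + 1)(j + 1). -/
lemma sqrt_add_add_one_le (i j : ℕ) :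
    √(((i + j : ℕ) : ℝ) + 1) ≤ √((i : ℝ) + 1) * √((j : ℝ) + 1) := by
  rw [← Real.sqrt_mul (by positivity)]
  refine Real.sqrt_le_sqrt ?_
  push_cast
  nlinarith [mul_nonneg (Nat.cast_nonneg (α := ℝ) i) (Nat.cast_nonneg (α := ℝ) j)]

lemma wnorm_mul_le (f g : PowerSeries ℂ) : wnorm (f * g) ≤ wnorm f * wnorm g := by
  have h1 : wnorm f * wnorm g = ∑' m : ℕ, ∑ p ∈ Finset.HasAntidiagonal.antidiagonal m,
      (ENNReal.ofReal (√((p.1 : ℝ) + 1)) * ‖coeff p.1 f‖ₑ) *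
        (ENNReal.ofReal (√((p.2 : ℝ) + 1)) * ‖coeff p.2 g‖ₑ) := by
    rw [ennreal_tsum_antidiagonal (fun p : ℕ × ℕ =>
      (ENNReal.ofReal (√((p.1 : ℝ) + 1)) * ‖coeff p.1 f‖ₑ) *
        (ENNReal.ofReal (√((p.2 : ℝ) + 1)) * ‖coeff p.2 g‖ₑ))]
    simp_rw [ENNReal.tsum_mul_left, ENNReal.tsum_mul_right]
    rfl
  rw [h1, wnorm]
  refine ENNReal.tsum_le_tsum fun m => ?_
  rw [coeff_mul]
  calc ENNReal.ofReal (√((m : ℝ) + 1)) *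
        ‖∑ p ∈ Finset.HasAntidiagonal.antidiagonal m, coeff p.1 f * coeff p.2 g‖ₑ
      ≤ ENNReal.ofReal (√((m : ℝ) + 1)) *
        ∑ p ∈ Finset.HasAntidiagonal.antidiagonal m, ‖coeff p.1 f * coeff p.2 g‖ₑ := by
        gcongr; exact enorm_sum_le _ _
    _ ≤ _ := by
        rw [Finset.mul_sum]
        refine Finset.sum_le_sum fun p hp => ?_
        rw [Finset.HasAntidiagonal.mem_antidiagonal] at hp
        have h2 : ENNReal.ofReal (√((m : ℝ) + 1)) ≤
            ENNReal.ofReal (√((p.1 : ℝ) + 1)) * ENNReal.ofReal (√((p.2 : ℝ) + 1)) := by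
          rw [← ENNReal.ofReal_mul (by positivity), ← hp]
          exact ENNReal.ofReal_le_ofReal (sqrt_add_add_one_le _ _)
        rw [enorm_mul]
        calc _ ≤ ENNReal.ofReal (√((p.1 : ℝ) + 1)) * ENNReal.ofReal (√((p.2 : ℝ) + 1)) *
              (‖coeff p.1 f‖ₑ * ‖coeff p.2 g‖ₑ) := by gcongr
          _ = _ := by ring

lemma wnorm_one : wnorm 1 = 1 := by
  rw [wnorm, tsum_eq_single 0]
  · simp
  · intro m hm; simp [coeff_one, hm]

lemma wnorm_pow_le (f : PowerSeries ℂ) (n : ℕ) : wnorm (f ^ n) ≤ wnorm f ^ n := by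
  induction n with
  | zero => simp [wnorm_one]
  | succ n ih => rw [pow_succ, pow_succ]; exact (wnorm_mul_le _ _).trans (by gcongr)

/-- If `P` is a polynomial and `P g = 1` near `0`, then the Taylor series of `g` is the inverse
of `P` as a formal power series. -/
lemma polynomial_mul_mk_eq_one (P : Polynomial ℂ) (g : ℂ → ℂ)
    (c : FormalMultilinearSeries ℂ ℂ ℂ) (ρ : ℝ≥0∞) (hg : HasFPowerSeriesOnBall g c 0 ρ)
    (h : ∀ z ∈ Metric.eball (0 : ℂ) ρ, P.eval z * g z = 1) :
    (P : PowerSeries ℂ) * PowerSeries.mk (fun m => c.coeff m) = 1 := by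
  set F : PowerSeries ℂ := (P : PowerSeries ℂ) * PowerSeries.mk (fun m => c.coeff m) with hF
  have key : ∀ z ∈ Metric.eball (0 : ℂ) ρ, HasSum (fun m => z ^ m • coeff m F) 1 := by
    intro z hz
    have h1 : HasSum (fun m => z ^ m * c.coeff m) (g z) := by
      have := hg.hasSum hz
      simpa [FormalMultilinearSeries.apply_eq_pow_smul_coeff] using this
    have h2 : HasSum (fun m => P.coeff m * z ^ m) (P.eval z) := by
      rw [Polynomial.eval_eq_sum_range]
      refine hasSum_sum_of_ne_finset_zero fun m hm => ?_
      rw [P.coeff_eq_zero_of_natDegree_lt (by simpa using hm), zero_mul]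
    have n1 : Summable fun m => ‖z ^ m * c.coeff m‖ := h1.summable.norm
    have n2 : Summable fun m => ‖P.coeff m * z ^ m‖ := h2.summable.norm
    have h3 := tsum_mul_tsum_eq_tsum_sum_antidiagonal_of_summable_norm n2 n1
    have h4 := (summable_norm_sum_mul_antidiagonal_of_summable_norm n2 n1).of_norm
    rw [h1.tsum_eq, h2.tsum_eq, h z hz] at h3
    have h5 : (fun m => z ^ m • coeff m F) = fun m => ∑ kl ∈ Finset.HasAntidiagonal.antidiagonal m,
        P.coeff kl.1 * z ^ kl.1 * (z ^ kl.2 * c.coeff kl.2) := by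
      funext m
      rw [hF, coeff_mul, smul_eq_mul, Finset.mul_sum]
      refine Finset.sum_congr rfl fun kl hkl => ?_
      rw [Finset.HasAntidiagonal.mem_antidiagonal] at hkl
      rw [← hkl, pow_add, Polynomial.coeff_coe, coeff_mk]
      ring
    rw [h5, h3]
    exact h4.hasSum
  have hev : ∀ᶠ z in 𝓝 (0 : ℂ), z ∈ Metric.eball (0 : ℂ) ρ :=
    Metric.eball_mem_nhds _ hg.r_pos
  -- The formal product and the constant series both represent the function 1 near 0, so uniqueness
  -- of power series expansions identifies them.
  have e1 : HasFPowerSeriesAt (fun _ : ℂ => (1 : ℂ))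
      (FormalMultilinearSeries.ofScalars ℂ (fun m => coeff m F)) 0 := by
    rw [hasFPowerSeriesAt_iff]
    filter_upwards [hev] with z hz
    simpa using key z hz
  have e2 : HasFPowerSeriesAt (fun _ : ℂ => (1 : ℂ)) (constFormalMultilinearSeries ℂ ℂ (1 : ℂ)) 0 :=
    hasFPowerSeriesAt_const
  have e3 := e1.eq_formalMultilinearSeries e2
  ext m
  have e4 := congrArg (fun s => FormalMultilinearSeries.coeff s m) e3
  simp only [FormalMultilinearSeries.coeff_ofScalars] at e4
  rw [e4, coeff_one]
  rcases Nat.eq_zero_or_pos m with rfl | hm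
  · simp [FormalMultilinearSeries.coeff]
  · rw [if_neg hm.ne']
    simp [FormalMultilinearSeries.coeff, constFormalMultilinearSeries_apply_of_nonzero hm.ne']

/-- Cauchy estimates for the powers of the reciprocal of a polynomial. -/
lemma exists_inverse_pow_bound (P : Polynomial ℂ) (ρ : NNReal) (s : ℝ) (hρ : 0 < ρ) (hs : 0 < s)
    (h : ∀ z : ℂ, ‖z‖ ≤ ρ → s ≤ ‖P.eval z‖) (n : ℕ) :
    ∃ G : PowerSeries ℂ, (P : PowerSeries ℂ) ^ n * G = 1 ∧
      ∀ m, ‖coeff m G‖ ≤ (s⁻¹) ^ n * ((ρ : ℝ)⁻¹) ^ m := by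
  -- The m-th Taylor coefficient of g is bounded by the mean of |g| over the circle |z| = ρ, divided
  -- by ρ^m; on that circle |g| ≤ s⁻ⁿ.
  set g : ℂ → ℂ := fun z => ((P.eval z) ^ n)⁻¹ with hgdef
  have hne : ∀ z : ℂ, ‖z‖ ≤ ρ → P.eval z ≠ 0 := fun z hz h0 => by
    have := h z hz; rw [h0, norm_zero] at this; linarith
  have hd : DifferentiableOn ℂ g (Metric.closedBall 0 ρ) := by
    intro z hz
    have : DifferentiableAt ℂ g z := by
      refine DifferentiableAt.inv (P.differentiableAt.pow n) ?_
      exact pow_ne_zero _ (hne z (by simpa using hz))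
    exact this.differentiableWithinAt
  have hfp := hd.hasFPowerSeriesOnBall hρ
  refine ⟨PowerSeries.mk fun m => (cauchyPowerSeries g 0 ρ).coeff m, ?_, fun m => ?_⟩
  · have := polynomial_mul_mk_eq_one (P ^ n) g _ _ hfp (fun z hz => by
      have hz' : ‖z‖ ≤ ρ := by
        rw [Metric.mem_eball, edist_zero_right] at hz
        have h2 : ‖z‖₊ < ρ := by rw [enorm_eq_nnnorm] at hz; exact_mod_cast hz
        exact_mod_cast h2.le
      rw [Polynomial.eval_pow]
      exact mul_inv_cancel₀ (pow_ne_zero _ (hne z hz')))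
    rwa [Polynomial.coe_pow] at this
  · rw [coeff_mk, FormalMultilinearSeries.coeff]
    have h1 : ‖(cauchyPowerSeries g 0 ρ) m 1‖ ≤ ‖cauchyPowerSeries g 0 ρ m‖ := by
      refine (ContinuousMultilinearMap.le_opNorm _ _).trans ?_
      simp
    refine h1.trans ((norm_cauchyPowerSeries_le g 0 ρ m).trans ?_)
    have h2 : (2 * Real.pi)⁻¹ * ∫ θ in (0)..2 * Real.pi, ‖g (circleMap 0 ρ θ)‖ ≤ (s⁻¹) ^ n := by
      have h3 : ∀ θ ∈ Set.uIoc 0 (2 * Real.pi), ‖‖g (circleMap 0 ρ θ)‖‖ ≤ (s⁻¹) ^ n := by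
        intro θ _
        rw [norm_norm, hgdef, norm_inv, norm_pow, ← inv_pow]
        have h4 : ‖circleMap 0 ρ θ‖ ≤ ρ := by simp
        have := h _ h4
        gcongr
      have h5 := intervalIntegral.norm_integral_le_of_norm_le_const h3
      have h6 := (le_abs_self _).trans h5
      rw [sub_zero, abs_of_pos Real.two_pi_pos] at h6
      rw [inv_mul_le_iff₀ Real.two_pi_pos]
      linarith
    have h7 : |(ρ : ℝ)| = ρ := abs_of_pos hρ
    rw [h7]
    gcongr

set_option maxHeartbeats 800000 in
/-- **Wiener's lemma** on the disc, with weights `√(i + 1)`. -/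
theorem exists_summable_inverse (α : ℕ → ℝ) (h0 : α 0 = 1)
    (hs : Summable fun i : ℕ => √((i : ℝ) + 1) * |α i|)
    (hz : ∀ z : ℂ, ‖z‖ ≤ 1 → ∑' i, (α i : ℂ) * z ^ i ≠ 0) :
    ∃ b : ℕ → ℝ, (Summable fun i : ℕ => √((i : ℝ) + 1) * |b i|) ∧
      ∀ m, ∑ p ∈ Finset.HasAntidiagonal.antidiagonal m, α p.1 * b p.2 = if m = 0 then 1 else 0 := by
  -- Newman's argument. A polynomial P is taken with `wnorm` (P − A) ≤ δ but |P| ≥ s = 3δ/2 on a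
  -- disc of radius ρ > 1. Then 1/A = ∑ (P − A)ⁿ / P^(n+1), and the Cauchy estimates bound `wnorm`
  -- (1/Pⁿ) by W s⁻ⁿ, so the series converges in the weighted norm with ratio δ/s = 2/3.
  have hw1 : ∀ i : ℕ, (1 : ℝ) ≤ √((i : ℝ) + 1) := fun i => by
    rw [Real.one_le_sqrt]; linarith [Nat.cast_nonneg (α := ℝ) i]
  have hsabs : Summable fun i => |α i| := by
    refine Summable.of_nonneg_of_le (fun i => abs_nonneg _) (fun i => ?_) hs
    exact le_mul_of_one_le_left (abs_nonneg _) (hw1 i)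
  have hbound : ∀ (i : ℕ) (z : ℂ), ‖z‖ ≤ 1 → ‖(α i : ℂ) * z ^ i‖ ≤ |α i| := by
    intro i z hz1
    rw [norm_mul, norm_pow, Complex.norm_real, Real.norm_eq_abs]
    exact mul_le_of_le_one_right (abs_nonneg _) (pow_le_one₀ (norm_nonneg _) hz1)
  -- a positive lower bound on the disc
  obtain ⟨δ, hδ, hδA⟩ : ∃ δ : ℝ, 0 < δ ∧ ∀ z : ℂ, ‖z‖ ≤ 1 →
      3 * δ ≤ ‖∑' i, (α i : ℂ) * z ^ i‖ := by
    have hcont : ContinuousOn (fun z : ℂ => ∑' i, (α i : ℂ) * z ^ i) (Metric.closedBall 0 1) := by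
      refine continuousOn_tsum (fun i => by fun_prop) hsabs (fun i z hz1 => ?_)
      exact hbound i z (by simpa using hz1)
    obtain ⟨z₀, hz₀, hmin⟩ := (isCompact_closedBall (0 : ℂ) 1).exists_isMinOn
      ⟨0, by simp⟩ hcont.norm
    refine ⟨‖∑' i, (α i : ℂ) * z₀ ^ i‖ / 3, ?_, fun z hz1 => ?_⟩
    · have := hz z₀ (by simpa using hz₀)
      positivity
    · have := hmin (show z ∈ Metric.closedBall (0 : ℂ) 1 by simpa using hz1)
      simp only [Set.mem_ofPred_eq] at this
      linarith
  -- truncation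
  obtain ⟨M, hM1, hMtail⟩ : ∃ M : ℕ, 1 ≤ M ∧
      ∑' i, √(((i + M : ℕ) : ℝ) + 1) * |α (i + M)| ≤ δ := by
    have h1 := tendsto_sum_nat_add fun i : ℕ => √((i : ℝ) + 1) * |α i|
    have h2 := (h1.eventually (ge_mem_nhds hδ)).and (eventually_ge_atTop 1)
    obtain ⟨M, hM⟩ := h2.exists
    exact ⟨M, hM.2, hM.1⟩
  set P : Polynomial ℂ := ∑ i ∈ Finset.range M, Polynomial.monomial i (α i : ℂ) with hP
  have hPcoeff : ∀ i, P.coeff i = if i < M then (α i : ℂ) else 0 := by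
    intro i
    rw [hP, Polynomial.finsetSum_coeff]
    simp [Polynomial.coeff_monomial]
  have hPeval : ∀ z, P.eval z = ∑ i ∈ Finset.range M, (α i : ℂ) * z ^ i := by
    intro z
    rw [hP, Polynomial.eval_finsetSum]
    simp
  have hPlow : ∀ z : ℂ, ‖z‖ ≤ 1 → 2 * δ ≤ ‖P.eval z‖ := by
    intro z hz1
    have hsum : Summable fun i => (α i : ℂ) * z ^ i :=
      Summable.of_norm_bounded hsabs fun i => hbound i z hz1
    have h1 := hsum.sum_add_tsum_nat_add M
    have h2 : ‖∑' i, (α (i + M) : ℂ) * z ^ (i + M)‖ ≤ δ := by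
      refine le_trans (tsum_of_norm_bounded
        (((summable_nat_add_iff M).2 hs).hasSum) fun i => ?_) hMtail
      exact (hbound _ z hz1).trans (le_mul_of_one_le_left (abs_nonneg _) (by exact_mod_cast hw1 _))
    have h3 := hδA z hz1
    rw [← h1] at h3
    rw [hPeval]
    have := norm_add_le (∑ i ∈ Finset.range M, (α i : ℂ) * z ^ i)
      (∑' i, (α (i + M) : ℂ) * z ^ (i + M))
    linarith
  -- Uniform continuity allows a radius above 1 at the cost of δ/2; then ρ⁻ᵐ is summable against the
  -- weights.
  obtain ⟨ρ, hρ1, hρ⟩ : ∃ ρ : NNReal, 1 < ρ ∧ ∀ z : ℂ, ‖z‖ ≤ ρ → 3 / 2 * δ ≤ ‖P.eval z‖ := by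
    have huc := (isCompact_closedBall (0 : ℂ) 2).uniformContinuousOn_of_continuous
      (P.continuous.continuousOn)
    rw [Metric.uniformContinuousOn_iff] at huc
    obtain ⟨η, hη, hηP⟩ := huc (δ / 2) (by linarith)
    set r : ℝ := 1 + min (η / 2) 1 with hr
    have hm : 0 < min (η / 2) 1 := lt_min (by linarith) one_pos
    have hr1 : 1 < r := by linarith
    refine ⟨⟨r, by linarith⟩, by exact_mod_cast hr1, fun z hzr => ?_⟩
    have hzr' : ‖z‖ ≤ r := hzr
    have hr2 : r ≤ 2 := by linarith [min_le_right (η / 2) 1]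
    have hw : ‖z / (r : ℂ)‖ ≤ 1 := by
      rw [norm_div, Complex.norm_real, Real.norm_eq_abs, abs_of_pos (by linarith)]
      exact div_le_one_of_le₀ hzr' (by linarith)
    have hdist : dist z (z / (r : ℂ)) < η := by
      have hrne : (r : ℂ) ≠ 0 := by exact_mod_cast (by linarith : r ≠ 0)
      have : z - z / (r : ℂ) = (z / (r : ℂ)) * ((r - 1 : ℝ) : ℂ) := by
        push_cast; field_simp
      rw [dist_eq_norm, this, norm_mul, Complex.norm_real, Real.norm_eq_abs,
        abs_of_pos (by linarith)]
      calc ‖z / (r : ℂ)‖ * (r - 1) ≤ 1 * (r - 1) := by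
            apply mul_le_mul_of_nonneg_right hw; linarith
        _ < η := by linarith [min_le_left (η / 2) 1]
    have h1 := hηP z (by simpa using hzr'.trans hr2) (z / (r : ℂ))
      (by simpa using hw.trans one_le_two) hdist
    have h2 := hPlow _ hw
    rw [dist_eq_norm] at h1
    have h3 := norm_sub_norm_le (P.eval (z / (r : ℂ))) (P.eval z)
    rw [norm_sub_rev] at h3
    linarith
  have hρ0 : 0 < ρ := lt_trans one_pos hρ1
  set s : ℝ := 3 / 2 * δ with hsdef
  have hspos : 0 < s := by positivity
  obtain ⟨H, hPH, -⟩ := exists_inverse_pow_bound P ρ s hρ0 hspos hρ 1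
  rw [pow_one] at hPH
  -- weighted norm of the powers of the reciprocal
  set W : ℝ≥0∞ := ∑' m : ℕ, ENNReal.ofReal (√((m : ℝ) + 1) * ((ρ : ℝ)⁻¹) ^ m) with hW
  have hWfin : W ≠ ⊤ := by
    have : Summable fun m : ℕ => √((m : ℝ) + 1) * ((ρ : ℝ)⁻¹) ^ m := by
      have hlt : ‖((ρ : ℝ)⁻¹)‖ < 1 := by
        rw [norm_inv, Real.norm_eq_abs, abs_of_pos (by exact_mod_cast hρ0)]
        exact inv_lt_one_of_one_lt₀ (by exact_mod_cast hρ1)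
      have h1 := summable_pow_mul_geometric_of_norm_lt_one 1 hlt
      have h2 := summable_geometric_of_norm_lt_one hlt
      refine Summable.of_nonneg_of_le (fun m => by positivity) (fun m => ?_) (h1.add h2)
      have h3 : √((m : ℝ) + 1) ≤ (m : ℝ) + 1 := by
        rw [Real.sqrt_le_left (by positivity)]
        nlinarith [Nat.cast_nonneg (α := ℝ) m]
      calc _ ≤ ((m : ℝ) + 1) * ((ρ : ℝ)⁻¹) ^ m := by gcongr
        _ = _ := by ring
    exact this.tsum_ofReal_ne_top
  have hHn : ∀ n, wnorm (H ^ n) ≤ ENNReal.ofReal (s⁻¹) ^ n * W := by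
    intro n
    obtain ⟨G, hG, hGb⟩ := exists_inverse_pow_bound P ρ s hρ0 hspos hρ n
    have hGH : H ^ n = G := by
      have : H ^ n * ((P : PowerSeries ℂ) ^ n * G) = G := by
        rw [← mul_assoc, ← mul_pow, mul_comm H, hPH, one_pow, one_mul]
      rw [← this, hG, mul_one]
    rw [hGH, wnorm, hW, ← ENNReal.tsum_mul_left]
    refine ENNReal.tsum_le_tsum fun m => ?_
    rw [← ENNReal.ofReal_pow (by positivity), ← ENNReal.ofReal_mul (by positivity),
      ← ofReal_norm, ← ENNReal.ofReal_mul (by positivity)]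
    refine ENNReal.ofReal_le_ofReal ?_
    calc _ ≤ √((m : ℝ) + 1) * ((s⁻¹) ^ n * ((ρ : ℝ)⁻¹) ^ m) := by gcongr; exact hGb m
      _ = _ := by ring
  set f : PowerSeries ℂ := PowerSeries.mk fun i => (α i : ℂ) with hf
  set q : PowerSeries ℂ := (P : PowerSeries ℂ) - f with hq
  have hqc : ∀ i, coeff i q = if i < M then 0 else -(α i : ℂ) := by
    intro i
    rw [hq, map_sub, Polynomial.coeff_coe, hPcoeff, hf, coeff_mk]
    split_ifs <;> simp
  have hqn : wnorm q ≤ ENNReal.ofReal δ := by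
    set u : ℕ → ℝ := fun i => if i < M then 0 else √((i : ℝ) + 1) * |α i| with hu
    have hu0 : ∀ i, 0 ≤ u i := fun i => by
      simp only [hu]; split_ifs <;> positivity
    have hus : Summable u := by
      refine Summable.of_nonneg_of_le hu0 (fun i => ?_) hs
      simp only [hu]; split_ifs
      · positivity
      · exact le_rfl
    have hut : ∑' i, u i ≤ δ := by
      rw [← hus.sum_add_tsum_nat_add M, Finset.sum_eq_zero, zero_add]
      · refine le_of_eq_of_le (tsum_congr fun i => ?_) hMtail
        simp [hu]
      · intro i hi
        simp only [hu]; rw [if_pos (Finset.mem_range.1 hi)]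
    have h1 : wnorm q = ∑' i, ENNReal.ofReal (u i) := by
      refine tsum_congr fun i => ?_
      rw [hqc]
      simp only [hu]
      split_ifs
      · simp
      · rw [enorm_neg, ← ofReal_norm, Complex.norm_real, Real.norm_eq_abs,
          ENNReal.ofReal_mul (by positivity)]
    rw [h1, ← ENNReal.ofReal_tsum_of_nonneg hu0 hus]
    exact ENNReal.ofReal_le_ofReal hut
  -- The formal inverse is formed over ℝ, so that b is real, and only its size is estimated over ℂ.
  set fR : PowerSeries ℝ := PowerSeries.mk α with hfR
  have hfR0 : constantCoeff fR ≠ 0 := by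
    rw [← coeff_zero_eq_constantCoeff_apply, hfR, coeff_mk, h0]; exact one_ne_zero
  set B : PowerSeries ℂ := PowerSeries.map Complex.ofRealHom fR⁻¹ with hB
  have hfB : f * B = 1 := by
    have h1 : f = PowerSeries.map Complex.ofRealHom fR := by
      ext i; simp [hf, hfR]
    rw [h1, hB, ← map_mul, PowerSeries.mul_inv_cancel _ hfR0, map_one]
  -- Because M ≥ 1, q has no constant term. The remainder after T terms of the geometric expansion
  -- therefore has no coefficient below T, and each coefficient of B is given exactly by a finite
  -- sum.
  have hXq : ∀ T, (X : PowerSeries ℂ) ^ T ∣ q ^ T := by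
    intro T
    refine pow_dvd_pow_of_dvd ?_ T
    have := (X_pow_dvd_iff (n := 1) (φ := q)).2 (fun m hm => by rw [hqc, if_pos (by omega)])
    simpa using this
  have hBexp : ∀ T, B = ∑ n ∈ Finset.range T, q ^ n * H ^ (n + 1) + B * (q * H) ^ T := by
    intro T
    have h1 : f * H = 1 - q * H := by
      rw [hq, sub_mul, hPH]; ring
    have h2 := geom_sum_mul_neg (q * H) T
    rw [← h1] at h2
    have h3 : ∑ n ∈ Finset.range T, q ^ n * H ^ (n + 1) =
        B * ((∑ n ∈ Finset.range T, (q * H) ^ n) * (f * H)) := by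
      have : B * ((∑ n ∈ Finset.range T, (q * H) ^ n) * (f * H)) =
          (f * B) * ((∑ n ∈ Finset.range T, (q * H) ^ n) * H) := by ring
      rw [this, hfB, one_mul, Finset.sum_mul]
      refine Finset.sum_congr rfl fun n _ => ?_
      rw [mul_pow]; ring
    rw [h3, h2]; ring
  have hBc : ∀ m, ‖coeff m B‖ₑ ≤ ∑' n, ‖coeff m (q ^ n * H ^ (n + 1))‖ₑ := by
    intro m
    have h1 : coeff m (B * (q * H) ^ (m + 1)) = 0 := by
      have : (X : PowerSeries ℂ) ^ (m + 1) ∣ B * (q * H) ^ (m + 1) := by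
        rw [mul_pow]
        exact ((hXq (m + 1)).mul_right _).mul_left _
      exact X_pow_dvd_iff.1 this m (Nat.lt_succ_self m)
    rw [hBexp (m + 1), map_add, h1, add_zero, map_sum]
    exact (enorm_sum_le _ _).trans (ENNReal.sum_le_tsum _)
  have hBn : wnorm B ≠ ⊤ := by
    have h1 : wnorm B ≤ ∑' n, wnorm (q ^ n * H ^ (n + 1)) := by
      simp_rw [wnorm]
      rw [ENNReal.tsum_comm]
      refine ENNReal.tsum_le_tsum fun m => ?_
      rw [ENNReal.tsum_mul_left]
      gcongr
      exact hBc m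
    have h2 : ∀ n, wnorm (q ^ n * H ^ (n + 1)) ≤
        ENNReal.ofReal (s⁻¹) * W * ENNReal.ofReal (2 / 3) ^ n := by
      intro n
      calc _ ≤ wnorm (q ^ n) * wnorm (H ^ (n + 1)) := wnorm_mul_le _ _
        _ ≤ ENNReal.ofReal δ ^ n * (ENNReal.ofReal (s⁻¹) ^ (n + 1) * W) := by
            gcongr
            · exact (wnorm_pow_le _ _).trans (by gcongr)
            · exact hHn _
        _ = ENNReal.ofReal (s⁻¹) * W * (ENNReal.ofReal δ * ENNReal.ofReal (s⁻¹)) ^ n := by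
            rw [mul_pow]; ring
        _ = _ := by
            rw [← ENNReal.ofReal_mul hδ.le]
            congr 3
            rw [hsdef]; field_simp
    refine ne_top_of_le_ne_top ?_ (h1.trans (ENNReal.tsum_le_tsum h2))
    rw [ENNReal.tsum_mul_left, ENNReal.tsum_geometric]
    refine ENNReal.mul_ne_top (ENNReal.mul_ne_top ENNReal.ofReal_ne_top hWfin) ?_
    rw [ENNReal.inv_ne_top]
    refine (tsub_pos_of_lt ?_).ne'
    rw [← ENNReal.ofReal_one]
    exact (ENNReal.ofReal_lt_ofReal_iff one_pos).2 (by norm_num)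
  refine ⟨fun i => coeff i fR⁻¹, ?_, fun m => ?_⟩
  · have h1 : wnorm B = ∑' i : ℕ, ENNReal.ofReal (√((i : ℝ) + 1) * |coeff i fR⁻¹|) := by
      rw [wnorm]
      refine tsum_congr fun i => ?_
      rw [hB, coeff_map, ← ofReal_norm, ENNReal.ofReal_mul (by positivity)]
      simp
    rw [h1] at hBn
    have := ENNReal.summable_toReal hBn
    refine this.congr fun i => ?_
    rw [ENNReal.toReal_ofReal (by positivity)]
  · have h1 := congrArg (coeff m) (PowerSeries.mul_inv_cancel fR hfR0)
    rw [coeff_mul, coeff_one] at h1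
    simpa [hfR] using h1

end Wiener

/-! ### Moment bounds -/

section Moments

open scoped ENNReal

variable {Ω : Type*} [MeasurableSpace Ω] {μ : Measure Ω}

/-- The `L^q` norm of `f` is at most `c`. -/
def MomentLE (μ : Measure Ω) (q : ℕ) (f : Ω → ℝ) (c : ℝ) : Prop :=
  AEStronglyMeasurable f μ ∧ eLpNorm f q μ ≤ ENNReal.ofReal c

namespace MomentLE

variable {q : ℕ} {f g : Ω → ℝ} {c d : ℝ}

lemma memLp (h : MomentLE μ q f c) : MemLp f q μ := ⟨h.1, h.2.trans_lt ENNReal.ofReal_lt_top⟩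

lemma mono (h : MomentLE μ q f c) (hcd : c ≤ d) : MomentLE μ q f d :=
  ⟨h.1, h.2.trans (ENNReal.ofReal_le_ofReal hcd)⟩

lemma congr (h : MomentLE μ q f c) (hfg : f =ᵐ[μ] g) : MomentLE μ q g c :=
  ⟨h.1.congr hfg, (eLpNorm_congr_ae hfg).symm ▸ h.2⟩

lemma of_le (h : MomentLE μ q g c) (hf : AEStronglyMeasurable f μ)
    (hfg : ∀ᵐ ω ∂μ, |f ω| ≤ |g ω|) : MomentLE μ q f c :=
  ⟨hf, (eLpNorm_mono_ae (by simpa using hfg)).trans h.2⟩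

lemma abs (h : MomentLE μ q f c) : MomentLE μ q (fun ω => |f ω|) c :=
  h.of_le h.1.norm (by simp)

lemma add (hq : 1 ≤ q) (hc : 0 ≤ c) (hd : 0 ≤ d) (hf : MomentLE μ q f c) (hg : MomentLE μ q g d) :
    MomentLE μ q (fun ω => f ω + g ω) (c + d) :=
  ⟨hf.1.add hg.1, (eLpNorm_add_le hf.1 hg.1 (by exact_mod_cast hq)).trans
    ((add_le_add hf.2 hg.2).trans (ENNReal.ofReal_add hc hd).ge)⟩

lemma const_mul (r : ℝ) (hf : MomentLE μ q f c) : MomentLE μ q (fun ω => r * f ω) (|r| * c) := by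
  refine ⟨hf.1.const_mul r, ?_⟩
  have := eLpNorm_const_smul_le (c := r) (f := f) (p := (q : ℝ≥0∞)) (μ := μ)
  refine this.trans ?_
  rw [ENNReal.ofReal_mul (abs_nonneg r)]
  have : ‖r‖ₑ = ENNReal.ofReal |r| := by rw [← ofReal_norm, Real.norm_eq_abs]
  rw [this]
  gcongr
  exact hf.2

lemma neg (hf : MomentLE μ q f c) : MomentLE μ q (fun ω => - f ω) c := by
  simpa using hf.const_mul (-1)

lemma sub (hq : 1 ≤ q) (hc : 0 ≤ c) (hd : 0 ≤ d) (hf : MomentLE μ q f c) (hg : MomentLE μ q g d) :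
    MomentLE μ q (fun ω => f ω - g ω) (c + d) := by
  simpa [sub_eq_add_neg] using hf.add hq hc hd hg.neg

lemma zero (c : ℝ) : MomentLE μ q (fun _ => (0 : ℝ)) c := by
  refine ⟨aestronglyMeasurable_const, ?_⟩
  have : eLpNorm (fun _ : Ω => (0 : ℝ)) q μ = 0 := eLpNorm_zero
  rw [this]; exact zero_le

lemma sum {ι : Type*} (hq : 1 ≤ q) (I : Finset ι) {f : ι → Ω → ℝ} {c : ι → ℝ}
    (hc : ∀ i ∈ I, 0 ≤ c i) (hf : ∀ i ∈ I, MomentLE μ q (f i) (c i)) :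
    MomentLE μ q (fun ω => ∑ i ∈ I, f i ω) (∑ i ∈ I, c i) := by
  classical
  induction I using Finset.induction_on with
  | empty => simpa using zero 0
  | insert a I ha ih =>
    simp only [Finset.sum_insert ha]
    exact (hf a (by simp)).add hq (hc a (by simp))
      (Finset.sum_nonneg fun i hi => hc i (by simp [hi]))
      (ih (fun i hi => hc i (by simp [hi])) fun i hi => hf i (by simp [hi]))

lemma mul (hc : 0 ≤ c) (hf : MomentLE μ (2 * q) f c) (hg : MomentLE μ (2 * q) g d) :
    MomentLE μ q (fun ω => f ω * g ω) (c * d) := by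
  refine ⟨hf.1.mul hg.1, ?_⟩
  have : ENNReal.HolderTriple ((2 * q : ℕ) : ℝ≥0∞) ((2 * q : ℕ) : ℝ≥0∞) (q : ℝ≥0∞) := by
    constructor
    push_cast
    rw [ENNReal.mul_inv (by simp) (by simp), ← add_mul, ENNReal.inv_two_add_inv_two, one_mul]
  have := eLpNorm_smul_le_mul_eLpNorm (p := ((2 * q : ℕ) : ℝ≥0∞)) (q := ((2 * q : ℕ) : ℝ≥0∞))
    (r := (q : ℝ≥0∞)) hg.1 hf.1
  refine this.trans ?_
  rw [ENNReal.ofReal_mul hc]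
  exact mul_le_mul' hf.2 hg.2

lemma exponent_mono [IsProbabilityMeasure μ] {p : ℕ} (hpq : p ≤ q) (hf : MomentLE μ q f c) :
    MomentLE μ p f c :=
  ⟨hf.1, (eLpNorm_le_eLpNorm_of_exponent_le (by exact_mod_cast hpq) hf.1).trans hf.2⟩

lemma const [IsProbabilityMeasure μ] (hq : 1 ≤ q) (r : ℝ) : MomentLE μ q (fun _ => r) |r| := by
  refine ⟨aestronglyMeasurable_const, ?_⟩
  rw [eLpNorm_const _ (by positivity) (NeZero.ne μ)]
  simp [← ofReal_norm]

lemma integrable_pow (hq : 1 ≤ q) (hf : MomentLE μ q f c) :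
    Integrable (fun ω => |f ω| ^ q) μ := by
  have := hf.memLp.integrable_norm_rpow (by positivity) (by simp)
  simpa using this

lemma integral_pow_le (hq : 1 ≤ q) (hc : 0 ≤ c) (hf : MomentLE μ q f c) :
    ∫ ω, |f ω| ^ q ∂μ ≤ c ^ q := by
  have h1 := hf.memLp.eLpNorm_eq_integral_rpow_norm (by positivity) (by simp)
  have h2 := hf.2
  rw [h1] at h2
  have h3 := (ENNReal.ofReal_le_ofReal_iff hc).1 h2
  simp only [ENNReal.toReal_natCast, Real.norm_eq_abs, Real.rpow_natCast] at h3
  have h4 : 0 ≤ ∫ ω, |f ω| ^ q ∂μ := integral_nonneg fun ω => by positivity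
  calc ∫ ω, |f ω| ^ q ∂μ = ((∫ ω, |f ω| ^ q ∂μ) ^ ((q : ℝ)⁻¹)) ^ q := by
        rw [Real.rpow_inv_natCast_pow h4 (by omega)]
    _ ≤ c ^ q := pow_le_pow_left₀ (by positivity) h3 q

lemma of_integral_pow (hq : 1 ≤ q) (hc : 0 ≤ c) (hf : AEStronglyMeasurable f μ)
    (hi : Integrable (fun ω => |f ω| ^ q) μ) (h : ∫ ω, |f ω| ^ q ∂μ ≤ c ^ q) :
    MomentLE μ q f c := by
  have hm : MemLp f q μ := by
    rw [← integrable_norm_rpow_iff hf (by positivity) (by simp)]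
    simpa using hi
  refine ⟨hf, ?_⟩
  rw [hm.eLpNorm_eq_integral_rpow_norm (by positivity) (by simp)]
  refine ENNReal.ofReal_le_ofReal ?_
  simp only [ENNReal.toReal_natCast, Real.norm_eq_abs, Real.rpow_natCast]
  have h4 : 0 ≤ ∫ ω, |f ω| ^ q ∂μ := integral_nonneg fun ω => by positivity
  calc _ ≤ (c ^ q) ^ ((q : ℝ)⁻¹) := by gcongr
    _ = c := Real.pow_rpow_inv_natCast hc (by omega)

lemma measure_ge_le (hq : 1 ≤ q) (hc : 0 ≤ c) (hf : MomentLE μ q f c) {t : ℝ} (ht : 0 < t) :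
    μ {ω | t ≤ |f ω|} ≤ ENNReal.ofReal ((c / t) ^ q) := by
  have h1 := meas_ge_le_mul_pow_eLpNorm_enorm μ (p := (q : ℝ≥0∞)) (by positivity) (by simp) hf.1
    (ε := ENNReal.ofReal t) (by simpa using ht)
  have h2 : {ω | t ≤ |f ω|} = {ω | ENNReal.ofReal t ≤ ‖f ω‖ₑ} := by
    ext ω
    simp only [Set.mem_ofPred_eq]
    rw [← ofReal_norm, ENNReal.ofReal_le_ofReal_iff (norm_nonneg _), Real.norm_eq_abs]
  rw [h2]
  simp only [ENNReal.toReal_natCast, ENNReal.rpow_natCast] at h1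
  refine (h1 (by simp)).trans ?_
  rw [div_pow, div_eq_mul_inv, mul_comm, ENNReal.ofReal_mul (by positivity),
    ENNReal.ofReal_pow hc, ENNReal.ofReal_inv_of_pos (by positivity), ENNReal.ofReal_pow ht.le,
    ENNReal.inv_pow]
  gcongr
  exact hf.2

lemma of_tendsto {F : ℕ → Ω → ℝ} (hF : ∀ n, MomentLE μ q (F n) c)
    (h : ∀ᵐ ω ∂μ, Tendsto (fun n => F n ω) atTop (𝓝 (f ω))) : MomentLE μ q f c :=
  ⟨aestronglyMeasurable_of_tendsto_ae _ (fun n => (hF n).1) h,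
    Lp.eLpNorm_le_of_ae_tendsto (Eventually.of_forall fun n => (hF n).2) (fun n => (hF n).1) h⟩

end MomentLE

lemma abs_pow_mul_pow_le (s d : ℝ) (r i : ℕ) (hi : i ≤ 2 * r) :
    |s| ^ i * |d| ^ (2 * r + 2 - i) ≤ s ^ (2 * r) * d ^ 2 + d ^ (2 * r + 2) := by
  have e1 : s ^ (2 * r) = |s| ^ (2 * r) := by rw [pow_mul, pow_mul, sq_abs]
  have e2 : d ^ (2 * r + 2) = |d| ^ (2 * r + 2) := by
    rw [show 2 * r + 2 = 2 * (r + 1) by ring, pow_mul, pow_mul, sq_abs]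
  rw [e1, e2, ← sq_abs d]
  have hs := abs_nonneg s
  have hd := abs_nonneg d
  rcases le_total |d| |s| with h | h
  · have : |s| ^ i * |d| ^ (2 * r + 2 - i) ≤ |s| ^ (2 * r) * |d| ^ 2 := by
      obtain ⟨j, hj⟩ := Nat.exists_eq_add_of_le hi
      rw [show 2 * r + 2 - i = j + 2 by omega, hj, pow_add, pow_add |s|, mul_assoc]
      gcongr
    have h3 : 0 ≤ |d| ^ (2 * r + 2) := by positivity
    linarith
  · have : |s| ^ i * |d| ^ (2 * r + 2 - i) ≤ |d| ^ (2 * r + 2) := by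
      calc _ ≤ |d| ^ i * |d| ^ (2 * r + 2 - i) := by gcongr
        _ = _ := by rw [← pow_add]; congr 1; omega
    have h3 : 0 ≤ |s| ^ (2 * r) * |d| ^ 2 := by positivity
    linarith

/-- The term linear in d is kept exactly, because it integrates to zero when d is a martingale
increment; all terms of higher degree in d are lumped together. -/
lemma add_pow_le_expansion (s d : ℝ) (r : ℕ) :
    (s + d) ^ (2 * r + 2) ≤ s ^ (2 * r + 2) + (2 * r + 2 : ℕ) * (s ^ (2 * r + 1) * d) +
      2 ^ (2 * r + 2) * (s ^ (2 * r) * d ^ 2 + d ^ (2 * r + 2)) := by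
  rw [add_pow, Finset.sum_range_succ, Finset.sum_range_succ]
  set T := s ^ (2 * r) * d ^ 2 + d ^ (2 * r + 2) with hT
  have h1 : ∑ i ∈ Finset.range (2 * r + 1),
      s ^ i * d ^ (2 * r + 2 - i) * ((2 * r + 2).choose i : ℝ) ≤ 2 ^ (2 * r + 2) * T := by
    have hT0 : 0 ≤ T := by
      rw [hT, show 2 * r + 2 = 2 * (r + 1) by ring, pow_mul, pow_mul]
      positivity
    calc _ ≤ ∑ i ∈ Finset.range (2 * r + 1), T * ((2 * r + 2).choose i : ℝ) := by
          refine Finset.sum_le_sum fun i hi => ?_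
          rw [Finset.mem_range] at hi
          refine mul_le_mul_of_nonneg_right ?_ (Nat.cast_nonneg _)
          refine (le_abs_self _).trans ?_
          rw [abs_mul, abs_pow, abs_pow]
          exact abs_pow_mul_pow_le s d r i (by omega)
      _ ≤ ∑ i ∈ Finset.range (2 * r + 2 + 1), T * ((2 * r + 2).choose i : ℝ) := by
          refine Finset.sum_le_sum_of_subset_of_nonneg ?_ (fun i _ _ => by positivity)
          intro i hi
          rw [Finset.mem_range] at *; omega
      _ = _ := by
          rw [← Finset.mul_sum]
          have := Nat.sum_range_choose (2 * r + 2)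
          rw [mul_comm]
          congr 1
          exact_mod_cast this
  have h2 : ((2 * r + 2).choose (2 * r + 1) : ℝ) = (2 * r + 2 : ℕ) := by
    rw [Nat.choose_succ_self_right (2 * r + 1)]
  rw [h2, Nat.choose_self, Nat.sub_self, show 2 * r + 2 - (2 * r + 1) = 1 by omega]
  simp only [pow_zero, pow_one, mul_one, Nat.cast_one]
  linarith

/-- The induction step of the even moment inequality. Bounds are written as (r+1)-th powers so that
adding an orthogonal increment adds a multiple of Y to X, and squared norms accumulate along the
sum. -/
lemma integral_add_pow_le {S d : Ω → ℝ} {r : ℕ} {X Y : ℝ}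
    (hX : 0 ≤ X) (hY : 0 ≤ Y)
    (hS : AEStronglyMeasurable S μ) (hd : AEStronglyMeasurable d μ)
    (hSi : Integrable (fun ω => S ω ^ (2 * r + 2)) μ)
    (hdi : Integrable (fun ω => d ω ^ (2 * r + 2)) μ)
    (h0 : ∫ ω, S ω ^ (2 * r + 1) * d ω ∂μ = 0)
    (hSX : ∫ ω, S ω ^ (2 * r + 2) ∂μ ≤ X ^ (r + 1))
    (hdY : ∫ ω, d ω ^ (2 * r + 2) ∂μ ≤ Y ^ (r + 1)) :
    Integrable (fun ω => (S ω + d ω) ^ (2 * r + 2)) μ ∧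
    ∫ ω, (S ω + d ω) ^ (2 * r + 2) ∂μ ≤ (X + 4 * 2 ^ (2 * r + 2) * Y) ^ (r + 1) := by
  have ev : ∀ x : ℝ, 0 ≤ x ^ (2 * r + 2) := fun x => by
    rw [show 2 * r + 2 = 2 * (r + 1) by ring, pow_mul]; positivity
  have ev' : ∀ x : ℝ, 0 ≤ x ^ (2 * r) := fun x => by rw [pow_mul]; positivity
  have habs : ∀ x : ℝ, x ^ (2 * r + 2) = |x| ^ (2 * r + 2) := fun x => by
    rw [show 2 * r + 2 = 2 * (r + 1) by ring, pow_mul, pow_mul, sq_abs]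
  have hmix : ∀ i ≤ 2 * r + 2, ∀ ω, |S ω ^ i * d ω ^ (2 * r + 2 - i)| ≤
      S ω ^ (2 * r + 2) + d ω ^ (2 * r + 2) := by
    intro i hi ω
    rw [abs_mul, abs_pow, abs_pow]
    rcases le_total |d ω| |S ω| with h | h
    · calc _ ≤ |S ω| ^ i * |S ω| ^ (2 * r + 2 - i) := by gcongr
        _ = |S ω| ^ (2 * r + 2) := by rw [← pow_add]; congr 1; omega
        _ ≤ _ := by rw [habs (S ω)]; linarith [ev (d ω)]
    · calc _ ≤ |d ω| ^ i * |d ω| ^ (2 * r + 2 - i) := by gcongr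
        _ = |d ω| ^ (2 * r + 2) := by rw [← pow_add]; congr 1; omega
        _ ≤ _ := by rw [habs (d ω)]; linarith [ev (S ω)]
  have imix : ∀ i ≤ 2 * r + 2, Integrable (fun ω => S ω ^ i * d ω ^ (2 * r + 2 - i)) μ := by
    intro i hi
    refine (hSi.add hdi).mono' ((hS.pow i).mul (hd.pow _)) (Eventually.of_forall fun ω => ?_)
    exact hmix i hi ω
  have i1 : Integrable (fun ω => S ω ^ (2 * r + 1) * d ω) μ := by
    have := imix (2 * r + 1) (by omega)
    simpa [show 2 * r + 2 - (2 * r + 1) = 1 by omega] using this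
  have i2 : Integrable (fun ω => S ω ^ (2 * r) * d ω ^ 2) μ := by
    have := imix (2 * r) (by omega)
    simpa [show 2 * r + 2 - (2 * r) = 2 by omega] using this
  have hsum : Integrable (fun ω => (S ω + d ω) ^ (2 * r + 2)) μ := by
    have hb : Integrable (fun ω => 2 ^ (2 * r + 2) * (S ω ^ (2 * r + 2) + d ω ^ (2 * r + 2))) μ :=
      (hSi.add hdi).const_mul _
    refine hb.mono' ((hS.add hd).pow _) (Eventually.of_forall fun ω => ?_)
    rw [Real.norm_eq_abs, abs_of_nonneg (ev _), habs, habs (S ω), habs (d ω)]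
    calc |S ω + d ω| ^ (2 * r + 2) ≤ (2 * max |S ω| |d ω|) ^ (2 * r + 2) := by
          gcongr
          refine (abs_add_le _ _).trans ?_
          linarith [le_max_left |S ω| |d ω|, le_max_right |S ω| |d ω|]
      _ = 2 ^ (2 * r + 2) * (max |S ω| |d ω|) ^ (2 * r + 2) := by rw [mul_pow]
      _ ≤ _ := by
          gcongr
          rcases max_cases |S ω| |d ω| with h | h <;> rw [h.1] <;>
            linarith [ev |S ω|, ev |d ω|]
  refine ⟨hsum, ?_⟩
  -- the cross term
  have hcross : ∫ ω, S ω ^ (2 * r) * d ω ^ 2 ∂μ ≤ 2 * (X ^ r * Y) := by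
    -- Young's inequality is applied to S²/X and d²/Y, so vanishing X or Y must be treated apart;
    -- then S or d vanishes almost surely, and for r = 0 the power of S is 1.
    rcases hX.eq_or_lt with hX0 | hXpos
    · rcases Nat.eq_zero_or_pos r with rfl | hr
      · simp only [mul_zero, pow_zero, one_mul]
        simp only [mul_zero, zero_add, pow_one] at hdY
        linarith
      · have h1 : ∫ ω, S ω ^ (2 * r + 2) ∂μ = 0 :=
          le_antisymm (hSX.trans_eq (by rw [← hX0, zero_pow (by omega)]))
            (integral_nonneg fun ω => ev _)
        rw [integral_eq_zero_iff_of_nonneg (fun ω => ev _) hSi] at h1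
        have h2 : ∫ ω, S ω ^ (2 * r) * d ω ^ 2 ∂μ = 0 := by
          refine integral_eq_zero_of_ae ?_
          filter_upwards [h1] with ω hω
          have : S ω = 0 := eq_zero_of_pow_eq_zero hω
          simp [this, hr.ne']
        rw [h2]; positivity
    · rcases hY.eq_or_lt with hY0 | hYpos
      · have h1 : ∫ ω, d ω ^ (2 * r + 2) ∂μ = 0 :=
          le_antisymm (hdY.trans_eq (by rw [← hY0, zero_pow (by omega)]))
            (integral_nonneg fun ω => ev _)
        rw [integral_eq_zero_iff_of_nonneg (fun ω => ev _) hdi] at h1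
        have h2 : ∫ ω, S ω ^ (2 * r) * d ω ^ 2 ∂μ = 0 := by
          refine integral_eq_zero_of_ae ?_
          filter_upwards [h1] with ω hω
          have : d ω = 0 := eq_zero_of_pow_eq_zero hω
          simp [this]
        rw [h2]; positivity
      · have young : ∀ u v : ℝ, 0 ≤ u → 0 ≤ v → u ^ r * v ≤ u ^ (r + 1) + v ^ (r + 1) := by
          intro u v hu hv
          rcases le_total u v with h | h
          · calc u ^ r * v ≤ v ^ r * v := by gcongr
              _ = v ^ (r + 1) := (pow_succ _ _).symm
              _ ≤ _ := by linarith [pow_nonneg hu (r + 1)]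
          · calc u ^ r * v ≤ u ^ r * u := by gcongr
              _ = u ^ (r + 1) := (pow_succ _ _).symm
              _ ≤ _ := by linarith [pow_nonneg hv (r + 1)]
        have hpt : ∀ ω, S ω ^ (2 * r) * d ω ^ 2 ≤ X ^ r * Y *
            (S ω ^ (2 * r + 2) / X ^ (r + 1) + d ω ^ (2 * r + 2) / Y ^ (r + 1)) := by
          intro ω
          have := young (S ω ^ 2 / X) (d ω ^ 2 / Y) (by positivity) (by positivity)
          rw [div_pow, div_pow, div_pow, ← pow_mul, ← pow_mul, ← pow_mul,
            show 2 * (r + 1) = 2 * r + 2 by ring] at this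
          calc S ω ^ (2 * r) * d ω ^ 2 = X ^ r * Y * (S ω ^ (2 * r) / X ^ r * (d ω ^ 2 / Y)) := by
                field_simp
            _ ≤ _ := by gcongr
        have hi3 : Integrable (fun ω => X ^ r * Y *
            (S ω ^ (2 * r + 2) / X ^ (r + 1) + d ω ^ (2 * r + 2) / Y ^ (r + 1))) μ :=
          ((hSi.div_const _).add (hdi.div_const _)).const_mul _
        refine (integral_mono i2 hi3 hpt).trans ?_
        rw [integral_const_mul, integral_add (hSi.div_const _) (hdi.div_const _),
          integral_div, integral_div]
        have a1 : (∫ ω, S ω ^ (2 * r + 2) ∂μ) / X ^ (r + 1) ≤ 1 :=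
          div_le_one_of_le₀ hSX (by positivity)
        have a2 : (∫ ω, d ω ^ (2 * r + 2) ∂μ) / Y ^ (r + 1) ≤ 1 :=
          div_le_one_of_le₀ hdY (by positivity)
        calc _ ≤ X ^ r * Y * (1 + 1) := by gcongr
          _ = _ := by ring
  set K : ℝ := 2 ^ (2 * r + 2) with hK
  have hK1 : 1 ≤ K := one_le_pow₀ one_le_two
  calc ∫ ω, (S ω + d ω) ^ (2 * r + 2) ∂μ
      ≤ ∫ ω, (S ω ^ (2 * r + 2) + (2 * r + 2 : ℕ) * (S ω ^ (2 * r + 1) * d ω) +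
        K * (S ω ^ (2 * r) * d ω ^ 2 + d ω ^ (2 * r + 2))) ∂μ :=
        integral_mono hsum ((hSi.add (i1.const_mul _)).add ((i2.add hdi).const_mul _))
          fun ω => add_pow_le_expansion _ _ _
    _ = ∫ ω, S ω ^ (2 * r + 2) ∂μ + K * (∫ ω, S ω ^ (2 * r) * d ω ^ 2 ∂μ +
        ∫ ω, d ω ^ (2 * r + 2) ∂μ) := by
        have j1 : Integrable (fun ω => ((2 * r + 2 : ℕ) : ℝ) * (S ω ^ (2 * r + 1) * d ω)) μ :=
          i1.const_mul _
        have j2 : Integrable (fun ω => K * (S ω ^ (2 * r) * d ω ^ 2 + d ω ^ (2 * r + 2))) μ :=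
          (i2.add hdi).const_mul _
        have j3 : Integrable (fun ω => S ω ^ (2 * r + 2) +
            ((2 * r + 2 : ℕ) : ℝ) * (S ω ^ (2 * r + 1) * d ω)) μ := hSi.add j1
        rw [integral_add j3 j2, integral_add hSi j1, integral_const_mul, h0, integral_const_mul,
          integral_add i2 hdi]
        ring
    _ ≤ X ^ (r + 1) + K * (2 * (X ^ r * Y) + Y ^ (r + 1)) := by gcongr
    _ ≤ (X + 4 * K * Y) ^ (r + 1) := by
        set Z := 4 * K * Y with hZ
        have hZ0 : 0 ≤ Z := by positivity
        have b1 : X ^ (r + 1) + X ^ r * Z ≤ (X + Z) ^ (r + 1) := by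
          calc _ = X ^ r * (X + Z) := by ring
            _ ≤ (X + Z) ^ r * (X + Z) := by gcongr; linarith
            _ = _ := (pow_succ _ _).symm
        have b2 : X ^ (r + 1) + Z ^ (r + 1) ≤ (X + Z) ^ (r + 1) :=
          pow_add_pow_le hX hZ0 (by omega)
        have b3 : 4 * K * Y ^ (r + 1) ≤ Z ^ (r + 1) := by
          rw [hZ, mul_pow]
          have : 4 * K ≤ (4 * K) ^ (r + 1) := le_self_pow₀ (by linarith) (by omega)
          gcongr
        have b4 : K * (2 * (X ^ r * Y)) = X ^ r * Z / 2 := by rw [hZ]; ring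
        have b5 : 0 ≤ K * Y ^ (r + 1) := by positivity
        nlinarith

end Moments

/-! ### A Burkholder type inequality for sums over independent noise. -/

section Martingale

set_option linter.unusedSectionVars false

open scoped ENNReal

variable {Ω : Type*} [mΩ : MeasurableSpace Ω] {μ : Measure Ω} {σ : ℝ} {e : ℤ → Ω → ℝ}

/-- The events determined by the variables `e s`, `s < t`. -/
abbrev past (e : ℤ → Ω → ℝ) (t : ℤ) : MeasurableSpace Ω :=
  ⨆ s ∈ Set.Iio t, MeasurableSpace.comap (e s) inferInstance

lemma past_mono {s t : ℤ} (h : s ≤ t) : past e s ≤ past e t :=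
  biSup_mono fun _ hi => lt_of_lt_of_le hi h

lemma past_le (he : ∀ t, Measurable (e t)) (t : ℤ) : past e t ≤ mΩ :=
  iSup₂_le fun s _ => (he s).comap_le

lemma measurable_past {s t : ℤ} (h : s < t) : Measurable[past e t] (e s) := by
  have h1 : MeasurableSpace.comap (e s) inferInstance ≤ past e t :=
    le_iSup₂_of_le s h le_rfl
  exact Measurable.mono (comap_measurable (e s)) h1 le_rfl

lemma indep_past (he : ∀ t, Measurable (e t)) (hind : iIndepFun e μ) (t : ℤ) :
    Indep (MeasurableSpace.comap (e t) inferInstance) (past e t) μ := by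
  have h1 := indep_iSup_of_disjoint (fun i => (he i).comap_le) hind
    (S := {t}) (T := Set.Iio t) (by simp)
  simpa [past] using h1

/-- Exact measurability is needed for σ-algebras such as `past e t`, which need not contain the null
sets. The set of summability is measurable, and off it `tsum` is 0 by convention. -/
lemma measurable_tsum {m : MeasurableSpace Ω} {f : ℕ → Ω → ℝ} (hf : ∀ n, Measurable[m] (f n)) :
    Measurable[m] (fun ω => ∑' n, f n ω) := by
  classical
  set S : Set Ω := {ω | ∑' n, ‖f n ω‖ₑ < ⊤} with hS
  have hSm : MeasurableSet[m] S :=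
    measurableSet_lt (Measurable.tsum fun n => (hf n).enorm) measurable_const
  have hSs : ∀ ω, ω ∈ S ↔ Summable fun n => f n ω := by
    intro ω
    rw [hS, Set.mem_ofPred_eq, lt_top_iff_ne_top]
    constructor
    · intro h
      have := ENNReal.summable_toReal h
      simp only [toReal_enorm] at this
      exact this.of_norm
    · intro h
      have h1 : Summable fun n => ‖f n ω‖ := h.norm
      have := h1.tsum_ofReal_ne_top
      simpa only [ofReal_norm] using this
  refine measurable_of_tendsto_metrizable
    (f := fun N : ℕ => S.indicator fun ω => ∑ n ∈ Finset.range N, f n ω)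
    (fun N => (Finset.measurable_fun_sum _ fun n _ => hf n).indicator hSm) ?_
  rw [tendsto_pi_nhds]
  intro ω
  by_cases h : ω ∈ S
  · simp only [Set.indicator_of_mem h]
    exact ((hSs ω).1 h).hasSum.tendsto_sum_nat
  · simp only [Set.indicator_of_notMem h]
    rw [tsum_eq_zero_of_not_summable (fun h' => h ((hSs ω).2 h'))]
    exact tendsto_const_nhds

lemma exists_moment_noise (he : IsNoise μ σ e) (hmom : UniformMoments μ e) (q : ℕ) :
    ∃ C, 0 ≤ C ∧ ∀ t, MomentLE μ q (e t) C := by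
  rcases Nat.eq_zero_or_pos q with rfl | hq
  · exact ⟨0, le_rfl, fun t => ⟨(he.measurable t).aestronglyMeasurable, by simp⟩⟩
  · obtain ⟨C, hC⟩ := hmom q hq
    refine ⟨max C 1, by positivity, fun t => ?_⟩
    refine MomentLE.of_integral_pow hq (by positivity)
      (he.measurable t).aestronglyMeasurable (hC t).1 ((hC t).2.trans ?_)
    exact (le_max_left C 1).trans (le_self_pow₀ (le_max_right _ _) (by omega))

/-- A Burkholder type inequality for sums `∑ ψ(e_s) g_s` with `g_s` depending on the past. -/
theorem exists_martingale_bound [IsProbabilityMeasure μ] (hem : ∀ t, Measurable (e t))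
    (hind : iIndepFun e μ)
    {ψ : ℝ → ℝ} (hψ : Measurable ψ) (hψ0 : ∀ t, ∫ ω, ψ (e t ω) ∂μ = 0) {q : ℕ} (hq : 1 ≤ q)
    {B : ℝ} (hB : 0 ≤ B) (hψB : ∀ t, MomentLE μ (4 * q) (fun ω => ψ (e t ω)) B) :
    ∃ C, 0 ≤ C ∧ ∀ (I : Finset ℤ) (g : ℤ → Ω → ℝ) (c : ℤ → ℝ),
      (∀ s ∈ I, Measurable[past e s] (g s)) → (∀ s ∈ I, 0 ≤ c s) →
      (∀ s ∈ I, MomentLE μ (4 * q) (g s) (c s)) →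
      MomentLE μ q (fun ω => ∑ s ∈ I, ψ (e s ω) * g s ω) (C * √(∑ s ∈ I, c s ^ 2)) := by
  obtain ⟨r, rfl⟩ : ∃ r, q = r + 1 := ⟨q - 1, by omega⟩
  set K : ℝ := 4 * 2 ^ (2 * r + 2) with hK
  have hK0 : 0 ≤ K := by positivity
  have ev : ∀ x : ℝ, |x| ^ (2 * r + 2) = x ^ (2 * r + 2) := fun x => by
    rw [show 2 * r + 2 = 2 * (r + 1) by ring, pow_mul, pow_mul, sq_abs]
  refine ⟨√K * B, by positivity, fun I => ?_⟩
  -- The even exponent 2r + 2 = 2q is what the one-step inequality handles. The largest index is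
  -- added last, so that its ψ(e_a) is independent of g_a and of the sum so far, and the linear term
  -- has mean zero. Moments of order 4q of the factors give moments of order 2q of the product.
  have main : ∀ (g : ℤ → Ω → ℝ) (c : ℤ → ℝ),
      (∀ s ∈ I, Measurable[past e s] (g s)) → (∀ s ∈ I, 0 ≤ c s) →
      (∀ s ∈ I, MomentLE μ (4 * (r + 1)) (g s) (c s)) →
      Integrable (fun ω => (∑ s ∈ I, ψ (e s ω) * g s ω) ^ (2 * r + 2)) μ ∧
      ∫ ω, (∑ s ∈ I, ψ (e s ω) * g s ω) ^ (2 * r + 2) ∂μ ≤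
        (K * ∑ s ∈ I, (B * c s) ^ 2) ^ (r + 1) := by
    induction I using Finset.induction_on_max with
    | empty => intro g c _ _ _; simp
    | insert a I ha ih =>
      intro g c hg hc hgc
      have haI : a ∉ I := fun h => lt_irrefl a (ha a h)
      obtain ⟨ih1, ih2⟩ := ih g c (fun s hs => hg s (Finset.mem_insert_of_mem hs))
        (fun s hs => hc s (Finset.mem_insert_of_mem hs))
        (fun s hs => hgc s (Finset.mem_insert_of_mem hs))
      have hga := hg a (Finset.mem_insert_self _ _)
      have hSm : Measurable[past e a] (fun ω => ∑ s ∈ I, ψ (e s ω) * g s ω) := by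
        refine Finset.measurable_fun_sum _ fun s hs => ?_
        refine Measurable.mul (hψ.comp (measurable_past (ha s hs))) ?_
        exact (hg s (Finset.mem_insert_of_mem hs)).mono (past_mono (ha s hs).le) le_rfl
      have hle := past_le hem a
      have hd : MomentLE μ (2 * r + 2) (fun ω => ψ (e a ω) * g a ω) (B * c a) := by
        refine MomentLE.mul hB ?_ ?_
        · exact (hψB a).exponent_mono (by omega)
        · exact (hgc a (Finset.mem_insert_self _ _)).exponent_mono (by omega)
      have hca := hc a (Finset.mem_insert_self _ _)
      have hdi := hd.integrable_pow (by omega)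
      have hdY := hd.integral_pow_le (by omega) (by positivity)
      simp only [ev] at hdi hdY
      have h0 : ∫ ω, (∑ s ∈ I, ψ (e s ω) * g s ω) ^ (2 * r + 1) * (ψ (e a ω) * g a ω) ∂μ = 0 := by
        have hindf : IndepFun (fun ω => ψ (e a ω))
            (fun ω => (∑ s ∈ I, ψ (e s ω) * g s ω) ^ (2 * r + 1) * g a ω) μ := by
          rw [IndepFun_iff_Indep]
          refine indep_of_indep_of_le_left (indep_of_indep_of_le_right
            (indep_past hem hind a) ?_) ?_
          · exact (Measurable.mul (hSm.pow_const _) hga).comap_le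
          · exact (hψ.comp (comap_measurable (e a))).comap_le
        have h1 := hindf.integral_mul_eq_mul_integral
          ((hψ.comp (hem a)).aestronglyMeasurable)
          (((hSm.pow_const _).mul hga).mono hle le_rfl).aestronglyMeasurable
        rw [hψ0 a, zero_mul] at h1
        rw [← h1]
        refine integral_congr_ae (Eventually.of_forall fun ω => ?_)
        simp only [Pi.mul_apply]
        ring
      have := integral_add_pow_le (r := r) (X := K * ∑ s ∈ I, (B * c s) ^ 2)
        (Y := (B * c a) ^ 2)
        (mul_nonneg hK0 (Finset.sum_nonneg fun s _ => sq_nonneg _)) (sq_nonneg _)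
        (hSm.mono hle le_rfl).aestronglyMeasurable hd.1 ih1 hdi h0 ih2
        (by rw [← pow_mul]; exact hdY)
      simp only [Finset.sum_insert haI]
      refine ⟨?_, ?_⟩
      · refine this.1.congr (Eventually.of_forall fun ω => ?_)
        simp only [add_comm]
      · calc _ = ∫ ω, (∑ s ∈ I, ψ (e s ω) * g s ω + ψ (e a ω) * g a ω) ^ (2 * r + 2) ∂μ := by
              simp only [add_comm]
          _ ≤ _ := this.2
          _ = _ := by rw [← hK]; ring
  intro g c hg hc hgc
  obtain ⟨h1, h2⟩ := main g c hg hc hgc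
  have hmeas : AEStronglyMeasurable (fun ω => ∑ s ∈ I, ψ (e s ω) * g s ω) μ := by
    refine (Finset.measurable_fun_sum _ fun s hs => ?_).aestronglyMeasurable
    exact (hψ.comp (hem s)).mul ((hg s hs).mono (past_le hem s) le_rfl)
  have h3 : MomentLE μ (2 * r + 2) (fun ω => ∑ s ∈ I, ψ (e s ω) * g s ω)
      (√K * B * √(∑ s ∈ I, c s ^ 2)) := by
    refine MomentLE.of_integral_pow (by omega) (by positivity) hmeas ?_ ?_
    · simpa only [ev] using h1
    · simp only [ev]
      refine h2.trans_eq ?_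
      have e1 : K * ∑ s ∈ I, (B * c s) ^ 2 = (√K * B * √(∑ s ∈ I, c s ^ 2)) ^ 2 := by
        rw [mul_pow, mul_pow, Real.sq_sqrt hK0,
          Real.sq_sqrt (Finset.sum_nonneg fun s _ => sq_nonneg _)]
        simp only [mul_pow, ← Finset.mul_sum]
        ring
      rw [e1, ← pow_mul, show 2 * (r + 1) = 2 * r + 2 by ring]
  exact h3.exponent_mono (by omega)

end Martingale

/-! ### Linear filters -/

section Filters

/-- The `ℓ¹` norm. -/
noncomputable def l1 (p : ℕ → ℝ) : ℝ := ∑' m, |p m|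

/-- The `ℓ²` norm. -/
noncomputable def l2 (p : ℕ → ℝ) : ℝ := √(∑' m, p m ^ 2)

lemma l1_nonneg (p : ℕ → ℝ) : 0 ≤ l1 p := tsum_nonneg fun _ => abs_nonneg _

lemma l2_nonneg (p : ℕ → ℝ) : 0 ≤ l2 p := Real.sqrt_nonneg _

lemma l2_sq (p : ℕ → ℝ) : l2 p ^ 2 = ∑' m, p m ^ 2 :=
  Real.sq_sqrt (tsum_nonneg fun _ => sq_nonneg _)

lemma summable_sq {p : ℕ → ℝ} (hp : Summable p) : Summable fun m => p m ^ 2 := by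
  have h := hp.abs
  have h1 := h.tendsto_atTop_zero.eventually (ge_mem_nhds one_pos)
  refine Summable.of_norm_bounded_eventually_nat h ?_
  filter_upwards [h1] with m hm
  rw [Real.norm_eq_abs, abs_pow, sq]
  exact mul_le_of_le_one_left (abs_nonneg _) hm

lemma sum_sq_le_l2_sq {p : ℕ → ℝ} (hp : Summable p) (I : Finset ℕ) :
    ∑ m ∈ I, p m ^ 2 ≤ l2 p ^ 2 := by
  rw [l2_sq]; exact (summable_sq hp).sum_le_tsum _ fun _ _ => sq_nonneg _

lemma abs_le_l2 {p : ℕ → ℝ} (hp : Summable p) (m : ℕ) : |p m| ≤ l2 p := by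
  have := sum_sq_le_l2_sq hp {m}
  rw [Finset.sum_singleton] at this
  exact abs_le_of_sq_le_sq this (l2_nonneg p)

lemma l2_shift_le {p : ℕ → ℝ} (hp : Summable p) (k : ℕ) : l2 (fun m => p (m + k)) ≤ l2 p := by
  refine Real.sqrt_le_sqrt ?_
  rw [← (summable_sq hp).sum_add_tsum_nat_add k]
  linarith [Finset.sum_nonneg fun m (_ : m ∈ Finset.range k) => sq_nonneg (p m)]

lemma l2_le_l1 {p : ℕ → ℝ} (hp : Summable p) : l2 p ≤ l1 p := by
  rw [l2, Real.sqrt_le_left (l1_nonneg p)]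
  have h1 : ∀ m, |p m| ≤ l1 p := fun m => hp.abs.le_tsum m fun _ _ => abs_nonneg _
  calc ∑' m, p m ^ 2 ≤ ∑' m, l1 p * |p m| := by
        refine (summable_sq hp).tsum_le_tsum (fun m => ?_) (hp.abs.mul_left _)
        rw [← sq_abs, sq]
        exact mul_le_mul_of_nonneg_right (h1 m) (abs_nonneg _)
    _ = l1 p ^ 2 := by rw [tsum_mul_left, sq, l1]

/-- The filter with coefficients `p` applied to the path `x`. -/
noncomputable def lin (p : ℕ → ℝ) (x : ℤ → ℝ) (t : ℤ) : ℝ := ∑' m : ℕ, p m * x (t - m)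

/-- Convolution of coefficient sequences. -/
def conv (v b : ℕ → ℝ) (m : ℕ) : ℝ := ∑ p ∈ Finset.HasAntidiagonal.antidiagonal m, v p.1 * b p.2

lemma conv_comm (v b : ℕ → ℝ) : conv v b = conv b v := by
  funext m
  rw [conv, conv, ← Finset.Nat.sum_antidiagonal_swap]
  simp [mul_comm]

lemma abs_conv_le (v b : ℕ → ℝ) (m : ℕ) :
    |conv v b m| ≤ conv (fun i => |v i|) (fun i => |b i|) m := by
  refine (Finset.abs_sum_le_sum_abs _ _).trans_eq ?_
  simp [conv, abs_mul]

lemma summable_conv {v b : ℕ → ℝ} (hv : Summable v) (hb : Summable b) : Summable (conv v b) :=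
  (summable_norm_sum_mul_antidiagonal_of_summable_norm hv.norm hb.norm).of_norm

lemma l1_conv_le {v b : ℕ → ℝ} (hv : Summable v) (hb : Summable b) :
    l1 (conv v b) ≤ l1 v * l1 b := by
  have h : l1 v * l1 b = ∑' m, conv (fun i => |v i|) (fun i => |b i|) m :=
    tsum_mul_tsum_eq_tsum_sum_antidiagonal_of_summable_norm (f := fun i => |v i|)
      (g := fun i => |b i|) hv.abs.norm hb.abs.norm
  have h2 : Summable (conv (fun i => |v i|) (fun i => |b i|)) := summable_conv hv.abs hb.abs
  rw [h]
  exact (summable_conv hv hb).abs.tsum_le_tsum (fun m => abs_conv_le v b m) h2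

/-- Young's inequality. -/
lemma l2_conv_le {v b : ℕ → ℝ} (hv : Summable v) (hb : Summable b) :
    l2 (conv v b) ≤ l2 v * l1 b := by
  rw [l2, Real.sqrt_le_left (mul_nonneg (l2_nonneg _) (l1_nonneg _)), mul_pow, l2_sq]
  have hv2 := summable_sq hv
  have h1 : ∀ m, conv v b m ^ 2 ≤ l1 b * conv (fun i => v i ^ 2) (fun i => |b i|) m := by
    intro m
    -- Cauchy–Schwarz with |b| split as √|b| · √|b|; the second factor then sums to at most `l1 b`.
    have hcs := Finset.sum_mul_sq_le_sq_mul_sq (Finset.HasAntidiagonal.antidiagonal m)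
      (fun p : ℕ × ℕ => |v p.1| * √|b p.2|) (fun p => √|b p.2|)
    have e1 : ∀ p : ℕ × ℕ, |v p.1| * √|b p.2| * √|b p.2| = |v p.1| * |b p.2| := fun p => by
      rw [mul_assoc, Real.mul_self_sqrt (abs_nonneg _)]
    have e2 : ∀ p : ℕ × ℕ, (|v p.1| * √|b p.2|) ^ 2 = v p.1 ^ 2 * |b p.2| := fun p => by
      rw [mul_pow, Real.sq_sqrt (abs_nonneg _), sq_abs]
    simp only [e1, e2, Real.sq_sqrt (abs_nonneg _)] at hcs
    have e3 : ∑ p ∈ Finset.HasAntidiagonal.antidiagonal m, |b p.2| ≤ l1 b := by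
      rw [Finset.Nat.sum_antidiagonal_eq_sum_range_succ (fun _ j => |b j|)]
      have := Finset.sum_range_reflect (fun j => |b j|) (m + 1)
      simp only [Nat.add_sub_cancel] at this
      rw [Nat.succ_eq_add_one, this]
      exact hb.abs.sum_le_tsum _ fun _ _ => abs_nonneg _
    have e4 : 0 ≤ ∑ p ∈ Finset.HasAntidiagonal.antidiagonal m, v p.1 ^ 2 * |b p.2| :=
      Finset.sum_nonneg fun _ _ => by positivity
    calc conv v b m ^ 2 ≤ (conv (fun i => |v i|) (fun i => |b i|) m) ^ 2 := by
          rw [← sq_abs]; exact pow_le_pow_left₀ (abs_nonneg _) (abs_conv_le v b m) 2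
      _ ≤ _ := hcs
      _ ≤ _ := by rw [mul_comm]; exact mul_le_mul_of_nonneg_right e3 e4
  have h2 := summable_conv hv2 hb.abs
  calc ∑' m, conv v b m ^ 2 ≤ ∑' m, l1 b * conv (fun i => v i ^ 2) (fun i => |b i|) m :=
        (summable_sq (summable_conv hv hb)).tsum_le_tsum h1 (h2.mul_left _)
    _ = (∑' m, v m ^ 2) * l1 b ^ 2 := by
        rw [tsum_mul_left]
        have := tsum_mul_tsum_eq_tsum_sum_antidiagonal_of_summable_norm
          (f := fun i => v i ^ 2) (g := fun i => |b i|) (by simpa using hv2)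
          (by simpa using hb.abs)
        simp only [conv]
        rw [← this, ← l1]; ring

/-- Convolution is the multiplication of formal power series, so no summability is needed. -/
lemma conv_assoc (u v w : ℕ → ℝ) : conv (conv u v) w = conv u (conv v w) := by
  have h : ∀ a b : ℕ → ℝ, PowerSeries.mk (conv a b) = PowerSeries.mk a * PowerSeries.mk b := by
    intro a b; ext m; simp [PowerSeries.coeff_mul, conv]
  have h2 : PowerSeries.mk (conv (conv u v) w) = PowerSeries.mk (conv u (conv v w)) := by
    rw [h, h, h, h, mul_assoc]
  funext m
  simpa using congrArg (PowerSeries.coeff m) h2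

/-- The unit of convolution. -/
def delta (m : ℕ) : ℝ := if m = 0 then 1 else 0

lemma conv_delta (v : ℕ → ℝ) : conv v delta = v := by
  have h : PowerSeries.mk (conv v delta) = PowerSeries.mk v := by
    have h1 : PowerSeries.mk delta = 1 := by ext m; simp [delta, PowerSeries.coeff_one]
    rw [← mul_one (PowerSeries.mk v), ← h1]
    ext m; simp [PowerSeries.coeff_mul, conv]
  funext m
  simpa using congrArg (PowerSeries.coeff m) h

lemma lin_delta (x : ℤ → ℝ) (t : ℤ) : lin delta x t = x t := by
  rw [lin, tsum_eq_single 0]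
  · simp [delta]
  · intro m hm; simp [delta, hm]

/-- The composition of two filters, for paths along which everything converges. -/
lemma lin_lin {v b : ℕ → ℝ} {x : ℤ → ℝ} {t : ℤ}
    (h : Summable fun m : ℕ => conv (fun i => |v i|) (fun i => |b i|) m * |x (t - m)|) :
    (Summable fun i : ℕ => v i * lin b x (t - i)) ∧ lin v (lin b x) t = lin (conv v b) x t := by
  set F : ℕ × ℕ → ℝ := fun p => v p.1 * b p.2 * x (t - (p.1 + p.2 : ℕ)) with hF
  have hFs : Summable F := by
    rw [← Finset.HasAntidiagonal.sigmaAntidiagonalEquivProd.summable_iff]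
    refine Summable.of_norm ?_
    rw [summable_sigma_of_nonneg (fun _ => norm_nonneg _)]
    refine ⟨fun m => (hasSum_fintype _).summable, ?_⟩
    refine h.congr fun m => ?_
    rw [tsum_fintype, Finset.univ_eq_attach]
    refine Eq.trans ?_ (Finset.sum_attach (Finset.HasAntidiagonal.antidiagonal m)
      (fun p => ‖F p‖)).symm
    rw [conv, Finset.sum_mul]
    refine Finset.sum_congr rfl fun p hp => ?_
    rw [Finset.HasAntidiagonal.mem_antidiagonal] at hp
    rw [hF]
    simp only [norm_mul, Real.norm_eq_abs, hp]
  have e1 : ∀ i, ∑' j, F (i, j) = v i * lin b x (t - i) := by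
    intro i
    rw [lin, ← tsum_mul_left]
    refine tsum_congr fun j => ?_
    simp only [hF]
    push_cast
    rw [sub_sub, mul_assoc]
  have e2 : ∑' p, F p = lin (conv v b) x t := by
    rw [← Finset.HasAntidiagonal.sigmaAntidiagonalEquivProd.tsum_eq F]
    refine ((Finset.HasAntidiagonal.sigmaAntidiagonalEquivProd.summable_iff).2
      hFs).tsum_sigma.trans ?_
    rw [lin]
    refine tsum_congr fun m => ?_
    rw [tsum_fintype, Finset.univ_eq_attach]
    have := Finset.sum_attach (Finset.HasAntidiagonal.antidiagonal m) F
    refine this.trans ?_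
    rw [conv, Finset.sum_mul]
    refine Finset.sum_congr rfl fun p hp => ?_
    rw [Finset.HasAntidiagonal.mem_antidiagonal] at hp
    simp only [hF, hp]
  refine ⟨hFs.prod.congr e1, ?_⟩
  rw [← e2, hFs.tsum_prod, lin]
  exact tsum_congr fun i => (e1 i).symm

end Filters

/-! ### Moments and covariance fluctuations of linear processes. -/

section LinearProcesses

open scoped ENNReal

variable {Ω : Type*} [MeasurableSpace Ω] {μ : Measure Ω} {σ : ℝ} {e : ℤ → Ω → ℝ}

/-- The linear process `∑ p_m e_{t-m}`. -/
noncomputable def filt (p : ℕ → ℝ) (e : ℤ → Ω → ℝ) (t : ℤ) (ω : Ω) : ℝ := lin p (fun s => e s ω) t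

/-- The series has expectation at most C ∑|p_m|, hence is finite almost surely; ℤ is countable, so
one null set serves all times. -/
lemma ae_summable_abs {X : ℤ → Ω → ℝ} {C : ℝ} (hX : ∀ t, MomentLE μ 1 (X t) C) {p : ℕ → ℝ}
    (hp : Summable p) : ∀ᵐ ω ∂μ, ∀ t : ℤ, Summable fun m : ℕ => |p m| * |X (t - m) ω| := by
  rw [ae_all_iff]
  intro t
  have h1 : ∫⁻ ω, ∑' m : ℕ, ‖p m * X (t - m) ω‖ₑ ∂μ ≠ ⊤ := by
    rw [lintegral_tsum fun m => ((hX _).1.const_mul _).enorm]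
    have h2 : ∀ m : ℕ, ∫⁻ ω, ‖p m * X (t - m) ω‖ₑ ∂μ ≤ ENNReal.ofReal (|p m| * C) := fun m => by
      have := ((hX (t - m)).const_mul (p m)).2
      rwa [Nat.cast_one, eLpNorm_one_eq_lintegral_enorm] at this
    refine ne_top_of_le_ne_top ?_ (ENNReal.tsum_le_tsum h2)
    exact (hp.abs.mul_right C).tsum_ofReal_ne_top
  have h2 := ae_lt_top' (AEMeasurable.tsum fun m : ℕ =>
    ((hX (t - m)).1.const_mul (p m)).enorm) h1
  filter_upwards [h2] with ω hω
  have := ENNReal.summable_toReal hω.ne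
  simpa [abs_mul] using this

lemma ae_summable_mul {X : ℤ → Ω → ℝ} {C : ℝ} (hX : ∀ t, MomentLE μ 1 (X t) C) {p : ℕ → ℝ}
    (hp : Summable p) : ∀ᵐ ω ∂μ, ∀ t : ℤ, Summable fun m : ℕ => p m * X (t - m) ω := by
  filter_upwards [ae_summable_abs hX hp] with ω hω t
  exact Summable.of_abs (by simpa [abs_mul] using hω t)

lemma measurable_filt {s t : ℤ} (p : ℕ → ℝ) (h : s < t) : Measurable[past e t] (filt p e s) := by
  refine measurable_tsum fun m => ?_
  exact (measurable_past (by omega)).const_mul (p m)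

lemma measurable_filt' (he : ∀ t, Measurable (e t)) (p : ℕ → ℝ) (t : ℤ) :
    Measurable (filt p e t) :=
  (measurable_filt p (lt_add_one t)).mono (past_le he _) le_rfl

lemma sum_sq_const_le (J : Finset ℤ) {d : ℝ} (hd : 0 ≤ d) :
    √(∑ _s ∈ J, d ^ 2) = √(J.card) * d := by
  rw [Finset.sum_const, nsmul_eq_mul, Real.sqrt_mul (by positivity), Real.sqrt_sq hd]

variable [IsProbabilityMeasure μ]

lemma integral_sq_noise (he : IsNoise μ σ e) (t : ℤ) : ∫ ω, e t ω ^ 2 ∂μ = σ ^ 2 := by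
  have h1 := variance_eq_sub (he.memLp t)
  rw [he.mean t, he.variance t] at h1
  simp only [Pi.pow_apply] at h1
  linarith

lemma exists_moment_noise_sq (he : IsNoise μ σ e) (hmom : UniformMoments μ e) {q : ℕ}
    (hq : 1 ≤ q) : ∃ C, 0 ≤ C ∧ ∀ t, MomentLE μ q (fun ω => e t ω ^ 2 - σ ^ 2) C := by
  obtain ⟨C, hC0, hC⟩ := exists_moment_noise he hmom (2 * q)
  refine ⟨C * C + |σ ^ 2|, by positivity, fun t => ?_⟩
  simp only [sq (e t _)]
  exact ((hC t).mul hC0 (hC t)).sub hq (by positivity) (by positivity) (MomentLE.const hq _)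

lemma exists_noise_bound (he : IsNoise μ σ e) (hmom : UniformMoments μ e) {q : ℕ} (hq : 1 ≤ q) :
    ∃ C, 0 ≤ C ∧ ∀ (I : Finset ℤ) (g : ℤ → Ω → ℝ) (c : ℤ → ℝ),
      (∀ s ∈ I, Measurable[past e s] (g s)) → (∀ s ∈ I, 0 ≤ c s) →
      (∀ s ∈ I, MomentLE μ (4 * q) (g s) (c s)) →
      MomentLE μ q (fun ω => ∑ s ∈ I, e s ω * g s ω) (C * √(∑ s ∈ I, c s ^ 2)) := by
  obtain ⟨B, hB0, hB⟩ := exists_moment_noise he hmom (4 * q)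
  exact exists_martingale_bound he.measurable he.indep (ψ := fun x => x) measurable_id he.mean hq
    hB0 hB

lemma exists_noise_sq_bound (he : IsNoise μ σ e) (hmom : UniformMoments μ e) {q : ℕ}
    (hq : 1 ≤ q) :
    ∃ C, 0 ≤ C ∧ ∀ (I : Finset ℤ) (g : ℤ → Ω → ℝ) (c : ℤ → ℝ),
      (∀ s ∈ I, Measurable[past e s] (g s)) → (∀ s ∈ I, 0 ≤ c s) →
      (∀ s ∈ I, MomentLE μ (4 * q) (g s) (c s)) →
      MomentLE μ q (fun ω => ∑ s ∈ I, (e s ω ^ 2 - σ ^ 2) * g s ω)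
        (C * √(∑ s ∈ I, c s ^ 2)) := by
  obtain ⟨B, hB0, hB⟩ := exists_moment_noise_sq he hmom (q := 4 * q) (by omega)
  refine exists_martingale_bound he.measurable he.indep (ψ := fun x => x ^ 2 - σ ^ 2)
    (by fun_prop) (fun t => ?_) hq hB0 hB
  have hi : Integrable (fun ω => e t ω ^ 2) μ := (he.memLp t).integrable_sq
  rw [integral_sub hi (integrable_const _), integral_sq_noise he]
  simp

/-- Linear combinations of the noise variables. -/
lemma exists_sum_bound (he : IsNoise μ σ e) (hmom : UniformMoments μ e) {q : ℕ} (hq : 1 ≤ q) :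
    ∃ C, 0 ≤ C ∧ ∀ (A : Finset ℕ) (φ : ℕ → ℤ) (v : ℕ → ℝ), Function.Injective φ →
      MomentLE μ q (fun ω => ∑ m ∈ A, v m * e (φ m) ω) (C * √(∑ m ∈ A, v m ^ 2)) := by
  obtain ⟨C, hC0, hC⟩ := exists_noise_bound he hmom hq
  refine ⟨C, hC0, fun A φ v hφ => ?_⟩
  have h := hC (A.image φ) (fun s _ => v (Function.invFun φ s)) (fun s => |v (Function.invFun φ s)|)
    (fun s _ => measurable_const) (fun s _ => abs_nonneg _)
    (fun s _ => MomentLE.const (by omega) _)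
  have hinv : ∀ m, Function.invFun φ (φ m) = m := Function.leftInverse_invFun hφ
  simp only [Finset.sum_image (fun a _ b _ hab => hφ hab), hinv, sq_abs] at h
  simpa only [mul_comm] using h

lemma exists_filt_bound (he : IsNoise μ σ e) (hmom : UniformMoments μ e) {q : ℕ} (hq : 1 ≤ q) :
    ∃ C, 0 ≤ C ∧ ∀ p : ℕ → ℝ, Summable p → ∀ t, MomentLE μ q (filt p e t) (C * l2 p) := by
  obtain ⟨C, hC0, hC⟩ := exists_sum_bound he hmom hq
  obtain ⟨B, -, hB⟩ := exists_moment_noise he hmom 1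
  refine ⟨C, hC0, fun p hp t => ?_⟩
  refine MomentLE.of_tendsto
    (F := fun N ω => ∑ m ∈ Finset.range N, p m * e (t - m) ω) (fun N => ?_) ?_
  · refine (hC (Finset.range N) (fun m => t - m) p (fun a b hab => by simpa using hab)).mono ?_
    gcongr
    exact Real.sqrt_le_iff.2 ⟨l2_nonneg p, sum_sq_le_l2_sq hp _⟩
  · filter_upwards [ae_summable_mul hB hp] with ω hω
    exact (hω t).hasSum.tendsto_sum_nat

lemma integral_noise_mul (he : IsNoise μ σ e) (s t : ℤ) :
    ∫ ω, e s ω * e t ω ∂μ = if s = t then σ ^ 2 else 0 := by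
  split_ifs with h
  · rw [h, ← integral_sq_noise he t]; simp only [sq]
  · have := (he.indep.indepFun h).integral_mul_eq_mul_integral
      (he.measurable s).aestronglyMeasurable (he.measurable t).aestronglyMeasurable
    rw [he.mean s, zero_mul] at this
    exact this

/-- The covariance of two linear processes. -/
lemma integral_filt_mul_filt (he : IsNoise μ σ e) (hmom : UniformMoments μ e) {p r : ℕ → ℝ}
    (hp : Summable p) (hr : Summable r) (t : ℤ) :
    ∫ ω, filt p e t ω * filt r e t ω ∂μ = σ ^ 2 * ∑' m, p m * r m := by
  obtain ⟨B, hB0, hB⟩ := exists_moment_noise he hmom 1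
  obtain ⟨B2, hB20, hB2⟩ := exists_moment_noise he hmom 2
  set F : ℕ × ℕ → Ω → ℝ := fun i ω => (p i.1 * e (t - i.1) ω) * (r i.2 * e (t - i.2) ω) with hF
  have hFm : ∀ i, MomentLE μ 1 (F i) (|p i.1| * B2 * (|r i.2| * B2)) := fun i =>
    MomentLE.mul (by positivity) ((hB2 _).const_mul _) ((hB2 _).const_mul _)
  have hFi : ∀ i, Integrable (F i) μ := fun i => memLp_one_iff_integrable.1 (by
    simpa using (hFm i).memLp)
  have hsum : Summable fun i : ℕ × ℕ => ∫ ω, ‖F i ω‖ ∂μ := by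
    have h1 : Summable fun i : ℕ × ℕ => (|p i.1| * B2) * (|r i.2| * B2) :=
      (hp.abs.mul_right B2).mul_of_nonneg (hr.abs.mul_right B2) (fun _ => by positivity)
        (fun _ => by positivity)
    refine Summable.of_nonneg_of_le (fun i => integral_nonneg fun _ => norm_nonneg _)
      (fun i => ?_) h1
    simpa using (hFm i).integral_pow_le le_rfl (by positivity)
  have h1 := integral_tsum_of_summable_integral_norm hFi hsum
  have h2 : ∫ ω, filt p e t ω * filt r e t ω ∂μ = ∫ ω, ∑' i, F i ω ∂μ := by
    refine integral_congr_ae ?_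
    filter_upwards [ae_summable_mul hB hp, ae_summable_mul hB hr] with ω h3 h4
    exact tsum_mul_tsum_of_summable_norm (h3 t).norm (h4 t).norm
  have h5 : ∀ i, ∫ ω, F i ω ∂μ = if i.1 = i.2 then σ ^ 2 * (p i.1 * r i.1) else 0 := by
    intro i
    have : ∀ ω, F i ω = p i.1 * r i.2 * (e (t - i.1) ω * e (t - i.2) ω) := fun ω => by
      simp only [hF]; ring
    simp only [this]
    rw [integral_const_mul, integral_noise_mul he]
    by_cases h : i.1 = i.2
    · rw [if_pos (by rw [h]), if_pos h, h]; ring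
    · rw [if_neg (by omega), if_neg h, mul_zero]
  have hFsum : Summable fun i => ∫ ω, F i ω ∂μ := by
    refine Summable.of_norm_bounded hsum fun i => norm_integral_le_integral_norm _
  rw [h2, ← h1, hFsum.tsum_prod, ← tsum_mul_left]
  refine tsum_congr fun m => ?_
  rw [tsum_eq_single m]
  · rw [h5, if_pos rfl]
  · intro j hj; rw [h5, if_neg (fun h => hj h.symm)]

lemma sum_ite_shift {M : Type*} [AddCommMonoid M] (J I : Finset ℤ) (l : ℤ) (h : ℤ → M)
    (hI : ∀ j ∈ J, j - l ∈ I) :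
    ∑ s ∈ I, (if s + l ∈ J then h s else 0) = ∑ j ∈ J, h (j - l) := by
  rw [← Finset.sum_filter]
  refine Finset.sum_nbij' (fun s => s + l) (fun j => j - l) ?_ ?_ ?_ ?_ ?_
  · intro s hs; exact (Finset.mem_filter.1 hs).2
  · intro j hj; simp [hI j hj, hj]
  · intro s _; simp
  · intro j _; simp
  · intro s _; simp

/-- Deviations of sums of products of a linear process with a noise variable. -/
lemma exists_filt_mul_noise_bound (he : IsNoise μ σ e) (hmom : UniformMoments μ e) {q : ℕ}
    (hq : 1 ≤ q) :
    ∃ C, 0 ≤ C ∧ ∀ (J : Finset ℤ) (p : ℕ → ℝ) (m : ℕ), Summable p →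
      MomentLE μ q (fun ω => ∑ j ∈ J, (filt p e j ω * e (j - m) ω - σ ^ 2 * p m))
        (C * (√(J.card) * l2 p)) := by
  obtain ⟨C1, hC10, hC1⟩ := exists_noise_bound he hmom hq
  obtain ⟨C2, hC20, hC2⟩ := exists_noise_sq_bound he hmom hq
  obtain ⟨C3, hC30, hC3⟩ := exists_filt_bound he hmom (q := 4 * q) (by omega)
  obtain ⟨C4, hC40, hC4⟩ := exists_sum_bound he hmom (q := 4 * q) (by omega)
  obtain ⟨B, -, hB⟩ := exists_moment_noise he hmom 1
  refine ⟨C1 * C3 + C2 + C1 * C4, by positivity, fun J p m hp => ?_⟩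
  -- The filter at time j is split at lag m. Noise older than e_{j−m} is a past multiplier of
  -- e_{j−m}; lag m itself leaves p_m(e² − σ²); for younger noise the roles are exchanged, and
  -- e_{j−m} becomes part of the past multiplier.
  set J' := J.image fun j => j - (m : ℤ) with hJ'
  have hinj : Function.Injective fun j : ℤ => j - (m : ℤ) := fun a b h => by simpa using h
  have hJc : J'.card = J.card := Finset.card_image_of_injective _ hinj
  have hl := l2_nonneg p
  -- older terms
  set p' : ℕ → ℝ := fun i => p (i + (m + 1)) with hp'
  have hp's : Summable p' := (summable_nat_add_iff (m + 1)).2 hp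
  have hA := hC1 J' (fun s => filt p' e (s - 1)) (fun _ => C3 * l2 p)
    (fun s _ => measurable_filt _ (by omega)) (fun s _ => by positivity)
    (fun s _ => (hC3 p' hp's _).mono (by gcongr; exact l2_shift_le hp _))
  rw [sum_sq_const_le _ (by positivity), hJc] at hA
  -- diagonal term
  have hD := (hC2 J' (fun s _ => p m) (fun _ => l2 p) (fun s _ => measurable_const)
    (fun s _ => hl) (fun s _ => (MomentLE.const (by omega) (p m)).mono (abs_le_l2 hp m)))
  rw [sum_sq_const_le _ hl, hJc] at hD
  -- younger terms
  set I : Finset ℤ := (J ×ˢ Finset.range m).image fun x => x.1 - (x.2 : ℤ) with hI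
  have hImem : ∀ l ∈ Finset.range m, ∀ j ∈ J, j - (l : ℤ) ∈ I := fun l hl j hj =>
    Finset.mem_image.2 ⟨(j, l), by simp [hj, Finset.mem_range.1 hl], rfl⟩
  -- The double sum is regrouped by the time s = j − l of the younger variable. Its multiplier is a
  -- linear combination of the distinct variables e_{s+l−m}, so its norm is an ℓ² norm of
  -- coefficients of p.
  have hY := hC1 I (fun s ω => ∑ l ∈ Finset.range m,
      (if s + (l : ℤ) ∈ J then p l else 0) * e (s + l - m) ω)
    (fun s => C4 * √(∑ l ∈ Finset.range m, (if s + (l : ℤ) ∈ J then p l else 0) ^ 2))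
    (fun s _ => by
      refine Finset.measurable_fun_sum _ fun l hl => ?_
      rw [Finset.mem_range] at hl
      exact (measurable_past (by omega)).const_mul _)
    (fun s _ => by positivity)
    (fun s _ => hC4 (Finset.range m) (fun l => s + l - m) _ (fun a b h => by simpa using h))
  have hYc : √(∑ s ∈ I, (C4 * √(∑ l ∈ Finset.range m,
      (if s + (l : ℤ) ∈ J then p l else 0) ^ 2)) ^ 2) ≤ C4 * (√(J.card) * l2 p) := by
    rw [Real.sqrt_le_left (by positivity)]
    have e1 : ∀ s : ℤ, (C4 * √(∑ l ∈ Finset.range m,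
        (if s + (l : ℤ) ∈ J then p l else 0) ^ 2)) ^ 2 =
        C4 ^ 2 * ∑ l ∈ Finset.range m, (if s + (l : ℤ) ∈ J then p l ^ 2 else 0) := by
      intro s
      rw [mul_pow, Real.sq_sqrt (Finset.sum_nonneg fun _ _ => sq_nonneg _)]
      congr 1
      refine Finset.sum_congr rfl fun l _ => ?_
      split_ifs <;> simp
    simp only [e1]
    rw [← Finset.mul_sum, Finset.sum_comm, mul_pow, mul_pow, Real.sq_sqrt (Nat.cast_nonneg _)]
    gcongr
    calc _ = ∑ l ∈ Finset.range m, ∑ _j ∈ J, p l ^ 2 :=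
          Finset.sum_congr rfl fun l hl => sum_ite_shift J I l (fun _ => p l ^ 2) (hImem l hl)
      _ = (J.card : ℝ) * ∑ l ∈ Finset.range m, p l ^ 2 := by
          simp [Finset.mul_sum]
      _ ≤ _ := by gcongr; exact sum_sq_le_l2_sq hp _
  have hYsum : ∀ ω, ∑ s ∈ I, e s ω * ∑ l ∈ Finset.range m,
      (if s + (l : ℤ) ∈ J then p l else 0) * e (s + l - m) ω =
      ∑ j ∈ J, ∑ l ∈ Finset.range m, p l * e (j - l) ω * e (j - m) ω := by
    intro ω
    calc _ = ∑ s ∈ I, ∑ l ∈ Finset.range m,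
          (if s + (l : ℤ) ∈ J then p l * e s ω * e (s + l - m) ω else 0) := by
          refine Finset.sum_congr rfl fun s _ => ?_
          rw [Finset.mul_sum]
          refine Finset.sum_congr rfl fun l _ => ?_
          split_ifs <;> ring
      _ = _ := by
          rw [Finset.sum_comm, Finset.sum_comm (s := J)]
          refine Finset.sum_congr rfl fun l hl => ?_
          rw [sum_ite_shift J I l (fun s => p l * e s ω * e (s + l - m) ω) (hImem l hl)]
          simp
  have hall := ((hA.add hq (by positivity) (by positivity) hD).add hq (by positivity)
    (by positivity) (hY.mono (mul_le_mul_of_nonneg_left hYc hC10)))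
  refine (hall.congr ?_).mono (le_of_eq (by ring))
  filter_upwards [ae_summable_mul hB hp] with ω hω
  rw [hYsum, hJ', Finset.sum_image (fun a _ b _ h => hinj h),
    Finset.sum_image (fun a _ b _ h => hinj h), ← Finset.sum_add_distrib, ← Finset.sum_add_distrib]
  refine Finset.sum_congr rfl fun j _ => ?_
  have h1 := (hω j).sum_add_tsum_nat_add (m + 1)
  have h2 : filt p' e (j - m - 1) ω = ∑' i : ℕ, p (i + (m + 1)) * e (j - (i + (m + 1) : ℕ)) ω := by
    rw [filt, lin]
    refine tsum_congr fun i => ?_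
    simp only [hp']
    congr 2
    push_cast; ring
  rw [← h2, Finset.sum_range_succ] at h1
  have h3 : filt p e j ω = ∑ l ∈ Finset.range m, p l * e (j - l) ω + p m * e (j - m) ω +
    filt p' e (j - m - 1) ω := h1.symm
  rw [h3, ← Finset.sum_mul]
  ring

/-- Deviations of sums of products of two linear processes. -/
theorem exists_filt_mul_filt_bound (he : IsNoise μ σ e) (hmom : UniformMoments μ e) {q : ℕ}
    (hq : 1 ≤ q) :
    ∃ C, 0 ≤ C ∧ ∀ (J : Finset ℤ) (p r : ℕ → ℝ), Summable p → Summable r →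
      MomentLE μ q (fun ω => ∑ j ∈ J, (filt p e j ω * filt r e j ω - σ ^ 2 * ∑' m, p m * r m))
        (C * (√(J.card) * (l2 p * l1 r))) := by
  obtain ⟨C, hC0, hC⟩ := exists_filt_mul_noise_bound he hmom hq
  obtain ⟨B, -, hB⟩ := exists_moment_noise he hmom 1
  refine ⟨C, hC0, fun J p r hp hr => ?_⟩
  have hl := l2_nonneg p
  have hpr : Summable fun m => p m * r m := by
    refine Summable.of_norm_bounded (hr.abs.mul_left (l2 p)) fun m => ?_
    rw [Real.norm_eq_abs, abs_mul]
    gcongr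
    exact abs_le_l2 hp m
  -- The second filter is expanded lag by lag and the triangle inequality costs `l1 r`, while p
  -- enters only through its ℓ² norm. This asymmetry is used later with p carrying the small bias.
  refine MomentLE.of_tendsto (F := fun N ω => ∑ m ∈ Finset.range N, r m *
    ∑ j ∈ J, (filt p e j ω * e (j - m) ω - σ ^ 2 * p m)) (fun N => ?_) ?_
  · refine (MomentLE.sum hq (Finset.range N) (c := fun m => |r m| * (C * (√(J.card) * l2 p)))
      (fun m _ => by positivity) (fun m _ => (hC J p m hp).const_mul (r m))).mono ?_
    rw [← Finset.sum_mul]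
    have : ∑ m ∈ Finset.range N, |r m| ≤ l1 r := hr.abs.sum_le_tsum _ fun _ _ => abs_nonneg _
    calc _ ≤ l1 r * (C * (√(J.card) * l2 p)) := by gcongr
      _ = _ := by ring
  · filter_upwards [ae_summable_mul hB hr] with ω hω
    have h1 : ∀ j ∈ J, Tendsto (fun N => ∑ m ∈ Finset.range N,
        (filt p e j ω * (r m * e (j - m) ω) - σ ^ 2 * (p m * r m))) atTop
        (𝓝 (filt p e j ω * filt r e j ω - σ ^ 2 * ∑' m, p m * r m)) := by
      intro j _
      have := ((hω j).hasSum.mul_left (filt p e j ω)).sub (hpr.hasSum.mul_left (σ ^ 2))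
      exact this.tendsto_sum_nat
    refine (tendsto_finsetSum J h1).congr fun N => ?_
    rw [Finset.sum_comm]
    refine Finset.sum_congr rfl fun m _ => ?_
    rw [Finset.mul_sum]
    exact Finset.sum_congr rfl fun j _ => by ring

end LinearProcesses

/-! ### Sequences -/

section Sequences

/-- The inner product of two coefficient sequences. -/
noncomputable def ip (p r : ℕ → ℝ) : ℝ := ∑' m, p m * r m

lemma summable_ip {p r : ℕ → ℝ} (hp : Summable p) (hr : Summable r) :
    Summable fun m => p m * r m := by
  refine Summable.of_norm_bounded (hr.abs.mul_left (l2 p)) fun m => ?_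
  rw [Real.norm_eq_abs, abs_mul]
  gcongr
  exact abs_le_l2 hp m

lemma ip_comm (p r : ℕ → ℝ) : ip p r = ip r p := by simp only [ip, mul_comm]

lemma ip_self (p : ℕ → ℝ) : ip p p = l2 p ^ 2 := by rw [l2_sq, ip]; simp only [sq]

lemma ip_add_left {p q r : ℕ → ℝ} (hp : Summable p) (hq : Summable q) (hr : Summable r) :
    ip (p + q) r = ip p r + ip q r := by
  rw [ip, ip, ip, ← (summable_ip hp hr).tsum_add (summable_ip hq hr)]
  simp [add_mul]

lemma ip_smul_left (s : ℝ) (p r : ℕ → ℝ) : ip (s • p) r = s * ip p r := by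
  rw [ip, ip, ← tsum_mul_left]; simp [mul_assoc]

lemma l2_sq_add {p r : ℕ → ℝ} (hp : Summable p) (hr : Summable r) :
    l2 (p + r) ^ 2 = l2 p ^ 2 + 2 * ip p r + l2 r ^ 2 := by
  have hpr : Summable (p + r) := hp.add hr
  rw [← ip_self, ← ip_self, ← ip_self, ip_add_left hp hr hpr, ip_comm p (p + r), ip_comm r (p + r),
    ip_add_left hp hr hp, ip_add_left hp hr hr, ip_comm r p]
  ring

lemma l2_sq_smul (s : ℝ) (p : ℕ → ℝ) : l2 (s • p) ^ 2 = s ^ 2 * l2 p ^ 2 := by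
  rw [← ip_self, ← ip_self, ip_smul_left, ip_comm, ip_smul_left]; ring

lemma conv_add (v w b : ℕ → ℝ) : conv (v + w) b = conv v b + conv w b := by
  funext m; simp [conv, add_mul, Finset.sum_add_distrib]

lemma conv_smul (s : ℝ) (v b : ℕ → ℝ) : conv (s • v) b = s • conv v b := by
  funext m; simp [conv, mul_assoc, Finset.mul_sum]

lemma conv_sub (v w b : ℕ → ℝ) : conv (v - w) b = conv v b - conv w b := by
  funext m; simp [conv, sub_mul, Finset.sum_sub_distrib]

/-- Extension of a vector by zeros. -/
def ext {k : ℕ} (v : Fin k → ℝ) (i : ℕ) : ℝ := if h : i < k then v ⟨i, h⟩ else 0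

lemma ext_of_ge {k i : ℕ} (v : Fin k → ℝ) (h : k ≤ i) : ext v i = 0 := by
  simp [ext, not_lt.2 h]

lemma ext_coe {k : ℕ} (v : Fin k → ℝ) (i : Fin k) : ext v i = v i := by simp [ext]

lemma hasSum_ext {k : ℕ} (v : Fin k → ℝ) (f : ℕ → ℝ) :
    HasSum (fun i => ext v i * f i) (∑ i : Fin k, v i * f i) := by
  have h1 : ∑ i : Fin k, v i * f i = ∑ i ∈ Finset.range k, ext v i * f i := by
    rw [Finset.sum_range]; simp [ext_coe]
  rw [h1]
  refine hasSum_sum_of_ne_finset_zero fun i hi => ?_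
  rw [ext_of_ge v (by simpa using hi), zero_mul]

lemma summable_ext {k : ℕ} (v : Fin k → ℝ) : Summable (ext v) := by
  simpa using (hasSum_ext v fun _ => 1).summable

lemma ext_add {k : ℕ} (v w : Fin k → ℝ) : ext (v + w) = ext v + ext w := by
  funext i; by_cases h : i < k <;> simp [ext, h]

lemma ext_smul {k : ℕ} (s : ℝ) (v : Fin k → ℝ) : ext (s • v) = s • ext v := by
  funext i; by_cases h : i < k <;> simp [ext, h]

lemma l2_ext_sq {k : ℕ} (v : Fin k → ℝ) : l2 (ext v) ^ 2 = v ⬝ᵥ v := by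
  rw [← ip_self, ip, (hasSum_ext v (ext v)).tsum_eq]
  simp [dotProduct, ext_coe]

lemma lin_ext {k : ℕ} (v : Fin k → ℝ) (x : ℤ → ℝ) (t : ℤ) :
    lin (ext v) x t = lagVec x t k ⬝ᵥ v := by
  rw [lin, (hasSum_ext v fun m => x (t - m)).tsum_eq]
  simp [dotProduct, lagVec, mul_comm]

/-- The unit vector at position `i`. -/
def unitSeq (i : ℕ) (m : ℕ) : ℝ := if m = i then 1 else 0

lemma summable_unitSeq (i : ℕ) : Summable (unitSeq i) :=
  summable_of_ne_finset_zero (s := {i}) fun m hm => by simp at hm; simp [unitSeq, hm]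

lemma lin_unitSeq (i : ℕ) (x : ℤ → ℝ) (t : ℤ) : lin (unitSeq i) x t = x (t - i) := by
  rw [lin, tsum_eq_single i]
  · simp [unitSeq]
  · intro m hm; simp [unitSeq, hm]

lemma l2_unitSeq (i : ℕ) : l2 (unitSeq i) = 1 := by
  rw [l2, tsum_eq_single i]
  · simp [unitSeq]
  · intro m hm; simp [unitSeq, hm]

lemma l1_unitSeq (i : ℕ) : l1 (unitSeq i) = 1 := by
  rw [l1, tsum_eq_single i]
  · simp [unitSeq]
  · intro m hm; simp [unitSeq, hm]

lemma lin_sub {v w : ℕ → ℝ} {x : ℤ → ℝ} {t : ℤ} (hv : Summable fun m : ℕ => v m * x (t - m))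
    (hw : Summable fun m : ℕ => w m * x (t - m)) :
    lin (v - w) x t = lin v x t - lin w x t := by
  rw [lin, lin, lin, ← hv.tsum_sub hw]; simp [sub_mul]

end Sequences

/-! ### The causal representation -/

section Causal

set_option linter.unusedSectionVars false

variable {Ω : Type*} [MeasurableSpace Ω]

/-- The coefficients of `A(z)`, including the leading one. -/
def arCoef (a : ℕ → ℝ) (i : ℕ) : ℝ := if i = 0 then 1 else a i

/-- An autoregression of infinite order together with its causal moving average representation,
whose coefficients are `b`. -/
structure CausalModel (μ : Measure Ω) (σ : ℝ) (a b : ℕ → ℝ) (e x : ℤ → Ω → ℝ) : Prop where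
  noise : IsNoise μ σ e
  moments : UniformMoments μ e
  sigma_pos : 0 < σ ^ 2
  weighted_ar : Summable fun i : ℕ => √((i : ℝ) + 1) * |arCoef a i|
  weighted_ma : Summable fun i : ℕ => √((i : ℝ) + 1) * |b i|
  inverse : conv (arCoef a) b = delta
  repr : ∀ t, x t = filt b e t

lemma one_le_sqrt_succ (i : ℕ) : (1 : ℝ) ≤ √((i : ℝ) + 1) := by
  rw [Real.one_le_sqrt]; linarith [Nat.cast_nonneg (α := ℝ) i]

lemma summable_of_weighted {c : ℕ → ℝ} (h : Summable fun i : ℕ => √((i : ℝ) + 1) * |c i|) :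
    Summable c := by
  refine Summable.of_abs (Summable.of_nonneg_of_le (fun i => abs_nonneg _) (fun i => ?_) h)
  exact le_mul_of_one_le_left (abs_nonneg _) (one_le_sqrt_succ i)

/-- A stationary solution of the autoregression equation is causal. -/
theorem exists_causal {μ : Measure Ω} [IsProbabilityMeasure μ] {a : ℕ → ℝ} {σ : ℝ}
    {e x : ℤ → Ω → ℝ} (he : IsNoise μ σ e) (hmom : UniformMoments μ e) (hσ : 0 < σ ^ 2)
    (hx : IsStationary μ x) (hAR : IsAutoregression μ a x e)
    (hA : ∀ z : ℂ, ‖z‖ ≤ 1 → arSeries a z ≠ 0)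
    (ha : Summable fun i : ℕ => √(i : ℝ) * |a i|) :
    ∃ b : ℕ → ℝ, CausalModel μ σ a b e (filt b e) ∧ ∀ᵐ ω ∂μ, ∀ t, x t ω = filt b e t ω := by
  have hw : Summable fun i : ℕ => √((i : ℝ) + 1) * |arCoef a i| := by
    rw [← summable_nat_add_iff 1]
    refine Summable.of_nonneg_of_le (fun i => by positivity) (fun i => ?_)
      (((summable_nat_add_iff 1).2 ha).mul_left 2)
    rw [arCoef, if_neg (by omega), ← mul_assoc]
    gcongr
    rw [Real.sqrt_le_left (by positivity), mul_pow, Real.sq_sqrt (by positivity)]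
    push_cast
    linarith [Nat.cast_nonneg (α := ℝ) i]
  have hα : Summable (arCoef a) := summable_of_weighted hw
  obtain ⟨b, hb, hinv⟩ := exists_summable_inverse (arCoef a) (by simp [arCoef]) hw (by
    intro z hz
    have h1 : Summable fun i : ℕ => (arCoef a i : ℂ) * z ^ i := by
      refine Summable.of_norm_bounded hα.abs fun i => ?_
      rw [norm_mul, norm_pow, Complex.norm_real, Real.norm_eq_abs]
      exact mul_le_of_le_one_right (abs_nonneg _) (pow_le_one₀ (norm_nonneg _) hz)
    have h2 := h1.sum_add_tsum_nat_add 1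
    rw [← h2]
    simpa [arCoef, arSeries] using hA z hz)
  have hinv' : conv (arCoef a) b = delta := funext fun m => hinv m
  have hbs := summable_of_weighted hb
  refine ⟨b, ⟨he, hmom, hσ, hw, hb, hinv', fun _ => rfl⟩, ?_⟩
  -- Stationarity gives x a constant second moment, hence a uniform L¹ bound, so summable filters of
  -- x converge absolutely almost surely.
  obtain ⟨C, hC⟩ : ∃ C, ∀ t, MomentLE μ 1 (x t) C := by
    set V := variance (x 0) μ + (∫ ω, x 0 ω ∂μ) ^ 2 with hV
    refine ⟨max V 1, fun t => ?_⟩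
    have h1 : ∫ ω, x t ω ^ 2 ∂μ = V := by
      have h2 := variance_eq_sub (hx.memLp t)
      have h3 := hx.covariance t 0
      rw [add_zero, covariance_self (hx.measurable _).aemeasurable,
        covariance_self (hx.measurable _).aemeasurable] at h3
      simp only [Pi.pow_apply] at h2
      rw [hx.mean t, h3] at h2
      rw [hV]; linarith
    refine MomentLE.exponent_mono (q := 2) (by omega) ?_
    refine MomentLE.of_integral_pow (by omega) (by positivity)
      (hx.measurable t).aestronglyMeasurable ?_ ?_
    · simpa only [sq_abs] using (hx.memLp t).integrable_sq
    · simp only [sq_abs]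
      rw [h1]
      exact (le_max_left V 1).trans (le_self_pow₀ (le_max_right _ _) (by omega))
  have hAR' : ∀ᵐ ω ∂μ, ∀ t, lin (arCoef a) (fun s => x s ω) t = e t ω := by
    rw [ae_all_iff]
    intro t
    filter_upwards [hAR t] with ω hω
    have h1 : HasSum (fun i : ℕ => arCoef a (i + 1) * x (t - ((i + 1 : ℕ) : ℤ)) ω)
        (e t ω - x t ω) := by
      simpa [arCoef] using hω
    have h2 := (hasSum_nat_add_iff (f := fun i : ℕ => arCoef a i * x (t - (i : ℤ)) ω) 1).1 h1
    rw [lin, h2.tsum_eq]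
    simp [arCoef]
  have hsum := ae_summable_abs hC (summable_conv hbs.abs hα.abs)
  filter_upwards [hAR', hsum] with ω h1 h2 t
  have h3 : ∀ m, |conv (fun i => |b i|) (fun i => |arCoef a i|) m| =
      conv (fun i => |b i|) (fun i => |arCoef a i|) m := fun m =>
    abs_of_nonneg (Finset.sum_nonneg fun _ _ => by positivity)
  -- Applying b to the autoregression: b ∗ A is the identity filter, so the left side becomes x and
  -- the right side b applied to e.
  have h4 := (lin_lin (v := b) (b := arCoef a) (x := fun s => x s ω) (t := t)
    (by simpa only [h3] using h2 t)).2
  rw [conv_comm, hinv', lin_delta] at h4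
  rw [filt, ← h4]
  congr 1
  funext s
  exact (h1 s)

namespace CausalModel

variable {μ : Measure Ω} [IsProbabilityMeasure μ] {a b : ℕ → ℝ} {σ : ℝ} {e x : ℤ → Ω → ℝ}

lemma summable_ar (M : CausalModel μ σ a b e x) : Summable (arCoef a) :=
  summable_of_weighted M.weighted_ar

lemma summable_ma (M : CausalModel μ σ a b e x) : Summable b :=
  summable_of_weighted M.weighted_ma

lemma summable_tail (M : CausalModel μ σ a b e x) : Summable fun i => a (i + 1) := by
  simpa [arCoef] using (summable_nat_add_iff 1).2 M.summable_ar

lemma conv_conv (M : CausalModel μ σ a b e x) (v : ℕ → ℝ) :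
    conv (conv v b) (arCoef a) = v := by
  rw [conv_assoc, conv_comm b, M.inverse, conv_delta]

lemma l1_ar_pos (M : CausalModel μ σ a b e x) : 0 < l1 (arCoef a) := by
  have h := M.summable_ar.abs.le_tsum 0 fun _ _ => abs_nonneg _
  simp only [arCoef, if_true, abs_one] at h
  exact lt_of_lt_of_le one_pos h

/-- Filtering with b is undone by filtering with A, and Young's inequality bounds the undoing. This
is the source of the lower eigenvalue bound for all covariance matrices at once. -/
lemma l2_conv_ge (M : CausalModel μ σ a b e x) {v : ℕ → ℝ} (hv : Summable v) :
    l2 v ≤ l1 (arCoef a) * l2 (conv v b) := by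
  have := l2_conv_le (summable_conv hv M.summable_ma) M.summable_ar
  rw [M.conv_conv, mul_comm] at this
  exact this

lemma exists_moment (M : CausalModel μ σ a b e x) (q : ℕ) (hq : 1 ≤ q) :
    ∃ C, 0 ≤ C ∧ ∀ t, MomentLE μ q (x t) C := by
  obtain ⟨C, hC0, hC⟩ := exists_filt_bound M.noise M.moments hq
  exact ⟨C * l2 b, mul_nonneg hC0 (l2_nonneg _), fun t => M.repr t ▸ hC b M.summable_ma t⟩

lemma measurable_past (M : CausalModel μ σ a b e x) {s t : ℤ} (h : s < t) :
    Measurable[past e t] (x s) := by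
  rw [M.repr]; exact measurable_filt b h

lemma measurable (M : CausalModel μ σ a b e x) (t : ℤ) : Measurable (x t) := by
  rw [M.repr]; exact measurable_filt' M.noise.measurable b t

/-- Filters of `x` as filters of the noise. -/
lemma ae_lin (M : CausalModel μ σ a b e x) {v : ℕ → ℝ} (hv : Summable v) :
    ∀ᵐ ω ∂μ, ∀ t, (Summable fun m : ℕ => v m * x (t - m) ω) ∧
      lin v (fun s => x s ω) t = filt (conv v b) e t ω := by
  obtain ⟨B, -, hB⟩ := exists_moment_noise M.noise M.moments 1
  filter_upwards [ae_summable_abs hB (summable_conv hv.abs M.summable_ma.abs)] with ω h2 t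
  have h3 : ∀ m, |conv (fun i => |v i|) (fun i => |b i|) m| =
      conv (fun i => |v i|) (fun i => |b i|) m := fun m =>
    abs_of_nonneg (Finset.sum_nonneg fun _ _ => by positivity)
  have h4 := lin_lin (v := v) (b := b) (x := fun s => e s ω) (t := t)
    (by simpa only [h3] using h2 t)
  simp only [M.repr]
  exact h4

lemma ae_ar (M : CausalModel μ σ a b e x) :
    ∀ᵐ ω ∂μ, ∀ t, x (t + 1) ω = e (t + 1) ω - lin (fun i => a (i + 1)) (fun s => x s ω) t := by
  filter_upwards [M.ae_lin M.summable_ar] with ω h t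
  obtain ⟨h1, h2⟩ := h (t + 1)
  rw [M.inverse, filt, lin_delta] at h2
  have h3 : _ + _ = lin (arCoef a) (fun s => x s ω) (t + 1) := h1.sum_add_tsum_nat_add 1
  rw [h2] at h3
  have h4 : ∑' i : ℕ, arCoef a (i + 1) * x (t + 1 - ((i + 1 : ℕ) : ℤ)) ω =
      lin (fun i => a (i + 1)) (fun s => x s ω) t := by
    rw [lin]
    refine tsum_congr fun i => ?_
    rw [arCoef, if_neg (by omega)]
    congr 2
    push_cast; ring
  rw [h4] at h3
  simp [arCoef] at h3
  linarith

/-- The one step prediction error of the coefficients `c`. -/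
lemma ae_residual (M : CausalModel μ σ a b e x) {k : ℕ} (c : Fin k → ℝ) :
    ∀ᵐ ω ∂μ, ∀ t, x (t + 1) ω + lagVec (fun s => x s ω) t k ⬝ᵥ c =
      e (t + 1) ω - lin ((fun i => a (i + 1)) - ext c) (fun s => x s ω) t := by
  filter_upwards [M.ae_ar, M.ae_lin M.summable_tail, M.ae_lin (summable_ext c)] with ω h1 h2 h3 t
  rw [lin_sub (x := fun s => x s ω) (h2 t).1 (h3 t).1, lin_ext, h1]
  ring

lemma moment_lin (M : CausalModel μ σ a b e x) {q : ℕ} (hq : 1 ≤ q) :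
    ∃ C, 0 ≤ C ∧ ∀ v : ℕ → ℝ, Summable v → ∀ t,
      MomentLE μ q (fun ω => lin v (fun s => x s ω) t) (C * l2 (conv v b)) := by
  obtain ⟨C, hC0, hC⟩ := exists_filt_bound M.noise M.moments hq
  refine ⟨C, hC0, fun v hv t => (hC _ (summable_conv hv M.summable_ma) t).congr ?_⟩
  filter_upwards [M.ae_lin hv] with ω h
  exact (h t).2.symm

lemma integral_lin_mul_lin (M : CausalModel μ σ a b e x) {v w : ℕ → ℝ} (hv : Summable v)
    (hw : Summable w) (t : ℤ) :
    ∫ ω, lin v (fun s => x s ω) t * lin w (fun s => x s ω) t ∂μ =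
      σ ^ 2 * ip (conv v b) (conv w b) := by
  rw [ip, ← integral_filt_mul_filt M.noise M.moments (summable_conv hv M.summable_ma)
    (summable_conv hw M.summable_ma) t]
  refine integral_congr_ae ?_
  filter_upwards [M.ae_lin hv, M.ae_lin hw] with ω h1 h2
  rw [(h1 t).2, (h2 t).2]

lemma measurable_lin_past (M : CausalModel μ σ a b e x) (v : ℕ → ℝ) {s t : ℤ} (h : s < t) :
    Measurable[past e t] (fun ω => lin v (fun s => x s ω) s) :=
  measurable_tsum fun _ => (M.measurable_past (by omega)).const_mul _

lemma deviation_lin_mul_lin (M : CausalModel μ σ a b e x) {q : ℕ} (hq : 1 ≤ q) :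
    ∃ C, 0 ≤ C ∧ ∀ (J : Finset ℤ) (v w : ℕ → ℝ), Summable v → Summable w →
      MomentLE μ q (fun ω => ∑ j ∈ J, (lin v (fun s => x s ω) j * lin w (fun s => x s ω) j -
        σ ^ 2 * ip (conv v b) (conv w b))) (C * (√(J.card) * (l2 (conv v b) * l1 (conv w b)))) := by
  obtain ⟨C, hC0, hC⟩ := exists_filt_mul_filt_bound M.noise M.moments hq
  refine ⟨C, hC0, fun J v w hv hw => (hC J _ _ (summable_conv hv M.summable_ma)
    (summable_conv hw M.summable_ma)).congr ?_⟩
  filter_upwards [M.ae_lin hv, M.ae_lin hw] with ω h1 h2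
  refine Finset.sum_congr rfl fun j _ => ?_
  rw [(h1 j).2, (h2 j).2, ip]

/-! ### The population regression -/

/-- The covariance matrix of `(x_j, …, x_{j-k+1})`. -/
noncomputable def _root_.InfAR.covMat (σ : ℝ) (b : ℕ → ℝ) (k : ℕ) : Matrix (Fin k) (Fin k) ℝ :=
  Matrix.of fun i l => σ ^ 2 * ip (conv (unitSeq i) b) (conv (unitSeq l) b)

lemma integral_mul (M : CausalModel μ σ a b e x) (t : ℤ) (i l : ℕ) :
    ∫ ω, x (t - i) ω * x (t - l) ω ∂μ = σ ^ 2 * ip (conv (unitSeq i) b) (conv (unitSeq l) b) := by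
  rw [← M.integral_lin_mul_lin (summable_unitSeq i) (summable_unitSeq l) t]
  simp only [lin_unitSeq]

lemma _root_.InfAR.ext_eq_sum {k : ℕ} (v : Fin k → ℝ) :
    ext v = ∑ i : Fin k, v i • unitSeq i := by
  funext m
  rw [Finset.sum_apply]
  simp only [Pi.smul_apply, smul_eq_mul, unitSeq]
  by_cases h : m < k
  · rw [Finset.sum_eq_single ⟨m, h⟩]
    · simp [ext, h]
    · intro i _ hi
      rw [if_neg (fun h' => hi (Fin.ext h'.symm)), mul_zero]
    · simp
  · rw [ext_of_ge v (not_lt.1 h), Finset.sum_eq_zero]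
    intro i _
    rw [if_neg (fun h' : m = i => h (h' ▸ i.2)), mul_zero]

lemma _root_.InfAR.ip_sum_left {ι : Type*} (I : Finset ι) {f : ι → ℕ → ℝ} {r : ℕ → ℝ}
    (hf : ∀ i ∈ I, Summable (f i)) (hr : Summable r) :
    ip (∑ i ∈ I, f i) r = ∑ i ∈ I, ip (f i) r := by
  classical
  induction I using Finset.induction_on with
  | empty => simp [ip]
  | insert i I hi ih =>
    have h1 : Summable (∑ i ∈ I, f i) := by
      have := summable_sum fun i hi' => hf i (Finset.mem_insert_of_mem hi')
      refine this.congr fun m => ?_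
      simp
    rw [Finset.sum_insert hi, Finset.sum_insert hi, ip_add_left (hf i (by simp)) h1 hr,
      ih fun i hi' => hf i (Finset.mem_insert_of_mem hi')]

lemma _root_.InfAR.conv_sum {ι : Type*} (I : Finset ι) (f : ι → ℕ → ℝ) (b : ℕ → ℝ) :
    conv (∑ i ∈ I, f i) b = ∑ i ∈ I, conv (f i) b := by
  classical
  induction I using Finset.induction_on with
  | empty => funext m; simp [conv]
  | insert i I hi ih => rw [Finset.sum_insert hi, Finset.sum_insert hi, conv_add, ih]

lemma ip_conv_ext_left (M : CausalModel μ σ a b e x) {k : ℕ} (v : Fin k → ℝ) {r : ℕ → ℝ}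
    (hr : Summable r) :
    ip (conv (ext v) b) r = ∑ i, v i * ip (conv (unitSeq i) b) r := by
  rw [ext_eq_sum, conv_sum]
  simp only [conv_smul]
  rw [ip_sum_left (f := fun i : Fin k => v i • conv (unitSeq i) b) _
    (fun i _ => (summable_conv (summable_unitSeq _) M.summable_ma).const_smul (v i)) hr]
  simp only [ip_smul_left]

lemma dotProduct_covMat (M : CausalModel μ σ a b e x) {k : ℕ} (v w : Fin k → ℝ) :
    v ⬝ᵥ covMat σ b k *ᵥ w = σ ^ 2 * ip (conv (ext v) b) (conv (ext w) b) := by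
  rw [M.ip_conv_ext_left v (summable_conv (summable_ext w) M.summable_ma)]
  simp only [dotProduct, Matrix.mulVec, covMat, Matrix.of_apply]
  rw [Finset.mul_sum]
  refine Finset.sum_congr rfl fun i _ => ?_
  rw [ip_comm, M.ip_conv_ext_left w (summable_conv (summable_unitSeq _) M.summable_ma),
    Finset.mul_sum, Finset.mul_sum, Finset.mul_sum]
  refine Finset.sum_congr rfl fun l _ => ?_
  rw [ip_comm]; ring

/-- A lower bound for the eigenvalues of the covariance matrices. -/
noncomputable def _root_.InfAR.eigLow (σ : ℝ) (a : ℕ → ℝ) : ℝ := σ ^ 2 / l1 (arCoef a) ^ 2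

/-- An upper bound for the eigenvalues of the covariance matrices. -/
noncomputable def _root_.InfAR.eigUp (σ : ℝ) (b : ℕ → ℝ) : ℝ := σ ^ 2 * l1 b ^ 2

lemma eigLow_pos (M : CausalModel μ σ a b e x) : 0 < eigLow σ a :=
  div_pos M.sigma_pos (pow_pos M.l1_ar_pos 2)

lemma eigLow_mul_le (M : CausalModel μ σ a b e x) {v : ℕ → ℝ} (hv : Summable v) :
    eigLow σ a * l2 v ^ 2 ≤ σ ^ 2 * l2 (conv v b) ^ 2 := by
  have h1 := M.l2_conv_ge hv
  have h2 := pow_le_pow_left₀ (l2_nonneg v) h1 2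
  have h3 := pow_pos M.l1_ar_pos 2
  rw [eigLow, div_mul_eq_mul_div, div_le_iff₀ h3]
  rw [mul_pow] at h2
  nlinarith [M.sigma_pos]

lemma le_eigUp_mul (M : CausalModel μ σ a b e x) {v : ℕ → ℝ} (hv : Summable v) :
    σ ^ 2 * l2 (conv v b) ^ 2 ≤ eigUp σ b * l2 v ^ 2 := by
  have h2 := pow_le_pow_left₀ (l2_nonneg _) (l2_conv_le hv M.summable_ma) 2
  rw [mul_pow] at h2
  rw [eigUp]
  nlinarith [M.sigma_pos]

lemma covMat_ge (M : CausalModel μ σ a b e x) {k : ℕ} (v : Fin k → ℝ) :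
    eigLow σ a * (v ⬝ᵥ v) ≤ v ⬝ᵥ covMat σ b k *ᵥ v := by
  rw [M.dotProduct_covMat, ip_self, ← l2_ext_sq]
  exact M.eigLow_mul_le (summable_ext v)

/-- The prediction error is the innovation minus a filter of the past. The two are independent and
the innovation has mean zero, so the squares add. -/
lemma predErr_eq (M : CausalModel μ σ a b e x) {k : ℕ} (c : Fin k → ℝ) :
    predErr μ x k c = σ ^ 2 + σ ^ 2 * l2 (conv ((fun i => a (i + 1)) - ext c) b) ^ 2 := by
  set w := (fun i => a (i + 1)) - ext c with hw
  have hws : Summable w := M.summable_tail.sub (summable_ext c)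
  set z : Ω → ℝ := fun ω => lin w (fun s => x s ω) k with hz
  obtain ⟨C, hC0, hC⟩ := M.moment_lin (q := 2) (by omega)
  have hz2 : MemLp z 2 μ := by simpa using (hC w hws k).memLp
  have he2 : MemLp (e (k + 1)) 2 μ := M.noise.memLp _
  have hind : IndepFun (e (k + 1)) z μ := by
    rw [IndepFun_iff_Indep]
    exact indep_of_indep_of_le_right (indep_past M.noise.measurable M.noise.indep _)
      (M.measurable_lin_past w (lt_add_one _)).comap_le
  have h0 : ∫ ω, e (k + 1) ω * z ω ∂μ = 0 := by
    have := hind.integral_mul_eq_mul_integral he2.1 hz2.1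
    rw [M.noise.mean, zero_mul] at this
    exact this
  have h1 : predErr μ x k c = ∫ ω, (e (k + 1) ω ^ 2 - 2 * (e (k + 1) ω * z ω) + z ω ^ 2) ∂μ := by
    rw [predErr]
    refine integral_congr_ae ?_
    filter_upwards [M.ae_residual c] with ω h
    rw [h]
    simp only [hz]
    ring
  have i1 : Integrable (fun ω => e (k + 1) ω ^ 2) μ := he2.integrable_sq
  have i2 : Integrable (fun ω => 2 * (e (k + 1) ω * z ω)) μ :=
    (he2.integrable_mul hz2).const_mul 2
  have i3 : Integrable (fun ω => z ω ^ 2) μ := hz2.integrable_sq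
  have i4 : Integrable (fun ω => e (k + 1) ω ^ 2 - 2 * (e (k + 1) ω * z ω)) μ := i1.sub i2
  rw [h1, integral_add i4 i3, integral_sub i1 i2, integral_const_mul, h0,
    integral_sq_noise M.noise, ← ip_self, ← M.integral_lin_mul_lin hws hws k]
  simp only [hz, sq]
  ring

end CausalModel

end Causal

/-! ### Normal equations and the bias of finite-order autoregressions. -/

section Population

set_option linter.unusedSectionVars false

lemma ip_conv_left {v b r : ℕ → ℝ} (hv : Summable v) (hb : Summable b) (hr : Summable r) :
    ip (conv v b) r = ∑' i, v i * ip (conv (unitSeq i) b) r := by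
  -- Read backwards in time, r becomes a path, and the inner product with r is a filter evaluated at
  -- time 0; the interchange of sums is then `lin_lin`. Positive times of y are never used.
  set y : ℤ → ℝ := fun t => r (-t).toNat with hy
  have hy0 : ∀ m : ℕ, y (0 - m) = r m := fun m => by simp [hy]
  have key : ∀ w : ℕ → ℝ, Summable w → lin w (lin b y) 0 = ip (conv w b) r := by
    intro w hw
    rw [(lin_lin ?_).2, lin, ip]
    · simp only [hy0]
    · simp only [hy0]
      exact summable_ip (summable_conv hw.abs hb.abs) hr.abs
  rw [← key v hv, lin]
  refine tsum_congr fun i => ?_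
  rw [← key _ (summable_unitSeq i), lin_unitSeq]

variable {Ω : Type*} [MeasurableSpace Ω]
variable {μ : Measure Ω} [IsProbabilityMeasure μ] {a b : ℕ → ℝ} {σ : ℝ} {e x : ℤ → Ω → ℝ}

/-- The `ℓ²` norm of `a - a(k)` filtered with `b`. -/
noncomputable def bias (μ : Measure Ω) (a b : ℕ → ℝ) (x : ℤ → Ω → ℝ) (k : ℕ) : ℝ :=
  l2 (conv (coefDiff μ a x k) b)

lemma bias_nonneg (k : ℕ) : 0 ≤ bias μ a b x k := l2_nonneg _

namespace CausalModel

lemma normRSq_eq (M : CausalModel μ σ a b e x) {v : ℕ → ℝ} (hv : Summable v) :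
    normRSq μ x v = σ ^ 2 * l2 (conv v b) ^ 2 := by
  have hvb := summable_conv hv M.summable_ma
  have h1 : ∀ i j : ℕ, ∫ ω, x ((i : ℤ) + 1) ω * x ((j : ℤ) + 1) ω ∂μ =
      σ ^ 2 * ip (conv (unitSeq j) b) (conv (unitSeq i) b) := by
    intro i j
    rw [← M.integral_mul ((i : ℤ) + j + 1) j i]
    congr 1
    funext ω
    congr 2 <;> ring
  rw [normRSq, ← ip_self, ip_conv_left hv M.summable_ma hvb, ← tsum_mul_left]
  refine tsum_congr fun i => ?_
  rw [ip_comm, ip_conv_left hv M.summable_ma (summable_conv (summable_unitSeq i) M.summable_ma),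
    ← tsum_mul_left, ← tsum_mul_left]
  refine tsum_congr fun j => ?_
  rw [h1]; ring

lemma covMat_mulVec_injective (M : CausalModel μ σ a b e x) (k : ℕ) :
    Function.Injective (covMat σ b k).mulVec := by
  intro v w hvw
  have h1 : covMat σ b k *ᵥ (v - w) = 0 := by rw [Matrix.mulVec_sub, hvw, sub_self]
  have h2 := M.covMat_ge (v - w)
  rw [h1, dotProduct_zero] at h2
  have h3 : 0 ≤ (v - w) ⬝ᵥ (v - w) := by
    rw [← l2_ext_sq]; positivity
  have h4 : (v - w) ⬝ᵥ (v - w) = 0 := le_antisymm (by nlinarith [M.eigLow_pos]) h3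
  exact sub_eq_zero.1 (dotProduct_self_eq_zero.1 h4)

lemma isUnit_covMat (M : CausalModel μ σ a b e x) (k : ℕ) : IsUnit (covMat σ b k) :=
  Matrix.mulVec_injective_iff_isUnit.1 (M.covMat_mulVec_injective k)

lemma covMat_symm (k : ℕ) : (covMat σ b k)ᵀ = covMat σ b k := by
  ext i l; simp [covMat, ip_comm]

/-- Pythagoras in the ℓ² space of filtered sequences. -/
lemma predErr_of_orthogonal (M : CausalModel μ σ a b e x) {k : ℕ} (c v : Fin k → ℝ)
    (h : ip (conv ((fun i => a (i + 1)) - ext c) b) (conv (ext v) b) = 0) :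
    predErr μ x k (c + v) = predErr μ x k c + v ⬝ᵥ covMat σ b k *ᵥ v := by
  have hs : Summable (conv ((fun i => a (i + 1)) - ext c) b) :=
    summable_conv (M.summable_tail.sub (summable_ext c)) M.summable_ma
  have hv := summable_conv (summable_ext v) M.summable_ma
  rw [M.predErr_eq, M.predErr_eq, M.dotProduct_covMat, ip_self]
  have h1 : conv ((fun i => a (i + 1)) - ext (c + v)) b =
      conv ((fun i => a (i + 1)) - ext c) b + (-1 : ℝ) • conv (ext v) b := by
    rw [ext_add, ← sub_sub, conv_sub]; simp [sub_eq_add_neg]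
  have hv' : Summable ((-1 : ℝ) • conv (ext v) b) := hv.const_smul (-1 : ℝ)
  rw [h1, l2_sq_add hs hv', ip_comm, ip_smul_left, ip_comm, h, l2_sq_smul]
  ring

lemma exists_orthogonal (M : CausalModel μ σ a b e x) (k : ℕ) :
    ∃ c : Fin k → ℝ, ∀ v : Fin k → ℝ,
      ip (conv ((fun i => a (i + 1)) - ext c) b) (conv (ext v) b) = 0 := by
  set r : Fin k → ℝ := fun i =>
    σ ^ 2 * ip (conv (unitSeq i) b) (conv (fun i => a (i + 1)) b) with hr
  have ht := summable_conv M.summable_tail M.summable_ma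
  refine ⟨(covMat σ b k)⁻¹ *ᵥ r, fun v => ?_⟩
  set c := (covMat σ b k)⁻¹ *ᵥ r with hc
  have h1 : covMat σ b k *ᵥ c = r := by
    rw [hc, Matrix.mulVec_mulVec, Matrix.mul_nonsing_inv _
      ((Matrix.isUnit_iff_isUnit_det _).1 (M.isUnit_covMat k)), Matrix.one_mulVec]
  have h2 := M.dotProduct_covMat v c
  rw [h1] at h2
  have h3 : v ⬝ᵥ r = σ ^ 2 * ip (conv (ext v) b) (conv (fun i => a (i + 1)) b) := by
    rw [M.ip_conv_ext_left v ht, dotProduct, Finset.mul_sum]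
    refine Finset.sum_congr rfl fun i _ => ?_
    rw [hr]; ring
  have h4 : conv ((fun i => a (i + 1)) - ext c) b =
      conv (fun i => a (i + 1)) b + (-1 : ℝ) • conv (ext c) b := by
    rw [conv_sub]; simp [sub_eq_add_neg]
  have hcs := summable_conv (summable_ext c) M.summable_ma
  have hcs' : Summable ((-1 : ℝ) • conv (ext c) b) := hcs.const_smul (-1 : ℝ)
  rw [h4, ip_add_left ht hcs' (summable_conv (summable_ext v) M.summable_ma),
    ip_smul_left, ip_comm, ip_comm (conv (ext c) b)]
  have h5 : σ ^ 2 * ip (conv (ext v) b) (conv (fun i => a (i + 1)) b) =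
      σ ^ 2 * ip (conv (ext v) b) (conv (ext c) b) := by rw [← h3, h2]
  have h6 := mul_left_cancel₀ M.sigma_pos.ne' h5
  rw [h6]; ring

/-- `bestCoef` is an arbitrary choice; it has the minimizing property because the normal equations
provide some minimizer. -/
lemma predErr_bestCoef_le (M : CausalModel μ σ a b e x) {k : ℕ} (c : Fin k → ℝ) :
    predErr μ x k (bestCoef μ x k) ≤ predErr μ x k c := by
  obtain ⟨c₀, hc₀⟩ := M.exists_orthogonal k
  have hex : ∃ c₁ : Fin k → ℝ, ∀ c', predErr μ x k c₁ ≤ predErr μ x k c' := by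
    refine ⟨c₀, fun c' => ?_⟩
    have h1 := M.predErr_of_orthogonal c₀ (c' - c₀) (hc₀ _)
    rw [add_sub_cancel] at h1
    rw [h1, M.dotProduct_covMat, ip_self]
    have := M.sigma_pos
    have : 0 ≤ σ ^ 2 * l2 (conv (ext (c' - c₀)) b) ^ 2 := by positivity
    linarith
  exact Classical.epsilon_spec hex c

lemma coefDiff_eq (k : ℕ) :
    coefDiff μ a x k = (fun i => a (i + 1)) - ext (bestCoef μ x k) := rfl

/-- The normal equations. -/
lemma orthogonal_coefDiff (M : CausalModel μ σ a b e x) {k : ℕ} (v : Fin k → ℝ) :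
    ip (conv (coefDiff μ a x k) b) (conv (ext v) b) = 0 := by
  obtain ⟨c₀, hc₀⟩ := M.exists_orthogonal k
  -- Positive definiteness makes the minimizer unique, so the chosen one is the solution of the
  -- normal equations.
  have h1 := M.predErr_of_orthogonal c₀ (bestCoef μ x k - c₀) (hc₀ _)
  rw [add_sub_cancel] at h1
  have h2 := M.predErr_bestCoef_le c₀
  have h3 := M.covMat_ge (bestCoef μ x k - c₀)
  have h4 : 0 ≤ (bestCoef μ x k - c₀) ⬝ᵥ (bestCoef μ x k - c₀) := by
    rw [← l2_ext_sq]; positivity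
  have h5 : (bestCoef μ x k - c₀) ⬝ᵥ (bestCoef μ x k - c₀) = 0 :=
    le_antisymm (by nlinarith [M.eigLow_pos]) h4
  rw [coefDiff_eq, sub_eq_zero.1 (dotProduct_self_eq_zero.1 h5)]
  exact hc₀ v

lemma summable_coefDiff (M : CausalModel μ σ a b e x) (k : ℕ) : Summable (coefDiff μ a x k) :=
  M.summable_tail.sub (summable_ext _)

lemma normRSq_coefDiff (M : CausalModel μ σ a b e x) (k : ℕ) :
    normRSq μ x (coefDiff μ a x k) = σ ^ 2 * bias μ a b x k ^ 2 :=
  M.normRSq_eq (M.summable_coefDiff k)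

lemma predErr_decomp (M : CausalModel μ σ a b e x) {k : ℕ} (c : Fin k → ℝ) :
    predErr μ x k c = σ ^ 2 + normRSq μ x (coefDiff μ a x k) +
      (c - bestCoef μ x k) ⬝ᵥ covMat σ b k *ᵥ (c - bestCoef μ x k) := by
  have h1 := M.predErr_of_orthogonal (bestCoef μ x k) (c - bestCoef μ x k)
    (M.orthogonal_coefDiff _)
  rw [add_sub_cancel] at h1
  rw [h1, M.predErr_eq, M.normRSq_coefDiff]
  rfl

lemma bias_le_of_ext (M : CausalModel μ σ a b e x) {k : ℕ} (c : Fin k → ℝ) :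
    bias μ a b x k ≤ l2 (conv ((fun i => a (i + 1)) - ext c) b) := by
  have h1 := M.predErr_bestCoef_le c
  rw [M.predErr_eq, M.predErr_eq] at h1
  refine le_of_sq_le_sq ?_ (l2_nonneg _)
  have h2 := M.sigma_pos
  have h3 : σ ^ 2 * bias μ a b x k ^ 2 ≤
      σ ^ 2 * l2 (conv ((fun i => a (i + 1)) - ext c) b) ^ 2 := by
    have : bias μ a b x k = l2 (conv ((fun i => a (i + 1)) - ext (bestCoef μ x k)) b) := rfl
    rw [this]; linarith
  exact le_of_mul_le_mul_left h3 h2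

lemma bias_antitone (M : CausalModel μ σ a b e x) : Antitone (bias μ a b x) := by
  intro k k' hkk'
  set c : Fin k' → ℝ := fun i => ext (bestCoef μ x k) i with hc
  have h1 : ext c = ext (bestCoef μ x k) := by
    funext i
    by_cases h : i < k'
    · simp [hc, ext, h]
    · rw [ext_of_ge c (not_lt.1 h), ext_of_ge _ (by omega)]
  have h2 := M.bias_le_of_ext c
  rw [h1] at h2
  exact h2

/-- The truncation of a to its first k entries is a competitor. Its error is the tail of a, on which
the weight √(i + 1) is at least √(k + 1). -/
lemma exists_bias_bound (M : CausalModel μ σ a b e x) :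
    ∃ C, 0 ≤ C ∧ ∀ k : ℕ, √((k : ℝ) + 1) * bias μ a b x k ≤ C := by
  set W := ∑' i : ℕ, √((i : ℝ) + 1) * |arCoef a i| with hW
  have hW0 : 0 ≤ W := tsum_nonneg fun i => by positivity
  refine ⟨W * l1 b, mul_nonneg hW0 (l1_nonneg _), fun k => ?_⟩
  set c : Fin k → ℝ := fun i => a (i + 1) with hc
  set τ : ℕ → ℝ := (fun i => a (i + 1)) - ext c with hτ
  have hτs : Summable τ := M.summable_tail.sub (summable_ext c)
  have h1 : bias μ a b x k ≤ l1 τ * l1 b := (M.bias_le_of_ext c).trans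
    ((l2_conv_le hτs M.summable_ma).trans
      (mul_le_mul_of_nonneg_right (l2_le_l1 hτs) (l1_nonneg _)))
  have h2 : √((k : ℝ) + 1) * l1 τ ≤ W := by
    rw [l1, ← tsum_mul_left]
    have hsh := (summable_nat_add_iff 1).2 M.weighted_ar
    calc ∑' i, √((k : ℝ) + 1) * |τ i| ≤
          ∑' i : ℕ, √(((i + 1 : ℕ) : ℝ) + 1) * |arCoef a (i + 1)| := by
          refine (hτs.abs.mul_left _).tsum_le_tsum (fun i => ?_) hsh
          by_cases h : i < k
          · have : τ i = 0 := by simp [hτ, hc, ext, h]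
            rw [this, abs_zero, mul_zero]; positivity
          · have : τ i = arCoef a (i + 1) := by simp [hτ, ext, h, arCoef]
            rw [this]
            gcongr
            have : (k : ℝ) ≤ i := by exact_mod_cast not_lt.1 h
            linarith
      _ ≤ W := by
          rw [hW, ← M.weighted_ar.sum_add_tsum_nat_add 1]
          have : 0 ≤ ∑ i ∈ Finset.range 1, √((i : ℝ) + 1) * |arCoef a i| :=
            Finset.sum_nonneg fun i _ => by positivity
          linarith
  calc √((k : ℝ) + 1) * bias μ a b x k ≤ √((k : ℝ) + 1) * (l1 τ * l1 b) := by gcongr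
    _ = (√((k : ℝ) + 1) * l1 τ) * l1 b := by ring
    _ ≤ W * l1 b := mul_le_mul_of_nonneg_right h2 (l1_nonneg _)

lemma exists_bias_le (M : CausalModel μ σ a b e x) :
    ∃ C, 0 ≤ C ∧ ∀ k : ℕ, bias μ a b x k ≤ C := by
  obtain ⟨C, hC0, hC⟩ := M.exists_bias_bound
  exact ⟨C, hC0, fun k => (le_mul_of_one_le_left (bias_nonneg k) (one_le_sqrt_succ k)).trans (hC k)⟩

/-- Beyond index k the difference is the tail of a. The first k entries sum to at most √k times the
ℓ² norm, and that norm is at most a constant times the bias, of order k^(−1/2); the weight √i in the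
hypothesis is just enough. -/
lemma exists_l1_coefDiff_le (M : CausalModel μ σ a b e x) :
    ∃ C, 0 ≤ C ∧ ∀ k : ℕ, l1 (conv (coefDiff μ a x k) b) ≤ C := by
  obtain ⟨C, hC0, hC⟩ := M.exists_bias_bound
  set A := l1 (arCoef a) with hA
  have hA0 : 0 ≤ A := l1_nonneg _
  refine ⟨(A * C + A) * l1 b, mul_nonneg (by positivity) (l1_nonneg _), fun k => ?_⟩
  set d := coefDiff μ a x k with hd
  have hds : Summable d := M.summable_coefDiff k
  refine (l1_conv_le hds M.summable_ma).trans (mul_le_mul_of_nonneg_right ?_ (l1_nonneg _))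
  rw [l1, ← hds.abs.sum_add_tsum_nat_add k]
  refine add_le_add ?_ ?_
  · have h1 := Finset.sum_mul_sq_le_sq_mul_sq (Finset.range k) (fun _ => (1 : ℝ)) (fun i => |d i|)
    simp only [one_mul, one_pow, Finset.sum_const, Finset.card_range, nsmul_eq_mul, mul_one,
      sq_abs] at h1
    have h2 : (∑ i ∈ Finset.range k, |d i|) ^ 2 ≤ (√((k : ℝ) + 1) * l2 d) ^ 2 := by
      refine h1.trans ?_
      rw [mul_pow, Real.sq_sqrt (by positivity)]
      gcongr
      · linarith
      · exact sum_sq_le_l2_sq hds _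
    have h3 := le_of_sq_le_sq h2 (mul_nonneg (by positivity) (l2_nonneg _))
    calc _ ≤ √((k : ℝ) + 1) * (A * bias μ a b x k) :=
          h3.trans (mul_le_mul_of_nonneg_left (M.l2_conv_ge hds) (by positivity))
      _ = A * (√((k : ℝ) + 1) * bias μ a b x k) := by ring
      _ ≤ A * C := by gcongr; exact hC k
  · have h1 : ∀ i, |d (i + k)| = |arCoef a (i + (k + 1))| := fun i => by
      have : d (i + k) = a (i + k + 1) - ext (bestCoef μ x k) (i + k) := rfl
      rw [this, ext_of_ge _ (by omega), sub_zero, arCoef, if_neg (by omega)]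
      rfl
    simp only [h1]
    rw [hA, l1, ← M.summable_ar.abs.sum_add_tsum_nat_add (k + 1)]
    have : 0 ≤ ∑ i ∈ Finset.range (k + 1), |arCoef a i| :=
      Finset.sum_nonneg fun i _ => abs_nonneg _
    linarith

/-- A nonzero a_i with i > k is an entry of a − a(k) that no choice of a(k) can remove. -/
lemma bias_pos (M : CausalModel μ σ a b e x) (hinf : {i : ℕ | a i ≠ 0}.Infinite) (k : ℕ) :
    0 < bias μ a b x k := by
  obtain ⟨i, hi, hik⟩ := hinf.exists_gt k
  have hds := M.summable_coefDiff k
  have h1 : coefDiff μ a x k (i - 1) = a i := by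
    have : coefDiff μ a x k (i - 1) = a (i - 1 + 1) - ext (bestCoef μ x k) (i - 1) := rfl
    rw [this, ext_of_ge _ (by omega), sub_zero, Nat.sub_add_cancel (by omega)]
  have h2 := abs_le_l2 hds (i - 1)
  rw [h1] at h2
  have h3 := M.l2_conv_ge hds
  have h4 : 0 < |a i| := abs_pos.2 hi
  have h5 := M.l1_ar_pos
  by_contra h
  have h6 : bias μ a b x k = 0 := le_antisymm (not_lt.1 h) (bias_nonneg k)
  have h7 : l2 (conv (coefDiff μ a x k) b) = 0 := h6
  rw [h7, mul_zero] at h3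
  linarith

end CausalModel

end Population

/-! ### Concentration of the quadratic form of the score. -/

section QuadraticForm

set_option linter.unusedSectionVars false

variable {Ω : Type*} [MeasurableSpace Ω]
variable {μ : Measure Ω} [IsProbabilityMeasure μ] {a b : ℕ → ℝ} {σ : ℝ} {e x : ℤ → Ω → ℝ}

namespace CausalModel

lemma covMat_mul_inv (M : CausalModel μ σ a b e x) (k : ℕ) :
    covMat σ b k * (covMat σ b k)⁻¹ = 1 :=
  Matrix.mul_nonsing_inv _ ((Matrix.isUnit_iff_isUnit_det _).1 (M.isUnit_covMat k))

lemma inv_covMat_mul (M : CausalModel μ σ a b e x) (k : ℕ) :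
    (covMat σ b k)⁻¹ * covMat σ b k = 1 :=
  Matrix.nonsing_inv_mul _ ((Matrix.isUnit_iff_isUnit_det _).1 (M.isUnit_covMat k))

lemma inv_covMat_symm (k : ℕ) (i l : Fin k) :
    (covMat σ b k)⁻¹ i l = (covMat σ b k)⁻¹ l i := by
  have h : ((covMat σ b k)⁻¹)ᵀ = (covMat σ b k)⁻¹ := by
    rw [Matrix.transpose_nonsing_inv, covMat_symm]
  exact congrFun (congrFun h l) i

/-- A row v of the inverse solves R v = e_i, whence `eigLow` · |v|² ≤ v'Rv = v_i ≤ |v|. -/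
lemma l2_row_inv_le (M : CausalModel μ σ a b e x) {k : ℕ} (i : Fin k) :
    l2 (ext ((covMat σ b k)⁻¹ i)) ≤ (eigLow σ a)⁻¹ := by
  set v : Fin k → ℝ := (covMat σ b k)⁻¹ i with hv
  have h1 : covMat σ b k *ᵥ v = Pi.single i 1 := by
    have h2 : v = (covMat σ b k)⁻¹ *ᵥ Pi.single i 1 := by
      funext l
      rw [Matrix.mulVec_single_one]
      exact inv_covMat_symm k i l
    rw [h2, Matrix.mulVec_mulVec, M.covMat_mul_inv, Matrix.one_mulVec]
  have h3 := M.covMat_ge v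
  rw [h1, dotProduct_single, mul_one, ← l2_ext_sq] at h3
  have h4 : v i ≤ l2 (ext v) := by
    have := abs_le_l2 (summable_ext v) i
    rw [ext_coe] at this
    exact (le_abs_self _).trans this
  rcases (l2_nonneg (ext v)).eq_or_lt with h0 | h0
  · rw [← h0]; exact (inv_pos.2 M.eigLow_pos).le
  · rw [← one_div, le_div_iff₀ M.eigLow_pos]
    nlinarith

lemma l2_conv_row_inv_le (M : CausalModel μ σ a b e x) {k : ℕ} (i : Fin k) :
    l2 (conv (ext ((covMat σ b k)⁻¹ i)) b) ≤ (eigLow σ a)⁻¹ * l1 b :=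
  (l2_conv_le (summable_ext _) M.summable_ma).trans
    (mul_le_mul_of_nonneg_right (M.l2_row_inv_le i) (l1_nonneg _))

/-- Sums of products of the noise with linear functions of the past. -/
lemma noise_mul_lin_bound (M : CausalModel μ σ a b e x) {q : ℕ} (hq : 1 ≤ q) :
    ∃ C, 0 ≤ C ∧ ∀ (J : Finset ℤ) (v : ℕ → ℝ), Summable v →
      MomentLE μ q (fun ω => ∑ j ∈ J, e (j + 1) ω * lin v (fun s => x s ω) j)
        (C * (√(J.card) * l2 (conv v b))) := by
  obtain ⟨C1, hC10, hC1⟩ := exists_noise_bound M.noise M.moments hq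
  obtain ⟨C2, hC20, hC2⟩ := M.moment_lin (q := 4 * q) (by omega)
  refine ⟨C1 * C2, by positivity, fun J v hv => ?_⟩
  have hl := l2_nonneg (conv v b)
  have hinj : Function.Injective fun j : ℤ => j + 1 := fun a b h => by simpa using h
  have h := hC1 (J.image fun j => j + 1) (fun s ω => lin v (fun s => x s ω) (s - 1))
    (fun _ => C2 * l2 (conv v b)) (fun s _ => M.measurable_lin_past v (by omega))
    (fun s _ => by positivity) (fun s _ => hC2 v hv _)
  rw [sum_sq_const_le _ (by positivity), Finset.card_image_of_injective _ hinj] at h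
  simp only [Finset.sum_image (fun a _ b _ h => hinj h), add_sub_cancel_right] at h
  exact h.mono (le_of_eq (by ring))

/-- Allows the moving average to be cut at lag K: there the weight exceeds √K, which offsets a sum
over k ≤ K coordinates. -/
lemma exists_tail_ma_le (M : CausalModel μ σ a b e x) :
    ∃ C, 0 ≤ C ∧ ∀ K : ℕ, √(K : ℝ) * l2 (fun m => b (m + K)) ≤ C := by
  refine ⟨∑' i : ℕ, √((i : ℝ) + 1) * |b i|, tsum_nonneg fun i => by positivity, fun K => ?_⟩
  have hs := (summable_nat_add_iff K).2 M.summable_ma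
  calc √(K : ℝ) * l2 (fun m => b (m + K)) ≤ √(K : ℝ) * l1 (fun m => b (m + K)) := by
        gcongr; exact l2_le_l1 hs
    _ = ∑' m, √(K : ℝ) * |b (m + K)| := by rw [l1, tsum_mul_left]
    _ ≤ ∑' m : ℕ, √(((m + K : ℕ) : ℝ) + 1) * |b (m + K)| := by
        refine (hs.abs.mul_left _).tsum_le_tsum (fun m => ?_)
          ((summable_nat_add_iff K).2 M.weighted_ma)
        gcongr
        push_cast
        linarith [Nat.cast_nonneg (α := ℝ) m]
    _ ≤ _ := by
        rw [← M.weighted_ma.sum_add_tsum_nat_add K]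
        have : 0 ≤ ∑ i ∈ Finset.range K, √((i : ℝ) + 1) * |b i| :=
          Finset.sum_nonneg fun i _ => by positivity
        linarith

lemma ae_split (M : CausalModel μ σ a b e x) (K : ℕ) :
    ∀ᵐ ω ∂μ, ∀ t, x t ω = ∑ m ∈ Finset.range K, b m * e (t - m) ω +
      filt (fun m => b (m + K)) e (t - K) ω := by
  obtain ⟨B, -, hB⟩ := exists_moment_noise M.noise M.moments 1
  filter_upwards [ae_summable_mul hB M.summable_ma] with ω hω t
  rw [M.repr, filt, lin, ← (hω t).sum_add_tsum_nat_add K, filt, lin]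
  congr 1
  refine tsum_congr fun i => ?_
  congr 2
  push_cast; ring

/-- A bilinear form in the present values of `x` and functions of the distant past. -/
lemma recent_mul_past_bound (M : CausalModel μ σ a b e x) {q : ℕ} (hq : 1 ≤ q) :
    ∃ C, 0 ≤ C ∧ ∀ (k K : ℕ) (j : ℤ) (Z : Fin k → Ω → ℝ) (B : ℝ), k ≤ K → 0 ≤ B →
      (∀ i, Measurable[past e (j - 2 * K + 1)] (Z i)) → (∀ i, MomentLE μ (4 * q) (Z i) B) →
      MomentLE μ q (fun ω => ∑ i : Fin k, x (j - (i : ℕ)) ω * Z i ω) (C * (√k * B)) := by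
  obtain ⟨C1, hC10, hC1⟩ := exists_noise_bound M.noise M.moments hq
  obtain ⟨C2, hC20, hC2⟩ := exists_filt_bound M.noise M.moments (q := 2 * q) (by omega)
  obtain ⟨C3, hC30, hC3⟩ := M.exists_tail_ma_le
  have hb0 := l1_nonneg b
  refine ⟨C1 * l1 b + C2 * C3, by positivity, fun k K j Z B hkK hB hZm hZ => ?_⟩
  -- Cut at lag K, the variables x_{j−i} with i < k involve only e_s with j − 2K < s ≤ j, all
  -- outside the past that determines Z, so the sum over s is a martingale. With u_s the total
  -- weight of e_s, ∑ u² ≤ (sup u)(∑ u) ≤ k (`l1 b`)², which gives √k in place of the trivial k. The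
  -- part beyond lag K is handled by the triangle inequality.
  set I := Finset.Ioc (j - 2 * K) j with hI
  set D : Fin k × ℕ → ℤ → Prop := fun p s => j - (p.1 : ℕ) - (p.2 : ℕ) = s with hD
  set T : Finset (Fin k × ℕ) := Finset.univ ×ˢ Finset.range K with hT
  have hTI : ∀ p ∈ T, j - (p.1 : ℕ) - (p.2 : ℕ) ∈ I := by
    intro p hp
    rw [hT, Finset.mem_product, Finset.mem_range] at hp
    rw [hI, Finset.mem_Ioc]
    have := p.1.2
    omega
  set u : ℤ → ℝ := fun s => ∑ p ∈ T, if j - (p.1 : ℕ) - (p.2 : ℕ) = s then |b p.2| else 0 with hu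
  have hu0 : ∀ s, 0 ≤ u s := fun s => Finset.sum_nonneg fun p _ => by split_ifs <;> positivity
  have hu1 : ∀ s, u s ≤ l1 b := by
    intro s
    rw [hu]
    simp only
    rw [hT, Finset.sum_product_right]
    calc _ ≤ ∑ m ∈ Finset.range K, |b m| := by
          refine Finset.sum_le_sum fun m _ => ?_
          by_cases h : ∃ i : Fin k, j - ((i : ℕ) : ℤ) - m = s
          · obtain ⟨i, hi⟩ := h
            rw [Finset.sum_eq_single i]
            · rw [if_pos hi]
            · intro i' _ hne
              rw [if_neg]
              intro h'
              refine hne (Fin.ext ?_)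
              simp only at h' hi
              omega
            · simp
          · push Not at h
            rw [Finset.sum_eq_zero fun i _ => if_neg (h i)]
            positivity
      _ ≤ _ := M.summable_ma.abs.sum_le_tsum _ fun _ _ => abs_nonneg _
  have hu2 : ∑ s ∈ I, u s ≤ k * l1 b := by
    rw [hu]
    simp only
    rw [Finset.sum_comm]
    calc _ = ∑ p ∈ T, |b p.2| := by
          refine Finset.sum_congr rfl fun p hp => ?_
          rw [Finset.sum_ite_eq, if_pos (hTI p hp)]
      _ = k * ∑ m ∈ Finset.range K, |b m| := by
          rw [hT, Finset.sum_product]; simp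
      _ ≤ _ := by
          gcongr
          exact M.summable_ma.abs.sum_le_tsum _ fun _ _ => abs_nonneg _
  have hnew := hC1 I (fun s ω => ∑ p ∈ T, (if j - (p.1 : ℕ) - (p.2 : ℕ) = s then b p.2 else 0) *
      Z p.1 ω) (fun s => u s * B)
    (fun s hs => by
      refine Finset.measurable_fun_sum _ fun p _ => ?_
      refine ((hZm p.1).mono (past_mono ?_) le_rfl).const_mul _
      rw [hI, Finset.mem_Ioc] at hs
      omega)
    (fun s _ => mul_nonneg (hu0 s) hB)
    (fun s _ => by
      have := MomentLE.sum (μ := μ) (q := 4 * q) (by omega) T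
        (f := fun p ω => (if j - (p.1 : ℕ) - (p.2 : ℕ) = s then b p.2 else 0) * Z p.1 ω)
        (c := fun p => |if j - (p.1 : ℕ) - (p.2 : ℕ) = s then b p.2 else 0| * B)
        (fun p _ => by positivity) (fun p _ => (hZ p.1).const_mul _)
      refine this.mono (le_of_eq ?_)
      rw [hu, Finset.sum_mul]
      refine Finset.sum_congr rfl fun p _ => ?_
      split_ifs <;> simp)
  have hnewc : √(∑ s ∈ I, (u s * B) ^ 2) ≤ l1 b * (√k * B) := by
    rw [Real.sqrt_le_left (by positivity)]
    calc ∑ s ∈ I, (u s * B) ^ 2 ≤ ∑ s ∈ I, l1 b * u s * B ^ 2 := by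
          refine Finset.sum_le_sum fun s _ => ?_
          rw [mul_pow, sq (u s)]
          have := hu0 s
          gcongr
          exact hu1 s
      _ = l1 b * (∑ s ∈ I, u s) * B ^ 2 := by rw [← Finset.sum_mul, ← Finset.mul_sum]
      _ ≤ l1 b * (k * l1 b) * B ^ 2 := by gcongr
      _ = _ := by rw [mul_pow, mul_pow, Real.sq_sqrt (Nat.cast_nonneg _)]; ring
  have hnewsum : ∀ ω, ∑ s ∈ I, e s ω * ∑ p ∈ T,
      (if j - (p.1 : ℕ) - (p.2 : ℕ) = s then b p.2 else 0) * Z p.1 ω =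
      ∑ i : Fin k, (∑ m ∈ Finset.range K, b m * e (j - (i : ℕ) - m) ω) * Z i ω := by
    intro ω
    calc _ = ∑ p ∈ T, ∑ s ∈ I,
          (if j - (p.1 : ℕ) - (p.2 : ℕ) = s then b p.2 * e s ω * Z p.1 ω else 0) := by
          rw [Finset.sum_comm]
          refine Finset.sum_congr rfl fun s _ => ?_
          rw [Finset.mul_sum]
          refine Finset.sum_congr rfl fun p _ => ?_
          split_ifs <;> ring
      _ = ∑ p ∈ T, b p.2 * e (j - (p.1 : ℕ) - (p.2 : ℕ)) ω * Z p.1 ω := by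
          refine Finset.sum_congr rfl fun p hp => ?_
          rw [Finset.sum_ite_eq, if_pos (hTI p hp)]
      _ = _ := by
          rw [hT, Finset.sum_product]
          refine Finset.sum_congr rfl fun i _ => ?_
          rw [Finset.sum_mul]
  set τ : ℕ → ℝ := fun m => b (m + K) with hτ
  have hτs : Summable τ := (summable_nat_add_iff K).2 M.summable_ma
  have hold := MomentLE.sum (μ := μ) hq (Finset.univ : Finset (Fin k))
    (f := fun i ω => filt τ e (j - (i : ℕ) - K) ω * Z i ω) (c := fun _ => C2 * l2 τ * B)
    (fun i _ => mul_nonneg (mul_nonneg hC20 (l2_nonneg _)) hB)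
    (fun i _ => MomentLE.mul (mul_nonneg hC20 (l2_nonneg _)) (hC2 τ hτs _)
      ((hZ i).exponent_mono (by omega)))
  have holdc : ∑ _i : Fin k, C2 * l2 τ * B ≤ C2 * C3 * (√k * B) := by
    rw [Finset.sum_const, Finset.card_univ, Fintype.card_fin, nsmul_eq_mul]
    have h1 : (k : ℝ) * l2 τ ≤ √k * C3 := by
      calc (k : ℝ) * l2 τ = √k * (√k * l2 τ) := by
            rw [← mul_assoc, Real.mul_self_sqrt (Nat.cast_nonneg _)]
        _ ≤ √k * (√K * l2 τ) := by
            have := l2_nonneg τ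
            gcongr
        _ ≤ √k * C3 := by gcongr; exact hC3 K
    calc _ = C2 * B * (k * l2 τ) := by ring
      _ ≤ C2 * B * (√k * C3) := by gcongr
      _ = _ := by ring
  have hall := (hnew.mono (mul_le_mul_of_nonneg_left hnewc hC10)).add hq (by positivity)
    (by positivity) (hold.mono holdc)
  refine (hall.congr ?_).mono (le_of_eq (by ring))
  filter_upwards [M.ae_split K] with ω hω
  rw [hnewsum, ← Finset.sum_add_distrib]
  refine Finset.sum_congr rfl fun i _ => ?_
  rw [hω (j - (i : ℕ))]
  ring

/-- The score vector `∑ x_j(k) e_{j+1}`. -/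
def _root_.InfAR.score (e x : ℤ → Ω → ℝ) (J : Finset ℤ) (k : ℕ) (ω : Ω) : Fin k → ℝ :=
  fun i => ∑ j ∈ J, x (j - (i : ℕ)) ω * e (j + 1) ω

/-- Expansion of a symmetric quadratic form in sums. -/
lemma _root_.InfAR.quadratic_expansion {k : ℕ} (P : Matrix (Fin k) (Fin k) ℝ)
    (hP : ∀ i l, P i l = P l i) (J : Finset ℤ) (u : ℤ → ℝ) (X : ℤ → Fin k → ℝ) :
    (fun i => ∑ j ∈ J, X j i * u j) ⬝ᵥ P *ᵥ (fun i => ∑ j ∈ J, X j i * u j) =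
      ∑ j ∈ J, u j ^ 2 * (X j ⬝ᵥ P *ᵥ X j) +
      2 * ∑ j ∈ J, u j * ∑ l ∈ J with l < j, u l * (X j ⬝ᵥ P *ᵥ X l) := by
  have hvec : (fun i => ∑ j ∈ J, X j i * u j) = ∑ j ∈ J, u j • X j := by
    funext i; simp [Finset.sum_apply, mul_comm]
  set B : ℤ → ℤ → ℝ := fun j l => u j * (u l * (X j ⬝ᵥ P *ᵥ X l)) with hB
  have hsymm : ∀ j l, B j l = B l j := by
    intro j l
    have : X j ⬝ᵥ P *ᵥ X l = X l ⬝ᵥ P *ᵥ X j := by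
      rw [Matrix.dotProduct_mulVec, ← Matrix.mulVec_transpose, dotProduct_comm]
      congr 2
      ext i l; exact hP l i
    simp only [hB, this]; ring
  have h1 : (fun i => ∑ j ∈ J, X j i * u j) ⬝ᵥ P *ᵥ (fun i => ∑ j ∈ J, X j i * u j) =
      ∑ j ∈ J, ∑ l ∈ J, B j l := by
    rw [hvec, sum_dotProduct]
    refine Finset.sum_congr rfl fun j _ => ?_
    rw [Matrix.mulVec_sum, dotProduct_sum]
    refine Finset.sum_congr rfl fun l _ => ?_
    rw [Matrix.mulVec_smul, dotProduct_smul, smul_dotProduct]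
    simp only [hB, smul_eq_mul]; ring
  have h2 : ∀ j ∈ J, ∑ l ∈ J, B j l =
      B j j + ∑ l ∈ J with l < j, B j l + ∑ l ∈ J with j < l, B j l := by
    intro j hj
    rw [← Finset.sum_filter_add_sum_filter_not J (fun l => l < j), add_comm (B j j), add_assoc]
    congr 1
    have : J.filter (fun l => ¬ l < j) = insert j (J.filter fun l => j < l) := by
      ext l
      simp only [Finset.mem_filter, Finset.mem_insert]
      constructor
      · rintro ⟨h1, h2⟩
        rcases eq_or_ne l j with h | h
        · exact Or.inl h
        · exact Or.inr ⟨h1, by omega⟩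
      · rintro (h | ⟨h1, h2⟩)
        · exact ⟨h ▸ hj, by omega⟩
        · exact ⟨h1, by omega⟩
    rw [this, Finset.sum_insert (by simp)]
  have h3 : ∑ j ∈ J, ∑ l ∈ J with j < l, B j l = ∑ j ∈ J, ∑ l ∈ J with l < j, B j l := by
    simp only [Finset.sum_filter]
    rw [Finset.sum_comm]
    refine Finset.sum_congr rfl fun j _ => Finset.sum_congr rfl fun l _ => ?_
    rw [hsymm]
  rw [h1, Finset.sum_congr rfl h2, Finset.sum_add_distrib, Finset.sum_add_distrib, h3]
  have h4 : ∀ j, B j j = u j ^ 2 * (X j ⬝ᵥ P *ᵥ X j) := fun j => by simp only [hB]; ring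
  simp only [h4]
  simp only [hB, ← Finset.mul_sum]
  ring

lemma _root_.InfAR.mulVec_lagVec {k : ℕ} (P : Matrix (Fin k) (Fin k) ℝ) (y : ℤ → ℝ) (l : ℤ)
    (i : Fin k) : (P *ᵥ lagVec y l k) i = lin (ext (P i)) y l := by
  rw [lin_ext, Matrix.mulVec, dotProduct_comm]

/-- The quadratic form of the score in the inverse covariance matrix concentrates at `N k σ²`. -/
theorem score_quadratic_bound (M : CausalModel μ σ a b e x) {q : ℕ} (hq : 1 ≤ q) :
    ∃ C, 0 ≤ C ∧ ∀ (k K : ℕ) (J : Finset ℤ), k ≤ K → 2 * K ^ 2 ≤ J.card →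
      MomentLE μ q (fun ω => score e x J k ω ⬝ᵥ (covMat σ b k)⁻¹ *ᵥ score e x J k ω -
        J.card * k * σ ^ 2) (C * (J.card * √k)) := by
  obtain ⟨C1, hC10, hC1⟩ := exists_noise_bound M.noise M.moments hq
  obtain ⟨C2, hC20, hC2⟩ := exists_noise_sq_bound M.noise M.moments hq
  obtain ⟨C3, hC30, hC3⟩ := M.noise_mul_lin_bound (q := 16 * q) (by omega)
  obtain ⟨C4, hC40, hC4⟩ := M.recent_mul_past_bound (q := 4 * q) (by omega)
  obtain ⟨C5, hC50, hC5⟩ := M.exists_moment (8 * q) (by omega)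
  obtain ⟨C6, hC60, hC6⟩ := M.moment_lin (q := 8 * q) (by omega)
  obtain ⟨C7, hC70, hC7⟩ := M.deviation_lin_mul_lin hq
  -- The form is its diagonal plus twice the part l < j. On the diagonal, e² fluctuates about σ² and
  -- X_j'R⁻¹X_j about trace(R⁻¹R) = k; both errors are O(√N k) ≤ O(N√k) because k ≤ N. The
  -- off-diagonal part is a martingale in the later index j, and its multiplier must be shown to be
  -- O(√(kN)).
  set L := (eigLow σ a)⁻¹ * l1 b with hL
  have hb0 := l1_nonneg b
  have hL0 : 0 ≤ L := mul_nonneg (inv_pos.2 M.eigLow_pos).le hb0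
  refine ⟨C2 * (C5 * (C6 * L)) + σ ^ 2 * (C7 * (L * l1 b)) +
    2 * (C1 * (C5 * (C3 * L) + C4 * (C3 * L))), by positivity, fun k K J hkK hKJ => ?_⟩
  set N := J.card with hN
  set P := (covMat σ b k)⁻¹ with hP
  have hrow : ∀ i : Fin k, l2 (conv (ext (P i)) b) ≤ L := fun i => M.l2_conv_row_inv_le i
  have hkN : (k : ℝ) ^ 2 ≤ N := by
    have h1 : k ^ 2 ≤ K ^ 2 := Nat.pow_le_pow_left hkK 2
    have h2 : k ^ 2 ≤ N := by omega
    exact_mod_cast h2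
  have hk1 : (k : ℝ) ≤ (k : ℝ) ^ 2 := by
    rcases Nat.eq_zero_or_pos k with h | h
    · simp [h]
    · exact_mod_cast Nat.le_self_pow two_ne_zero k
  have hks : √(k : ℝ) ≤ √(N : ℝ) := Real.sqrt_le_sqrt (hk1.trans hkN)
  have hk2 : √(k : ℝ) * √k = k := Real.mul_self_sqrt (Nat.cast_nonneg _)
  have hN2 : √(N : ℝ) * √N = N := Real.mul_self_sqrt (Nat.cast_nonneg _)
  have hkN' : √(N : ℝ) * k ≤ N * √k := by
    calc √(N : ℝ) * k = √N * √k * √k := by rw [mul_assoc, hk2]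
      _ ≤ √N * √k * √N := by gcongr
      _ = N * √k := by rw [mul_right_comm, hN2]
  -- notation for the vectors
  set X : Ω → ℤ → Fin k → ℝ := fun ω j => lagVec (fun s => x s ω) j k with hX
  have hY : ∀ ω l i, (P *ᵥ X ω l) i = lin (ext (P i)) (fun s => x s ω) l := fun ω l i =>
    mulVec_lagVec P _ l i
  have hG : ∀ ω j l, X ω j ⬝ᵥ P *ᵥ X ω l =
      ∑ i : Fin k, x (j - (i : ℕ)) ω * lin (ext (P i)) (fun s => x s ω) l := by
    intro ω j l
    rw [dotProduct]
    refine Finset.sum_congr rfl fun i _ => ?_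
    rw [hY]; rfl
  have hinj : Function.Injective fun j : ℤ => j + 1 := fun a b h => by simpa using h
  set J' := J.image fun j => j + 1 with hJ'
  have hJc : J'.card = N := Finset.card_image_of_injective _ hinj
  -- the diagonal, fluctuation of squares
  have hGmeas : ∀ s : ℤ, Measurable[past e s] (fun ω => X ω (s - 1) ⬝ᵥ P *ᵥ X ω (s - 1)) := by
    intro s
    simp only [hG]
    refine Finset.measurable_fun_sum _ fun i _ => ?_
    exact (M.measurable_past (by omega)).mul (M.measurable_lin_past _ (by omega))
  have hGmom : ∀ j l : ℤ, MomentLE μ (4 * q) (fun ω => X ω j ⬝ᵥ P *ᵥ X ω l)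
      (k * (C5 * (C6 * L))) := by
    intro j l
    simp only [hG]
    have := MomentLE.sum (μ := μ) (q := 4 * q) (by omega) (Finset.univ : Finset (Fin k))
      (f := fun i ω => x (j - (i : ℕ)) ω * lin (ext (P i)) (fun s => x s ω) l)
      (c := fun _ => C5 * (C6 * L)) (fun i _ => by positivity)
      (fun i _ => MomentLE.mul hC50 ((hC5 _).exponent_mono (by omega))
        (((hC6 _ (summable_ext _) l).mono
          (mul_le_mul_of_nonneg_left (hrow i) hC60)).exponent_mono (by omega)))
    refine this.mono (le_of_eq ?_)
    simp
  have hA := hC2 J' (fun s ω => X ω (s - 1) ⬝ᵥ P *ᵥ X ω (s - 1)) (fun _ => k * (C5 * (C6 * L)))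
    (fun s _ => hGmeas s) (fun s _ => by positivity) (fun s _ => hGmom _ _)
  rw [sum_sq_const_le _ (by positivity), hJc] at hA
  simp only [hJ', Finset.sum_image (fun a _ b _ h => hinj h), add_sub_cancel_right] at hA
  -- the diagonal, fluctuation of the covariances
  have hcenter : ∀ i : Fin k, σ ^ 2 * ip (conv (ext (P i)) b) (conv (unitSeq i) b) = 1 := by
    intro i
    have h1 : (P * covMat σ b k) i i = 1 := by
      rw [hP, M.inv_covMat_mul, Matrix.one_apply_eq]
    rw [M.ip_conv_ext_left _ (summable_conv (summable_unitSeq _) M.summable_ma), Finset.mul_sum,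
      ← h1, Matrix.mul_apply]
    refine Finset.sum_congr rfl fun l _ => ?_
    simp only [covMat, Matrix.of_apply]
    ring
  have hDv : MomentLE μ q (fun ω => ∑ i : Fin k, ∑ j ∈ J,
      (lin (ext (P i)) (fun s => x s ω) j * x (j - (i : ℕ)) ω - 1))
      (k * (C7 * (√N * (L * l1 b)))) := by
    have := MomentLE.sum (μ := μ) hq (Finset.univ : Finset (Fin k))
      (f := fun i ω => ∑ j ∈ J, (lin (ext (P i)) (fun s => x s ω) j * x (j - (i : ℕ)) ω - 1))
      (c := fun _ => C7 * (√N * (L * l1 b))) (fun i _ => by positivity)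
      (fun i _ => by
        have h := hC7 J _ _ (summable_ext (P i)) (summable_unitSeq i)
        rw [hcenter] at h
        simp only [lin_unitSeq] at h
        refine h.mono ?_
        have h2 : l1 (conv (unitSeq i) b) ≤ l1 b := by
          simpa [l1_unitSeq] using l1_conv_le (summable_unitSeq i) M.summable_ma
        have h3 := hrow i
        have h4 := l1_nonneg (conv (unitSeq (i : ℕ)) b)
        gcongr)
    refine this.mono (le_of_eq ?_)
    simp
  -- the off-diagonal part
  have hg : ∀ j : ℤ, MomentLE μ (4 * q) (fun ω => ∑ l ∈ J with l < j,
      e (l + 1) ω * (X ω j ⬝ᵥ P *ᵥ X ω l))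
      ((C5 * (C3 * L) + C4 * (C3 * L)) * (√k * √N)) := by
    intro j
    -- There are at most 2K near indices, so the triangle inequality over coordinates costs k√(2K) ≤
    -- √k √N. The far ones depend only on noise of time at most j − 2K, as `recent_mul_past_bound`
    -- requires.
    set A1 := {l ∈ J | l < j ∧ j - 2 * K ≤ l} with hA1
    set A2 := {l ∈ J | l < j - 2 * K} with hA2
    have hsplit : ∀ f : ℤ → ℝ, ∑ l ∈ J with l < j, f l = ∑ l ∈ A1, f l + ∑ l ∈ A2, f l := by
      intro f
      rw [← Finset.sum_union]
      · congr 1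
        ext l
        simp only [hA1, hA2, Finset.mem_filter, Finset.mem_union]
        constructor
        · rintro ⟨h1, h2⟩
          by_cases h : j - 2 * K ≤ l
          · exact Or.inl ⟨h1, h2, h⟩
          · exact Or.inr ⟨h1, by omega⟩
        · rintro (⟨h1, h2, -⟩ | ⟨h1, h2⟩)
          · exact ⟨h1, h2⟩
          · exact ⟨h1, by omega⟩
      · rw [Finset.disjoint_left]
        intro l h1 h2
        rw [hA1, Finset.mem_filter] at h1
        rw [hA2, Finset.mem_filter] at h2
        omega
    have hA1c : A1.card ≤ 2 * K := by
      have : A1 ⊆ Finset.Ico (j - 2 * K) j := by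
        intro l hl
        rw [hA1, Finset.mem_filter] at hl
        rw [Finset.mem_Ico]; exact ⟨hl.2.2, hl.2.1⟩
      refine (Finset.card_le_card this).trans ?_
      rw [Int.card_Ico]; omega
    have hA2c : A2.card ≤ N := Finset.card_filter_le _ _
    set Z : Finset ℤ → Fin k → Ω → ℝ := fun A i ω =>
      ∑ l ∈ A, e (l + 1) ω * lin (ext (P i)) (fun s => x s ω) l with hZ
    have hZb : ∀ A i, MomentLE μ (16 * q) (Z A i) (C3 * L * √(A.card)) := fun A i =>
      (hC3 A _ (summable_ext (P i))).mono (by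
        calc _ ≤ C3 * (√(A.card) * L) := by gcongr; exact hrow i
          _ = _ := by ring)
    have hsum : ∀ A ω, ∑ l ∈ A, e (l + 1) ω * (X ω j ⬝ᵥ P *ᵥ X ω l) =
        ∑ i : Fin k, x (j - (i : ℕ)) ω * Z A i ω := by
      intro A ω
      simp only [hG, hZ, Finset.mul_sum]
      rw [Finset.sum_comm]
      refine Finset.sum_congr rfl fun i _ => Finset.sum_congr rfl fun l _ => ?_
      ring
    have hnear : MomentLE μ (4 * q) (fun ω => ∑ i : Fin k, x (j - (i : ℕ)) ω * Z A1 i ω)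
        (C5 * (C3 * L) * (√k * √N)) := by
      have := MomentLE.sum (μ := μ) (q := 4 * q) (by omega) (Finset.univ : Finset (Fin k))
        (f := fun i ω => x (j - (i : ℕ)) ω * Z A1 i ω) (c := fun _ => C5 * (C3 * L * √(A1.card)))
        (fun i _ => by positivity)
        (fun i _ => MomentLE.mul hC50 ((hC5 _).exponent_mono (by omega))
          ((hZb A1 i).exponent_mono (by omega)))
      refine this.mono ?_
      rw [Finset.sum_const, Finset.card_univ, Fintype.card_fin, nsmul_eq_mul]
      have h1 : √(k : ℝ) * √(A1.card) ≤ √N := by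
        rw [← Real.sqrt_mul (Nat.cast_nonneg _)]
        refine Real.sqrt_le_sqrt ?_
        have : k * A1.card ≤ N := by
          calc k * A1.card ≤ K * (2 * K) := Nat.mul_le_mul hkK hA1c
            _ = 2 * K ^ 2 := by ring
            _ ≤ N := hKJ
        exact_mod_cast this
      calc (k : ℝ) * (C5 * (C3 * L * √(A1.card))) =
            C5 * (C3 * L) * (√k * (√k * √(A1.card))) := by
            conv_lhs => rw [← hk2]
            ring
        _ ≤ _ := by gcongr
    have hfar : MomentLE μ (4 * q) (fun ω => ∑ i : Fin k, x (j - (i : ℕ)) ω * Z A2 i ω)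
        (C4 * (C3 * L) * (√k * √N)) := by
      have := hC4 k K j (Z A2) (C3 * L * √N) hkK (by positivity)
        (fun i => by
          refine Finset.measurable_fun_sum _ fun l hl => ?_
          rw [hA2, Finset.mem_filter] at hl
          exact (InfAR.measurable_past (by omega)).mul (M.measurable_lin_past _ (by omega)))
        (fun i => ((hZb A2 i).mono (by gcongr)).exponent_mono (by omega))
      exact this.mono (le_of_eq (by ring))
    have hboth := hnear.add (by omega) (by positivity) (by positivity) hfar
    refine (hboth.congr (Eventually.of_forall fun ω => ?_)).mono (le_of_eq (by ring))
    simp only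
    rw [hsplit, hsum, hsum]
  have hO := hC1 J' (fun s ω => ∑ l ∈ J with l < s - 1,
      e (l + 1) ω * (X ω (s - 1) ⬝ᵥ P *ᵥ X ω l))
    (fun _ => (C5 * (C3 * L) + C4 * (C3 * L)) * (√k * √N))
    (fun s _ => by
      refine Finset.measurable_fun_sum _ fun l hl => ?_
      rw [Finset.mem_filter] at hl
      refine (InfAR.measurable_past (by omega)).mul ?_
      simp only [hG]
      refine Finset.measurable_fun_sum _ fun i _ => ?_
      exact (M.measurable_past (by omega)).mul (M.measurable_lin_past _ (by omega)))
    (fun s _ => by positivity) (fun s _ => hg (s - 1))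
  rw [sum_sq_const_le _ (by positivity), hJc] at hO
  simp only [hJ', Finset.sum_image (fun a _ b _ h => hinj h), add_sub_cancel_right] at hO
  have hall := (hA.add hq (by positivity) (by positivity) (hDv.const_mul (σ ^ 2))).add hq
    (by positivity) (by positivity) (hO.const_mul 2)
  refine (hall.congr (Eventually.of_forall fun ω => ?_)).mono ?_
  · have hs : score e x J k ω = fun i => ∑ j ∈ J, X ω j i * e (j + 1) ω := rfl
    simp only
    rw [hs, quadratic_expansion P (fun i l => inv_covMat_symm k i l)]
    have h1 : ∑ i : Fin k, ∑ j ∈ J, (lin (ext (P i)) (fun s => x s ω) j * x (j - (i : ℕ)) ω - 1) =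
        ∑ j ∈ J, (X ω j ⬝ᵥ P *ᵥ X ω j) - N * k := by
      rw [Finset.sum_comm]
      have : ∀ j, ∑ i : Fin k, (lin (ext (P i)) (fun s => x s ω) j * x (j - (i : ℕ)) ω - 1) =
          X ω j ⬝ᵥ P *ᵥ X ω j - k := by
        intro j
        rw [Finset.sum_sub_distrib, hG]
        simp [mul_comm]
      simp only [this]
      rw [Finset.sum_sub_distrib]
      simp [hN]
    rw [h1]
    have h2 : ∑ j ∈ J, (e (j + 1) ω ^ 2 - σ ^ 2) * (X ω j ⬝ᵥ P *ᵥ X ω j) =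
        ∑ j ∈ J, e (j + 1) ω ^ 2 * (X ω j ⬝ᵥ P *ᵥ X ω j) -
          σ ^ 2 * ∑ j ∈ J, (X ω j ⬝ᵥ P *ᵥ X ω j) := by
      rw [Finset.mul_sum, ← Finset.sum_sub_distrib]
      exact Finset.sum_congr rfl fun j _ => by ring
    rw [h2]
    ring
  · have hN0 : (0 : ℝ) ≤ N := Nat.cast_nonneg _
    have t1 : C2 * (√N * (k * (C5 * (C6 * L)))) ≤ C2 * (C5 * (C6 * L)) * (N * √k) := by
      calc _ = C2 * (C5 * (C6 * L)) * (√N * k) := by ring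
        _ ≤ _ := by gcongr
    have t2 : |σ ^ 2| * (k * (C7 * (√N * (L * l1 b)))) ≤ σ ^ 2 * (C7 * (L * l1 b)) * (N * √k) := by
      rw [abs_of_pos M.sigma_pos]
      calc _ = σ ^ 2 * (C7 * (L * l1 b)) * (√N * k) := by ring
        _ ≤ _ := by gcongr
    have t3 : |(2 : ℝ)| * (C1 * (√N * ((C5 * (C3 * L) + C4 * (C3 * L)) * (√k * √N)))) =
        2 * (C1 * (C5 * (C3 * L) + C4 * (C3 * L))) * (N * √k) := by
      rw [abs_two]
      conv_rhs => rw [← hN2]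
      ring
    rw [t3]
    linarith

end CausalModel

end QuadraticForm

/-! ### Perturbation of quadratic forms -/

section Perturbation

variable {k : ℕ}

lemma dotProduct_self_nonneg' (v : Fin k → ℝ) : 0 ≤ v ⬝ᵥ v :=
  Finset.sum_nonneg fun _ _ => mul_self_nonneg _

lemma abs_dotProduct_le (v w : Fin k → ℝ) : |v ⬝ᵥ w| ≤ √(v ⬝ᵥ v) * √(w ⬝ᵥ w) := by
  rw [← Real.sqrt_mul (dotProduct_self_nonneg' v)]
  refine Real.abs_le_sqrt ?_
  simpa [dotProduct, sq] using Finset.sum_mul_sq_le_sq_mul_sq Finset.univ v w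

lemma sum_abs_le (v : Fin k → ℝ) : ∑ i, |v i| ≤ √k * √(v ⬝ᵥ v) := by
  rw [← Real.sqrt_mul (Nat.cast_nonneg k)]
  refine Real.le_sqrt_of_sq_le ?_
  simpa [dotProduct, sq] using sq_sum_le_card_mul_sum_sq (s := Finset.univ) (f := fun i => |v i|)

/-- The factor k lost in passing from entries to the operator norm is the reason why `goodEvent`
asks for accuracy ε/(K + 1). -/
lemma abs_bilinear_le_of_entries {Δ : Matrix (Fin k) (Fin k) ℝ} {η : ℝ}
    (h : ∀ i l, |Δ i l| ≤ η) (hη : 0 ≤ η) (v w : Fin k → ℝ) :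
    |v ⬝ᵥ Δ *ᵥ w| ≤ (η * k) * (√(v ⬝ᵥ v) * √(w ⬝ᵥ w)) := by
  have h1 : |v ⬝ᵥ Δ *ᵥ w| ≤ η * ((∑ i, |v i|) * ∑ l, |w l|) := by
    rw [Finset.sum_mul_sum, Finset.mul_sum]
    refine (Finset.abs_sum_le_sum_abs _ _).trans (Finset.sum_le_sum fun i _ => ?_)
    rw [Finset.mul_sum]
    have e1 : v i * (Δ *ᵥ w) i = ∑ l, v i * (Δ i l * w l) := by
      rw [← Finset.mul_sum]; rfl
    rw [e1]
    refine (Finset.abs_sum_le_sum_abs _ _).trans (Finset.sum_le_sum fun l _ => ?_)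
    rw [abs_mul, abs_mul]
    have := mul_le_mul_of_nonneg_left (h i l) (mul_nonneg (abs_nonneg (v i)) (abs_nonneg (w l)))
    linarith
  refine h1.trans ?_
  have h2 : (∑ i, |v i|) * ∑ l, |w l| ≤ (√k * √(v ⬝ᵥ v)) * (√k * √(w ⬝ᵥ w)) :=
    mul_le_mul (sum_abs_le v) (sum_abs_le w) (Finset.sum_nonneg fun _ _ => abs_nonneg _)
      (by positivity)
  have h3 : √(k : ℝ) * √k = k := Real.mul_self_sqrt (Nat.cast_nonneg k)
  calc η * ((∑ i, |v i|) * ∑ l, |w l|) ≤ η * ((√k * √(v ⬝ᵥ v)) * (√k * √(w ⬝ᵥ w))) :=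
        mul_le_mul_of_nonneg_left h2 hη
    _ = (η * (√k * √k)) * (√(v ⬝ᵥ v) * √(w ⬝ᵥ w)) := by ring
    _ = _ := by rw [h3]

/-- `A` is within `ε` of `R`, as bilinear forms. -/
def BilinClose (R A : Matrix (Fin k) (Fin k) ℝ) (ε : ℝ) : Prop :=
  ∀ v w : Fin k → ℝ, |v ⬝ᵥ (A - R) *ᵥ w| ≤ ε * (√(v ⬝ᵥ v) * √(w ⬝ᵥ w))

variable {R A : Matrix (Fin k) (Fin k) ℝ} {c ε : ℝ}

lemma BilinClose.ge (h : BilinClose R A ε) (hR : ∀ v, c * (v ⬝ᵥ v) ≤ v ⬝ᵥ R *ᵥ v)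
    (hε : ε ≤ c / 2) (v : Fin k → ℝ) : c / 2 * (v ⬝ᵥ v) ≤ v ⬝ᵥ A *ᵥ v := by
  have h1 := (abs_le.1 (h v v)).1
  rw [Matrix.sub_mulVec, dotProduct_sub, Real.mul_self_sqrt (dotProduct_self_nonneg' v)] at h1
  nlinarith [hR v, dotProduct_self_nonneg' v]

lemma isUnit_det_of_ge (hc : 0 < c) (hA : ∀ v, c * (v ⬝ᵥ v) ≤ v ⬝ᵥ A *ᵥ v) : IsUnit A.det := by
  rw [← Matrix.isUnit_iff_isUnit_det, ← Matrix.mulVec_injective_iff_isUnit]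
  intro v w hvw
  have h1 : A *ᵥ (v - w) = 0 := by
    rw [Matrix.mulVec_sub]; exact sub_eq_zero.2 hvw
  have h2 := hA (v - w)
  rw [h1, dotProduct_zero] at h2
  have h3 := dotProduct_self_nonneg' (v - w)
  exact sub_eq_zero.1 (dotProduct_self_eq_zero.1 (le_antisymm (by nlinarith) h3))

lemma sqrt_inv_mulVec_le (hc : 0 < c) (hA : ∀ v, c * (v ⬝ᵥ v) ≤ v ⬝ᵥ A *ᵥ v) (h : Fin k → ℝ) :
    √((A⁻¹ *ᵥ h) ⬝ᵥ (A⁻¹ *ᵥ h)) ≤ c⁻¹ * √(h ⬝ᵥ h) := by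
  set β := A⁻¹ *ᵥ h with hβ
  have h1 : A *ᵥ β = h := by
    rw [hβ, Matrix.mulVec_mulVec, Matrix.mul_nonsing_inv _ (isUnit_det_of_ge hc hA),
      Matrix.one_mulVec]
  have h2 := hA β
  rw [h1] at h2
  have h3 := (le_abs_self _).trans (abs_dotProduct_le β h)
  have h4 := Real.mul_self_sqrt (dotProduct_self_nonneg' β)
  rcases (Real.sqrt_nonneg (β ⬝ᵥ β)).eq_or_lt with h0 | h0
  · rw [← h0]; positivity
  · rw [inv_mul_eq_div, le_div_iff₀ hc]
    nlinarith

/-- With β = A⁻¹g and γ = R⁻¹g, both differences reduce to γ'(A − R)β and β'(A − R)β, so A⁻¹ − R⁻¹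
is never estimated; 6 = 2 + 4 adds the two contributions. The first form occurs in the residual sum
of squares, the second in the loss. -/
lemma quadratic_perturbation (hc : 0 < c) (hsymm : Rᵀ = R)
    (hR : ∀ v, c * (v ⬝ᵥ v) ≤ v ⬝ᵥ R *ᵥ v) (h : BilinClose R A ε) (hε0 : 0 ≤ ε)
    (hε : ε ≤ c / 2) (g : Fin k → ℝ) :
    |g ⬝ᵥ A⁻¹ *ᵥ g - g ⬝ᵥ R⁻¹ *ᵥ g| ≤ 6 / c ^ 2 * (ε * (g ⬝ᵥ g)) ∧
    |(A⁻¹ *ᵥ g) ⬝ᵥ R *ᵥ (A⁻¹ *ᵥ g) - g ⬝ᵥ R⁻¹ *ᵥ g| ≤ 6 / c ^ 2 * (ε * (g ⬝ᵥ g)) := by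
  have hA := h.ge hR hε
  have hc2 : 0 < c / 2 := by positivity
  set β := A⁻¹ *ᵥ g with hβ
  set γ := R⁻¹ *ᵥ g with hγ
  have hAβ : A *ᵥ β = g := by
    rw [hβ, Matrix.mulVec_mulVec, Matrix.mul_nonsing_inv _ (isUnit_det_of_ge hc2 hA),
      Matrix.one_mulVec]
  have hRγ : R *ᵥ γ = g := by
    rw [hγ, Matrix.mulVec_mulVec, Matrix.mul_nonsing_inv _ (isUnit_det_of_ge hc hR),
      Matrix.one_mulVec]
  have nβ := sqrt_inv_mulVec_le hc2 hA g
  have nγ := sqrt_inv_mulVec_le hc hR g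
  rw [← hβ] at nβ
  rw [← hγ] at nγ
  set s := √(g ⬝ᵥ g) with hs
  have hs2 : g ⬝ᵥ g = s * s := (Real.mul_self_sqrt (dotProduct_self_nonneg' g)).symm
  have hs0 : 0 ≤ s := Real.sqrt_nonneg _
  have hT : ∀ v w : Fin k → ℝ, v ⬝ᵥ R *ᵥ w = (R *ᵥ v) ⬝ᵥ w := by
    intro v w
    rw [Matrix.dotProduct_mulVec, ← Matrix.mulVec_transpose, hsymm]
  have e1 : g ⬝ᵥ β - g ⬝ᵥ γ = - (γ ⬝ᵥ (A - R) *ᵥ β) := by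
    rw [Matrix.sub_mulVec, dotProduct_sub, hAβ, hT, hRγ, dotProduct_comm γ g]; ring
  have e2 : β ⬝ᵥ R *ᵥ β - g ⬝ᵥ γ = - (β ⬝ᵥ (A - R) *ᵥ β) - γ ⬝ᵥ (A - R) *ᵥ β := by
    have : β ⬝ᵥ (A - R) *ᵥ β = g ⬝ᵥ β - β ⬝ᵥ R *ᵥ β := by
      rw [Matrix.sub_mulVec, dotProduct_sub, hAβ, dotProduct_comm]
    rw [this]; linarith
  have b1 : |γ ⬝ᵥ (A - R) *ᵥ β| ≤ ε * ((c⁻¹ * s) * ((c / 2)⁻¹ * s)) :=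
    (h γ β).trans (mul_le_mul_of_nonneg_left
      (mul_le_mul nγ nβ (Real.sqrt_nonneg _) (by positivity)) hε0)
  have b2 : |β ⬝ᵥ (A - R) *ᵥ β| ≤ ε * (((c / 2)⁻¹ * s) * ((c / 2)⁻¹ * s)) :=
    (h β β).trans (mul_le_mul_of_nonneg_left
      (mul_le_mul nβ nβ (Real.sqrt_nonneg _) (by positivity)) hε0)
  have f1 : ε * ((c⁻¹ * s) * ((c / 2)⁻¹ * s)) = 2 / c ^ 2 * (ε * (s * s)) := by
    field_simp
  have f2 : ε * (((c / 2)⁻¹ * s) * ((c / 2)⁻¹ * s)) = 4 / c ^ 2 * (ε * (s * s)) := by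
    field_simp; ring
  rw [f1] at b1
  rw [f2] at b2
  have hp : 0 ≤ 1 / c ^ 2 * (ε * (s * s)) := by positivity
  have r1 : 2 / c ^ 2 * (ε * (s * s)) = 2 * (1 / c ^ 2 * (ε * (s * s))) := by ring
  have r2 : 4 / c ^ 2 * (ε * (s * s)) = 4 * (1 / c ^ 2 * (ε * (s * s))) := by ring
  have r3 : 6 / c ^ 2 * (ε * (s * s)) = 6 * (1 / c ^ 2 * (ε * (s * s))) := by ring
  rw [r1] at b1
  rw [r2] at b2
  rw [hs2, r3, e1, e2]
  rw [abs_le] at b1 b2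
  constructor <;> rw [abs_le] <;> constructor <;> linarith [b1.1, b1.2, b2.1, b2.2]

end Perturbation

/-! ### Least squares on a path -/

section LeastSquares

/-- The time points `K, …, n - 1` entering the regressions. -/
def window (K n : ℕ) : Finset ℤ := (Finset.Ico K n).map Nat.castEmbedding

lemma card_window (K n : ℕ) : (window K n).card = n - K := by simp [window]

lemma sum_window {M : Type*} [AddCommMonoid M] (K n : ℕ) (f : ℤ → M) :
    ∑ j ∈ window K n, f j = ∑ j ∈ Finset.Ico K n, f (j : ℤ) := by
  simp [window]

variable {k : ℕ}

/-- `∑_j x_j(k) u_j` -/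
def crossSum (u x : ℤ → ℝ) (J : Finset ℤ) (k : ℕ) : Fin k → ℝ := fun i => ∑ j ∈ J, x (j - (i : ℕ)) * u j

lemma sum_smul_lagVec (u x : ℤ → ℝ) (J : Finset ℤ) (k : ℕ) :
    ∑ j ∈ J, u j • lagVec x j k = crossSum u x J k := by
  funext i
  simp [crossSum, lagVec, Finset.sum_apply, mul_comm]

lemma Rhat_eq (x : ℤ → ℝ) (K n k : ℕ) : Rhat x K n k = (((n - K : ℕ) : ℝ)⁻¹) •
    ∑ j ∈ window K n, Matrix.vecMulVec (lagVec x j k) (lagVec x j k) := by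
  rw [Rhat, sum_window]

lemma Rhat_apply (x : ℤ → ℝ) (K n k : ℕ) (i l : Fin k) :
    Rhat x K n k i l = ((n - K : ℕ) : ℝ)⁻¹ * ∑ j ∈ window K n, x (j - (i : ℕ)) * x (j - (l : ℕ)) := by
  rw [Rhat_eq, Matrix.smul_apply, Matrix.sum_apply]
  simp [Matrix.vecMulVec_apply, lagVec]

lemma ahat_eq (x : ℤ → ℝ) (K n k : ℕ) : ahat x K n k =
    -((Rhat x K n k)⁻¹ *ᵥ
      ((((n - K : ℕ) : ℝ)⁻¹) • crossSum (fun j => x (j + 1)) x (window K n) k)) := by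
  rw [ahat, ← sum_smul_lagVec, sum_window]

lemma residVar_eq (x : ℤ → ℝ) (K n k : ℕ) : residVar x K n k = ((n - K : ℕ) : ℝ)⁻¹ *
    ∑ j ∈ window K n, (x (j + 1) + lagVec x j k ⬝ᵥ ahat x K n k) ^ 2 := by
  rw [residVar, sum_window]
  simp only [dotProduct_comm]

lemma Rhat_bilinear (x : ℤ → ℝ) {K n k : ℕ} (hKn : K < n) (v w : Fin k → ℝ) :
    ((n - K : ℕ) : ℝ) * (v ⬝ᵥ Rhat x K n k *ᵥ w) =
      ∑ j ∈ window K n, (lagVec x j k ⬝ᵥ v) * (lagVec x j k ⬝ᵥ w) := by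
  have hN : ((n - K : ℕ) : ℝ) ≠ 0 := by
    have : 0 < n - K := by omega
    exact_mod_cast this.ne'
  rw [Rhat_eq, Matrix.smul_mulVec, dotProduct_smul, smul_eq_mul, mul_inv_cancel_left₀ hN,
    Matrix.sum_mulVec, dotProduct_sum]
  refine Finset.sum_congr rfl fun j _ => ?_
  rw [Matrix.vecMulVec_mulVec, dotProduct_smul, dotProduct_comm v]
  simp

lemma dotProduct_crossSum (u x : ℤ → ℝ) (J : Finset ℤ) (v : Fin k → ℝ) :
    v ⬝ᵥ crossSum u x J k = ∑ j ∈ J, u j * (lagVec x j k ⬝ᵥ v) := by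
  rw [← sum_smul_lagVec, dotProduct_sum]
  refine Finset.sum_congr rfl fun j _ => ?_
  rw [dotProduct_smul, dotProduct_comm, smul_eq_mul]

/-- Least squares estimation error and residual variance in terms of the errors
`u j` of another coefficient vector. -/
lemma least_squares {x u : ℤ → ℝ} {K n k : ℕ} (hKn : K < n) (hdet : IsUnit (Rhat x K n k).det)
    (c : Fin k → ℝ) (hu : ∀ j, x (j + 1) + lagVec x j k ⬝ᵥ c = u j) :
    ahat x K n k - c = -((Rhat x K n k)⁻¹ *ᵥ (((n - K : ℕ) : ℝ)⁻¹ • crossSum u x (window K n) k)) ∧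
    ((n - K : ℕ) : ℝ) * residVar x K n k = ∑ j ∈ window K n, u j ^ 2 - ((n - K : ℕ) : ℝ)⁻¹ *
      (crossSum u x (window K n) k ⬝ᵥ (Rhat x K n k)⁻¹ *ᵥ crossSum u x (window K n) k) := by
  have hN : ((n - K : ℕ) : ℝ) ≠ 0 := by
    have : 0 < n - K := by omega
    exact_mod_cast this.ne'
  set N : ℝ := ((n - K : ℕ) : ℝ) with hNdef
  set A := Rhat x K n k with hA
  set g := crossSum u x (window K n) k with hg
  have h1 : N⁻¹ • crossSum (fun j => x (j + 1)) x (window K n) k = N⁻¹ • g - A *ᵥ c := by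
    have : A *ᵥ c = N⁻¹ • ∑ j ∈ window K n, (lagVec x j k ⬝ᵥ c) • lagVec x j k := by
      rw [hA, Rhat_eq, Matrix.smul_mulVec, Matrix.sum_mulVec]
      congr 1
      refine Finset.sum_congr rfl fun j _ => ?_
      rw [Matrix.vecMulVec_mulVec]
      simp
    rw [this, ← smul_sub, hg, sum_smul_lagVec]
    congr 1
    funext i
    simp only [crossSum, Pi.sub_apply, ← Finset.sum_sub_distrib]
    refine Finset.sum_congr rfl fun j _ => ?_
    rw [← hu]; ring
  have h2 : ahat x K n k - c = -(A⁻¹ *ᵥ (N⁻¹ • g)) := by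
    rw [ahat_eq, ← hNdef, h1, Matrix.mulVec_sub, Matrix.mulVec_mulVec,
      Matrix.nonsing_inv_mul _ hdet, Matrix.one_mulVec]
    abel
  refine ⟨h2, ?_⟩
  set β := ahat x K n k - c with hβ
  have h3 : ∀ j, x (j + 1) + lagVec x j k ⬝ᵥ ahat x K n k = u j + lagVec x j k ⬝ᵥ β := by
    intro j
    rw [← hu, hβ, dotProduct_sub]; ring
  have h4 : ∑ j ∈ window K n, (u j + lagVec x j k ⬝ᵥ β) ^ 2 =
      ∑ j ∈ window K n, u j ^ 2 + 2 * (β ⬝ᵥ g) + N * (β ⬝ᵥ A *ᵥ β) := by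
    rw [hNdef, Rhat_bilinear x hKn, hg, dotProduct_crossSum, Finset.mul_sum,
      ← Finset.sum_add_distrib, ← Finset.sum_add_distrib]
    exact Finset.sum_congr rfl fun j _ => by ring
  have h5 : A *ᵥ β = -(N⁻¹ • g) := by
    rw [h2, Matrix.mulVec_neg, Matrix.mulVec_mulVec, Matrix.mul_nonsing_inv _ hdet,
      Matrix.one_mulVec]
  have h6 : β ⬝ᵥ g = - (N⁻¹ * (g ⬝ᵥ A⁻¹ *ᵥ g)) := by
    rw [h2, neg_dotProduct, Matrix.mulVec_smul, smul_dotProduct, dotProduct_comm, smul_eq_mul]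
  rw [residVar_eq, ← hNdef, mul_inv_cancel_left₀ hN]
  simp only [h3]
  rw [h4, h5, dotProduct_neg, dotProduct_smul, smul_eq_mul, h6]
  field_simp
  ring

end LeastSquares

/-! ### Uniform control of the empirical autocovariances. -/

section Fluctuation

set_option linter.unusedSectionVars false

variable {Ω : Type*} [MeasurableSpace Ω]
variable {μ : Measure Ω} [IsProbabilityMeasure μ] {a b : ℕ → ℝ} {σ : ℝ} {e x : ℤ → Ω → ℝ}

/-- The autocovariances. -/
noncomputable def acov (σ : ℝ) (b : ℕ → ℝ) (i l : ℕ) : ℝ :=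
  σ ^ 2 * ip (conv (unitSeq i) b) (conv (unitSeq l) b)

/-- Deviation of an empirical autocovariance. -/
noncomputable def covDev (σ : ℝ) (b : ℕ → ℝ) (x : ℤ → Ω → ℝ) (K n i l : ℕ) (ω : Ω) : ℝ :=
  ((n - K : ℕ) : ℝ)⁻¹ * ∑ j ∈ window K n, x (j + 1 - i) ω * x (j + 1 - l) ω - acov σ b i l

/-- The event that all empirical autocovariances are within `ε / (K + 1)` of their means. -/
def goodEvent (σ : ℝ) (b : ℕ → ℝ) (x : ℤ → Ω → ℝ) (K n : ℕ) (ε : ℝ) : Set Ω :=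
  {ω | ∀ i ∈ Finset.range (K + 1), ∀ l ∈ Finset.range (K + 1),
    |covDev σ b x K n i l ω| ≤ ε / (K + 1)}

lemma sum_window_shift {M : Type*} [AddCommMonoid M] (K n : ℕ) (f : ℤ → M) :
    ∑ j ∈ window K n, f (j + 1) = ∑ j ∈ window (K + 1) (n + 1), f j := by
  rw [sum_window, sum_window, ← Finset.sum_Ico_add' (fun j : ℕ => f (j : ℤ)) K n 1]
  simp

lemma l2_conv_unitSeq_le (hb : Summable b) (i : ℕ) : l2 (conv (unitSeq i) b) ≤ l1 b := by
  simpa [l2_unitSeq] using l2_conv_le (summable_unitSeq i) hb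

lemma l1_conv_unitSeq_le (hb : Summable b) (i : ℕ) : l1 (conv (unitSeq i) b) ≤ l1 b := by
  simpa [l1_unitSeq] using l1_conv_le (summable_unitSeq i) hb

namespace CausalModel

/-- `covDev` counts lags from the response x_{j+1} while the regressors start at x_j; stationarity
absorbs the shift by one. -/
lemma acov_succ (M : CausalModel μ σ a b e x) (i l : ℕ) :
    acov σ b (i + 1) (l + 1) = acov σ b i l := by
  rw [acov, acov, ← M.integral_mul 1 (i + 1) (l + 1), ← M.integral_mul 0 i l]
  congr 1
  funext ω
  congr 2 <;> (push_cast; ring)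

lemma measurable_covDev (M : CausalModel μ σ a b e x) (K n i l : ℕ) :
    Measurable (covDev σ b x K n i l) :=
  ((Finset.measurable_sum _ fun _ _ => (M.measurable _).mul (M.measurable _)).const_mul _).sub_const _

lemma measurableSet_goodEvent (M : CausalModel μ σ a b e x) (K n : ℕ) (ε : ℝ) :
    MeasurableSet (goodEvent σ b x K n ε) := by
  have : goodEvent σ b x K n ε = ⋂ i ∈ Finset.range (K + 1), ⋂ l ∈ Finset.range (K + 1),
      {ω | |covDev σ b x K n i l ω| ≤ ε / (K + 1)} := by
    ext ω; simp [goodEvent]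
  rw [this]
  refine Finset.measurableSet_biInter _ fun i _ => Finset.measurableSet_biInter _ fun l _ => ?_
  exact measurableSet_le (continuous_abs.measurable.comp (M.measurable_covDev K n i l))
    measurable_const

lemma moment_covDev (M : CausalModel μ σ a b e x) {q : ℕ} (hq : 1 ≤ q) :
    ∃ C, 0 ≤ C ∧ ∀ K n i l : ℕ, K < n →
      MomentLE μ q (covDev σ b x K n i l) (C * (√((n - K : ℕ) : ℝ))⁻¹) := by
  obtain ⟨C, hC0, hC⟩ := M.deviation_lin_mul_lin hq
  have hb0 := l1_nonneg b
  refine ⟨C * (l1 b * l1 b), by positivity, fun K n i l hKn => ?_⟩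
  have hN : (0 : ℝ) < ((n - K : ℕ) : ℝ) := by
    have : 0 < n - K := by omega
    exact_mod_cast this
  set N : ℝ := ((n - K : ℕ) : ℝ) with hNdef
  have h1 := (hC (window (K + 1) (n + 1)) _ _ (summable_unitSeq i) (summable_unitSeq l)).const_mul N⁻¹
  simp only [lin_unitSeq] at h1
  rw [card_window, Nat.add_sub_add_right, ← hNdef, abs_of_pos (inv_pos.2 hN)] at h1
  have h2 : covDev σ b x K n i l = fun ω => N⁻¹ * ∑ j ∈ window (K + 1) (n + 1),
      (x (j - i) ω * x (j - l) ω - σ ^ 2 * ip (conv (unitSeq i) b) (conv (unitSeq l) b)) := by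
    funext ω
    rw [covDev, Finset.sum_sub_distrib, Finset.sum_const, card_window, Nat.add_sub_add_right,
      nsmul_eq_mul, ← hNdef, mul_sub, inv_mul_cancel_left₀ hN.ne', acov,
      ← sum_window_shift K n (fun j => x (j - i) ω * x (j - l) ω)]
  rw [h2]
  refine h1.mono ?_
  have h3 : √N * √N = N := Real.mul_self_sqrt hN.le
  have h4 : 0 < √N := Real.sqrt_pos.2 hN
  have h5 : N⁻¹ * √N = (√N)⁻¹ := by
    nth_rewrite 1 [← h3]
    field_simp
  calc N⁻¹ * (C * (√N * (l2 (conv (unitSeq i) b) * l1 (conv (unitSeq l) b))))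
      = (C * (l2 (conv (unitSeq i) b) * l1 (conv (unitSeq l) b))) * (N⁻¹ * √N) := by ring
    _ ≤ (C * (l1 b * l1 b)) * (N⁻¹ * √N) := by
        refine mul_le_mul_of_nonneg_right (mul_le_mul_of_nonneg_left ?_ hC0) (by positivity)
        exact mul_le_mul (l2_conv_unitSeq_le M.summable_ma i) (l1_conv_unitSeq_le M.summable_ma l)
          (l1_nonneg _) hb0
    _ = _ := by rw [h5]

/-- The complement of the good event has small probability. -/
lemma measure_compl_goodEvent_le (M : CausalModel μ σ a b e x) {q : ℕ} (hq : 1 ≤ q) :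
    ∃ C, 0 ≤ C ∧ ∀ (K n : ℕ) (ε : ℝ), K < n → 0 < ε →
      (K : ℝ) + 1 ≤ ε ^ 2 * √((n - K : ℕ) : ℝ) →
      μ.real (goodEvent σ b x K n ε)ᶜ ≤ ((K : ℝ) + 1) ^ 2 * (C * ε) ^ q := by
  obtain ⟨C, hC0, hC⟩ := M.moment_covDev hq
  refine ⟨C, hC0, fun K n ε hKn hε hKε => ?_⟩
  have hN : (0 : ℝ) < ((n - K : ℕ) : ℝ) := by
    have : 0 < n - K := by omega
    exact_mod_cast this
  set N : ℝ := ((n - K : ℕ) : ℝ) with hNdef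
  have hs : 0 < √N := Real.sqrt_pos.2 hN
  have hsub : (goodEvent σ b x K n ε)ᶜ ⊆ ⋃ i ∈ Finset.range (K + 1), ⋃ l ∈ Finset.range (K + 1),
      {ω | ε / (K + 1) ≤ |covDev σ b x K n i l ω|} := by
    intro ω hω
    simp only [goodEvent, Set.mem_compl_iff, Set.mem_ofPred_eq, not_forall, not_le] at hω
    obtain ⟨i, hi, l, hl, h⟩ := hω
    simp only [Set.mem_iUnion, Set.mem_ofPred_eq]
    exact ⟨i, hi, l, hl, h.le⟩
  have hone : ∀ i l, μ.real {ω | ε / (K + 1) ≤ |covDev σ b x K n i l ω|} ≤ (C * ε) ^ q := by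
    intro i l
    have h1 := (hC K n i l hKn).measure_ge_le hq (by positivity) (t := ε / (K + 1)) (by positivity)
    have h2 : μ.real {ω | ε / (K + 1) ≤ |covDev σ b x K n i l ω|} ≤
        (C * (√N)⁻¹ / (ε / (K + 1))) ^ q :=
      ENNReal.toReal_le_of_le_ofReal (by positivity) h1
    refine h2.trans (pow_le_pow_left₀ (by positivity) ?_ q)
    -- Since (K + 1)/√N ≤ ε², the ratio in Markov's inequality is at most Cε, and q can be taken as
    -- large as desired.
    rw [div_div_eq_mul_div, div_le_iff₀ hε]
    calc C * (√N)⁻¹ * (K + 1) ≤ C * (√N)⁻¹ * (ε ^ 2 * √N) :=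
          mul_le_mul_of_nonneg_left hKε (by positivity)
      _ = C * ε * ε := by field_simp
  refine (measureReal_mono hsub (measure_ne_top _ _)).trans ?_
  refine (measureReal_biUnion_finset_le _ _).trans ?_
  have h3 : ∀ i ∈ Finset.range (K + 1), μ.real (⋃ l ∈ Finset.range (K + 1),
      {ω | ε / (K + 1) ≤ |covDev σ b x K n i l ω|}) ≤ ((K : ℝ) + 1) * (C * ε) ^ q := by
    intro i _
    refine (measureReal_biUnion_finset_le _ _).trans ?_
    refine (Finset.sum_le_sum fun l _ => hone i l).trans ?_
    simp
  refine (Finset.sum_le_sum h3).trans (le_of_eq ?_)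
  simp; ring

lemma bilinClose_of_good (M : CausalModel μ σ a b e x) {K n k : ℕ} {ε : ℝ} (hε : 0 ≤ ε)
    (hk : k ≤ K) {ω : Ω} (hω : ω ∈ goodEvent σ b x K n ε) :
    BilinClose (covMat σ b k) (Rhat (fun t => x t ω) K n k) ε := by
  intro v w
  have h1 : ∀ i l : Fin k, |(Rhat (fun t => x t ω) K n k - covMat σ b k) i l| ≤ ε / (K + 1) := by
    intro i l
    have h2 := hω (i + 1) (by simp; omega) (l + 1) (by simp; omega)
    rw [covDev, M.acov_succ] at h2
    have h3 : ∀ (j : ℤ) (i : ℕ), j + 1 - ((i + 1 : ℕ) : ℤ) = j - i := by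
      intros; push_cast; ring
    simp only [h3] at h2
    rw [Matrix.sub_apply, Rhat_apply]
    exact h2
  refine (abs_bilinear_le_of_entries h1 (by positivity) v w).trans ?_
  refine mul_le_mul_of_nonneg_right ?_ (by positivity)
  have hk' : (k : ℝ) ≤ K := by exact_mod_cast hk
  rw [div_mul_eq_mul_div, div_le_iff₀ (by positivity)]
  nlinarith

/-- On the good event residual variances are bounded away from zero and infinity. -/
lemma residVar_bounds_of_good (M : CausalModel μ σ a b e x) {K n k : ℕ} {ε : ℝ} (hε : 0 ≤ ε)
    (hε' : ε ≤ eigLow σ a / 2) (hKn : K < n) (hk : k ≤ K) {ω : Ω}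
    (hω : ω ∈ goodEvent σ b x K n ε) :
    eigLow σ a / 2 ≤ residVar (fun t => x t ω) K n k ∧
      residVar (fun t => x t ω) K n k ≤ acov σ b 0 0 + ε := by
  have hN : (0 : ℝ) < ((n - K : ℕ) : ℝ) := by
    have : 0 < n - K := by omega
    exact_mod_cast this
  set N : ℝ := ((n - K : ℕ) : ℝ) with hNdef
  set X : ℤ → ℝ := fun t => x t ω with hX
  set c := eigLow σ a with hc
  have hc0 : 0 < c := M.eigLow_pos
  constructor
  -- The residual variance is the quadratic form of the empirical covariance matrix of response and
  -- regressors together, taken at the vector (1, â), whose squared norm is at least 1.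
  · set A : Matrix (Fin (k + 1)) (Fin (k + 1)) ℝ := Rhat (fun t => X (t + 1)) K n (k + 1) with hA
    have h1 : ∀ i l : Fin (k + 1), |(A - covMat σ b (k + 1)) i l| ≤ ε / (K + 1) := by
      intro i l
      have h2 := hω i (by simp; omega) l (by simp; omega)
      rw [covDev] at h2
      have h3 : ∀ (j : ℤ) (i : ℕ), j - (i : ℤ) + 1 = j + 1 - i := by intros; ring
      rw [Matrix.sub_apply, hA, Rhat_apply]
      simp only [h3]
      exact h2
    have hcl : BilinClose (covMat σ b (k + 1)) A ε := by
      intro v w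
      refine (abs_bilinear_le_of_entries h1 (by positivity) v w).trans ?_
      refine mul_le_mul_of_nonneg_right ?_ (by positivity)
      have hk' : (k : ℝ) ≤ K := by exact_mod_cast hk
      rw [div_mul_eq_mul_div, div_le_iff₀ (by positivity)]
      push_cast
      nlinarith
    set v : Fin (k + 1) → ℝ := Fin.cons 1 (ahat X K n k) with hv
    have h3 := hcl.ge (fun v => M.covMat_ge v) hε' v
    have h4 : ∀ j, lagVec (fun t => X (t + 1)) j (k + 1) ⬝ᵥ v =
        X (j + 1) + lagVec X j k ⬝ᵥ ahat X K n k := by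
      intro j
      rw [dotProduct, Fin.sum_univ_succ, hv]
      have h3 : ∀ i : ℕ, j - ((i : ℤ) + 1) + 1 = j - i := by intros; ring
      simp [lagVec, dotProduct, h3]
    have h5 := Rhat_bilinear (fun t => X (t + 1)) hKn v v
    simp only [h4] at h5
    have h6 : residVar X K n k = v ⬝ᵥ A *ᵥ v := by
      rw [residVar_eq, ← hNdef, inv_mul_eq_iff_eq_mul₀ hN.ne', h5]
      simp only [sq]
    rw [h6]
    refine le_trans ?_ h3
    have h7 : (1 : ℝ) ≤ v ⬝ᵥ v := by
      rw [dotProduct, Fin.sum_univ_succ, hv]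
      have := dotProduct_self_nonneg' (ahat X K n k)
      simp only [Fin.cons_zero, Fin.cons_succ]
      rw [dotProduct] at this
      linarith
    nlinarith
  -- Comparison with zero coefficients: fitting only lowers the sum of squares, and the mean of x²
  -- is controlled by entry (0, 0) of the good event.
  · have hcl := M.bilinClose_of_good hε hk hω
    have hge := hcl.ge (fun v => M.covMat_ge v) hε'
    have hdet := isUnit_det_of_ge (by positivity) hge
    have h1 := (least_squares hKn hdet 0 (u := fun j => X (j + 1)) (by simp [hX])).2
    set g := crossSum (fun j => X (j + 1)) X (window K n) k with hg
    have h2 : 0 ≤ g ⬝ᵥ (Rhat X K n k)⁻¹ *ᵥ g := by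
      have h3 := hge ((Rhat X K n k)⁻¹ *ᵥ g)
      rw [Matrix.mulVec_mulVec, Matrix.mul_nonsing_inv _ hdet, Matrix.one_mulVec,
        dotProduct_comm _ g] at h3
      have := dotProduct_self_nonneg' ((Rhat X K n k)⁻¹ *ᵥ g)
      have h4 : 0 ≤ c / 2 * ((Rhat X K n k)⁻¹ *ᵥ g ⬝ᵥ (Rhat X K n k)⁻¹ *ᵥ g) := by positivity
      exact h4.trans h3
    have h4 := (abs_le.1 (hω 0 (by simp) 0 (by simp))).2
    rw [covDev, ← hNdef] at h4
    have h5 : residVar X K n k ≤ N⁻¹ * ∑ j ∈ window K n, X (j + 1) ^ 2 := by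
      rw [le_inv_mul_iff₀ hN, h1]
      have : 0 ≤ N⁻¹ * (g ⬝ᵥ (Rhat X K n k)⁻¹ *ᵥ g) := by positivity
      linarith
    have h6 : ∑ j ∈ window K n, X (j + 1) ^ 2 =
        ∑ j ∈ window K n, x (j + 1 - (0 : ℕ)) ω * x (j + 1 - (0 : ℕ)) ω := by
      refine Finset.sum_congr rfl fun j _ => ?_
      simp [hX, sq]
    rw [h6] at h5
    have h7 : ε / ((K : ℝ) + 1) ≤ ε := div_le_self hε (by linarith [(Nat.cast_nonneg K : (0:ℝ) ≤ K)])
    linarith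

end CausalModel

end Fluctuation

/-! ### Quadratic forms of a score contaminated by a bias term. -/

section Perturbation

variable {k : ℕ} {R A : Matrix (Fin k) (Fin k) ℝ} {c ε : ℝ}

lemma abs_dotProduct_inv_mulVec_le (hc : 0 < c) (hR : ∀ v, c * (v ⬝ᵥ v) ≤ v ⬝ᵥ R *ᵥ v)
    (v w : Fin k → ℝ) : |v ⬝ᵥ R⁻¹ *ᵥ w| ≤ c⁻¹ * (√(v ⬝ᵥ v) * √(w ⬝ᵥ w)) := by
  refine (abs_dotProduct_le _ _).trans ?_
  have := mul_le_mul_of_nonneg_left (sqrt_inv_mulVec_le hc hR w) (Real.sqrt_nonneg (v ⬝ᵥ v))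
  linarith

/-- The cross terms between S and T are split as 2√(S'S · T'T) ≤ ε S'S + ε⁻¹ T'T. The weight ε⁻¹ is
affordable because T will be the cross sum of regressors and bias, which is small. -/
lemma quadratic_perturbation_sub (hc : 0 < c) (hsymm : Rᵀ = R)
    (hR : ∀ v, c * (v ⬝ᵥ v) ≤ v ⬝ᵥ R *ᵥ v) (h : BilinClose R A ε) (hε0 : 0 < ε) (hε1 : ε ≤ 1)
    (hε : ε ≤ c / 2) (S T : Fin k → ℝ) :
    |(S - T) ⬝ᵥ A⁻¹ *ᵥ (S - T) - S ⬝ᵥ R⁻¹ *ᵥ S| ≤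
      (2 / c + 12 / c ^ 2) * (ε * (S ⬝ᵥ S) + ε⁻¹ * (T ⬝ᵥ T)) ∧
    |(A⁻¹ *ᵥ (S - T)) ⬝ᵥ R *ᵥ (A⁻¹ *ᵥ (S - T)) - S ⬝ᵥ R⁻¹ *ᵥ S| ≤
      (2 / c + 12 / c ^ 2) * (ε * (S ⬝ᵥ S) + ε⁻¹ * (T ⬝ᵥ T)) := by
  obtain ⟨h1, h2⟩ := quadratic_perturbation hc hsymm hR h hε0.le hε (S - T)
  set SS := S ⬝ᵥ S with hSS
  set TT := T ⬝ᵥ T with hTT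
  have hSS0 : 0 ≤ SS := dotProduct_self_nonneg' S
  have hTT0 : 0 ≤ TT := dotProduct_self_nonneg' T
  have hei : 1 ≤ ε⁻¹ := (one_le_inv₀ hε0).2 hε1
  set W := ε * SS + ε⁻¹ * TT with hW
  have hTW : TT ≤ ε⁻¹ * TT := le_mul_of_one_le_left hTT0 hei
  have heT : ε * TT ≤ ε⁻¹ * TT := mul_le_mul_of_nonneg_right (hε1.trans hei) hTT0
  have heS : 0 ≤ ε * SS := by positivity
  have hgg : (S - T) ⬝ᵥ (S - T) ≤ 2 * SS + 2 * TT := by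
    rw [hSS, hTT]
    simp only [dotProduct, Finset.mul_sum, ← Finset.sum_add_distrib, Pi.sub_apply]
    exact Finset.sum_le_sum fun i _ => by nlinarith [sq_nonneg (S i + T i)]
  have hA1 : 6 / c ^ 2 * (ε * ((S - T) ⬝ᵥ (S - T))) ≤ 12 / c ^ 2 * W := by
    have : ε * ((S - T) ⬝ᵥ (S - T)) ≤ 2 * W := by
      have := mul_le_mul_of_nonneg_left hgg hε0.le
      rw [hW]; nlinarith
    calc _ ≤ 6 / c ^ 2 * (2 * W) := mul_le_mul_of_nonneg_left this (by positivity)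
      _ = _ := by ring
  have hcross : √SS * √TT ≤ W / 2 := by
    have e1 : √SS * √SS = SS := Real.mul_self_sqrt hSS0
    have e2 : √TT * √TT = TT := Real.mul_self_sqrt hTT0
    have h3 : 0 ≤ (ε * √SS - √TT) ^ 2 := sq_nonneg _
    have h4 : 2 * (ε * (√SS * √TT)) ≤ ε * W := by
      have : ε * W = ε ^ 2 * SS + TT := by rw [hW]; field_simp
      rw [this]; nlinarith
    nlinarith
  have hB : |(S - T) ⬝ᵥ R⁻¹ *ᵥ (S - T) - S ⬝ᵥ R⁻¹ *ᵥ S| ≤ 2 / c * W := by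
    have e : (S - T) ⬝ᵥ R⁻¹ *ᵥ (S - T) - S ⬝ᵥ R⁻¹ *ᵥ S =
        -(S ⬝ᵥ R⁻¹ *ᵥ T) - T ⬝ᵥ R⁻¹ *ᵥ S + T ⬝ᵥ R⁻¹ *ᵥ T := by
      simp only [Matrix.mulVec_sub, dotProduct_sub, sub_dotProduct]; ring
    have b1 := abs_dotProduct_inv_mulVec_le hc hR S T
    have b2 := abs_dotProduct_inv_mulVec_le hc hR T S
    have b3 := abs_dotProduct_inv_mulVec_le hc hR T T
    rw [← hSS, ← hTT] at b1 b2
    rw [← hTT, Real.mul_self_sqrt hTT0] at b3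
    have hci : 0 < c⁻¹ := inv_pos.2 hc
    have d1 : c⁻¹ * (√SS * √TT) ≤ c⁻¹ * (W / 2) := mul_le_mul_of_nonneg_left hcross hci.le
    have d2 : c⁻¹ * (√TT * √SS) ≤ c⁻¹ * (W / 2) := by rw [mul_comm √TT]; exact d1
    have d3 : c⁻¹ * TT ≤ c⁻¹ * W := mul_le_mul_of_nonneg_left (by linarith) hci.le
    have e4 : 2 / c * W = 2 * (c⁻¹ * W) := by rw [div_eq_mul_inv]; ring
    rw [e, e4]
    rw [abs_le] at b1 b2 b3 ⊢
    constructor <;> linarith [b1.1, b1.2, b2.1, b2.2, b3.1, b3.2]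
  rw [add_mul]
  rw [abs_le] at h1 h2 hB ⊢
  rw [abs_le]
  refine ⟨⟨?_, ?_⟩, ⟨?_, ?_⟩⟩ <;> linarith [h1.1, h1.2, h2.1, h2.2, hB.1, hB.2]

end Perturbation

/-! ### Loss and residual variance at a fixed order. -/

section Fluctuation

set_option linter.unusedSectionVars false

variable {Ω : Type*} [MeasurableSpace Ω]
variable {μ : Measure Ω} [IsProbabilityMeasure μ] {a b : ℕ → ℝ} {σ : ℝ} {e x : ℤ → Ω → ℝ}

/-- `N L_n(k)` as a function of `N` and `k`. -/
noncomputable def scaledLoss (μ : Measure Ω) (σ : ℝ) (a b : ℕ → ℝ) (x : ℤ → Ω → ℝ) (N : ℝ)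
    (k : ℕ) : ℝ :=
  k * σ ^ 2 + N * (σ ^ 2 * bias μ a b x k ^ 2)

/-- Sampling fluctuation of the loss and of the residual sum of squares at order `k`. -/
noncomputable def fluctuation (μ : Measure Ω) (σ : ℝ) (a b : ℕ → ℝ) (e x : ℤ → Ω → ℝ)
    (K n : ℕ) (ε : ℝ) (k : ℕ) (ω : Ω) : ℝ :=
  let N : ℝ := ((n - K : ℕ) : ℝ)
  let z : ℤ → ℝ := lin (coefDiff μ a x k) (fun s => x s ω)
  let S := score e x (window K n) k ω
  let T := crossSum z (fun s => x s ω) (window K n) k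
  2 * |∑ j ∈ window K n, e (j + 1) ω * z j| +
    |∑ j ∈ window K n, (z j * z j - σ ^ 2 * bias μ a b x k ^ 2)| +
    (N⁻¹ * |S ⬝ᵥ (covMat σ b k)⁻¹ *ᵥ S - N * k * σ ^ 2| +
      (2 / eigLow σ a + 12 / eigLow σ a ^ 2) * (ε * (N⁻¹ * (S ⬝ᵥ S)) + ε⁻¹ * (N⁻¹ * (T ⬝ᵥ T))))

namespace CausalModel

/-- Estimating k coefficients adds about kσ² to N times the loss and removes about kσ² from the
residual sum of squares, both through N⁻¹S'R⁻¹S. Adding 2kσ² therefore makes the latter follow the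
same curve; ∑e² is common to all orders. -/
lemma fluctuation_spec (M : CausalModel μ σ a b e x) {K n k : ℕ} {ε : ℝ} (hKn : K < n) (hk : k ≤ K)
    (hε0 : 0 < ε) (hε1 : ε ≤ 1) (hε : ε ≤ eigLow σ a / 2) {ω : Ω}
    (hω : ω ∈ goodEvent σ b x K n ε)
    (hres : ∀ t : ℤ, x (t + 1) ω + lagVec (fun s => x s ω) t k ⬝ᵥ bestCoef μ x k =
      e (t + 1) ω - lin (coefDiff μ a x k) (fun s => x s ω) t) :
    |((n - K : ℕ) : ℝ) * (predErr μ x k (ahat (fun s => x s ω) K n k) - σ ^ 2) -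
        scaledLoss μ σ a b x ((n - K : ℕ) : ℝ) k| ≤ fluctuation μ σ a b e x K n ε k ω ∧
    |((n - K : ℕ) : ℝ) * residVar (fun s => x s ω) K n k + 2 * k * σ ^ 2 -
        ∑ j ∈ window K n, e (j + 1) ω ^ 2 - scaledLoss μ σ a b x ((n - K : ℕ) : ℝ) k| ≤
      fluctuation μ σ a b e x K n ε k ω := by
  have hN : (0 : ℝ) < ((n - K : ℕ) : ℝ) := by
    have : 0 < n - K := by omega
    exact_mod_cast this
  have hcl := M.bilinClose_of_good hε0.le hk hω
  have hdet := isUnit_det_of_ge (half_pos M.eigLow_pos) (hcl.ge (fun v => M.covMat_ge v) hε)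
  rw [fluctuation]
  set N : ℝ := ((n - K : ℕ) : ℝ) with hNdef
  set X : ℤ → ℝ := fun s => x s ω with hX
  set z : ℤ → ℝ := lin (coefDiff μ a x k) X with hz
  set S := score e x (window K n) k ω with hS
  set T := crossSum z X (window K n) k with hT
  set R := covMat σ b k with hR
  set A := Rhat X K n k with hA
  obtain ⟨h1, h2⟩ := least_squares hKn hdet (bestCoef μ x k) hres
  obtain ⟨p1, p2⟩ := quadratic_perturbation_sub M.eigLow_pos (covMat_symm k)
    (fun v => M.covMat_ge v) hcl hε0 hε1 hε S T
  have hg : crossSum (fun j => e (j + 1) ω - z j) X (window K n) k = S - T := by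
    funext i
    simp only [crossSum, Pi.sub_apply, hS, score, hT, ← Finset.sum_sub_distrib, mul_sub, hX]
  rw [hg] at h1 h2
  rw [← hNdef] at h1 h2
  set W := (2 / eigLow σ a + 12 / eigLow σ a ^ 2) * (ε * (S ⬝ᵥ S) + ε⁻¹ * (T ⬝ᵥ T)) with hW
  have hW' : (2 / eigLow σ a + 12 / eigLow σ a ^ 2) *
      (ε * (N⁻¹ * (S ⬝ᵥ S)) + ε⁻¹ * (N⁻¹ * (T ⬝ᵥ T))) = N⁻¹ * W := by rw [hW]; ring
  rw [hW']
  set V := S ⬝ᵥ R⁻¹ *ᵥ S - N * k * σ ^ 2 with hV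
  have hNi : 0 < N⁻¹ := inv_pos.2 hN
  have hVa := abs_le.1 (le_refl |V|)
  rw [abs_le] at p1 p2
  have hSR : S ⬝ᵥ R⁻¹ *ᵥ S = V + N * k * σ ^ 2 := by rw [hV]; ring
  rw [hSR] at p1 p2
  have key : ∀ y : ℝ, -W ≤ y - (V + N * k * σ ^ 2) → y - (V + N * k * σ ^ 2) ≤ W →
      -(N⁻¹ * |V| + N⁻¹ * W) ≤ N⁻¹ * y - k * σ ^ 2 ∧
        N⁻¹ * y - k * σ ^ 2 ≤ N⁻¹ * |V| + N⁻¹ * W := by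
    intro y hy1 hy2
    have e1 : N⁻¹ * y - k * σ ^ 2 = N⁻¹ * (y - N * k * σ ^ 2) := by field_simp
    rw [e1, ← mul_add, ← mul_neg]
    exact ⟨mul_le_mul_of_nonneg_left (by linarith [hVa.1]) hNi.le,
      mul_le_mul_of_nonneg_left (by linarith [hVa.2]) hNi.le⟩
  set E1 := ∑ j ∈ window K n, e (j + 1) ω * z j with hE1
  set E2 := ∑ j ∈ window K n, (z j * z j - σ ^ 2 * bias μ a b x k ^ 2) with hE2
  have hE1a := abs_le.1 (le_refl |E1|)
  have hE2a := abs_le.1 (le_refl |E2|)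
  have hE1n := abs_nonneg E1
  have hE2n := abs_nonneg E2
  constructor
  · have e1 : N * (predErr μ x k (ahat X K n k) - σ ^ 2) - scaledLoss μ σ a b x N k =
        N⁻¹ * ((A⁻¹ *ᵥ (S - T)) ⬝ᵥ R *ᵥ (A⁻¹ *ᵥ (S - T))) - k * σ ^ 2 := by
      rw [M.predErr_decomp, M.normRSq_coefDiff, h1, scaledLoss, Matrix.mulVec_smul]
      simp only [neg_dotProduct, Matrix.mulVec_neg, dotProduct_neg, Matrix.mulVec_smul,
        smul_dotProduct, dotProduct_smul, smul_eq_mul]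
      field_simp
      ring
    rw [e1, abs_le]
    have := key _ p2.1 p2.2
    constructor <;> linarith [this.1, this.2]
  · have e2 : ∑ j ∈ window K n, (e (j + 1) ω - z j) ^ 2 =
        ∑ j ∈ window K n, e (j + 1) ω ^ 2 - 2 * E1 + (E2 + N * (σ ^ 2 * bias μ a b x k ^ 2)) := by
      have : N * (σ ^ 2 * bias μ a b x k ^ 2) =
          ∑ j ∈ window K n, (σ ^ 2 * bias μ a b x k ^ 2) := by
        rw [Finset.sum_const, card_window, nsmul_eq_mul]
      rw [this, hE1, hE2, Finset.mul_sum, ← Finset.sum_add_distrib, ← Finset.sum_sub_distrib,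
        ← Finset.sum_add_distrib]
      exact Finset.sum_congr rfl fun j _ => by ring
    rw [h2, e2, scaledLoss]
    have := key _ p1.1 p1.2
    rw [abs_le]
    constructor <;> linarith [this.1, this.2, hE1a.1, hE1a.2, hE2a.1, hE2a.2]

end CausalModel

end Fluctuation

/-! ### Moments of the fluctuation. -/

section FluctuationMoments

set_option linter.unusedSectionVars false

variable {Ω : Type*} [MeasurableSpace Ω]
variable {μ : Measure Ω} [IsProbabilityMeasure μ] {a b : ℕ → ℝ} {σ : ℝ} {e x : ℤ → Ω → ℝ}

namespace CausalModel

lemma scaledLoss_nonneg (M : CausalModel μ σ a b e x) {N : ℝ} (hN : 0 ≤ N) (k : ℕ) :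
    0 ≤ scaledLoss μ σ a b x N k := by
  have := M.sigma_pos
  rw [scaledLoss]; positivity

lemma order_le_scaledLoss (M : CausalModel μ σ a b e x) {N : ℝ} (hN : 0 ≤ N) (k : ℕ) :
    k * σ ^ 2 ≤ scaledLoss μ σ a b x N k := by
  have := M.sigma_pos
  rw [scaledLoss]
  have : 0 ≤ N * (σ ^ 2 * bias μ a b x k ^ 2) := by positivity
  linarith

lemma bias_le_scaledLoss (M : CausalModel μ σ a b e x) (N : ℝ) (k : ℕ) :
    N * bias μ a b x k ^ 2 * σ ^ 2 ≤ scaledLoss μ σ a b x N k := by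
  have := M.sigma_pos
  rw [scaledLoss]
  have : 0 ≤ (k : ℝ) * σ ^ 2 := by positivity
  linarith

lemma moment_sum_sq {q : ℕ} (hq : 1 ≤ q) {k : ℕ} {S : Ω → Fin k → ℝ} {c : ℝ} (hc : 0 ≤ c)
    (h : ∀ i, MomentLE μ (2 * q) (fun ω => S ω i) c) :
    MomentLE μ q (fun ω => S ω ⬝ᵥ S ω) (k * (c * c)) := by
  have := MomentLE.sum hq Finset.univ (f := fun (i : Fin k) ω => S ω i * S ω i)
    (c := fun _ => c * c) (fun i _ => by positivity) (fun i _ => (h i).mul hc (h i))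
  simpa [dotProduct] using this

lemma moment_score_sq (M : CausalModel μ σ a b e x) {q : ℕ} (hq : 1 ≤ q) :
    ∃ C, 0 ≤ C ∧ ∀ (J : Finset ℤ) (k : ℕ),
      MomentLE μ q (fun ω => score e x J k ω ⬝ᵥ score e x J k ω) (C * (J.card * k)) := by
  obtain ⟨C, hC0, hC⟩ := M.noise_mul_lin_bound (q := 2 * q) (by omega)
  have hb0 := l1_nonneg b
  refine ⟨(C * l1 b) ^ 2, by positivity, fun J k => ?_⟩
  have h1 : ∀ i : Fin k, MomentLE μ (2 * q) (fun ω => score e x J k ω i) (C * (√J.card * l1 b)) := by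
    intro i
    have h2 := hC J _ (summable_unitSeq i)
    simp only [lin_unitSeq] at h2
    have h3 := h2.mono (mul_le_mul_of_nonneg_left (mul_le_mul_of_nonneg_left
      (l2_conv_unitSeq_le M.summable_ma i) (Real.sqrt_nonneg _)) hC0)
    have h4 : (fun ω => score e x J k ω i) = fun ω => ∑ j ∈ J, e (j + 1) ω * x (j - (i : ℕ)) ω := by
      funext ω
      exact Finset.sum_congr rfl fun j _ => mul_comm _ _
    rw [h4]
    exact h3
  refine (moment_sum_sq hq (by positivity) h1).mono (le_of_eq ?_)
  have h3 : √(J.card : ℝ) * √J.card = J.card := Real.mul_self_sqrt (Nat.cast_nonneg _)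
  calc (k : ℝ) * (C * (√J.card * l1 b) * (C * (√J.card * l1 b)))
      = (C * l1 b) ^ 2 * ((√J.card * √J.card) * k) := by ring
    _ = _ := by rw [h3]

/-- The normal equations give every summand mean zero, so each coordinate is O(√N · bias) and not
O(N · bias). -/
lemma moment_bias_cross_sq (M : CausalModel μ σ a b e x) {q : ℕ} (hq : 1 ≤ q) :
    ∃ C, 0 ≤ C ∧ ∀ (J : Finset ℤ) (k : ℕ),
      MomentLE μ q (fun ω => crossSum (lin (coefDiff μ a x k) (fun s => x s ω)) (fun s => x s ω) J k ⬝ᵥ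
        crossSum (lin (coefDiff μ a x k) (fun s => x s ω)) (fun s => x s ω) J k)
        (C * (J.card * (k * bias μ a b x k ^ 2))) := by
  obtain ⟨C, hC0, hC⟩ := M.deviation_lin_mul_lin (q := 2 * q) (by omega)
  have hb0 := l1_nonneg b
  refine ⟨(C * l1 b) ^ 2, by positivity, fun J k => ?_⟩
  have hβ := bias_nonneg (μ := μ) (a := a) (b := b) (x := x) k
  have h1 : ∀ i : Fin k, MomentLE μ (2 * q)
      (fun ω => crossSum (lin (coefDiff μ a x k) (fun s => x s ω)) (fun s => x s ω) J k i)
      (C * (√J.card * (bias μ a b x k * l1 b))) := by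
    intro i
    have h2 := hC J _ _ (M.summable_coefDiff k) (summable_unitSeq i)
    have h5 : ip (conv (coefDiff μ a x k) b) (conv (unitSeq i) b) = 0 := by
      have h6 : unitSeq (i : ℕ) = ext (Pi.single i (1 : ℝ)) := by
        rw [ext_eq_sum, Finset.sum_eq_single i (fun l _ hl => by simp [hl]) (by simp)]
        simp
      rw [h6]
      exact M.orthogonal_coefDiff _
    simp only [lin_unitSeq, h5, mul_zero, sub_zero] at h2
    have h3 := h2.mono (mul_le_mul_of_nonneg_left (mul_le_mul_of_nonneg_left
      (mul_le_mul_of_nonneg_left (l1_conv_unitSeq_le M.summable_ma i) hβ)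
      (Real.sqrt_nonneg _)) hC0)
    have h4 : (fun ω => crossSum (lin (coefDiff μ a x k) (fun s => x s ω)) (fun s => x s ω) J k i) =
        fun ω => ∑ j ∈ J, lin (coefDiff μ a x k) (fun s => x s ω) j * x (j - (i : ℕ)) ω := by
      funext ω
      exact Finset.sum_congr rfl fun j _ => mul_comm _ _
    rw [h4]
    exact h3
  refine (moment_sum_sq hq (by positivity) h1).mono (le_of_eq ?_)
  have h3 : √(J.card : ℝ) * √J.card = J.card := Real.mul_self_sqrt (Nat.cast_nonneg _)
  calc (k : ℝ) * (C * (√J.card * (bias μ a b x k * l1 b)) * (C * (√J.card * (bias μ a b x k * l1 b))))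
      = (C * l1 b) ^ 2 * ((√J.card * √J.card) * (k * bias μ a b x k ^ 2)) := by ring
    _ = _ := by rw [h3]

-- Up to constants √D dominates √k and √N · bias, which gives the terms of first order. The
-- perturbation terms are εk and ε⁻¹ k · bias²; the second is at most εN · bias² because k ≤ ε²N,
-- and so both are at most a multiple of εD.
set_option maxHeartbeats 800000 in
theorem moment_fluctuation (M : CausalModel μ σ a b e x) {q : ℕ} (hq : 1 ≤ q) :
    ∃ C, 0 ≤ C ∧ ∀ (K n k : ℕ) (ε : ℝ), K < n → k ≤ K → 0 < ε → ε ≤ 1 →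
      (K : ℝ) + 1 ≤ ε ^ 2 * √((n - K : ℕ) : ℝ) → 2 * K ^ 2 ≤ n - K →
      MomentLE μ q (fluctuation μ σ a b e x K n ε k)
        (C * (√(scaledLoss μ σ a b x ((n - K : ℕ) : ℝ) k) +
          ε * scaledLoss μ σ a b x ((n - K : ℕ) : ℝ) k)) := by
  obtain ⟨C1, hC10, hC1⟩ := M.noise_mul_lin_bound hq
  obtain ⟨C2, hC20, hC2⟩ := M.deviation_lin_mul_lin hq
  obtain ⟨C3, hC30, hC3⟩ := M.score_quadratic_bound hq
  obtain ⟨C4, hC40, hC4⟩ := M.moment_score_sq hq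
  obtain ⟨C5, hC50, hC5⟩ := M.moment_bias_cross_sq hq
  obtain ⟨B, hB0, hB⟩ := M.exists_l1_coefDiff_le
  have hc := M.eigLow_pos
  have hs := M.sigma_pos
  set C0 := 2 / eigLow σ a + 12 / eigLow σ a ^ 2 with hC0
  have hC00 : 0 ≤ C0 := by positivity
  refine ⟨(2 * C1 + C2 * B + C3) * (√(σ ^ 2))⁻¹ + C0 * (C4 + C5) * (σ ^ 2)⁻¹, by positivity,
    fun K n k ε hKn hk hε0 hε1 hKε hK2 => ?_⟩
  have hN1 : (1 : ℝ) ≤ ((n - K : ℕ) : ℝ) := by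
    have : 1 ≤ n - K := by omega
    exact_mod_cast this
  have hcard := card_window K n
  have hβ := bias_nonneg (μ := μ) (a := a) (b := b) (x := x) k
  have hD1 := M.order_le_scaledLoss (N := ((n - K : ℕ) : ℝ)) (by positivity) k
  have hD2 := M.bias_le_scaledLoss ((n - K : ℕ) : ℝ) k
  have hkK : (k : ℝ) ≤ K := by exact_mod_cast hk
  have hsN : √((n - K : ℕ) : ℝ) ≤ ((n - K : ℕ) : ℝ) := by
    rw [Real.sqrt_le_left (by positivity)]; nlinarith
  set N : ℝ := ((n - K : ℕ) : ℝ) with hNdef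
  set β := bias μ a b x k with hβdef
  set D := scaledLoss μ σ a b x N k with hD
  have hN : 0 < N := by linarith
  have hss : 0 < √(σ ^ 2) := Real.sqrt_pos.2 hs
  have hkD : √(k : ℝ) ≤ (√(σ ^ 2))⁻¹ * √D := by
    rw [inv_mul_eq_div, le_div_iff₀ hss, ← Real.sqrt_mul (Nat.cast_nonneg k)]
    exact Real.sqrt_le_sqrt hD1
  have hβD : √N * β ≤ (√(σ ^ 2))⁻¹ * √D := by
    rw [inv_mul_eq_div, le_div_iff₀ hss]
    nth_rewrite 1 [← Real.sqrt_sq hβ]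
    rw [← Real.sqrt_mul hN.le, ← Real.sqrt_mul (by positivity)]
    exact Real.sqrt_le_sqrt hD2
  have hkD' : (k : ℝ) ≤ (σ ^ 2)⁻¹ * D := by
    rw [inv_mul_eq_div, le_div_iff₀ hs]; exact hD1
  have hβD' : N * β ^ 2 ≤ (σ ^ 2)⁻¹ * D := by
    rw [inv_mul_eq_div, le_div_iff₀ hs]; exact hD2
  have t1 := ((hC1 (window K n) _ (M.summable_coefDiff k)).abs).const_mul 2
  have t2 := (hC2 (window K n) _ _ (M.summable_coefDiff k) (M.summable_coefDiff k)).abs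
  have t3 := ((hC3 k K (window K n) hk (by rw [hcard]; exact hK2)).abs).const_mul N⁻¹
  have t4 := ((hC4 (window K n) k).const_mul N⁻¹).const_mul ε
  have t5 := ((hC5 (window K n) k).const_mul N⁻¹).const_mul ε⁻¹
  simp only [hcard, ← hNdef, abs_of_pos (inv_pos.2 hN), abs_of_pos hε0,
    abs_of_pos (inv_pos.2 hε0), abs_of_pos (two_pos : (0 : ℝ) < 2), ip_self] at t1 t2 t3 t4 t5
  have hl1 := l1_nonneg (conv (coefDiff μ a x k) b)
  have hl2 := l2_nonneg (conv (coefDiff μ a x k) b)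
  have t45 := (t4.add hq (by positivity) (by positivity) t5).const_mul C0
  rw [abs_of_nonneg hC00] at t45
  have t345 := t3.add hq (by positivity) (by positivity) t45
  have t := (t1.add hq (by positivity) (by positivity) t2).add hq (by positivity) (by positivity) t345
  have hfun : fluctuation μ σ a b e x K n ε k = _ := rfl
  refine (show MomentLE μ q (fluctuation μ σ a b e x K n ε k) _ from t).mono ?_
  clear hfun t t345 t45 t1 t2 t3 t4 t5
  rw [show l2 (conv (coefDiff μ a x k) b) = β from rfl]
  have hεk : ε⁻¹ * k ≤ ε * N := by
    rw [inv_mul_eq_div, div_le_iff₀ hε0]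
    have : ε ^ 2 * √N ≤ ε ^ 2 * N := mul_le_mul_of_nonneg_left hsN (by positivity)
    nlinarith
  have r1 : 2 * (C1 * (√N * β)) ≤ 2 * C1 * ((√(σ ^ 2))⁻¹ * √D) := by
    rw [← mul_assoc]; exact mul_le_mul_of_nonneg_left hβD (by positivity)
  have r2 : C2 * (√N * (β * l1 (conv (coefDiff μ a x k) b))) ≤ C2 * B * ((√(σ ^ 2))⁻¹ * √D) := by
    calc C2 * (√N * (β * l1 (conv (coefDiff μ a x k) b)))
        = C2 * l1 (conv (coefDiff μ a x k) b) * (√N * β) := by ring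
      _ ≤ C2 * B * ((√(σ ^ 2))⁻¹ * √D) :=
        mul_le_mul (mul_le_mul_of_nonneg_left (hB k) hC20) hβD (by positivity) (by positivity)
  have r3 : N⁻¹ * (C3 * (N * √k)) ≤ C3 * ((√(σ ^ 2))⁻¹ * √D) := by
    have : N⁻¹ * (C3 * (N * √k)) = C3 * √k := by field_simp
    rw [this]; exact mul_le_mul_of_nonneg_left hkD hC30
  have r4 : ε * (N⁻¹ * (C4 * (N * k))) ≤ C4 * ((σ ^ 2)⁻¹ * (ε * D)) := by
    have : ε * (N⁻¹ * (C4 * (N * k))) = C4 * ε * k := by field_simp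
    rw [this]
    calc C4 * ε * k ≤ C4 * ε * ((σ ^ 2)⁻¹ * D) := mul_le_mul_of_nonneg_left hkD' (by positivity)
      _ = _ := by ring
  have r5 : ε⁻¹ * (N⁻¹ * (C5 * (N * (k * β ^ 2)))) ≤ C5 * ((σ ^ 2)⁻¹ * (ε * D)) := by
    have : ε⁻¹ * (N⁻¹ * (C5 * (N * (k * β ^ 2)))) = C5 * β ^ 2 * (ε⁻¹ * k) := by field_simp
    rw [this]
    calc C5 * β ^ 2 * (ε⁻¹ * k) ≤ C5 * β ^ 2 * (ε * N) :=
          mul_le_mul_of_nonneg_left hεk (by positivity)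
      _ = C5 * ε * (N * β ^ 2) := by ring
      _ ≤ C5 * ε * ((σ ^ 2)⁻¹ * D) := mul_le_mul_of_nonneg_left hβD' (by positivity)
      _ = _ := by ring
  have hsD : 0 ≤ √D := Real.sqrt_nonneg _
  have hDD : 0 ≤ D := by
    refine le_trans ?_ hD1
    positivity
  have r45 := mul_le_mul_of_nonneg_left (add_le_add r4 r5) hC00
  have s1 : 0 ≤ (2 * C1 + C2 * B + C3) * (√(σ ^ 2))⁻¹ * (ε * D) := by positivity
  have s2 : 0 ≤ C0 * (C4 + C5) * (σ ^ 2)⁻¹ * √D := by positivity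
  calc _ ≤ (2 * C1 * ((√(σ ^ 2))⁻¹ * √D) + C2 * B * ((√(σ ^ 2))⁻¹ * √D)) +
        (C3 * ((√(σ ^ 2))⁻¹ * √D) +
          C0 * (C4 * ((σ ^ 2)⁻¹ * (ε * D)) + C5 * ((σ ^ 2)⁻¹ * (ε * D)))) := by
        exact add_le_add (add_le_add r1 r2) (add_le_add r3 r45)
    _ ≤ _ := by linarith [s1, s2]

end CausalModel

end FluctuationMoments

/-! ### Selection criteria -/

section Criteria

/-- Up to monotone transformations that do not depend on the order, each criterion is
`N r_k + 2 k v` with a proxy `v` of the noise variance and a remainder of order `k K / N`. -/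
lemma criterion_transform {x : ℤ → ℝ} {K n : ℕ} {B : ℝ} (hKN : 4 * K + 4 ≤ n - K)
    (hr : ∀ k ∈ Finset.Icc 1 K, 0 < residVar x K n k ∧ residVar x K n k ≤ B)
    (crit : Criterion) :
    ∃ F : ℕ → ℝ, (∀ k ∈ Finset.Icc 1 K, ∀ l ∈ Finset.Icc 1 K,
        crit.value x K n k ≤ crit.value x K n l → F k ≤ F l) ∧
      ∀ k ∈ Finset.Icc 1 K, ∃ v : ℝ, (v = residVar x K n k ∨ v = residVar x K n K) ∧
        |F k - (((n - K : ℕ) : ℝ) * residVar x K n k + 2 * k * v)| ≤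
          16 * B * (k * K / ((n - K : ℕ) : ℝ)) := by
  rcases Nat.eq_zero_or_pos K with hK0 | hK1
  · subst hK0
    exact ⟨fun _ => 0, by simp, by simp⟩
  have hN4 : 4 * (K : ℝ) + 4 ≤ ((n - K : ℕ) : ℝ) := by exact_mod_cast hKN
  have hnN : (n : ℝ) = ((n - K : ℕ) : ℝ) + K := by
    have : n = (n - K) + K := by omega
    exact_mod_cast this
  set N : ℝ := ((n - K : ℕ) : ℝ) with hN
  set r : ℕ → ℝ := residVar x K n with hrdef
  have hK1' : (1 : ℝ) ≤ K := by exact_mod_cast hK1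
  have hN0 : 0 < N := by linarith
  have hB0 : 0 < B := (hr K (by simp; omega)).1.trans_le (hr K (by simp; omega)).2
  have hkmem : ∀ k ∈ Finset.Icc 1 K, (1 : ℝ) ≤ k ∧ (k : ℝ) ≤ K := by
    intro k hk
    rw [Finset.mem_Icc] at hk
    exact ⟨by exact_mod_cast hk.1, by exact_mod_cast hk.2⟩
  have scale : ∀ {k : ℕ}, k ∈ Finset.Icc 1 K → ∀ {t y : ℝ}, |t| ≤ 16 * (k * K / N) → 0 < y → y ≤ B →
      |y * t| ≤ 16 * B * (k * K / N) := by
    intro k hk t y ht hy hyB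
    rw [abs_mul, abs_of_pos hy]
    have : (0 : ℝ) ≤ 16 * (k * K / N) := (abs_nonneg t).trans ht
    calc y * |t| ≤ B * (16 * (k * K / N)) := mul_le_mul hyB ht (abs_nonneg _) hB0.le
      _ = _ := by ring
  cases crit with
  | S =>
    refine ⟨fun k => (N + 2 * k) * r k, fun k _ l _ h => h, fun k hk => ⟨r k, Or.inl rfl, ?_⟩⟩
    have : (0 : ℝ) ≤ 16 * B * (k * K / N) := by positivity
    convert this using 1
    rw [abs_eq_zero]; ring
  | AIC =>
    -- Exponentiating keeps the order. The penalty factor is 1 + 2k/n + O((k/n)²), and n = N + K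
    -- turns 2kN/n into 2k up to 2kK/n.
    refine ⟨fun k => N * (r k * Real.exp (2 * k / n)), fun k hk l hl h => ?_,
      fun k hk => ⟨r k, Or.inl rfl, ?_⟩⟩
    · have h1 := Real.exp_le_exp.2 h
      simp only [Criterion.value] at h1
      rw [Real.exp_add, Real.exp_add, Real.exp_log (hr k hk).1, Real.exp_log (hr l hl).1] at h1
      exact mul_le_mul_of_nonneg_left h1 hN0.le
    · obtain ⟨hk1, hkK⟩ := hkmem k hk
      have e1 : N * (r k * Real.exp (2 * k / n)) - (N * r k + 2 * k * r k) =
          r k * (N * (Real.exp (2 * k / n) - 1 - 2 * k / n) - 2 * k * K / n) := by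
        rw [hnN]; field_simp; ring
      rw [e1]
      refine scale hk ?_ (hr k hk).1 (hr k hk).2
      have hn0 : (0 : ℝ) < n := by rw [hnN]; linarith
      have hnN' : N ≤ n := by rw [hnN]; linarith
      have ht : |2 * (k : ℝ) / n| ≤ 1 := by
        rw [abs_of_nonneg (by positivity), div_le_one hn0]; linarith
      have h2 := Real.abs_exp_sub_one_sub_id_le ht
      have h3 : N * (2 * (k : ℝ) / n) ^ 2 ≤ 4 * (k * K / N) := by
        have : N * (2 * (k : ℝ) / n) ^ 2 ≤ N * (2 * (k : ℝ) / N) ^ 2 := by gcongr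
        refine this.trans ?_
        have e3 : N * (2 * (k : ℝ) / N) ^ 2 = 4 * (k * k / N) := by field_simp; ring
        rw [e3]; gcongr
      have h4 : 2 * (k : ℝ) * K / n ≤ 2 * (k * K / N) := by
        rw [← mul_div_assoc, ← mul_assoc]; gcongr
      have h5 : (0 : ℝ) ≤ 2 * k * K / n := by positivity
      have h6 : (0 : ℝ) ≤ k * K / N := by positivity
      have h7 := mul_le_mul_of_nonneg_left h2 hN0.le
      rw [← abs_of_pos hN0, ← abs_mul, abs_of_pos hN0] at h7
      rw [abs_le] at h7 ⊢
      constructor <;> linarith [h7.1, h7.2]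
  | FPE =>
    refine ⟨fun k => N * (((n + k) / (n - k)) * r k), fun k hk l hl h => ?_,
      fun k hk => ⟨r k, Or.inl rfl, ?_⟩⟩
    · exact mul_le_mul_of_nonneg_left h hN0.le
    · obtain ⟨hk1, hkK⟩ := hkmem k hk
      have hnk : N ≤ n - k := by rw [hnN]; linarith
      have hnk0 : (0 : ℝ) < n - k := by linarith
      have e1 : N * ((((n : ℝ) + k) / (n - k)) * r k) - (N * r k + 2 * k * r k) =
          r k * -(2 * k * (K - k) / (n - k)) := by
        have : N = n - K := by linarith
        rw [this]; field_simp; ring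
      rw [e1]
      refine scale hk ?_ (hr k hk).1 (hr k hk).2
      rw [abs_neg, abs_of_nonneg (div_nonneg (mul_nonneg (by positivity) (by linarith)) hnk0.le)]
      have : 2 * (k : ℝ) * (K - k) / (n - k) ≤ 2 * k * K / N := by
        gcongr
        linarith
      refine this.trans ?_
      have h6 : (0 : ℝ) ≤ k * K / N := by positivity
      have : 2 * (k : ℝ) * K / N = 2 * (k * K / N) := by ring
      linarith
  | Sp =>
    refine ⟨fun k => N * ((1 + k / (N - k - 1)) * (N / (N - k) * r k)), fun k hk l hl h => ?_,
      fun k hk => ⟨r k, Or.inl rfl, ?_⟩⟩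
    · exact mul_le_mul_of_nonneg_left h hN0.le
    · obtain ⟨hk1, hkK⟩ := hkmem k hk
      have h1 : N / 2 ≤ N - k - 1 := by linarith
      have h2 : N / 2 ≤ N - k := by linarith
      have h1' : 0 < N - k - 1 := by linarith
      have h2' : 0 < N - k := by linarith
      have e1 : N * ((1 + (k : ℝ) / (N - k - 1)) * (N / (N - k) * r k)) - (N * r k + 2 * k * r k) =
          r k * (k * (3 * k * N + N - 2 * k ^ 2 - 2 * k) / ((N - k - 1) * (N - k))) := by
        field_simp; ring
      rw [e1]
      refine scale hk ?_ (hr k hk).1 (hr k hk).2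
      have hnum : 0 ≤ 3 * (k : ℝ) * N + N - 2 * k ^ 2 - 2 * k := by nlinarith
      rw [abs_of_nonneg (div_nonneg (mul_nonneg (by positivity) hnum) (by positivity))]
      have h3 : N / 2 * (N / 2) ≤ (N - k - 1) * (N - k) := mul_le_mul h1 h2 (by positivity) h1'.le
      have h4 : 3 * (k : ℝ) * N + N - 2 * k ^ 2 - 2 * k ≤ 4 * K * N := by nlinarith
      calc (k : ℝ) * (3 * k * N + N - 2 * k ^ 2 - 2 * k) / ((N - k - 1) * (N - k))
          ≤ k * (4 * K * N) / (N / 2 * (N / 2)) := by gcongr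
        _ = 16 * (k * K / N) := by field_simp; ring
  | Cp =>
    -- Adding N s_n², which does not depend on k, leaves the penalty 2k s_n².
    refine ⟨fun k => N * r k - (N - 2 * k) * (N / (N - K) * r K) + N * (N / (N - K) * r K),
      fun k hk l hl h => ?_, fun k hk => ⟨r K, Or.inr rfl, ?_⟩⟩
    · have h' : N * r k - (N - 2 * k) * (N / (N - K) * r K) ≤
        N * r l - (N - 2 * l) * (N / (N - K) * r K) := h
      linarith
    · obtain ⟨hk1, hkK⟩ := hkmem k hk
      have h2 : N / 2 ≤ N - K := by linarith
      have h2' : 0 < N - (K : ℝ) := by linarith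
      have e1 : N * r k - (N - 2 * k) * (N / (N - K) * r K) + N * (N / (N - K) * r K) -
          (N * r k + 2 * k * r K) = r K * (2 * k * K / (N - K)) := by
        field_simp; ring
      rw [e1]
      have hKm : K ∈ Finset.Icc 1 K := by simp; omega
      refine scale hk ?_ (hr K hKm).1 (hr K hKm).2
      rw [abs_of_nonneg (by positivity)]
      calc 2 * (k : ℝ) * K / (N - K) ≤ 2 * k * K / (N / 2) := by gcongr
        _ = 4 * (k * K / N) := by field_simp; ring
        _ ≤ _ := by
          have h6 : (0 : ℝ) ≤ k * K / N := by positivity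
          linarith
  | CpUnadj =>
    refine ⟨fun k => N * r k - (N - 2 * k) * r K + N * r K,
      fun k hk l hl h => ?_, fun k hk => ⟨r K, Or.inr rfl, ?_⟩⟩
    · have h' : N * r k - (N - 2 * k) * r K ≤ N * r l - (N - 2 * l) * r K := h
      linarith
    · have : (0 : ℝ) ≤ 16 * B * (k * K / N) := by positivity
      convert this using 1
      rw [abs_eq_zero]; ring

end Criteria

lemma sqrt_le_self_of_one_le {t : ℝ} (ht : 1 ≤ t) : √t ≤ t := by
  rw [Real.sqrt_le_left (by positivity)]; nlinarith

lemma sqrt_le_one_add {t : ℝ} (ht : 0 ≤ t) : √t ≤ 1 + t := by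
  rw [Real.sqrt_le_left (by positivity)]; nlinarith

/-! ### The selected order against an arbitrary competitor. -/

section Selection

set_option linter.unusedSectionVars false

variable {Ω : Type*} [MeasurableSpace Ω]
variable {μ : Measure Ω} [IsProbabilityMeasure μ] {a b : ℕ → ℝ} {σ : ℝ} {e x : ℤ → Ω → ℝ}

lemma _root_.InfAR.CausalModel.noise_variance_bound (M : CausalModel μ σ a b e x) {q : ℕ}
    (hq : 1 ≤ q) :
    ∃ C, 0 ≤ C ∧ ∀ K n : ℕ, MomentLE μ q
      (fun ω => ∑ j ∈ window K n, e (j + 1) ω ^ 2 - ((n - K : ℕ) : ℝ) * σ ^ 2)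
      (C * √((n - K : ℕ) : ℝ)) := by
  obtain ⟨C, hC0, hC⟩ := exists_noise_sq_bound M.noise M.moments hq
  refine ⟨C, hC0, fun K n => ?_⟩
  have h := hC (window (K + 1) (n + 1)) (fun _ _ => 1) (fun _ => 1)
    (fun _ _ => measurable_const) (fun _ _ => zero_le_one)
    (fun _ _ => by simpa using MomentLE.const (μ := μ) (q := 4 * q) (by omega) (1 : ℝ))
  simp only [mul_one, one_pow, Finset.sum_const, card_window, Nat.add_sub_add_right,
    nsmul_eq_mul] at h
  convert h using 2 with ω
  rw [sum_window_shift K n (fun j => e j ω ^ 2), Finset.sum_sub_distrib, Finset.sum_const,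
    card_window, Nat.add_sub_add_right, nsmul_eq_mul]

/-- Fluctuation in the comparison of two orders by a criterion. -/
noncomputable def selectionError (μ : Measure Ω) (σ : ℝ) (a b : ℕ → ℝ) (e x : ℤ → Ω → ℝ)
    (K n : ℕ) (ε : ℝ) (k : ℕ) (ω : Ω) : ℝ :=
  let N : ℝ := ((n - K : ℕ) : ℝ)
  let W := |∑ j ∈ window K n, e (j + 1) ω ^ 2 - N * σ ^ 2|
  let D := scaledLoss μ σ a b x N
  let f := fun k => fluctuation μ σ a b e x K n ε k ω
  f k + (2 * (k / N) * (2 * W + (f k + f K)) + (2 * (k / N) * ((D k + 2 * k * σ ^ 2) +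
    (D K + 2 * K * σ ^ 2)) + 16 * (acov σ b 0 0 + 1) * (k * K / N)))

namespace CausalModel

lemma fluctuation_nonneg (M : CausalModel μ σ a b e x) (K n k : ℕ) {ε : ℝ} (hε : 0 < ε) (ω : Ω) :
    0 ≤ fluctuation μ σ a b e x K n ε k ω := by
  have hc := M.eigLow_pos
  have h1 := dotProduct_self_nonneg' (score e x (window K n) k ω)
  have h2 := dotProduct_self_nonneg' (crossSum (lin (coefDiff μ a x k) (fun s => x s ω))
    (fun s => x s ω) (window K n) k)
  rw [fluctuation]
  positivity

lemma acov_zero_nonneg (M : CausalModel μ σ a b e x) : 0 ≤ acov σ b 0 0 := by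
  have := M.sigma_pos
  rw [acov, ip_self]; positivity

lemma fluctuation_le_selectionError (M : CausalModel μ σ a b e x) (K n k : ℕ) {ε : ℝ} (hε : 0 < ε)
    (ω : Ω) : fluctuation μ σ a b e x K n ε k ω ≤ selectionError μ σ a b e x K n ε k ω := by
  have h1 := M.fluctuation_nonneg K n k hε ω
  have h2 := M.fluctuation_nonneg K n K hε ω
  have h3 := M.scaledLoss_nonneg (N := ((n - K : ℕ) : ℝ)) (by positivity) k
  have h4 := M.scaledLoss_nonneg (N := ((n - K : ℕ) : ℝ)) (by positivity) K
  have h5 := M.sigma_pos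
  have h6 := M.acov_zero_nonneg
  rw [selectionError]
  refine le_add_of_nonneg_right ?_
  positivity

/-- The transformed criterion at k is ∑e² + D(k) up to `selectionError`, which collects the
fluctuation, the effect 2k|v − σ²| of replacing the proxy v by σ², and the remainder of
`criterion_transform`. The common term ∑e² cancels in the comparison. -/
lemma selection_spec (M : CausalModel μ σ a b e x) {K n : ℕ} {ε : ℝ} (hKN : 4 * K + 4 ≤ n - K)
    (hε0 : 0 < ε) (hε1 : ε ≤ 1) (hε : ε ≤ eigLow σ a / 2) {ω : Ω}
    (hω : ω ∈ goodEvent σ b x K n ε)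
    (hres : ∀ k, ∀ t : ℤ, x (t + 1) ω + lagVec (fun s => x s ω) t k ⬝ᵥ bestCoef μ x k =
      e (t + 1) ω - lin (coefDiff μ a x k) (fun s => x s ω) t)
    (crit : Criterion) {k l : ℕ}
    (hk : IsArgmin (fun k => crit.value (fun t => x t ω) K n k) K k) (hl : l ∈ Finset.Icc 1 K) :
    scaledLoss μ σ a b x ((n - K : ℕ) : ℝ) k ≤ scaledLoss μ σ a b x ((n - K : ℕ) : ℝ) l +
      (selectionError μ σ a b e x K n ε k ω + selectionError μ σ a b e x K n ε l ω) := by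
  have hc := M.eigLow_pos
  have hs := M.sigma_pos
  obtain ⟨hkm, hkmin⟩ := hk
  have hKn : K < n := by omega
  have hf : ∀ k ∈ Finset.Icc 1 K, _ := fun k hk =>
    (M.fluctuation_spec hKn (Finset.mem_Icc.1 hk).2 hε0 hε1 hε hω (hres k)).2
  obtain ⟨F, hF1, hF2⟩ := criterion_transform (x := fun t => x t ω) (B := acov σ b 0 0 + 1) hKN
    (fun k hk => ⟨lt_of_lt_of_le (by positivity)
      (M.residVar_bounds_of_good hε0.le hε hKn (Finset.mem_Icc.1 hk).2 hω).1,
      (M.residVar_bounds_of_good hε0.le hε hKn (Finset.mem_Icc.1 hk).2 hω).2.trans (by linarith)⟩)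
    crit
  have hN : (0 : ℝ) < ((n - K : ℕ) : ℝ) := by
    have : 0 < n - K := by omega
    exact_mod_cast this
  set N : ℝ := ((n - K : ℕ) : ℝ) with hNdef
  set D := scaledLoss μ σ a b x N with hD
  set r := residVar (fun t => x t ω) K n with hr
  set Se := ∑ j ∈ window K n, e (j + 1) ω ^ 2 with hSe
  set W := |Se - N * σ ^ 2| with hW
  have hKm : K ∈ Finset.Icc 1 K := by
    rw [Finset.mem_Icc] at hkm ⊢; omega
  have hD0 : ∀ k, 0 ≤ D k := fun k => M.scaledLoss_nonneg hN.le k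
  have hf0 : ∀ k, 0 ≤ fluctuation μ σ a b e x K n ε k ω := fun k => M.fluctuation_nonneg K n k hε0 ω
  have hW0 : 0 ≤ W := abs_nonneg _
  have hWle := abs_le.1 (le_refl W)
  have hdev : ∀ k ∈ Finset.Icc 1 K, |r k - σ ^ 2| ≤
      N⁻¹ * (W + (D k + 2 * k * σ ^ 2) + fluctuation μ σ a b e x K n ε k ω) := by
    intro k hk
    have h1 := hf k hk
    rw [le_inv_mul_iff₀ hN]
    nth_rewrite 1 [← abs_of_pos hN]
    rw [← abs_mul]
    have hks : 0 ≤ 2 * k * σ ^ 2 := by positivity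
    have hd := hD0 k
    have hW2 : |Se - N * σ ^ 2| ≤ W := le_rfl
    rw [abs_le] at h1 hW2 ⊢
    constructor <;> linarith [h1.1, h1.2, hW2.1, hW2.2]
  have hterm : ∀ k ∈ Finset.Icc 1 K, |F k - (Se + D k)| ≤ selectionError μ σ a b e x K n ε k ω := by
    intro k hk
    obtain ⟨v, hv, hFv⟩ := hF2 k hk
    have hdv : |v - σ ^ 2| ≤ N⁻¹ * ((2 * W + (fluctuation μ σ a b e x K n ε k ω +
        fluctuation μ σ a b e x K n ε K ω)) + ((D k + 2 * k * σ ^ 2) + (D K + 2 * K * σ ^ 2))) := by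
      have g1 := hf0 k
      have g2 := hf0 K
      have g3 := hD0 k
      have g4 := hD0 K
      have g5 : 0 ≤ 2 * (k : ℝ) * σ ^ 2 := by positivity
      have g6 : 0 ≤ 2 * (K : ℝ) * σ ^ 2 := by positivity
      rcases hv with rfl | rfl
      · exact (hdev k hk).trans (mul_le_mul_of_nonneg_left (by linarith) (inv_pos.2 hN).le)
      · exact (hdev K hKm).trans (mul_le_mul_of_nonneg_left (by linarith) (inv_pos.2 hN).le)
    have h1 := hf k hk
    have h2 : |2 * (k : ℝ) * (v - σ ^ 2)| ≤ 2 * k * (N⁻¹ * ((2 * W + (fluctuation μ σ a b e x K n ε k ω +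
        fluctuation μ σ a b e x K n ε K ω)) + ((D k + 2 * k * σ ^ 2) + (D K + 2 * K * σ ^ 2)))) := by
      rw [abs_mul, abs_of_nonneg (by positivity : (0 : ℝ) ≤ 2 * k)]
      exact mul_le_mul_of_nonneg_left hdv (by positivity)
    have h3 : selectionError μ σ a b e x K n ε k ω = fluctuation μ σ a b e x K n ε k ω +
        2 * k * (N⁻¹ * ((2 * W + (fluctuation μ σ a b e x K n ε k ω +
        fluctuation μ σ a b e x K n ε K ω)) + ((D k + 2 * k * σ ^ 2) + (D K + 2 * K * σ ^ 2)))) +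
        16 * (acov σ b 0 0 + 1) * (k * K / N) := by
      rw [selectionError]
      simp only [← hNdef, ← hSe, ← hW, ← hD]
      rw [div_eq_mul_inv (k : ℝ) N]
      ring
    rw [h3]
    rw [abs_le] at h1 h2 hFv ⊢
    constructor <;> linarith [h1.1, h1.2, h2.1, h2.2, hFv.1, hFv.2]
  have hFkl := hF1 k hkm l hl (hkmin l hl)
  have h1 := hterm k hkm
  have h2 := hterm l hl
  rw [abs_le] at h1 h2
  linarith [h1.1, h1.2, h2.1, h2.2]

-- Most additional terms carry a factor k/N ≤ ε. The delicate one is (k/N) D(K), since D(K) may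
-- exceed D(k) by far: its bias part is σ² k · bias(K)², bounded by `exists_bias_bound`, and a
-- constant is absorbed because D(k) ≥ σ².
set_option maxHeartbeats 800000 in
theorem moment_selectionError (M : CausalModel μ σ a b e x) {q : ℕ} (hq : 1 ≤ q) :
    ∃ C, 0 ≤ C ∧ ∀ (K n k : ℕ) (ε : ℝ), K < n → 1 ≤ k → k ≤ K → 0 < ε → ε ≤ 1 →
      (K : ℝ) + 1 ≤ ε ^ 2 * √((n - K : ℕ) : ℝ) → 2 * K ^ 2 ≤ n - K →
      MomentLE μ q (selectionError μ σ a b e x K n ε k)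
        (C * (√(scaledLoss μ σ a b x ((n - K : ℕ) : ℝ) k) +
          ε * scaledLoss μ σ a b x ((n - K : ℕ) : ℝ) k)) := by
  obtain ⟨C1, hC10, hC1⟩ := M.moment_fluctuation hq
  obtain ⟨C2, hC20, hC2⟩ := M.noise_variance_bound hq
  obtain ⟨B, hB0, hB⟩ := M.exists_bias_bound
  have hs := M.sigma_pos
  have hac := M.acov_zero_nonneg
  set s := σ ^ 2 with hsdef
  have hss : 0 < √s := Real.sqrt_pos.2 hs
  set C3 := 1 + s * B ^ 2 * (√s)⁻¹ with hC3
  have hC30 : 0 ≤ C3 := by positivity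
  refine ⟨C1 + (4 * C2 * s⁻¹ + 2 * C1 + 2 * C1 * (s⁻¹ + 2 * C3)) + (2 + 4 + 2 * C3 + 4) +
      16 * (acov σ b 0 0 + 1) * s⁻¹, by positivity,
    fun K n k ε hKn hk1 hk hε0 hε1 hKε hK2 => ?_⟩
  have hN1 : (1 : ℝ) ≤ ((n - K : ℕ) : ℝ) := by
    have : 1 ≤ n - K := by omega
    exact_mod_cast this
  have hD1 := M.order_le_scaledLoss (N := ((n - K : ℕ) : ℝ)) (by positivity) k
  have hDn := M.scaledLoss_nonneg (N := ((n - K : ℕ) : ℝ)) (by positivity) k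
  have hDKn := M.scaledLoss_nonneg (N := ((n - K : ℕ) : ℝ)) (by positivity) K
  have hkK : (k : ℝ) ≤ K := by exact_mod_cast hk
  have hk1' : (1 : ℝ) ≤ k := by exact_mod_cast hk1
  have hsN : √((n - K : ℕ) : ℝ) ≤ ((n - K : ℕ) : ℝ) := by
    exact sqrt_le_self_of_one_le hN1
  have m1 := hC1 K n k ε hKn hk hε0 hε1 hKε hK2
  have m2 := hC1 K n K ε hKn le_rfl hε0 hε1 hKε hK2
  have m3 := (hC2 K n).abs
  set N : ℝ := ((n - K : ℕ) : ℝ) with hNdef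
  have hN : 0 < N := by linarith
  have hDKeq : scaledLoss μ σ a b x N K = K * s + N * (s * bias μ a b x K ^ 2) := rfl
  have hselfun : selectionError μ σ a b e x K n ε k = fun ω =>
      fluctuation μ σ a b e x K n ε k ω + (2 * (k / N) *
        (2 * |∑ j ∈ window K n, e (j + 1) ω ^ 2 - N * s| +
          (fluctuation μ σ a b e x K n ε k ω + fluctuation μ σ a b e x K n ε K ω)) +
        (2 * (k / N) * ((scaledLoss μ σ a b x N k + 2 * k * s) +
          (scaledLoss μ σ a b x N K + 2 * K * s)) + 16 * (acov σ b 0 0 + 1) * (k * K / N))) := rfl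
  set D := scaledLoss μ σ a b x N k with hD
  set DK := scaledLoss μ σ a b x N K with hDK
  set β := bias μ a b x K with hβ
  have hβ0 : 0 ≤ β := bias_nonneg K
  have hsD0 : 0 ≤ √D := Real.sqrt_nonneg _
  set m := √D + ε * D with hm
  have hm0 : 0 ≤ m := by positivity
  have hεD : ε * D ≤ m := by linarith
  have hkε : ε * k ≤ s⁻¹ * m := by
    have : (k : ℝ) ≤ s⁻¹ * D := by rw [inv_mul_eq_div, le_div_iff₀ hs]; exact hD1
    calc ε * k ≤ ε * (s⁻¹ * D) := mul_le_mul_of_nonneg_left this hε0.le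
      _ = s⁻¹ * (ε * D) := by ring
      _ ≤ s⁻¹ * m := mul_le_mul_of_nonneg_left hεD (by positivity)
  have hKN : (K : ℝ) / N ≤ ε := by
    rw [div_le_iff₀ hN]
    have : ε ^ 2 * √N ≤ ε * N := by
      have : ε ^ 2 ≤ ε := pow_le_of_le_one hε0.le hε1 two_ne_zero
      exact mul_le_mul this hsN (by positivity) (by positivity)
    linarith
  have hkN : (k : ℝ) / N ≤ ε := (div_le_div_of_nonneg_right hkK hN.le).trans hKN
  have hkN0 : 0 ≤ (k : ℝ) / N := by positivity
  have hkN1 : (k : ℝ) / N ≤ s⁻¹ * m := by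
    exact hkN.trans ((le_mul_of_one_le_right hε0.le hk1').trans hkε)
  have hkN2 : (k : ℝ) / N ≤ 1 := hkN.trans hε1
  have d1 : (k : ℝ) / N * (C2 * √N) ≤ C2 * s⁻¹ * m := by
    have h1 : (k : ℝ) / N * √N ≤ ε := by
      have h2 : √N * √N = N := Real.mul_self_sqrt hN.le
      have h3 : 0 < √N := Real.sqrt_pos.2 hN
      have h4 : (k : ℝ) / N * √N = k / √N := by
        nth_rewrite 1 [← h2]; field_simp
      rw [h4, div_le_iff₀ h3]
      have : ε ^ 2 * √N ≤ ε * √N := by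
        have : ε ^ 2 ≤ ε := pow_le_of_le_one hε0.le hε1 two_ne_zero
        exact mul_le_mul_of_nonneg_right this h3.le
      linarith
    have h2 : (k : ℝ) / N * √N ≤ s⁻¹ * m := by
      exact h1.trans ((le_mul_of_one_le_right hε0.le hk1').trans hkε)
    calc (k : ℝ) / N * (C2 * √N) = C2 * (k / N * √N) := by ring
      _ ≤ C2 * (s⁻¹ * m) := mul_le_mul_of_nonneg_left h2 hC20
      _ = _ := by ring
  have d2 : (k : ℝ) / N * D ≤ m := (mul_le_mul_of_nonneg_right hkN hDn).trans hεD
  have d3 : (k : ℝ) / N * (k * s) ≤ m := (mul_le_mul_of_nonneg_left hD1 hkN0).trans d2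
  have d3' : (k : ℝ) / N * (K * s) ≤ m := by
    have : (k : ℝ) / N * (K * s) = K / N * (k * s) := by ring
    rw [this]
    exact (mul_le_mul hKN hD1 (by positivity) hε0.le).trans hεD
  have d4 : (k : ℝ) / N * DK ≤ C3 * m := by
    have h1 : (k : ℝ) * β ^ 2 ≤ B ^ 2 := by
      have h2 := pow_le_pow_left₀ (by positivity) (hB K) 2
      rw [mul_pow, Real.sq_sqrt (by positivity)] at h2
      exact (mul_le_mul_of_nonneg_right (by linarith) (sq_nonneg _)).trans h2
    have h3 : 1 ≤ (√s)⁻¹ * √D := by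
      rw [inv_mul_eq_div, one_le_div hss]
      exact Real.sqrt_le_sqrt ((le_mul_of_one_le_left hs.le hk1').trans hD1)
    have h4 : 1 ≤ (√s)⁻¹ * m :=
      h3.trans (mul_le_mul_of_nonneg_left (by rw [hm]; linarith [mul_nonneg hε0.le hDn]) (by positivity))
    have h5 : (k : ℝ) / N * DK = k / N * (K * s) + s * (k * β ^ 2) := by
      rw [hDKeq]; field_simp
    have h6 : s * (k * β ^ 2) ≤ s * B ^ 2 * ((√s)⁻¹ * m) :=
      calc s * (k * β ^ 2) ≤ s * B ^ 2 * 1 := by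
            rw [mul_one]; exact mul_le_mul_of_nonneg_left h1 hs.le
        _ ≤ _ := mul_le_mul_of_nonneg_left h4 (by positivity)
    rw [h5, hC3]
    linarith
  have d5 : (k : ℝ) / N * (C1 * (√DK + ε * DK)) ≤ C1 * (s⁻¹ + 2 * C3) * m := by
    have h1 : √DK ≤ 1 + DK := sqrt_le_one_add hDKn
    have h2 : √DK + ε * DK ≤ 1 + 2 * DK := by linarith [mul_le_of_le_one_left hDKn hε1]
    calc (k : ℝ) / N * (C1 * (√DK + ε * DK)) ≤ k / N * (C1 * (1 + 2 * DK)) := by gcongr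
      _ = C1 * (k / N + 2 * (k / N * DK)) := by ring
      _ ≤ C1 * (s⁻¹ * m + 2 * (C3 * m)) := by gcongr
      _ = _ := by ring
  have d6 : (k : ℝ) * K / N ≤ s⁻¹ * m := by
    refine le_trans ?_ hkε
    rw [mul_div_assoc, mul_comm]
    exact mul_le_mul_of_nonneg_right hKN (by positivity)
  have t := ((m3.const_mul 2).add hq (by positivity) (by positivity)
    (m1.add hq (by positivity) (by positivity) m2)).const_mul (2 * (k / N))
  have tc := MomentLE.const (μ := μ) hq (2 * (k / N) * ((D + 2 * k * s) +
          (DK + 2 * K * s)) + 16 * (acov σ b 0 0 + 1) * (k * K / N))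
  have tt := m1.add hq (by positivity) (by positivity) (t.add hq (by positivity) (by positivity) tc)
  rw [hselfun]
  refine tt.mono ?_
  have hc0 : 0 ≤ 2 * (k / N) * ((D + 2 * k * s) +
          (DK + 2 * K * s)) + 16 * (acov σ b 0 0 + 1) * (k * K / N) := by positivity
  rw [abs_of_nonneg hc0, abs_of_nonneg (by positivity : 0 ≤ 2 * ((k : ℝ) / N)), abs_two]
  have d7 : (k : ℝ) / N * (C1 * m) ≤ C1 * m := mul_le_of_le_one_left (by positivity) hkN2
  have d8 : 16 * (acov σ b 0 0 + 1) * (k * K / N) ≤ 16 * (acov σ b 0 0 + 1) * (s⁻¹ * m) :=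
    mul_le_mul_of_nonneg_left d6 (by positivity)
  linarith

end CausalModel

end Selection

/-! ### Small ball probabilities. -/

section SmallBall

open scoped ENNReal

set_option linter.unusedSectionVars false

variable {Ω : Type*} [mΩ : MeasurableSpace Ω]
variable {μ : Measure Ω} [IsProbabilityMeasure μ] {a b : ℕ → ℝ} {σ : ℝ} {e x : ℤ → Ω → ℝ}

/-- Small ball probabilities of variables with uniformly Hölder continuous distribution functions. -/
lemma UniformHolderCDF.exists_small_ball (hF : UniformHolderCDF μ e)
    (he : ∀ t, Measurable (e t)) :
    ∃ α C r₀ : ℝ, 0 < α ∧ 0 < C ∧ 0 < r₀ ∧ ∀ (t : ℤ) (u r : ℝ), 0 < r → r ≤ r₀ →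
      μ {ω | |e t ω + u| ≤ r} ≤ ENNReal.ofReal (C * r ^ α) := by
  obtain ⟨α, δ, C₀, hα, hδ, hC, h⟩ := hF
  refine ⟨α, C₀ * 3 ^ α, δ / 4, hα, by positivity, by positivity, fun t u r hr hr0 => ?_⟩
  have hprob : IsProbabilityMeasure (μ.map (e t)) := Measure.isProbabilityMeasure_map (he t).aemeasurable
  -- Increments of a distribution function measure half-open intervals, so the closed interval is
  -- enlarged to the left. Its length becomes 3r < δ, whence r₀ = δ/4.
  have h1 : {ω | |e t ω + u| ≤ r} ⊆ e t ⁻¹' Set.Ioc (-u - 2 * r) (-u + r) := by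
    intro ω hω
    have := abs_le.1 (show |e t ω + u| ≤ r from hω)
    constructor <;> linarith [this.1, this.2]
  refine (measure_mono h1).trans ?_
  rw [← Measure.map_apply (he t) measurableSet_Ioc, ← measure_cdf (μ.map (e t)),
    StieltjesFunction.measure_Ioc]
  refine ENNReal.ofReal_le_ofReal ((le_abs_self _).trans ?_)
  have h2 : (-u + r) - (-u - 2 * r) = 3 * r := by ring
  have h30 : 0 < 3 * r := by positivity
  have h3 := h t (-u + r) (-u - 2 * r) (by rw [h2, abs_of_pos h30]; linarith)
  rw [h2, abs_of_pos h30, Real.mul_rpow (by norm_num) hr.le] at h3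
  linarith

/-- Zero variance would put an atom of mass one at 0, against the vanishing of small ball
probabilities. -/
lemma UniformHolderCDF.sigma_pos (hF : UniformHolderCDF μ e) (he : IsNoise μ σ e) : 0 < σ ^ 2 := by
  obtain ⟨α, C, r₀, hα, hC, hr₀, h⟩ := hF.exists_small_ball he.measurable
  rcases (sq_nonneg σ).lt_or_eq with h0 | h0
  · exact h0
  exfalso
  have h1 : e 0 =ᵐ[μ] fun _ => 0 := by
    have h2 : ∫ ω, e 0 ω ^ 2 ∂μ = 0 := by rw [integral_sq_noise he, ← h0]
    have h3 := (integral_eq_zero_iff_of_nonneg (fun ω => sq_nonneg (e 0 ω))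
      (he.memLp 0).integrable_sq).1 h2
    filter_upwards [h3] with ω hω
    exact pow_eq_zero_iff (two_ne_zero) |>.1 hω
  have h2 : ∀ r, 0 < r → r ≤ r₀ → 1 ≤ C * r ^ α := by
    intro r hr hr1
    have h3 : μ {ω | |e 0 ω + 0| ≤ r} = 1 := by
      rw [← mem_ae_iff_prob_eq_one]
      · filter_upwards [h1] with ω hω
        simp [hω, hr.le]
      · exact measurableSet_le (continuous_abs.measurable.comp ((he.measurable 0).add_const 0))
          measurable_const
    have h4 := h 0 0 r hr hr1
    rw [h3, ENNReal.one_le_ofReal] at h4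
    exact h4
  have h3 : Tendsto (fun r : ℝ => C * r ^ α) (𝓝[>] 0) (𝓝 0) := by
    have := ((Real.continuousAt_rpow_const 0 α (Or.inr hα.le)).tendsto.const_mul C)
    rw [Real.zero_rpow hα.ne', mul_zero] at this
    exact this.mono_left nhdsWithin_le_nhds
  have h4 : ∀ᶠ r : ℝ in 𝓝[>] 0, 1 ≤ C * r ^ α := by
    filter_upwards [Ioo_mem_nhdsGT hr₀] with r hr
    exact h2 r hr.1 hr.2.le
  exact absurd (ge_of_tendsto h3 h4) (by norm_num)

/-- A small ball event for an independent summand, on an event independent of that summand. -/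
lemma measure_inter_small_ball_le {Ω : Type*} {m mΩ : MeasurableSpace Ω} {μ : Measure Ω}
    [IsProbabilityMeasure μ] {ξ U : Ω → ℝ} {B : Set Ω} (hm : m ≤ mΩ)
    (hξ : Measurable ξ) (hU : Measurable[m] U) (hB : MeasurableSet[m] B)
    (hind : Indep (MeasurableSpace.comap ξ inferInstance) m μ) {r : ℝ} {ρ : ℝ≥0∞}
    (h : ∀ u : ℝ, μ {ω | |ξ ω + u| ≤ r} ≤ ρ) :
    μ (B ∩ {ω | |ξ ω + U ω| ≤ r}) ≤ ρ * μ B := by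
  -- The event B travels along as a second coordinate, so that one application of Fubini to the
  -- independent pair (ξ, Z) suffices.
  set Z : Ω → ℝ × ℝ := fun ω => (U ω, B.indicator (fun _ => (1 : ℝ)) ω) with hZ
  have hZm : Measurable[m] Z := hU.prodMk ((measurable_const (a := (1 : ℝ))).indicator hB)
  have hZm' : Measurable Z := hZm.mono hm le_rfl
  have hI : IndepFun ξ Z μ := by
    rw [IndepFun_iff_Indep]
    exact indep_of_indep_of_le_right hind hZm.comap_le
  have hmap := (indepFun_iff_map_prod_eq_prod_map_map hξ.aemeasurable hZm'.aemeasurable).1 hI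
  set S : Set (ℝ × (ℝ × ℝ)) := {p | |p.1 + p.2.1| ≤ r ∧ p.2.2 = 1} with hS
  have hSm : MeasurableSet S :=
    (measurableSet_le (continuous_abs.measurable.comp (measurable_fst.add measurable_snd.fst))
      measurable_const).inter (measurableSet_eq_fun measurable_snd.snd measurable_const)
  have h1 : B ∩ {ω | |ξ ω + U ω| ≤ r} = (fun ω => (ξ ω, Z ω)) ⁻¹' S := by
    ext ω
    by_cases hω : ω ∈ B <;> simp [hS, hZ, hω]
  have hprob : IsProbabilityMeasure (μ.map ξ) := Measure.isProbabilityMeasure_map hξ.aemeasurable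
  have hprob2 : IsProbabilityMeasure (μ.map Z) := Measure.isProbabilityMeasure_map hZm'.aemeasurable
  rw [h1, ← Measure.map_apply (hξ.prodMk hZm') hSm, hmap, Measure.prod_apply_symm hSm]
  have h2 : ∀ z : ℝ × ℝ, (μ.map ξ) ((fun y => (y, z)) ⁻¹' S) ≤
      Set.indicator {z : ℝ × ℝ | z.2 = 1} (fun _ => ρ) z := by
    intro z
    by_cases hz : z.2 = 1
    · rw [Set.indicator_of_mem (by exact hz), Measure.map_apply hξ (hSm.preimage (by fun_prop))]
      refine (measure_mono ?_).trans (h z.1)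
      intro ω hω
      exact hω.1
    · have : (fun y => (y, z)) ⁻¹' S = ∅ := by
        ext y; simp [hS, hz]
      rw [this]; simp
  have hT : MeasurableSet {z : ℝ × ℝ | z.2 = 1} := measurableSet_eq_fun measurable_snd measurable_const
  refine (lintegral_mono h2).trans ?_
  rw [lintegral_indicator_const hT, Measure.map_apply hZm' hT]
  refine mul_le_mul_right (measure_mono ?_) _
  intro ω hω
  by_contra hω'
  simp [hZ, hω'] at hω

/-- The σ-algebra generated by all noise variables but one. -/
abbrev others (e : ℤ → Ω → ℝ) (t : ℤ) : MeasurableSpace Ω :=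
  ⨆ s ∈ ({t} : Set ℤ)ᶜ, MeasurableSpace.comap (e s) inferInstance

lemma others_le (he : ∀ t, Measurable (e t)) (t : ℤ) : others e t ≤ mΩ :=
  iSup₂_le fun s _ => (he s).comap_le

lemma measurable_others {s t : ℤ} (h : s ≠ t) : Measurable[others e t] (e s) := by
  have h1 : MeasurableSpace.comap (e s) inferInstance ≤ others e t :=
    le_iSup₂_of_le s h le_rfl
  exact Measurable.mono (comap_measurable (e s)) h1 le_rfl

lemma indep_others (he : ∀ t, Measurable (e t)) (hind : iIndepFun e μ) (t : ℤ) :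
    Indep (MeasurableSpace.comap (e t) inferInstance) (others e t) μ := by
  have h1 := indep_iSup_of_disjoint (fun i => (he i).comap_le) hind
    (S := {t}) (T := ({t} : Set ℤ)ᶜ) (by simp)
  simpa [others] using h1

lemma measurableSet_abs_le {m : MeasurableSpace Ω} {f : Ω → ℝ} (hf : Measurable[m] f) (r : ℝ) :
    MeasurableSet[m] {ω | |f ω| ≤ r} :=
  measurableSet_le (continuous_abs.measurable.comp hf) measurable_const

lemma measurable_zero_mul {m : MeasurableSpace Ω} (f : Ω → ℝ) :
    Measurable[m] (fun ω => 0 * f ω) := by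
  simp only [zero_mul]; exact measurable_const

/-- Small ball probabilities of a moving average, jointly at times spaced by `K`. -/
lemma measure_small_ball_filt_le (he : IsNoise μ σ e) (hmom : UniformMoments μ e) {w : ℕ → ℝ}
    (hw : Summable w) {m₀ K : ℕ} (hm₀ : m₀ < K) {c r : ℝ} (hc : 0 < c) (hwm : c ≤ |w m₀|)
    {ρ : ℝ≥0∞} (h : ∀ (t : ℤ) (u : ℝ), μ {ω | |e t ω + u| ≤ r / c} ≤ ρ) (t₀ : ℤ) (M : ℕ) :
    μ {ω | ∀ i < M, |filt w e (t₀ + i * K) ω| ≤ r} ≤ ρ ^ M := by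
  induction M with
  | zero => simp
  | succ M ih =>
    set t : ℤ := t₀ + M * K with ht
    -- As m₀ < K, time s₀ is later than all the earlier sampling times, so B does not involve
    -- e_{s₀}. The filter at time t also contains noise after s₀, and therefore one conditions on
    -- `others` and not on `past`.
    set s₀ : ℤ := t - m₀ with hs₀
    set B : Set Ω := {ω | ∀ i < M, |filt w e (t₀ + i * K) ω| ≤ r} with hB
    have hBm : MeasurableSet[others e s₀] B := by
      have : B = ⋂ i ∈ Finset.range M, {ω | |filt w e (t₀ + i * K) ω| ≤ r} := by
        ext ω; simp [hB]
      rw [this]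
      refine Finset.measurableSet_biInter _ fun i hi => ?_
      have hiM : i + 1 ≤ M := Finset.mem_range.1 hi
      have h1 : Measurable[others e s₀] (filt w e (t₀ + i * K)) := by
        refine measurable_tsum fun l => (measurable_others ?_).const_mul (w l)
        have : ((i : ℤ) + 1) * K ≤ M * K := by
          have : ((i : ℤ) + 1) ≤ M := by exact_mod_cast hiM
          exact mul_le_mul_of_nonneg_right this (by positivity)
        rw [hs₀, ht]
        have h3 : (i : ℤ) * K + K ≤ M * K := by linarith
        omega
      exact measurableSet_abs_le h1 r
    have hwm0 : w m₀ ≠ 0 := by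
      intro h0; rw [h0, abs_zero] at hwm; linarith
    set w' : ℕ → ℝ := Function.update w m₀ 0 with hw'
    set U : Ω → ℝ := fun ω => (w m₀)⁻¹ * filt w' e t ω with hU
    have hUm : Measurable[others e s₀] U := by
      refine Measurable.const_mul (measurable_tsum fun l => ?_) _
      by_cases hl : l = m₀
      · subst hl
        simp only [hw', Function.update_self]
        exact measurable_zero_mul _
      · refine (measurable_others ?_).const_mul _
        rw [hs₀]; omega
    obtain ⟨C, -, hC⟩ := exists_moment_noise he hmom 1
    have hsplit : ∀ᵐ ω ∂μ, filt w e t ω = w m₀ * (e s₀ ω + U ω) := by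
      filter_upwards [ae_summable_mul hC hw] with ω hω
      have h1 : filt w e t ω = w m₀ * e s₀ ω + filt w' e t ω := by
        rw [filt, lin, (hω t).tsum_eq_add_tsum_ite m₀, filt, lin]
        congr 1
        refine tsum_congr fun l => ?_
        by_cases hl : l = m₀ <;> simp [hw', hl]
      rw [h1, hU]; field_simp
    have hle : {ω | ∀ i < M + 1, |filt w e (t₀ + i * K) ω| ≤ r} ≤ᵐ[μ]
        (B ∩ {ω | |e s₀ ω + U ω| ≤ r / c} : Set Ω) := by
      filter_upwards [hsplit] with ω hω h1
      refine ⟨fun i hi => h1 i (by omega), ?_⟩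
      have h2 : |filt w e t ω| ≤ r := h1 M (by omega)
      rw [hω, abs_mul] at h2
      have h3 : c * |e s₀ ω + U ω| ≤ r := (mul_le_mul_of_nonneg_right hwm (abs_nonneg _)).trans h2
      change |e s₀ ω + U ω| ≤ r / c
      rw [le_div_iff₀ hc]; linarith
    refine (measure_mono_ae hle).trans ?_
    refine (measure_inter_small_ball_le (others_le he.measurable s₀) (he.measurable s₀)
      hUm hBm (indep_others he.measurable he.indep s₀) (h s₀)).trans ?_
    rw [pow_succ, mul_comm]
    exact mul_le_mul_left ih ρ

/-- Some early coefficient of a filtered vector is not small. -/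
lemma CausalModel.exists_coef_ge (M : CausalModel μ σ a b e x) (v : ℕ → ℝ) (i : ℕ) :
    ∃ m ≤ i, |v i| ≤ l1 (arCoef a) * |conv v b m| := by
  by_contra! hcon
  have hA := M.l1_ar_pos
  -- Undoing the filter: v_i is a combination of entries 0, …, i of v ∗ b with coefficients from A,
  -- so they cannot all be small.
  have h0 : v i = conv (conv v b) (arCoef a) i := by rw [M.conv_conv]
  obtain ⟨m₁, hm₁, hmax⟩ := Finset.exists_max_image (Finset.range (i + 1)) (fun m => |conv v b m|)
    ⟨0, by simp⟩
  have h1 : |v i| ≤ ∑ m ∈ Finset.range (i + 1), |conv v b m₁| * |arCoef a (i - m)| := by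
    rw [h0, conv, Finset.Nat.sum_antidiagonal_eq_sum_range_succ_mk]
    refine (Finset.abs_sum_le_sum_abs _ _).trans (Finset.sum_le_sum fun m hm => ?_)
    rw [abs_mul]
    exact mul_le_mul_of_nonneg_right (hmax _ hm) (abs_nonneg _)
  have h4 := Finset.sum_range_reflect (fun j => |arCoef a j|) (i + 1)
  simp only [Nat.add_sub_cancel] at h4
  rw [← Finset.mul_sum, h4] at h1
  have h2 : ∑ j ∈ Finset.range (i + 1), |arCoef a j| ≤ l1 (arCoef a) :=
    M.summable_ar.abs.sum_le_tsum _ fun _ _ => abs_nonneg _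
  have h3 := hcon m₁ (by simpa [Nat.lt_succ_iff] using hm₁)
  have h5 := mul_le_mul_of_nonneg_left h2 (abs_nonneg (conv v b m₁))
  linarith

end SmallBall

/-! ### Near collinearity of the regressors. -/

section InverseMoment

open scoped ENNReal

set_option linter.unusedSectionVars false

variable {Ω : Type*} [mΩ : MeasurableSpace Ω]
variable {μ : Measure Ω} [IsProbabilityMeasure μ] {a b : ℕ → ℝ} {σ : ℝ} {e x : ℤ → Ω → ℝ}

lemma mem_window {K n : ℕ} {j : ℤ} : j ∈ window K n ↔ (K : ℤ) ≤ j ∧ j < n := by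
  simp only [window, Finset.mem_map, Finset.mem_Ico, Nat.castEmbedding_apply]
  constructor
  · rintro ⟨i, ⟨h1, h2⟩, rfl⟩
    exact ⟨by exact_mod_cast h1, by exact_mod_cast h2⟩
  · rintro ⟨h1, h2⟩
    refine ⟨j.toNat, ⟨by omega, by omega⟩, by omega⟩

/-- The regressors are nearly collinear. -/
def NearlyCollinear (X : ℤ → ℝ) (K n : ℕ) (r : ℝ) : Prop :=
  ∃ v : Fin K → ℝ, (∀ i, |v i| ≤ 1) ∧ (∃ i, |v i| = 1) ∧ ∀ j ∈ window K n, |lagVec X j K ⬝ᵥ v| ≤ r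

/-- Discretization of near collinearity. -/
lemma NearlyCollinear.exists_grid {X : ℤ → ℝ} {K n L : ℕ} {r H : ℝ} (hL : 2 ≤ L)
    (hKL : K * H ≤ r * L) (hX : ∀ t : ℤ, 1 ≤ t → t ≤ n → |X t| ≤ H)
    (h : NearlyCollinear X K n r) :
    ∃ z ∈ Fintype.piFinset (fun _ : Fin K => Finset.Icc (-(L : ℤ)) L),
      (∃ i, 1 / 2 ≤ |(z i : ℝ) / L|) ∧
      ∀ j ∈ window K n, |lagVec X j K ⬝ᵥ (fun i => (z i : ℝ) / L)| ≤ 2 * r := by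
  obtain ⟨v, hv1, ⟨i₀, hi₀⟩, hv⟩ := h
  have hL0 : (0 : ℝ) < L := by positivity
  have hL2 : (2 : ℝ) ≤ L := by exact_mod_cast hL
  have hd : ∀ i, |(⌊L * v i⌋ : ℝ) / L - v i| ≤ 1 / L := by
    intro i
    have e1 : (⌊L * v i⌋ : ℝ) / L - v i = ((⌊L * v i⌋ : ℝ) - L * v i) / L := by field_simp
    rw [e1, abs_div, abs_of_pos hL0]
    refine div_le_div_of_nonneg_right ?_ hL0.le
    rw [abs_le]
    constructor <;> linarith [Int.floor_le (L * v i), Int.lt_floor_add_one (L * v i)]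
  refine ⟨fun i => ⌊L * v i⌋, ?_, ⟨i₀, ?_⟩, fun j hj => ?_⟩
  · rw [Fintype.mem_piFinset]
    intro i
    have h1 := abs_le.1 (hv1 i)
    rw [Finset.mem_Icc]
    constructor
    · rw [Int.le_floor]; push_cast; nlinarith [h1.1]
    · rw [← Int.cast_le (R := ℝ)]
      refine (Int.floor_le _).trans ?_
      push_cast; nlinarith [h1.2]
  · have h1 := hd i₀
    have h2 : |v i₀| - |(⌊L * v i₀⌋ : ℝ) / L| ≤ |(⌊L * v i₀⌋ : ℝ) / L - v i₀| := by
      rw [abs_sub_comm]; exact abs_sub_abs_le_abs_sub _ _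
    have h3 : 1 / (L : ℝ) ≤ 1 / 2 := one_div_le_one_div_of_le two_pos hL2
    rw [hi₀] at h2
    linarith
  · have h1 : lagVec X j K ⬝ᵥ (fun i => (⌊L * v i⌋ : ℝ) / L) =
        lagVec X j K ⬝ᵥ v + ∑ i, lagVec X j K i * ((⌊L * v i⌋ : ℝ) / L - v i) := by
      simp only [dotProduct, ← Finset.sum_add_distrib]
      exact Finset.sum_congr rfl fun i _ => by ring
    have h2 : |∑ i, lagVec X j K i * ((⌊L * v i⌋ : ℝ) / L - v i)| ≤ r := by
      refine (Finset.abs_sum_le_sum_abs _ _).trans ?_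
      have h3 : ∀ i ∈ Finset.univ, |lagVec X j K i * ((⌊L * v i⌋ : ℝ) / L - v i)| ≤ H * (1 / L) := by
        intro i _
        rw [mem_window] at hj
        have hi := i.2
        have h4 : |X (j - (i : ℕ))| ≤ H := hX _ (by omega) (by omega)
        rw [abs_mul]
        exact mul_le_mul h4 (hd i) (abs_nonneg _) ((abs_nonneg _).trans h4)
      refine (Finset.sum_le_sum h3).trans ?_
      rw [Finset.sum_const, Finset.card_univ, Fintype.card_fin, nsmul_eq_mul, ← mul_assoc,
        mul_one_div, div_le_iff₀ hL0]
      exact hKL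
    rw [h1]
    refine (abs_add_le _ _).trans ?_
    linarith [hv j hj]

/-- Without near collinearity the least squares coefficients are bounded. -/
lemma norm_ahat_le_of_not_collinear {X : ℤ → ℝ} {K n k J : ℕ} (hKn : K < n) (hk : k ≤ K)
    (hnJ : n ≤ J) (hJ : 2 ≤ J) (hX : ∀ t : ℤ, 1 ≤ t → t ≤ n → |X t| ≤ J)
    (h : ¬ NearlyCollinear X K n (1 / J)) (i : Fin k) : |ahat X K n k i| ≤ (J : ℝ) ^ 4 := by
  have hJ2 : (2 : ℝ) ≤ J := by exact_mod_cast hJ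
  have hJ0 : (0 : ℝ) < J := by positivity
  have hN : (0 : ℝ) < ((n - K : ℕ) : ℝ) := by
    have : 0 < n - K := by omega
    exact_mod_cast this
  -- The negation of near collinearity, applied to v scaled to sup norm 1 and padded with zeros to
  -- length K. The residual sum of squares is at most that of the zero vector, hence at most J⁴. So
  -- fitted values are at most J² + J ≤ 2J² in size, and the coefficients at most 2J³ ≤ J⁴.
  have key : ∀ v : Fin k → ℝ, v ≠ 0 → ∃ j ∈ window K n, ‖v‖ < J * |lagVec X j k ⬝ᵥ v| := by
    intro v hv
    have hv0 : 0 < ‖v‖ := norm_pos_iff.2 hv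
    by_contra! hcon
    refine h ⟨fun i : Fin K => ext (‖v‖⁻¹ • v) i, fun i => ?_, ?_, fun j hj => ?_⟩
    · change |ext (‖v‖⁻¹ • v) i| ≤ 1
      rw [ext_smul, Pi.smul_apply, smul_eq_mul, abs_mul, abs_of_pos (inv_pos.2 hv0),
        inv_mul_le_iff₀ hv0, mul_one, ext]
      split_ifs with hi
      · exact norm_le_pi_norm v ⟨i, hi⟩
      · simp [hv0.le]
    · obtain ⟨i₁, -, hi₁⟩ := Finset.exists_max_image (Finset.univ : Finset (Fin k)) (fun i => |v i|)
        ⟨i, Finset.mem_univ i⟩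
      have h1 : ‖v‖ = |v i₁| := le_antisymm
        ((pi_norm_le_iff_of_nonneg (abs_nonneg _)).2 fun i => hi₁ i (Finset.mem_univ i))
        (norm_le_pi_norm v i₁)
      refine ⟨⟨i₁, by omega⟩, ?_⟩
      change |ext (‖v‖⁻¹ • v) i₁| = 1
      rw [ext_smul, Pi.smul_apply, smul_eq_mul, abs_mul, abs_of_pos (inv_pos.2 hv0), ext_coe, ← h1,
        inv_mul_cancel₀ hv0.ne']
    · have h1 : ext (fun i : Fin K => ext (‖v‖⁻¹ • v) i) = ext (‖v‖⁻¹ • v) := by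
        funext i
        by_cases hi : i < K
        · simp [ext, hi]
        · rw [ext_of_ge _ (by omega), ext_of_ge _ (by omega)]
      rw [← lin_ext, h1, lin_ext, dotProduct_smul, smul_eq_mul, abs_mul, abs_of_pos (inv_pos.2 hv0),
        inv_mul_le_iff₀ hv0, mul_one_div, le_div_iff₀ hJ0]
      linarith [hcon j hj]
  have hdet : IsUnit (Rhat X K n k).det := by
    rw [← Matrix.isUnit_iff_isUnit_det, ← Matrix.mulVec_injective_iff_isUnit]
    intro v w hvw
    by_contra hne
    obtain ⟨j, hj, hlt⟩ := key (v - w) (sub_ne_zero.2 hne)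
    have h1 : Rhat X K n k *ᵥ (v - w) = 0 := by
      rw [Matrix.mulVec_sub]; exact sub_eq_zero.2 hvw
    have h2 := Rhat_bilinear X hKn (v - w) (v - w)
    rw [h1, dotProduct_zero, mul_zero] at h2
    have h3 := (Finset.sum_eq_zero_iff_of_nonneg (fun j _ => mul_self_nonneg _)).1 h2.symm j hj
    rw [mul_self_eq_zero.1 h3, abs_zero, mul_zero] at hlt
    exact absurd hlt (not_lt.2 (norm_nonneg _))
  have hls := (least_squares hKn hdet 0 (u := fun j => X (j + 1)) (by simp)).2
  set g := crossSum (fun j => X (j + 1)) X (window K n) k with hg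
  have h2 : 0 ≤ g ⬝ᵥ (Rhat X K n k)⁻¹ *ᵥ g := by
    set β := (Rhat X K n k)⁻¹ *ᵥ g with hβ
    have h3 : Rhat X K n k *ᵥ β = g := by
      rw [hβ, Matrix.mulVec_mulVec, Matrix.mul_nonsing_inv _ hdet, Matrix.one_mulVec]
    have h4 := Rhat_bilinear X hKn β β
    rw [h3, dotProduct_comm] at h4
    have h5 : 0 ≤ ∑ j ∈ window K n, (lagVec X j k ⬝ᵥ β) * (lagVec X j k ⬝ᵥ β) :=
      Finset.sum_nonneg fun _ _ => mul_self_nonneg _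
    rw [← h4] at h5
    exact nonneg_of_mul_nonneg_right h5 hN
  have hxw : ∀ j ∈ window K n, |X (j + 1)| ≤ J := by
    intro j hj
    rw [mem_window] at hj
    exact hX _ (by omega) (by omega)
  have hrss : ∑ j ∈ window K n, (X (j + 1) + lagVec X j k ⬝ᵥ ahat X K n k) ^ 2 ≤ (J : ℝ) ^ 4 := by
    rw [residVar_eq, mul_inv_cancel_left₀ hN.ne'] at hls
    rw [hls]
    have h3 : ∑ j ∈ window K n, X (j + 1) ^ 2 ≤ ((n - K : ℕ) : ℝ) * (J : ℝ) ^ 2 := by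
      rw [← card_window, ← nsmul_eq_mul]
      exact Finset.sum_le_card_nsmul _ _ _ fun j hj => sq_le_sq' (abs_le.1 (hxw j hj)).1 (abs_le.1 (hxw j hj)).2
    have h4 : ((n - K : ℕ) : ℝ) ≤ J := by
      have : n - K ≤ J := by omega
      exact_mod_cast this
    have h5 : ((n - K : ℕ) : ℝ) * (J : ℝ) ^ 2 ≤ J ^ 4 := by
      have : ((n - K : ℕ) : ℝ) * (J : ℝ) ^ 2 ≤ J * J ^ 2 := by gcongr
      nlinarith [pow_pos hJ0 3]
    have h6 : 0 ≤ ((n - K : ℕ) : ℝ)⁻¹ * (g ⬝ᵥ (Rhat X K n k)⁻¹ *ᵥ g) := by positivity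
    linarith
  by_cases h0 : ahat X K n k = 0
  · rw [h0]; simp
  obtain ⟨j, hj, hlt⟩ := key _ h0
  have h3 : (X (j + 1) + lagVec X j k ⬝ᵥ ahat X K n k) ^ 2 ≤ ((J : ℝ) ^ 2) ^ 2 := by
    rw [← pow_mul]
    exact (Finset.single_le_sum (f := fun j => (X (j + 1) + lagVec X j k ⬝ᵥ ahat X K n k) ^ 2)
      (fun _ _ => sq_nonneg _) hj).trans hrss
  have h4 := abs_le_of_sq_le_sq h3 (by positivity)
  have h5 : |lagVec X j k ⬝ᵥ ahat X K n k| ≤ 2 * (J : ℝ) ^ 2 := by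
    have h6 := abs_le.1 (hxw j hj)
    rw [abs_le] at h4 ⊢
    constructor <;> nlinarith [h6.1, h6.2, h4.1, h4.2]
  calc |ahat X K n k i| ≤ ‖ahat X K n k‖ := norm_le_pi_norm (ahat X K n k) i
    _ ≤ J * (2 * (J : ℝ) ^ 2) := hlt.le.trans (mul_le_mul_of_nonneg_left h5 hJ0.le)
    _ ≤ (J : ℝ) ^ 4 := by nlinarith [pow_pos hJ0 3]

/-- Near collinearity and large observations are improbable. -/
theorem CausalModel.exists_collinear_bound (M : CausalModel μ σ a b e x)
    (hF : UniformHolderCDF μ e) (q : ℕ) :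
    ∃ (C : ℝ) (A J₀ : ℕ), 0 ≤ C ∧ 3 ≤ J₀ ∧ ∀ K n J : ℕ, 1 ≤ K → K < n → n ≤ J → J₀ ≤ J →
      A * (K + 1) * K ≤ n - K →
      μ {ω | NearlyCollinear (fun t => x t ω) K n (1 / J) ∨
        ∃ t : ℤ, 1 ≤ t ∧ t ≤ n ∧ (J : ℝ) < |x t ω|} ≤ ENNReal.ofReal (C / (J : ℝ) ^ q) := by
  obtain ⟨α, C₁, r₀, hα, hC₁, hr₀, hball⟩ := hF.exists_small_ball M.noise.measurable
  obtain ⟨Cx, hCx0, hCx⟩ := M.exists_moment (q + 1) (by omega)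
  set l := l1 (arCoef a) with hl
  have hl0 : 0 < l := M.l1_ar_pos
  -- With τ = C₁ y^α and y of order 1/J, αs ≥ 2 gives τ^s = O(J⁻²) ≤ J⁻¹, one power of J paying for
  -- constants. A = s(4 + q) provides at least s(4 + q)(K + 1) times spaced by K, so a single grid
  -- vector has probability at most J^(−(4+q)(K+1)), against at most J^(4K) grid vectors.
  obtain ⟨s, hs⟩ := exists_nat_ge (2 / α)
  have hsα : 2 ≤ α * s := by rwa [div_le_iff₀ hα, mul_comm] at hs
  obtain ⟨J₁, hJ₁⟩ := exists_nat_ge (max (4 * l / r₀) (max (4 * l) (C₁ ^ s * (4 * l) ^ 2)))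
  refine ⟨1 + Cx ^ (q + 1), s * (4 + q), max 3 J₁, by positivity, le_max_left _ _,
    fun K n J hK1 hKn hnJ hJ hA => ?_⟩
  have hJ3 : 3 ≤ J := (le_max_left _ _).trans hJ
  have hJ3' : (3 : ℝ) ≤ J := by exact_mod_cast hJ3
  have hJ0 : (0 : ℝ) < J := by linarith
  have hJJ : (J₁ : ℝ) ≤ J := by exact_mod_cast (le_max_right _ _).trans hJ
  have hb1 : 4 * l / r₀ ≤ J := ((le_max_left _ _).trans hJ₁).trans hJJ
  have hb2 : 4 * l ≤ J := (((le_max_left _ _).trans (le_max_right _ _)).trans hJ₁).trans hJJ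
  have hb3 : C₁ ^ s * (4 * l) ^ 2 ≤ J :=
    (((le_max_right _ _).trans (le_max_right _ _)).trans hJ₁).trans hJJ
  set y : ℝ := 4 * l / J with hy
  have hy0 : 0 < y := by positivity
  have hy1 : y ≤ 1 := by rw [hy, div_le_one hJ0]; exact hb2
  have hyr : y ≤ r₀ := by rw [hy, div_le_iff₀ hJ0]; rw [div_le_iff₀ hr₀] at hb1; linarith
  set τ : ℝ := C₁ * y ^ α with hτ
  have hτ0 : 0 < τ := by positivity
  have hτs : τ ^ s ≤ (J : ℝ)⁻¹ := by
    have h1 : (y ^ α) ^ s ≤ y ^ 2 := by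
      rw [← Real.rpow_mul_natCast hy0.le, ← Real.rpow_natCast y 2]
      exact Real.rpow_le_rpow_of_exponent_ge hy0 hy1 (by exact_mod_cast hsα)
    rw [hτ, mul_pow]
    calc C₁ ^ s * (y ^ α) ^ s ≤ C₁ ^ s * y ^ 2 := mul_le_mul_of_nonneg_left h1 (by positivity)
      _ = (C₁ ^ s * (4 * l) ^ 2) / J ^ 2 := by rw [hy]; ring
      _ ≤ J / J ^ 2 := by gcongr
      _ = (J : ℝ)⁻¹ := by field_simp
  have hs0 : s ≠ 0 := by rintro rfl; simp at hsα; linarith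
  have hτ1 : τ ≤ 1 := by
    have h1 : τ ^ s ≤ 1 := hτs.trans (inv_le_one_of_one_le₀ (by linarith))
    exact (pow_le_one_iff_of_nonneg hτ0.le hs0).1 h1
  -- Mesh 1/L: for observations bounded by J the rounding error of the inner product is at most K ·
  -- J/L = 1/J.
  set L : ℕ := K * J ^ 2 with hL
  have hKJ : K ≤ J := by omega
  have hL2 : 2 ≤ L := by
    have : 1 * 3 ^ 2 ≤ K * J ^ 2 := Nat.mul_le_mul hK1 (Nat.pow_le_pow_left hJ3 2)
    omega
  set T := (n - K) / K with hT
  have hTA : s * (4 + q) * (K + 1) ≤ T := (Nat.le_div_iff_mul_le (by omega)).2 hA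
  -- a single grid point
  have hpt : ∀ z : Fin K → ℤ, (∃ i, 1 / 2 ≤ |(z i : ℝ) / L|) →
      μ {ω | ∀ j ∈ window K n, |lagVec (fun t => x t ω) j K ⬝ᵥ (fun i => (z i : ℝ) / L)| ≤ 2 * (1 / J)}
        ≤ ENNReal.ofReal (τ ^ T) := by
    rintro z ⟨i, hi⟩
    set v : Fin K → ℝ := fun i => (z i : ℝ) / L with hv
    obtain ⟨m₀, hm₀, hm⟩ := M.exists_coef_ge (ext v) i
    rw [ext_coe, ← hl] at hm
    set c : ℝ := 1 / (2 * l) with hc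
    have hcm : c ≤ |conv (ext v) b m₀| := by
      rw [hc, div_le_iff₀ (by positivity)]
      have : (1 : ℝ) / 2 ≤ l * |conv (ext v) b m₀| := hi.trans hm
      linarith
    have hrc : 2 * (1 / (J : ℝ)) / c = y := by rw [hc, hy]; field_simp; ring
    have h1 := measure_small_ball_filt_le M.noise M.moments
      (summable_conv (summable_ext v) M.summable_ma) (m₀ := m₀) (K := K) (by omega)
      (by positivity : 0 < c) hcm (r := 2 * (1 / J)) (ρ := ENNReal.ofReal τ)
      (fun t u => by rw [hrc]; exact hball t u y hy0 hyr) K T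
    rw [ENNReal.ofReal_pow hτ0.le]
    refine le_trans (measure_mono_ae ?_) h1
    filter_upwards [M.ae_lin (summable_ext v)] with ω hω h2 i hi
    have h3 := h2 (K + i * K) (by
      rw [mem_window]
      have h4 : i * K + K ≤ T * K := by
        calc i * K + K = (i + 1) * K := by ring
          _ ≤ T * K := Nat.mul_le_mul_right _ hi
      have h5 : T * K ≤ n - K := Nat.div_mul_le_self _ _
      have h6 : (i : ℤ) * K = ((i * K : ℕ) : ℤ) := by push_cast; ring
      rw [h6]
      omega)
    rw [← lin_ext, (hω _).2] at h3
    exact h3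
  -- the union over the grid
  set G := (Fintype.piFinset (fun _ : Fin K => Finset.Icc (-(L : ℤ)) L)).filter
    fun z => ∃ i, 1 / 2 ≤ |(z i : ℝ) / L| with hG
  have hGcard : (G.card : ℝ) ≤ ((J : ℝ) ^ 4) ^ K := by
    have h1 : G.card ≤ (2 * L + 1) ^ K := by
      refine (Finset.card_filter_le _ _).trans (le_of_eq ?_)
      rw [Fintype.card_piFinset]
      simp only [Int.card_Icc, Finset.prod_const, Finset.card_univ, Fintype.card_fin]
      congr 1; omega
    have h2 : 2 * L + 1 ≤ J ^ 4 := by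
      have h3 : L ≤ J ^ 3 := by
        calc L = K * J ^ 2 := rfl
          _ ≤ J * J ^ 2 := Nat.mul_le_mul_right _ hKJ
          _ = J ^ 3 := by ring
      have h4 : 3 * J ^ 3 ≤ J ^ 4 := by
        calc 3 * J ^ 3 ≤ J * J ^ 3 := Nat.mul_le_mul_right _ hJ3
          _ = J ^ 4 := by ring
      have h5 : 1 ≤ J ^ 3 := Nat.one_le_pow _ _ (by omega)
      omega
    have h3 : G.card ≤ (J ^ 4) ^ K := h1.trans (Nat.pow_le_pow_left h2 K)
    exact_mod_cast h3
  have hsub : {ω | NearlyCollinear (fun t => x t ω) K n (1 / J) ∨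
      ∃ t : ℤ, 1 ≤ t ∧ t ≤ n ∧ (J : ℝ) < |x t ω|} ⊆
      (⋃ z ∈ G, {ω | ∀ j ∈ window K n,
        |lagVec (fun t => x t ω) j K ⬝ᵥ (fun i => (z i : ℝ) / L)| ≤ 2 * (1 / J)}) ∪
      ⋃ t ∈ Finset.Icc (1 : ℤ) n, {ω | (J : ℝ) ≤ |x t ω|} := by
    intro ω hω
    by_cases hlarge : ∃ t : ℤ, 1 ≤ t ∧ t ≤ n ∧ (J : ℝ) < |x t ω|
    · obtain ⟨t, h1, h2, h3⟩ := hlarge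
      right
      simp only [Set.mem_iUnion]
      exact ⟨t, Finset.mem_Icc.2 ⟨h1, h2⟩, h3.le⟩
    · left
      have hcol := hω.resolve_right hlarge
      push Not at hlarge
      obtain ⟨z, hz, hz1, hz2⟩ := hcol.exists_grid (L := L) (H := J) hL2
        (by rw [hL]; push_cast; field_simp; exact le_rfl) hlarge
      simp only [Set.mem_iUnion]
      exact ⟨z, Finset.mem_filter.2 ⟨hz, hz1⟩, hz2⟩
  have hA1 : μ (⋃ z ∈ G, {ω | ∀ j ∈ window K n,
      |lagVec (fun t => x t ω) j K ⬝ᵥ (fun i => (z i : ℝ) / L)| ≤ 2 * (1 / J)}) ≤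
      ENNReal.ofReal (1 / (J : ℝ) ^ q) := by
    refine (measure_biUnion_finset_le _ _).trans ?_
    refine (Finset.sum_le_sum fun z hz => hpt z (Finset.mem_filter.1 hz).2).trans ?_
    rw [Finset.sum_const, nsmul_eq_mul, ← ENNReal.ofReal_natCast, ← ENNReal.ofReal_mul (by positivity)]
    refine ENNReal.ofReal_le_ofReal ?_
    have h1 : τ ^ T ≤ ((J : ℝ)⁻¹) ^ ((4 + q) * (K + 1)) := by
      calc τ ^ T ≤ τ ^ (s * ((4 + q) * (K + 1))) :=
            pow_le_pow_of_le_one hτ0.le hτ1 (by rw [← mul_assoc]; exact hTA)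
        _ = (τ ^ s) ^ ((4 + q) * (K + 1)) := by rw [pow_mul]
        _ ≤ _ := pow_le_pow_left₀ (by positivity) hτs _
    have h2 : ((J : ℝ)⁻¹) ^ ((4 + q) * (K + 1)) ≤ ((J : ℝ)⁻¹) ^ (4 * K + q) :=
      pow_le_pow_of_le_one (by positivity) (inv_le_one_of_one_le₀ (by linarith)) (by nlinarith)
    calc (G.card : ℝ) * τ ^ T ≤ ((J : ℝ) ^ 4) ^ K * ((J : ℝ)⁻¹) ^ (4 * K + q) :=
          mul_le_mul hGcard (h1.trans h2) (by positivity) (by positivity)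
      _ = 1 / (J : ℝ) ^ q := by rw [pow_add, inv_pow, inv_pow, ← pow_mul]; field_simp
  have hA2 : μ (⋃ t ∈ Finset.Icc (1 : ℤ) n, {ω | (J : ℝ) ≤ |x t ω|}) ≤
      ENNReal.ofReal (Cx ^ (q + 1) / (J : ℝ) ^ q) := by
    refine (measure_biUnion_finset_le _ _).trans ?_
    refine (Finset.sum_le_sum fun t _ => (hCx t).measure_ge_le (by omega) hCx0 hJ0).trans ?_
    rw [Finset.sum_const, nsmul_eq_mul, ← ENNReal.ofReal_natCast, ← ENNReal.ofReal_mul (by positivity)]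
    refine ENNReal.ofReal_le_ofReal ?_
    have h1 : ((Finset.Icc (1 : ℤ) n).card : ℝ) ≤ J := by
      have : (Finset.Icc (1 : ℤ) n).card ≤ J := by simp; omega
      exact_mod_cast this
    calc ((Finset.Icc (1 : ℤ) n).card : ℝ) * (Cx / J) ^ (q + 1) ≤ J * (Cx / J) ^ (q + 1) := by gcongr
      _ = Cx ^ (q + 1) / (J : ℝ) ^ q := by rw [div_pow]; field_simp; ring
  refine (measure_mono hsub).trans ((measure_union_le _ _).trans ((add_le_add hA1 hA2).trans ?_))
  rw [← ENNReal.ofReal_add (by positivity) (by positivity), add_div]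

end InverseMoment

/-! ### Measurability of the least squares coefficients. -/

section Measurability

variable {α : Type*} [MeasurableSpace α] {k : ℕ}

lemma measurable_det {A : α → Matrix (Fin k) (Fin k) ℝ} (hA : ∀ i j, Measurable fun p => A p i j) :
    Measurable fun p => (A p).det := by
  simp only [Matrix.det_apply']
  exact Finset.measurable_sum _ fun s _ => (Finset.measurable_prod _ fun i _ => hA _ _).const_mul _

/-- Cramer's rule; singular matrices need no separate treatment, because their inverse is 0 by the
same convention as 0⁻¹ = 0. -/
lemma measurable_matrix_inv {A : α → Matrix (Fin k) (Fin k) ℝ}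
    (hA : ∀ i j, Measurable fun p => A p i j) (i j : Fin k) : Measurable fun p => (A p)⁻¹ i j := by
  simp only [Matrix.inv_def, Matrix.smul_apply, smul_eq_mul, Ring.inverse_eq_inv',
    Matrix.adjugate_apply]
  refine (measurable_det hA).inv.mul (measurable_det fun r s => ?_)
  simp only [Matrix.updateRow_apply]
  split_ifs
  · exact measurable_const
  · exact hA _ _

lemma measurable_dotProduct {v w : α → Fin k → ℝ} (hv : ∀ i, Measurable fun p => v p i)
    (hw : ∀ i, Measurable fun p => w p i) : Measurable fun p => v p ⬝ᵥ w p :=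
  Finset.measurable_sum _ fun i _ => (hv i).mul (hw i)

lemma measurable_ahat {X : α → ℤ → ℝ} (hX : ∀ t, Measurable fun p => X p t) (K n k : ℕ) (i : Fin k) :
    Measurable fun p => ahat (X p) K n k i := by
  simp only [ahat_eq, Pi.neg_apply]
  refine (measurable_dotProduct (fun j => measurable_matrix_inv (fun r s => ?_) i j) fun j => ?_).neg
  · simp only [Rhat_apply]
    exact (Finset.measurable_sum _ fun j _ => (hX _).mul (hX _)).const_mul _
  · exact (Finset.measurable_sum _ fun j _ => (hX _).mul (hX _)).const_mul _

end Measurability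

/-! ### Polynomial moments of the prediction error. -/

section InverseMoment

open scoped ENNReal

set_option linter.unusedSectionVars false

variable {Ω : Type*} [mΩ : MeasurableSpace Ω]
variable {μ : Measure Ω} [IsProbabilityMeasure μ] {a b : ℕ → ℝ} {σ : ℝ} {e x : ℤ → Ω → ℝ}

/-- Moment bounds from polynomial tails. -/
lemma MomentLE.exists_of_tail {p : ℕ} (hp : 1 ≤ p) {C : ℝ} (hC : 0 ≤ C) :
    ∃ D, 0 ≤ D ∧ ∀ (f : Ω → ℝ) (n : ℕ), Measurable f → 1 ≤ n →
      (∀ J : ℕ, n ≤ J → μ {ω | (J : ℝ) ^ 4 < |f ω|} ≤ ENNReal.ofReal (C / (J : ℝ) ^ (4 * p + 2))) →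
      MomentLE μ p f (D * (n : ℝ) ^ 4) := by
  set u : ℕ → ℝ := fun J => 2 ^ (4 * p) * C * (1 / (J : ℝ) ^ 2) with hu
  have hu0 : ∀ J, 0 ≤ u J := fun J => by positivity
  have hus : Summable u := (Real.summable_one_div_nat_pow.2 one_lt_two).mul_left _
  set S := ∑' J, u J with hS
  have hS0 : 0 ≤ S := tsum_nonneg hu0
  refine ⟨1 + S, by positivity, fun f n hf hn htail => ?_⟩
  have hn' : (1 : ℝ) ≤ n := by exact_mod_cast hn
  have hfa : Measurable fun ω => |f ω| := continuous_abs.measurable.comp hf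
  -- Layers by fourth powers: where |f| > n⁴, the layer J⁴ < |f| ≤ (J + 1)⁴ contributes at most (J +
  -- 1)^(4p), and a tail of order J^(−4p−2) leaves the summable J⁻².
  set F : ℕ → Ω → ℝ≥0∞ := fun J => if n ≤ J then
    Set.indicator {ω | (J : ℝ) ^ 4 < |f ω|} (fun _ => ENNReal.ofReal (((J : ℝ) + 1) ^ (4 * p))) else 0
    with hF
  have hms : ∀ J : ℕ, MeasurableSet {ω | (J : ℝ) ^ 4 < |f ω|} := fun J =>
    measurableSet_lt measurable_const hfa
  have hFm : ∀ J, Measurable (F J) := by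
    intro J
    simp only [hF]
    split_ifs
    · exact measurable_const.indicator (hms J)
    · exact measurable_zero
  have hFint : ∀ J, ∫⁻ ω, F J ω ∂μ ≤ ENNReal.ofReal (u J) := by
    intro J
    by_cases hJ : n ≤ J
    · have hJ' : (1 : ℝ) ≤ J := hn'.trans (by exact_mod_cast hJ)
      simp only [hF, if_pos hJ]
      rw [lintegral_indicator_const (hms J)]
      refine (mul_le_mul_right (htail J hJ) _).trans ?_
      rw [← ENNReal.ofReal_mul (by positivity)]
      refine ENNReal.ofReal_le_ofReal ?_
      calc ((J : ℝ) + 1) ^ (4 * p) * (C / (J : ℝ) ^ (4 * p + 2))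
          ≤ (2 * (J : ℝ)) ^ (4 * p) * (C / (J : ℝ) ^ (4 * p + 2)) := by
            gcongr; linarith
        _ = u J := by rw [hu, mul_pow, pow_add]; field_simp
    · simp [hF, if_neg hJ]
  have hpt : ∀ ω, ENNReal.ofReal (|f ω| ^ p) ≤ ENNReal.ofReal ((n : ℝ) ^ (4 * p)) + ∑' J, F J ω := by
    intro ω
    by_cases hω : |f ω| ≤ (n : ℝ) ^ 4
    · refine le_add_of_le_of_nonneg (ENNReal.ofReal_le_ofReal ?_) zero_le
      rw [pow_mul]
      exact pow_le_pow_left₀ (abs_nonneg _) hω p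
    · have hex : ∃ m : ℕ, |f ω| ≤ (m : ℝ) ^ 4 := by
        obtain ⟨m, hm⟩ := exists_nat_ge |f ω|
        refine ⟨m, hm.trans ?_⟩
        exact_mod_cast Nat.le_self_pow (by norm_num) m
      classical
      set m := Nat.find hex with hm
      have hm1 : |f ω| ≤ (m : ℝ) ^ 4 := Nat.find_spec hex
      have hnm : n < m := by
        by_contra! hle
        refine hω (hm1.trans ?_)
        have : (m : ℝ) ≤ n := by exact_mod_cast hle
        gcongr
      obtain ⟨J, hJ⟩ : ∃ J, m = J + 1 := ⟨m - 1, by omega⟩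
      have hJ2 : (J : ℝ) ^ 4 < |f ω| := by
        have := Nat.find_min hex (m := J) (by omega)
        exact not_le.1 this
      refine le_trans ?_ (le_add_of_nonneg_left zero_le)
      refine le_trans ?_ (ENNReal.le_tsum J)
      simp only [hF, if_pos (show n ≤ J by omega)]
      rw [Set.indicator_of_mem (by exact hJ2)]
      refine ENNReal.ofReal_le_ofReal ?_
      rw [pow_mul]
      rw [hJ] at hm1
      push_cast at hm1
      exact pow_le_pow_left₀ (abs_nonneg _) hm1 p
  have hlint : ∫⁻ ω, ENNReal.ofReal (|f ω| ^ p) ∂μ ≤ ENNReal.ofReal ((n : ℝ) ^ (4 * p) + S) := by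
    refine (lintegral_mono hpt).trans ?_
    rw [lintegral_add_left measurable_const, lintegral_const, measure_univ, mul_one,
      lintegral_tsum fun J => (hFm J).aemeasurable, ENNReal.ofReal_add (by positivity) hS0]
    refine add_le_add le_rfl ?_
    rw [hS, ENNReal.ofReal_tsum_of_nonneg hu0 hus]
    exact ENNReal.tsum_le_tsum hFint
  have hint : Integrable (fun ω => |f ω| ^ p) μ := by
    refine ⟨(hfa.pow_const p).aestronglyMeasurable, ?_⟩
    rw [hasFiniteIntegral_iff_ofReal (Eventually.of_forall fun ω => by positivity)]
    exact hlint.trans_lt ENNReal.ofReal_lt_top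
  refine MomentLE.of_integral_pow hp (by positivity) hf.aestronglyMeasurable hint ?_
  rw [← ofReal_integral_eq_lintegral_ofReal hint (Eventually.of_forall fun ω => by positivity),
    ENNReal.ofReal_le_ofReal_iff (by positivity)] at hlint
  refine hlint.trans ?_
  rw [mul_pow, ← pow_mul]
  have h1 : 1 + S ≤ (1 + S) ^ p := le_self_pow₀ (by linarith) (by omega)
  have h2 : (1 : ℝ) ≤ (n : ℝ) ^ (4 * p) := one_le_pow₀ hn'
  nlinarith

namespace CausalModel

lemma measurable_predErr (M : CausalModel μ σ a b e x) {α : Type*} [MeasurableSpace α] {k : ℕ}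
    {c : α → Fin k → ℝ} (hc : ∀ i, Measurable fun p => c p i) :
    Measurable fun p => predErr μ x k (c p) := by
  simp only [M.predErr_decomp]
  have hd : ∀ i, Measurable fun p => (c p - bestCoef μ x k) i := fun i => (hc i).sub_const _
  refine (measurable_dotProduct hd fun i => ?_).const_add _
  exact measurable_dotProduct (v := fun _ => covMat σ b k i) (fun _ => measurable_const) hd

lemma predErr_nonneg (k : ℕ) (c : Fin k → ℝ) : 0 ≤ predErr μ x k c :=
  integral_nonneg fun _ => sq_nonneg _

lemma exists_predErr_le (M : CausalModel μ σ a b e x) :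
    ∃ C, 0 ≤ C ∧ ∀ (k : ℕ) (c : Fin k → ℝ), predErr μ x k c ≤ C * (1 + c ⬝ᵥ c) := by
  have hs := M.sigma_pos
  set t : ℕ → ℝ := fun i => a (i + 1) with ht
  have hts : Summable t := M.summable_tail
  have hU : 0 ≤ eigUp σ b := by rw [eigUp]; positivity
  refine ⟨σ ^ 2 + eigUp σ b * (2 * l2 t ^ 2 + 2), by positivity, fun k c => ?_⟩
  rw [M.predErr_eq]
  have h1 : l2 (t - ext c) ^ 2 ≤ 2 * l2 t ^ 2 + 2 * (c ⬝ᵥ c) := by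
    rw [← l2_ext_sq, l2_sq, l2_sq, l2_sq, ← tsum_mul_left, ← tsum_mul_left,
      ← ((summable_sq hts).mul_left 2).tsum_add ((summable_sq (summable_ext c)).mul_left 2)]
    refine (summable_sq (hts.sub (summable_ext c))).tsum_le_tsum (fun i => ?_)
      (((summable_sq hts).mul_left 2).add ((summable_sq (summable_ext c)).mul_left 2))
    simp only [Pi.sub_apply]
    nlinarith [sq_nonneg (t i + ext c i)]
  have h2 := M.le_eigUp_mul (hts.sub (summable_ext c))
  have h3 := dotProduct_self_nonneg' c
  have h4 := mul_le_mul_of_nonneg_left h1 hU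
  have h5 : 0 ≤ l2 t ^ 2 := sq_nonneg _
  have h6 : 0 ≤ eigUp σ b * (l2 t ^ 2 * (c ⬝ᵥ c)) := by positivity
  have h7 : 0 ≤ σ ^ 2 * (c ⬝ᵥ c) := by positivity
  have h8 : σ ^ 2 * l2 (conv (t - ext c) b) ^ 2 ≤ eigUp σ b * (2 * l2 t ^ 2 + 2 * (c ⬝ᵥ c)) :=
    h2.trans h4
  nlinarith

/-- Crude moment bound for the prediction error of the least squares predictors. -/
theorem exists_predErr_moment (M : CausalModel μ σ a b e x) (hF : UniformHolderCDF μ e) :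
    ∃ (C : ℝ) (A n₀ : ℕ), 0 ≤ C ∧ ∀ K n : ℕ, 1 ≤ K → K < n → n₀ ≤ n → A * (K + 1) * K ≤ n - K →
      ∀ k ≤ K, MomentLE μ 2 (fun ω => predErr μ x k (ahat (fun t => x t ω) K n k))
        (C * (n : ℝ) ^ 9) := by
  -- The exponent is 4p + 2 with p = 4: fourth moments of the coefficients give second moments of
  -- their squares, of size n⁸, and a sum over k ≤ n of them makes n⁹.
  obtain ⟨C, A, J₀, hC0, hJ₀, hC⟩ := M.exists_collinear_bound hF (4 * 4 + 2)
  obtain ⟨D, hD0, hD⟩ := MomentLE.exists_of_tail (μ := μ) (p := 4) (by norm_num) hC0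
  obtain ⟨B, hB0, hB⟩ := M.exists_predErr_le
  refine ⟨B * (1 + D ^ 2), A, J₀, by positivity, fun K n hK1 hKn hn hA k hk => ?_⟩
  have hn1 : (1 : ℝ) ≤ n := by
    have : 1 ≤ n := by omega
    exact_mod_cast this
  have hmeas : ∀ i : Fin k, Measurable fun ω => ahat (fun t => x t ω) K n k i := fun i =>
    measurable_ahat (fun t => M.measurable t) K n k i
  have hah : ∀ i : Fin k, MomentLE μ (2 * 2) (fun ω => ahat (fun t => x t ω) K n k i)
      (D * (n : ℝ) ^ 4) := by
    intro i
    refine hD _ n (hmeas i) (by omega) fun J hJ => ?_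
    refine le_trans (measure_mono ?_) (hC K n J hK1 hKn hJ (hn.trans hJ) hA)
    intro ω hω
    by_contra hcon
    simp only [Set.mem_ofPred_eq, not_or, not_exists, not_and, not_lt] at hcon
    have h1 := norm_ahat_le_of_not_collinear (X := fun t => x t ω) hKn hk hJ (by omega)
      (fun t h1 h2 => hcon.2 t h1 h2) hcon.1 i
    exact absurd hω (not_lt.2 h1)
  have h1 := moment_sum_sq (S := fun ω => ahat (fun t => x t ω) K n k) (by norm_num)
    (by positivity) hah
  have h2 := ((MomentLE.const (μ := μ) (q := 2) (by norm_num) 1).add (by norm_num)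
    (by simp) (by positivity) h1).const_mul B
  refine (h2.of_le (M.measurable_predErr hmeas).aestronglyMeasurable (Eventually.of_forall fun ω => ?_)).mono ?_
  · rw [abs_of_nonneg (predErr_nonneg _ _)]
    exact (hB k _).trans (le_abs_self _)
  · rw [abs_of_nonneg hB0, abs_one, mul_assoc B]
    refine mul_le_mul_of_nonneg_left ?_ hB0
    have hkn : (k : ℝ) ≤ n := by
      have : k ≤ n := by omega
      exact_mod_cast this
    have h3 : (1 : ℝ) ≤ (n : ℝ) ^ 9 := one_le_pow₀ hn1
    calc 1 + (k : ℝ) * (D * (n : ℝ) ^ 4 * (D * (n : ℝ) ^ 4))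
        ≤ (n : ℝ) ^ 9 + n * (D * (n : ℝ) ^ 4 * (D * (n : ℝ) ^ 4)) := by gcongr
      _ = _ := by ring

end CausalModel

end InverseMoment

/-! ### Consequences of the growth condition on the maximal order. -/

section Growth

lemma OrderGrowth.tendsto {K : ℕ → ℕ} (hK : OrderGrowth K) : Tendsto K atTop atTop := by
  obtain ⟨δ, Cl, Cu, hδ, hCl, hCu, h⟩ := hK
  have h1 : Tendsto (fun n : ℕ => (K n : ℝ) ^ (2 + δ)) atTop atTop := by
    refine tendsto_atTop_mono' atTop (f₁ := fun n : ℕ => Cl * (n : ℝ)) ?_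
      (tendsto_natCast_atTop_atTop.const_mul_atTop hCl)
    filter_upwards [h, eventually_gt_atTop 0] with n hn hn0
    have hn0' : (0 : ℝ) < n := by exact_mod_cast hn0
    exact (le_div_iff₀ hn0').1 hn.1
  rw [tendsto_atTop]
  intro B
  filter_upwards [tendsto_atTop.1 h1 ((B : ℝ) ^ (2 + δ))] with n hn
  have := (Real.rpow_le_rpow_iff (Nat.cast_nonneg B) (Nat.cast_nonneg (K n)) (by linarith : 0 < 2 + δ)).1 hn
  exact_mod_cast this

/-- A rate at which empirical covariances are controlled uniformly. -/
lemma OrderGrowth.exists_rate {K : ℕ → ℕ} (hK : OrderGrowth K) :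
    ∃ (ε : ℕ → ℝ) (q₀ : ℕ), (∀ᶠ n in atTop, 0 < ε n) ∧ Tendsto ε atTop (𝓝 0) ∧
      (∀ᶠ n in atTop, n * ε n ^ q₀ ≤ 1) ∧
      ∀ᶠ n in atTop, (K n : ℝ) + 1 ≤ ε n ^ 2 * √((n - K n : ℕ) : ℝ) := by
  have hKt := hK.tendsto
  obtain ⟨δ, Cl, Cu, hδ, hCl, hCu, h⟩ := hK
  -- K_n is of order n^τ with 2τ < 1. With ε = n^(−θ) the requirement is essentially K² n^(4θ) ≤ N,
  -- and θ = (1 − 2τ)/8 spends half of the available exponent; the remaining n^((1−2τ)/2) beats the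
  -- constant B.
  set τ : ℝ := 1 / (2 + δ) with hτ
  have hτ0 : 0 < τ := by positivity
  have hτ1 : 2 * τ < 1 := by
    rw [hτ, mul_one_div, div_lt_one (by linarith)]; linarith
  set θ : ℝ := (1 - 2 * τ) / 8 with hθ
  have hθ0 : 0 < θ := by rw [hθ]; linarith
  set B : ℝ := 4 * Cu ^ (2 * τ) + Cu ^ τ with hB
  obtain ⟨q₀, hq₀⟩ := exists_nat_ge (1 / θ)
  have hq₀' : 1 ≤ θ * q₀ := by rwa [div_le_iff₀ hθ0, mul_comm] at hq₀
  refine ⟨fun n => (n : ℝ) ^ (-θ), q₀, ?_, ?_, ?_, ?_⟩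
  · filter_upwards [eventually_gt_atTop 0] with n hn
    have : (0 : ℝ) < n := by exact_mod_cast hn
    positivity
  · exact (tendsto_rpow_neg_atTop hθ0).comp tendsto_natCast_atTop_atTop
  · filter_upwards [eventually_gt_atTop 0] with n hn
    have hn1 : (1 : ℝ) ≤ n := by exact_mod_cast hn
    have hn0 : (0 : ℝ) < n := by linarith
    rw [← Real.rpow_mul_natCast hn0.le]
    have h1 : (n : ℝ) ^ (-θ * q₀) ≤ (n : ℝ) ^ (-1 : ℝ) :=
      Real.rpow_le_rpow_of_exponent_le hn1 (by linarith)
    calc (n : ℝ) * (n : ℝ) ^ (-θ * q₀) ≤ n * (n : ℝ) ^ (-1 : ℝ) :=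
          mul_le_mul_of_nonneg_left h1 hn0.le
      _ = 1 := by rw [Real.rpow_neg_one, mul_inv_cancel₀ hn0.ne']
  · have hbig : ∀ᶠ n : ℕ in atTop, B ≤ (n : ℝ) ^ ((1 - 2 * τ) / 2) :=
      ((tendsto_rpow_atTop (by linarith : 0 < (1 - 2 * τ) / 2)).comp
        tendsto_natCast_atTop_atTop).eventually_ge_atTop B
    filter_upwards [h, hbig, hKt.eventually_ge_atTop 1, eventually_gt_atTop 0] with n hn hnB hK1 hn0
    have hn1 : (1 : ℝ) ≤ n := by exact_mod_cast hn0
    have hn0 : (0 : ℝ) < n := by linarith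
    have hK1' : (1 : ℝ) ≤ K n := by exact_mod_cast hK1
    have hKle : (K n : ℝ) ≤ Cu ^ τ * (n : ℝ) ^ τ := by
      have h1 := (div_le_iff₀ hn0).1 hn.2
      have h2 := Real.rpow_le_rpow (by positivity) h1 hτ0.le
      rwa [← Real.rpow_mul (by positivity), hτ, mul_one_div_cancel (by linarith), Real.rpow_one,
        Real.mul_rpow hCu.le hn0.le] at h2
    have hsq : ((K n : ℝ) + 1) ^ 2 * (n : ℝ) ^ (4 * θ) + K n ≤ n := by
      have h1 : ((K n : ℝ) + 1) ^ 2 ≤ 4 * Cu ^ (2 * τ) * (n : ℝ) ^ (2 * τ) := by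
        have h2 : (K n : ℝ) + 1 ≤ 2 * (Cu ^ τ * (n : ℝ) ^ τ) := by linarith
        have h3 := pow_le_pow_left₀ (by positivity) h2 2
        have e1 : Cu ^ (2 * τ) = (Cu ^ τ) ^ 2 := by
          rw [mul_comm, Real.rpow_mul hCu.le, Real.rpow_two]
        have e2 : (n : ℝ) ^ (2 * τ) = ((n : ℝ) ^ τ) ^ 2 := by
          rw [mul_comm, Real.rpow_mul hn0.le, Real.rpow_two]
        rw [e1, e2]
        refine h3.trans (le_of_eq (by ring))
      have h2 : (n : ℝ) ^ τ ≤ (n : ℝ) ^ (2 * τ + 4 * θ) :=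
        Real.rpow_le_rpow_of_exponent_le hn1 (by linarith)
      have h3 : (n : ℝ) ^ (2 * τ) * (n : ℝ) ^ (4 * θ) = (n : ℝ) ^ (2 * τ + 4 * θ) :=
        (Real.rpow_add hn0 _ _).symm
      have h4 : (n : ℝ) ^ ((1 - 2 * τ) / 2) * (n : ℝ) ^ (2 * τ + 4 * θ) = n := by
        rw [← Real.rpow_add hn0]
        have : (1 - 2 * τ) / 2 + (2 * τ + 4 * θ) = 1 := by rw [hθ]; ring
        rw [this, Real.rpow_one]
      calc ((K n : ℝ) + 1) ^ 2 * (n : ℝ) ^ (4 * θ) + K n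
          ≤ 4 * Cu ^ (2 * τ) * (n : ℝ) ^ (2 * τ) * (n : ℝ) ^ (4 * θ) +
              Cu ^ τ * (n : ℝ) ^ (2 * τ + 4 * θ) :=
            add_le_add (mul_le_mul_of_nonneg_right h1 (by positivity))
              (hKle.trans (mul_le_mul_of_nonneg_left h2 (by positivity)))
        _ = B * (n : ℝ) ^ (2 * τ + 4 * θ) := by rw [mul_assoc, h3, hB]; ring
        _ ≤ (n : ℝ) ^ ((1 - 2 * τ) / 2) * (n : ℝ) ^ (2 * τ + 4 * θ) :=
            mul_le_mul_of_nonneg_right hnB (by positivity)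
        _ = n := h4
    have hKn : K n ≤ n := by
      have : (K n : ℝ) ≤ n := by
        have : 0 ≤ ((K n : ℝ) + 1) ^ 2 * (n : ℝ) ^ (4 * θ) := by positivity
        linarith
      exact_mod_cast this
    rw [Nat.cast_sub hKn]
    have e3 : ((n : ℝ) ^ (-θ)) ^ 2 = ((n : ℝ) ^ (2 * θ))⁻¹ := by
      rw [← Real.rpow_mul_natCast hn0.le, ← Real.rpow_neg hn0.le]
      congr 1; push_cast; ring
    rw [e3, inv_mul_eq_div, le_div_iff₀ (by positivity)]
    refine Real.le_sqrt_of_sq_le ?_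
    have e4 : ((n : ℝ) ^ (2 * θ)) ^ 2 = (n : ℝ) ^ (4 * θ) := by
      rw [← Real.rpow_mul_natCast hn0.le]
      congr 1; push_cast; ring
    rw [mul_pow, e4]
    linarith

end Growth

/-! ### From the independent copy to the loss of the estimated coefficients. -/

section Prediction

set_option linter.unusedSectionVars false

variable {Ω : Type*} [MeasurableSpace Ω]
variable {μ : Measure Ω} [IsProbabilityMeasure μ] {a b : ℕ → ℝ} {σ : ℝ} {e x y : ℤ → Ω → ℝ}

namespace CausalModel

/-- The scaled loss of every order is large when the sample is large. -/
lemma exists_scaledLoss_ge (M : CausalModel μ σ a b e x) (hinf : {i : ℕ | a i ≠ 0}.Infinite) (B : ℝ) :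
    ∃ N₀ : ℝ, ∀ N : ℝ, N₀ ≤ N → 0 ≤ N → ∀ k, B ≤ scaledLoss μ σ a b x N k := by
  have hs := M.sigma_pos
  -- Orders above m are expensive through kσ². Orders below m keep a bias of at least that of m,
  -- which is positive and is multiplied by N.
  obtain ⟨m, hm⟩ := exists_nat_ge (B / σ ^ 2)
  have hβ := M.bias_pos hinf m
  refine ⟨B / (σ ^ 2 * bias μ a b x m ^ 2), fun N hN hN0 k => ?_⟩
  rcases le_total m k with h | h
  · have h1 : (m : ℝ) ≤ k := by exact_mod_cast h
    rw [div_le_iff₀ hs] at hm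
    refine le_trans ?_ (M.order_le_scaledLoss hN0 k)
    nlinarith
  · have h1 := M.bias_antitone h
    rw [div_le_iff₀ (by positivity)] at hN
    have h2 : N * bias μ a b x m ^ 2 * σ ^ 2 ≤ N * bias μ a b x k ^ 2 * σ ^ 2 := by gcongr
    linarith [M.bias_le_scaledLoss N k]

lemma scaledLoss_eq (M : CausalModel μ σ a b e x) {K n : ℕ} (hKn : K < n) (k : ℕ) :
    L μ σ a x K n k = scaledLoss μ σ a b x ((n - K : ℕ) : ℝ) k / ((n - K : ℕ) : ℝ) := by
  have hN : (0 : ℝ) < ((n - K : ℕ) : ℝ) := by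
    have : 0 < n - K := by omega
    exact_mod_cast this
  rw [L, M.normRSq_coefDiff, scaledLoss]
  field_simp

lemma lagVec_cons (X : ℤ → ℝ) (t : ℤ) {k : ℕ} (c : Fin k → ℝ) :
    X (t + 1) + lagVec X t k ⬝ᵥ c = lin (ext (Fin.cons 1 c : Fin (k + 1) → ℝ)) X (t + 1) := by
  rw [lin_ext, dotProduct, dotProduct, Fin.sum_univ_succ]
  have h : ∀ i : ℕ, t + 1 - ((i : ℤ) + 1) = t - i := by intros; ring
  simp [lagVec, h]

lemma memLp_predictor (M : CausalModel μ σ a b e x) (t : ℤ) {k : ℕ} (c : Fin k → ℝ) :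
    MemLp (fun ω => x (t + 1) ω + lagVec (fun s => x s ω) t k ⬝ᵥ c) 2 μ := by
  obtain ⟨C, -, hC⟩ := M.moment_lin (q := 2) (by norm_num)
  have h := (hC _ (summable_ext (Fin.cons 1 c : Fin (k + 1) → ℝ)) (t + 1)).memLp
  simp only [← lagVec_cons (fun s => x s _)] at h
  exact_mod_cast h

/-- Prediction errors do not depend on the time. -/
lemma integral_predictor_sq (M : CausalModel μ σ a b e x) (t : ℤ) {k : ℕ} (c : Fin k → ℝ) :
    ∫ ω, (x (t + 1) ω + lagVec (fun s => x s ω) t k ⬝ᵥ c) ^ 2 ∂μ = predErr μ x k c := by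
  have h := fun t => M.integral_lin_mul_lin (summable_ext (Fin.cons 1 c : Fin (k + 1) → ℝ))
    (summable_ext (Fin.cons 1 c : Fin (k + 1) → ℝ)) (t + 1)
  simp only [← lagVec_cons (fun s => x s _), ← sq] at h
  rw [predErr, h, h]

lemma _root_.InfAR.measurable_select {α : Type*} [MeasurableSpace α] {β : Type*} [MeasurableSpace β]
    {κ : α → ℕ} (hκ : Measurable κ) {G : ℕ → α → β} (hG : ∀ k, Measurable (G k)) :
    Measurable fun p => G (κ p) p := by
  have h : Measurable fun q : ℕ × α => G q.1 q.2 := measurable_from_prod_countable_right hG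
  exact h.comp (hκ.prodMk measurable_id)

/-- The mean squared error of prediction of an independent copy. -/
lemma lintegral_predictor_sq (M : CausalModel μ σ a b e x) (hymeas : ∀ t, Measurable (y t))
    (hy : IsIndepCopy μ x y) (K n : ℕ) {κ : (ℤ → ℝ) → ℕ} (hκ : Measurable κ) :
    ∫⁻ ω, ENNReal.ofReal ((y ((n : ℤ) + 1) ω - predictor (fun t => x t ω) (fun t => y t ω) K n
        (κ fun t => x t ω)) ^ 2) ∂μ =
      ∫⁻ ω, ENNReal.ofReal (predErr μ x (κ fun t => x t ω)
        (ahat (fun t => x t ω) K n (κ fun t => x t ω))) ∂μ := by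
  set X : Ω → ℤ → ℝ := fun ω t => x t ω with hX
  set Y : Ω → ℤ → ℝ := fun ω t => y t ω with hY
  have hXm : Measurable X := measurable_pi_iff.2 M.measurable
  have hYm : Measurable Y := measurable_pi_iff.2 hymeas
  have hpm : Measurable fun p : (ℤ → ℝ) × (ℤ → ℝ) => ENNReal.ofReal
      ((p.2 ((n : ℤ) + 1) - predictor p.1 p.2 K n (κ p.1)) ^ 2) := by
    refine ENNReal.measurable_ofReal.comp (Measurable.pow_const (Measurable.sub ?_ ?_) 2)
    · exact (measurable_pi_apply _).comp measurable_snd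
    · refine measurable_select (hκ.comp measurable_fst)
        (G := fun k p => predictor p.1 p.2 K n k) fun k => ?_
      refine (measurable_dotProduct (fun i => ?_) fun i => ?_).neg
      · exact (measurable_pi_apply _).comp measurable_snd
      · exact measurable_ahat (fun t => (measurable_pi_apply t).comp measurable_fst) K n k i
  -- By independence the joint law of the two paths is a product. With the first path frozen, the
  -- inner integral over a path distributed like x is `predErr` at fixed coefficients. Integrals of
  -- nonnegative functions avoid assuming integrability.
  have hmap := (indepFun_iff_map_prod_eq_prod_map_map hXm.aemeasurable hYm.aemeasurable).1 hy.2
  have hpX : IsProbabilityMeasure (μ.map X) := Measure.isProbabilityMeasure_map hXm.aemeasurable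
  have hpY : IsProbabilityMeasure (μ.map Y) := Measure.isProbabilityMeasure_map hYm.aemeasurable
  have h1 := lintegral_map (μ := μ) hpm (hXm.prodMk hYm)
  have hXY : μ.map Y = μ.map X := hy.1.map_eq
  rw [hmap, lintegral_prod _ hpm.aemeasurable, hXY] at h1
  refine h1.symm.trans ?_
  have hinner : ∀ X₀ : ℤ → ℝ, ∫⁻ Y₀, ENNReal.ofReal
      ((Y₀ ((n : ℤ) + 1) - predictor X₀ Y₀ K n (κ X₀)) ^ 2) ∂(μ.map X) =
      ENNReal.ofReal (predErr μ x (κ X₀) (ahat X₀ K n (κ X₀))) := by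
    intro X₀
    have hm : Measurable fun Y₀ : ℤ → ℝ =>
        ENNReal.ofReal ((Y₀ ((n : ℤ) + 1) - predictor X₀ Y₀ K n (κ X₀)) ^ 2) :=
      hpm.comp (measurable_const.prodMk measurable_id)
    rw [lintegral_map hm hXm,
      ← M.integral_predictor_sq n, ofReal_integral_eq_lintegral_ofReal]
    · refine lintegral_congr fun ω => ?_
      simp only [predictor, sub_neg_eq_add, hX]
    · exact (M.memLp_predictor n _).integrable_sq
    · exact Eventually.of_forall fun ω => sq_nonneg _
  simp only [hinner]
  rw [lintegral_map _ hXm]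
  refine ENNReal.measurable_ofReal.comp (measurable_select hκ
    (G := fun k X₀ => predErr μ x k (ahat X₀ K n k)) fun k => ?_)
  exact M.measurable_predErr fun i => measurable_ahat (fun t => measurable_pi_apply t) K n k i

end CausalModel

end Prediction

/-! ### Uniform control over all orders and over the bad event. -/

section Assembly

set_option linter.unusedSectionVars false

variable {Ω : Type*} [MeasurableSpace Ω]
variable {μ : Measure Ω} [IsProbabilityMeasure μ] {a b : ℕ → ℝ} {σ : ℝ} {e x : ℤ → Ω → ℝ}

/-- Either Y ≤ t or (Y/t)^q ≥ 1. With t = ηD(k) this trades a maximum over random orders for a sum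
of high moments. -/
lemma le_add_pow_div {Y t : ℝ} (hY : 0 ≤ Y) (ht : 0 < t) (q : ℕ) :
    Y ≤ t + Y ^ (q + 1) / t ^ q := by
  rcases le_total Y t with h | h
  · exact h.trans (le_add_of_nonneg_right (by positivity))
  · refine le_trans ?_ (le_add_of_nonneg_left ht.le)
    rw [le_div_iff₀ (by positivity), pow_succ, mul_comm]
    exact mul_le_mul_of_nonneg_right (pow_le_pow_left₀ ht.le h q) hY

/-- Comparison of the loss at the selected order with the minimal loss. -/
lemma abs_sub_le_of_selection {D Dmin Y Ymin S Q η : ℝ} (hη0 : 0 ≤ η) (hη : η ≤ 1 / 4)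
    (hDmin : 0 ≤ Dmin) (hS : 0 ≤ S) (hle : Dmin ≤ D) (hsel : D ≤ Dmin + (Y + Ymin))
    (hQ : |Q - D| ≤ Y) (hY : Y ≤ η * D + S) (hYmin : Ymin ≤ η * Dmin + S) :
    |Q - Dmin| ≤ 5 * (η * Dmin) + 5 * S := by
  have h1 : η * D ≤ 1 / 4 * D := mul_le_mul_of_nonneg_right hη (hDmin.trans hle)
  have h2 : η * Dmin ≤ 1 / 4 * Dmin := mul_le_mul_of_nonneg_right hη hDmin
  -- With η ≤ 1/4 the term ηD on the right is absorbed on the left, leaving (3/4)D ≤ (5/4)Dmin + 2S.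
  have h3 : D ≤ 5 / 3 * Dmin + 8 / 3 * S := by linarith
  have h4 : η * D ≤ η * (5 / 3 * Dmin + 8 / 3 * S) := mul_le_mul_of_nonneg_left h3 hη0
  have h5 : η * S ≤ 1 / 4 * S := mul_le_mul_of_nonneg_right hη hS
  have h6 : 0 ≤ η * Dmin := mul_nonneg hη0 hDmin
  rw [abs_le] at hQ ⊢
  constructor <;> linarith [hQ.1, hQ.2]

namespace CausalModel

lemma exists_scaledLoss_le (M : CausalModel μ σ a b e x) :
    ∃ C, 0 ≤ C ∧ ∀ K n k : ℕ, K < n → k ≤ K →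
      scaledLoss μ σ a b x ((n - K : ℕ) : ℝ) k ≤ C * n := by
  obtain ⟨B, hB0, hB⟩ := M.exists_bias_le
  have hs := M.sigma_pos
  refine ⟨σ ^ 2 + σ ^ 2 * B ^ 2, by positivity, fun K n k hKn hk => ?_⟩
  have h1 : (k : ℝ) ≤ n := by
    have : k ≤ n := by omega
    exact_mod_cast this
  have h2 : ((n - K : ℕ) : ℝ) ≤ n := by exact_mod_cast Nat.sub_le n K
  have h3 := bias_nonneg (μ := μ) (a := a) (b := b) (x := x) k
  have h4 := hB k
  rw [scaledLoss]
  calc (k : ℝ) * σ ^ 2 + ((n - K : ℕ) : ℝ) * (σ ^ 2 * bias μ a b x k ^ 2)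
      ≤ n * σ ^ 2 + n * (σ ^ 2 * B ^ 2) := by gcongr
    _ = _ := by ring

/-- The large deviations of the selection errors, summed over the orders. -/
noncomputable def _root_.InfAR.excessSum (μ : Measure Ω) (σ : ℝ) (a b : ℕ → ℝ) (e x : ℤ → Ω → ℝ)
    (K n : ℕ) (ε η : ℝ) (q : ℕ) (ω : Ω) : ℝ :=
  ∑ k ∈ Finset.Icc 1 K, |selectionError μ σ a b e x K n ε k ω| ^ (q + 1) /
    (η * scaledLoss μ σ a b x ((n - K : ℕ) : ℝ) k) ^ q

lemma scaledLoss_pos (M : CausalModel μ σ a b e x) {N : ℝ} (hN : 0 ≤ N) {k : ℕ} (hk : 1 ≤ k) :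
    0 < scaledLoss μ σ a b x N k := by
  have hs := M.sigma_pos
  have : (0 : ℝ) < k := by exact_mod_cast hk
  exact lt_of_lt_of_le (by positivity) (M.order_le_scaledLoss hN k)

lemma excessSum_nonneg (M : CausalModel μ σ a b e x) (K n : ℕ) {ε η : ℝ} (hη : 0 ≤ η) (q : ℕ)
    (ω : Ω) : 0 ≤ excessSum μ σ a b e x K n ε η q ω := by
  refine Finset.sum_nonneg fun k _ => ?_
  have := M.scaledLoss_nonneg (N := ((n - K : ℕ) : ℝ)) (by positivity) k
  positivity

lemma selectionError_le (M : CausalModel μ σ a b e x) {K n k : ℕ} {ε η : ℝ} (hη : 0 < η)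
    (hk : k ∈ Finset.Icc 1 K) (q : ℕ) (ω : Ω) :
    selectionError μ σ a b e x K n ε k ω ≤
      η * scaledLoss μ σ a b x ((n - K : ℕ) : ℝ) k + excessSum μ σ a b e x K n ε η q ω := by
  have hD := M.scaledLoss_pos (N := ((n - K : ℕ) : ℝ)) (by positivity) (Finset.mem_Icc.1 hk).1
  refine (le_abs_self _).trans ((le_add_pow_div (abs_nonneg _) (mul_pos hη hD) q).trans ?_)
  refine add_le_add le_rfl (Finset.single_le_sum (f := fun k =>
    |selectionError μ σ a b e x K n ε k ω| ^ (q + 1) /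
    (η * scaledLoss μ σ a b x ((n - K : ℕ) : ℝ) k) ^ q) (fun l _ => ?_) hk)
  have := M.scaledLoss_nonneg (N := ((n - K : ℕ) : ℝ)) (by positivity) l
  positivity

/-- The moment of order 2r divided by D^(2r−1) is of order D^(1−r) + ε^(2r) D. The first part is
summable over k because D(k) ≥ kσ² and r − 1 ≥ 2. The second, with D = O(n) and at most n orders,
totals O(n² ε^(2r)). -/
theorem integral_excessSum_le (M : CausalModel μ σ a b e x) {r : ℕ} (hr : 3 ≤ r) {η : ℝ}
    (hη : 0 < η) :
    ∃ C, 0 ≤ C ∧ ∀ (K n : ℕ) (ε : ℝ), K < n → 0 < ε → ε ≤ 1 →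
      (K : ℝ) + 1 ≤ ε ^ 2 * √((n - K : ℕ) : ℝ) → 2 * K ^ 2 ≤ n - K →
      (n : ℝ) ^ 2 * ε ^ (2 * r) ≤ 1 →
      Integrable (excessSum μ σ a b e x K n ε η (2 * r - 1)) μ ∧
        ∫ ω, excessSum μ σ a b e x K n ε η (2 * r - 1) ω ∂μ ≤ C := by
  obtain ⟨C, hC0, hC⟩ := M.moment_selectionError (q := 2 * r) (by omega)
  obtain ⟨B, hB0, hB⟩ := M.exists_scaledLoss_le
  have hs := M.sigma_pos
  set s := σ ^ 2 with hsdef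
  set T : ℝ := ∑' k : ℕ, 1 / (k : ℝ) ^ 2 with hT
  have hTs : Summable fun k : ℕ => 1 / (k : ℝ) ^ 2 := Real.summable_one_div_nat_pow.2 one_lt_two
  have hT0 : 0 ≤ T := tsum_nonneg fun _ => by positivity
  set A : ℝ := C ^ (2 * r) * 2 ^ (2 * r) / η ^ (2 * r - 1) with hA
  have hA0 : 0 ≤ A := by positivity
  refine ⟨A * ((s ^ (r - 1))⁻¹ * T + B), by positivity, fun K n ε hKn hε0 hε1 hKε hK2 hnε => ?_⟩
  have hmom : ∀ k ∈ Finset.Icc 1 K, _ := fun k hk =>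
    hC K n k ε hKn (Finset.mem_Icc.1 hk).1 (Finset.mem_Icc.1 hk).2 hε0 hε1 hKε hK2
  have hDpos : ∀ k ∈ Finset.Icc 1 K, 0 < scaledLoss μ σ a b x ((n - K : ℕ) : ℝ) k := fun k hk =>
    M.scaledLoss_pos (by positivity) (Finset.mem_Icc.1 hk).1
  have e1 : 2 * r - 1 + 1 = 2 * r := by omega
  have hfun : excessSum μ σ a b e x K n ε η (2 * r - 1) = fun ω => ∑ k ∈ Finset.Icc 1 K,
      |selectionError μ σ a b e x K n ε k ω| ^ (2 * r) /
        (η * scaledLoss μ σ a b x ((n - K : ℕ) : ℝ) k) ^ (2 * r - 1) := by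
    funext ω
    rw [excessSum, e1]
  have hint : ∀ k ∈ Finset.Icc 1 K, Integrable (fun ω =>
      |selectionError μ σ a b e x K n ε k ω| ^ (2 * r) /
        (η * scaledLoss μ σ a b x ((n - K : ℕ) : ℝ) k) ^ (2 * r - 1)) μ := fun k hk =>
    ((hmom k hk).integrable_pow (by omega)).div_const _
  rw [hfun]
  refine ⟨integrable_finsetSum _ hint, ?_⟩
  rw [integral_finsetSum _ hint]
  have hterm : ∀ k ∈ Finset.Icc 1 K, ∫ ω, |selectionError μ σ a b e x K n ε k ω| ^ (2 * r) /
        (η * scaledLoss μ σ a b x ((n - K : ℕ) : ℝ) k) ^ (2 * r - 1) ∂μ ≤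
      A * ((s ^ (r - 1))⁻¹ * (1 / (k : ℝ) ^ 2) + ε ^ (2 * r) * (B * n)) := by
    intro k hk
    have hD := hDpos k hk
    have hDle := hB K n k hKn (Finset.mem_Icc.1 hk).2
    have hkD := M.order_le_scaledLoss (N := ((n - K : ℕ) : ℝ)) (by positivity) k
    have hm := hmom k hk
    set D := scaledLoss μ σ a b x ((n - K : ℕ) : ℝ) k with hDdef
    have hk1 : (1 : ℝ) ≤ k := by exact_mod_cast (Finset.mem_Icc.1 hk).1
    have hsD : 0 ≤ √D := Real.sqrt_nonneg _
    rw [integral_div, div_le_iff₀ (by positivity)]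
    refine (hm.integral_pow_le (by omega) (by positivity)).trans ?_
    have h1 : (√D + ε * D) ^ (2 * r) ≤ 2 ^ (2 * r) * (D ^ r + (ε * D) ^ (2 * r)) := by
      have h2 := add_pow_le hsD (by positivity : 0 ≤ ε * D) (2 * r)
      have h3 : √D ^ (2 * r) = D ^ r := by rw [pow_mul, Real.sq_sqrt hD.le]
      rw [h3] at h2
      refine h2.trans (mul_le_mul_of_nonneg_right ?_ (by positivity))
      exact pow_le_pow_right₀ one_le_two (by omega)
    have h4 : D ^ r ≤ (s ^ (r - 1))⁻¹ * (1 / (k : ℝ) ^ 2) * D ^ (2 * r - 1) := by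
      have h5 : s ^ (r - 1) * (k : ℝ) ^ 2 ≤ D ^ (r - 1) := by
        calc s ^ (r - 1) * (k : ℝ) ^ 2 ≤ s ^ (r - 1) * (k : ℝ) ^ (r - 1) := by
              refine mul_le_mul_of_nonneg_left (pow_le_pow_right₀ hk1 (by omega)) (by positivity)
          _ = (k * s) ^ (r - 1) := by rw [mul_pow, mul_comm]
          _ ≤ D ^ (r - 1) := pow_le_pow_left₀ (by positivity) hkD _
      have h6 : D ^ (2 * r - 1) = D ^ (r - 1) * D ^ r := by
        rw [← pow_add]; congr 1; omega
      rw [h6, one_div, ← mul_inv, ← mul_assoc]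
      refine le_mul_of_one_le_left (by positivity) ?_
      rw [inv_mul_eq_div, one_le_div (by positivity)]
      exact h5
    have h7 : (ε * D) ^ (2 * r) ≤ ε ^ (2 * r) * (B * n) * D ^ (2 * r - 1) := by
      have h8 : D ^ (2 * r) = D * D ^ (2 * r - 1) := by rw [← pow_succ', e1]
      rw [mul_pow, h8, ← mul_assoc]
      gcongr
    calc (C * (√D + ε * D)) ^ (2 * r) = C ^ (2 * r) * (√D + ε * D) ^ (2 * r) := mul_pow _ _ _
      _ ≤ C ^ (2 * r) * (2 ^ (2 * r) * ((s ^ (r - 1))⁻¹ * (1 / (k : ℝ) ^ 2) * D ^ (2 * r - 1) +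
            ε ^ (2 * r) * (B * n) * D ^ (2 * r - 1))) := by
          refine mul_le_mul_of_nonneg_left (h1.trans ?_) (by positivity)
          exact mul_le_mul_of_nonneg_left (add_le_add h4 h7) (by positivity)
      _ = _ := by rw [hA, mul_pow]; field_simp
  refine (Finset.sum_le_sum hterm).trans ?_
  rw [← Finset.mul_sum, Finset.sum_add_distrib, ← Finset.mul_sum, Finset.sum_const, nsmul_eq_mul,
    Nat.card_Icc, Nat.add_sub_cancel]
  refine mul_le_mul_of_nonneg_left (add_le_add ?_ ?_) hA0
  · exact mul_le_mul_of_nonneg_left (hTs.sum_le_tsum _ fun _ _ => by positivity) (by positivity)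
  · have hKn' : (K : ℝ) ≤ n := by exact_mod_cast hKn.le
    calc (K : ℝ) * (ε ^ (2 * r) * (B * n)) ≤ n * (ε ^ (2 * r) * (B * n)) := by gcongr
      _ = B * ((n : ℝ) ^ 2 * ε ^ (2 * r)) := by ring
      _ ≤ B * 1 := mul_le_mul_of_nonneg_left hnε hB0
      _ = B := mul_one B

/-- The contribution of the complement of the good event. -/
theorem integral_bad_le (M : CausalModel μ σ a b e x) (hF : UniformHolderCDF μ e) {q : ℕ}
    (hq : 1 ≤ q) :
    ∃ (C : ℝ) (A n₀ : ℕ), 0 ≤ C ∧ ∀ (K n : ℕ) (ε : ℝ), 1 ≤ K → K < n → n₀ ≤ n → 0 < ε →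
      (K : ℝ) + 1 ≤ ε ^ 2 * √((n - K : ℕ) : ℝ) → A * (K + 1) * K ≤ n - K →
      (n : ℝ) ^ 13 * ε ^ q ≤ 1 →
      Integrable (fun ω => (goodEvent σ b x K n ε)ᶜ.indicator (fun _ => (1 : ℝ)) ω *
        (n * ∑ k ∈ Finset.Icc 1 K, predErr μ x k (ahat (fun t => x t ω) K n k) + n)) μ ∧
      ∫ ω, (goodEvent σ b x K n ε)ᶜ.indicator (fun _ => (1 : ℝ)) ω *
        (n * ∑ k ∈ Finset.Icc 1 K, predErr μ x k (ahat (fun t => x t ω) K n k) + n) ∂μ ≤ C := by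
  obtain ⟨C, A, n₀, hC0, hC⟩ := M.exists_predErr_moment hF
  obtain ⟨B, hB0, hB⟩ := M.measure_compl_goodEvent_le (q := 2 * q) (by omega)
  refine ⟨2 * B ^ q * (C + 1), A, n₀, by positivity, fun K n ε hK1 hKn hn hε hKε hA hnε => ?_⟩
  have hn1 : (1 : ℝ) ≤ n := by
    have : 1 ≤ n := by omega
    exact_mod_cast this
  have hKn' : (K : ℝ) ≤ n := by exact_mod_cast hKn.le
  set G := goodEvent σ b x K n ε with hG
  have hGm : MeasurableSet G := M.measurableSet_goodEvent K n ε
  set g : Ω → ℝ := Gᶜ.indicator (fun _ => (1 : ℝ)) with hg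
  -- Square root of the probability bound used with exponent 2q, that is, the L² norm of the
  -- indicator. By Cauchy–Schwarz it meets a factor of L² norm O(n¹¹), and K + 1 ≤ 2n makes n¹² in
  -- all.
  set c : ℝ := (K + 1) * (B * ε) ^ q with hc
  have hc0 : 0 ≤ c := by positivity
  have hgm : Measurable g := measurable_const.indicator hGm.compl
  have hg2 : (fun ω => |g ω| ^ 2) = g := by
    funext ω
    by_cases hω : ω ∈ Gᶜ
    · simp [hg, Set.indicator_of_mem hω]
    · simp [hg, Set.indicator_of_notMem hω]
  have hgi : Integrable g μ := (integrable_const (1 : ℝ)).indicator hGm.compl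
  have hgmom : MomentLE μ 2 g c := by
    refine MomentLE.of_integral_pow (by norm_num) hc0 hgm.aestronglyMeasurable ?_ ?_
    · rw [hg2]; exact hgi
    · rw [hg2, hg, integral_indicator_const _ hGm.compl, smul_eq_mul, mul_one]
      refine (hB K n ε hKn hε hKε).trans (le_of_eq ?_)
      rw [hc]; ring
  set F : Ω → ℝ := fun ω => n * ∑ k ∈ Finset.Icc 1 K,
    predErr μ x k (ahat (fun t => x t ω) K n k) + n with hFdef
  have hFmom : MomentLE μ 2 F (n * (K * (C * (n : ℝ) ^ 9)) + n) := by
    have h1 := MomentLE.sum (μ := μ) (q := 2) (by norm_num) (Finset.Icc 1 K)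
      (f := fun k ω => predErr μ x k (ahat (fun t => x t ω) K n k))
      (c := fun _ => C * (n : ℝ) ^ 9) (fun _ _ => by positivity)
      (fun k hk => hC K n hK1 hKn hn hA k (Finset.mem_Icc.1 hk).2)
    rw [Finset.sum_const, Nat.card_Icc, Nat.add_sub_cancel, nsmul_eq_mul] at h1
    have h2 := (h1.const_mul (n : ℝ)).add (by norm_num) (by positivity) (by positivity)
      (MomentLE.const (μ := μ) (q := 2) (by norm_num) (n : ℝ))
    rwa [abs_of_nonneg (by positivity : (0 : ℝ) ≤ n)] at h2
  have hprod := MomentLE.mul (q := 1) hc0 hgmom hFmom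
  have hi : Integrable (fun ω => g ω * F ω) μ := by
    have := hprod.memLp
    rw [Nat.cast_one] at this
    exact memLp_one_iff_integrable.1 this
  refine ⟨hi, ?_⟩
  have h1 := hprod.integral_pow_le le_rfl (by positivity)
  simp only [pow_one] at h1
  refine (integral_mono hi hi.abs fun ω => le_abs_self _).trans (h1.trans ?_)
  have h2 : n * (K * (C * (n : ℝ) ^ 9)) + n ≤ (C + 1) * (n : ℝ) ^ 11 := by
    have h3 : (n : ℝ) ≤ (n : ℝ) ^ 11 := le_self_pow₀ hn1 (by norm_num)
    have h4 : n * (K * (C * (n : ℝ) ^ 9)) ≤ n * (n * (C * (n : ℝ) ^ 9)) := by gcongr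
    calc n * (K * (C * (n : ℝ) ^ 9)) + n ≤ n * (n * (C * (n : ℝ) ^ 9)) + (n : ℝ) ^ 11 := add_le_add h4 h3
      _ = _ := by ring
  have h5 : c ≤ 2 * n * (B ^ q * ε ^ q) := by
    rw [hc, mul_pow]
    refine mul_le_mul_of_nonneg_right ?_ (by positivity)
    linarith
  calc c * (n * (K * (C * (n : ℝ) ^ 9)) + n)
      ≤ (2 * n * (B ^ q * ε ^ q)) * ((C + 1) * (n : ℝ) ^ 11) :=
        mul_le_mul h5 h2 (by positivity) (by positivity)
    _ = 2 * B ^ q * (C + 1) * ((n : ℝ) ^ 12 * ε ^ q) := by ring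
    _ ≤ 2 * B ^ q * (C + 1) * 1 := by
        refine mul_le_mul_of_nonneg_left (le_trans ?_ hnε) (by positivity)
        refine mul_le_mul_of_nonneg_right (pow_le_pow_right₀ hn1 (by norm_num)) (by positivity)
    _ = _ := mul_one _

end CausalModel

end Assembly

/-! ### The mean loss at the selected order. -/

section Limit

set_option linter.unusedSectionVars false

variable {Ω : Type*} [MeasurableSpace Ω]
variable {μ : Measure Ω} [IsProbabilityMeasure μ] {a b : ℕ → ℝ} {σ : ℝ} {e x y : ℤ → Ω → ℝ}

namespace CausalModel

lemma ae_residual_bestCoef (M : CausalModel μ σ a b e x) :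
    ∀ᵐ ω ∂μ, ∀ k, ∀ t : ℤ, x (t + 1) ω + lagVec (fun s => x s ω) t k ⬝ᵥ bestCoef μ x k =
      e (t + 1) ω - lin (coefDiff μ a x k) (fun s => x s ω) t := by
  rw [ae_all_iff]
  exact fun k => M.ae_residual (bestCoef μ x k)

/-- The mean loss at the selected order, relative to the minimal loss. -/
theorem exists_mean_loss_bound (M : CausalModel μ σ a b e x) (hF : UniformHolderCDF μ e)
    {K : ℕ → ℕ} (hK : OrderGrowth K) {η : ℝ} (hη0 : 0 < η) (hη : η ≤ 1 / 4) :
    ∃ C, 0 ≤ C ∧ ∀ᶠ n : ℕ in atTop, ∀ (crit : Criterion) (κ : (ℤ → ℝ) → ℕ) (m : ℕ), Measurable κ →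
      IsArgmin (scaledLoss μ σ a b x ((n - K n : ℕ) : ℝ)) (K n) m →
      (∀ᵐ ω ∂μ, IsArgmin (fun k => crit.value (fun t => x t ω) (K n) n k) (K n)
        (κ fun t => x t ω)) →
      Integrable (fun ω => predErr μ x (κ fun t => x t ω)
        (ahat (fun t => x t ω) (K n) n (κ fun t => x t ω))) μ ∧
      |((n - K n : ℕ) : ℝ) * ((∫ ω, predErr μ x (κ fun t => x t ω)
        (ahat (fun t => x t ω) (K n) n (κ fun t => x t ω)) ∂μ) - σ ^ 2) -
          scaledLoss μ σ a b x ((n - K n : ℕ) : ℝ) m| ≤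
        5 * (η * scaledLoss μ σ a b x ((n - K n : ℕ) : ℝ) m) + C := by
  obtain ⟨ε, q₀, hεpos, hε0, hεq, hεK⟩ := hK.exists_rate
  -- As n ε^(q₀+1) ≤ 1, the j-th power controls n^j ε^(j(q₀+1)). The two integral bounds need j = 6,
  -- which covers the required n², and j = 13.
  obtain ⟨C₁, hC₁0, hC₁⟩ := M.integral_excessSum_le (r := 3 * (q₀ + 1)) (by omega) hη0
  obtain ⟨C₂, A, n₀, hC₂0, hC₂⟩ := M.integral_bad_le hF (q := 13 * (q₀ + 1)) (by omega)
  obtain ⟨B, hB0, hB⟩ := M.exists_scaledLoss_le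
  have hc := M.eigLow_pos
  have hs := M.sigma_pos
  set β : ℝ := 1 + σ ^ 2 + B with hβ
  -- The bound 1/(A + 4) yields (A + 4)(K + 1)² ≤ N, from which all three size conditions on K
  -- follow.
  have hsmall : ∀ᶠ n in atTop, ε n < min (min 1 (eigLow σ a / 2)) (1 / (A + 4)) :=
    hε0.eventually_lt_const (by positivity)
  refine ⟨5 * C₁ + β * C₂, by positivity, ?_⟩
  filter_upwards [hεpos, hεq, hεK, hsmall, hK.tendsto.eventually_ge_atTop 1,
    eventually_ge_atTop n₀] with n hε hnε hKε hεs hK1 hn crit κ m hκ hm hsel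
  have hε1 : ε n ≤ 1 := (hεs.le.trans (min_le_left _ _)).trans (min_le_left _ _)
  have hεc : ε n ≤ eigLow σ a / 2 := (hεs.le.trans (min_le_left _ _)).trans (min_le_right _ _)
  have hεA : ε n * (A + 4) ≤ 1 := by
    have := hεs.le.trans (min_le_right _ _)
    rwa [le_div_iff₀ (by positivity)] at this
  have hKn : K n < n := by
    by_contra! hle
    rw [Nat.sub_eq_zero_of_le hle, Nat.cast_zero, Real.sqrt_zero, mul_zero] at hKε
    linarith [(Nat.cast_nonneg (K n) : (0 : ℝ) ≤ K n)]
  have hA4 : (A + 4) * (K n + 1) ^ 2 ≤ n - K n := by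
    have h1 := pow_le_pow_left₀ (by positivity) hKε 2
    rw [mul_pow, Real.sq_sqrt (Nat.cast_nonneg _)] at h1
    have h2 : ((A : ℝ) + 4) * (ε n ^ 2) ^ 2 ≤ 1 := by
      have h3 : ε n ^ 3 ≤ 1 := pow_le_one₀ hε.le hε1
      calc ((A : ℝ) + 4) * (ε n ^ 2) ^ 2 = (ε n * (A + 4)) * ε n ^ 3 := by ring
        _ ≤ 1 * 1 := mul_le_mul hεA h3 (by positivity) zero_le_one
        _ = 1 := one_mul 1
    have h3 : ((A : ℝ) + 4) * ((K n : ℝ) + 1) ^ 2 ≤ ((n - K n : ℕ) : ℝ) := by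
      calc ((A : ℝ) + 4) * ((K n : ℝ) + 1) ^ 2
          ≤ ((A : ℝ) + 4) * ((ε n ^ 2) ^ 2 * ((n - K n : ℕ) : ℝ)) :=
            mul_le_mul_of_nonneg_left h1 (by positivity)
        _ = (((A : ℝ) + 4) * (ε n ^ 2) ^ 2) * ((n - K n : ℕ) : ℝ) := by ring
        _ ≤ 1 * ((n - K n : ℕ) : ℝ) := mul_le_mul_of_nonneg_right h2 (by positivity)
        _ = _ := one_mul _
    exact_mod_cast h3
  have hK2 : 2 * K n ^ 2 ≤ n - K n := le_trans (by nlinarith) hA4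
  have hK4 : 4 * K n + 4 ≤ n - K n := le_trans (by nlinarith) hA4
  have hKA : A * (K n + 1) * K n ≤ n - K n := le_trans (by nlinarith) hA4
  have hn0 : (0 : ℝ) ≤ n := Nat.cast_nonneg n
  have hn1 : (1 : ℝ) ≤ n := by
    have : 1 ≤ n := by omega
    exact_mod_cast this
  have hpow : ∀ j : ℕ, (n : ℝ) ^ j * ε n ^ (j * (q₀ + 1)) ≤ 1 := by
    intro j
    have h1 : (n : ℝ) * ε n ^ (q₀ + 1) ≤ 1 := by
      rw [pow_succ, ← mul_assoc]
      exact mul_le_one₀ hnε hε.le hε1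
    rw [mul_comm j, pow_mul, ← mul_pow]
    exact pow_le_one₀ (by positivity) h1
  obtain ⟨hSi, hSle⟩ := hC₁ (K n) n (ε n) hKn hε hε1 hKε hK2 (by
    have h1 : 2 * (3 * (q₀ + 1)) = 6 * (q₀ + 1) := by ring
    rw [h1]
    exact le_trans (mul_le_mul_of_nonneg_right (pow_le_pow_right₀ hn1 (by norm_num))
      (by positivity)) (hpow 6))
  obtain ⟨hBi, hBle⟩ := hC₂ (K n) n (ε n) hK1 hKn hn hε hKε hKA (hpow 13)
  set N : ℝ := ((n - K n : ℕ) : ℝ) with hN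
  have hN0 : 0 < N := by
    exact Nat.cast_pos.2 (by omega)
  have hNn : N ≤ n := by rw [hN]; exact_mod_cast Nat.sub_le n (K n)
  set D := scaledLoss μ σ a b x N with hD
  set P : Ω → ℝ := fun ω => predErr μ x (κ fun t => x t ω)
    (ahat (fun t => x t ω) (K n) n (κ fun t => x t ω)) with hP
  set S := excessSum μ σ a b e x (K n) n (ε n) η (2 * (3 * (q₀ + 1)) - 1) with hS
  set G := goodEvent σ b x (K n) n (ε n) with hG
  set F : Ω → ℝ := fun ω => Gᶜ.indicator (fun _ => (1 : ℝ)) ω *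
    (n * ∑ k ∈ Finset.Icc 1 (K n), predErr μ x k (ahat (fun t => x t ω) (K n) n k) + n) with hFdef
  have hPm : Measurable P := by
    refine measurable_select (hκ.comp (measurable_pi_iff.2 M.measurable))
      (G := fun k ω => predErr μ x k (ahat (fun t => x t ω) (K n) n k)) fun k => ?_
    exact M.measurable_predErr fun i => measurable_ahat (fun t => M.measurable t) (K n) n k i
  have hDm : 0 ≤ D m := M.scaledLoss_nonneg hN0.le m
  have hDmn : D m ≤ B * n := hB (K n) n m hKn (Finset.mem_Icc.1 hm.1).2
  -- On the good event this is the comparison of selected and optimal order. Off it, the loss at the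
  -- selected order is bounded by the sum over all orders, and β absorbs σ² and the bound D ≤ Bn.
  have hbound : ∀ᵐ ω ∂μ, |N * (P ω - σ ^ 2) - D m| ≤ 5 * (η * D m) + 5 * S ω + β * F ω := by
    filter_upwards [M.ae_residual_bestCoef, hsel] with ω hres hsω
    have hS0 : 0 ≤ S ω := M.excessSum_nonneg (K n) n hη0.le _ ω
    have hsum0 : 0 ≤ ∑ k ∈ Finset.Icc 1 (K n), predErr μ x k (ahat (fun t => x t ω) (K n) n k) :=
      Finset.sum_nonneg fun _ _ => predErr_nonneg _ _
    by_cases hω : ω ∈ G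
    · have hF0 : F ω = 0 := by simp [hFdef, hω]
      rw [hF0, mul_zero, add_zero]
      have hkm := hsω.1
      have h1 := (M.fluctuation_spec hKn (Finset.mem_Icc.1 hkm).2 hε hε1 hεc hω (hres _)).1
      exact abs_sub_le_of_selection hη0.le hη hDm hS0 (hm.2 _ hkm)
        (M.selection_spec hK4 hε hε1 hεc hω hres crit hsω hm.1)
        (h1.trans (M.fluctuation_le_selectionError (K n) n _ hε ω))
        (M.selectionError_le hη0 hkm _ ω) (M.selectionError_le hη0 hm.1 _ ω)
    · have hF1 : F ω = n * ∑ k ∈ Finset.Icc 1 (K n),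
          predErr μ x k (ahat (fun t => x t ω) (K n) n k) + n := by
        simp [hFdef, hω]
      have hPle : P ω ≤ ∑ k ∈ Finset.Icc 1 (K n), predErr μ x k (ahat (fun t => x t ω) (K n) n k) :=
        Finset.single_le_sum (f := fun k => predErr μ x k (ahat (fun t => x t ω) (K n) n k))
          (fun _ _ => predErr_nonneg _ _) hsω.1
      have hP0 : 0 ≤ P ω := predErr_nonneg _ _
      rw [hF1]
      set T := ∑ k ∈ Finset.Icc 1 (K n), predErr μ x k (ahat (fun t => x t ω) (K n) n k) with hT
      have h1 : N * P ω ≤ n * T := mul_le_mul hNn hPle hP0 hn0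
      have h2 : N * σ ^ 2 ≤ n * σ ^ 2 := mul_le_mul_of_nonneg_right hNn hs.le
      have h3 : 0 ≤ n * T := by positivity
      have h4 : 0 ≤ N * P ω := by positivity
      have h5 : 0 ≤ N * σ ^ 2 := by positivity
      have h6 : β * (n * T + n) = n * T + (σ ^ 2 + B) * (n * T) + n + σ ^ 2 * n + B * n := by
        rw [hβ]; ring
      have h7 : 0 ≤ (σ ^ 2 + B) * (n * T) := by positivity
      have h8 : 0 ≤ η * D m := by positivity
      rw [h6, abs_le]
      constructor <;> linarith
  have hRi : Integrable (fun ω => 5 * (η * D m) + 5 * S ω + β * F ω) μ :=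
    ((integrable_const _).add (hSi.const_mul 5)).add (hBi.const_mul β)
  have hdm : AEStronglyMeasurable (fun ω => N * (P ω - σ ^ 2) - D m) μ :=
    (((hPm.sub_const _).const_mul _).sub_const _).aestronglyMeasurable
  have hdi : Integrable (fun ω => N * (P ω - σ ^ 2) - D m) μ :=
    hRi.mono' hdm hbound
  have hPi : Integrable P μ := by
    have h1 : P = fun ω => N⁻¹ * ((N * (P ω - σ ^ 2) - D m) + D m) + σ ^ 2 := by
      funext ω; field_simp; ring
    rw [h1]
    exact ((hdi.add (integrable_const _)).const_mul _).add (integrable_const _)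
  refine ⟨hPi, ?_⟩
  have h1 : N * ((∫ ω, P ω ∂μ) - σ ^ 2) - D m = ∫ ω, (N * (P ω - σ ^ 2) - D m) ∂μ := by
    have hi2 : Integrable (fun ω => P ω - σ ^ 2) μ := hPi.sub (integrable_const _)
    rw [integral_sub (hi2.const_mul N) (integrable_const _), integral_const_mul,
      integral_sub hPi (integrable_const _)]
    simp
  rw [h1]
  refine abs_integral_le_integral_abs.trans ((integral_mono_ae hdi.abs hRi hbound).trans ?_)
  have hi1 : Integrable (fun ω => 5 * (η * D m) + 5 * S ω) μ :=
    (integrable_const _).add (hSi.const_mul 5)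
  have h3 : ∫ ω, 5 * S ω ∂μ = 5 * ∫ ω, S ω ∂μ := integral_const_mul _ _
  have h4 : ∫ ω, β * F ω ∂μ = β * ∫ ω, F ω ∂μ := integral_const_mul _ _
  rw [integral_add hi1 (hBi.const_mul β), integral_add (integrable_const _) (hSi.const_mul 5), h3, h4,
    integral_const]
  simp only [probReal_univ, one_smul]
  have h2 : β * ∫ ω, F ω ∂μ ≤ β * C₂ := mul_le_mul_of_nonneg_left hBle (by positivity)
  linarith

end CausalModel

end Limit

/-! ### The limit, and the passage to the causal version of the process. -/

section Efficiency

variable {Ω : Type*} [MeasurableSpace Ω] {μ : Measure Ω} {σ : ℝ} {a b : ℕ → ℝ}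
  {e x x' y : ℤ → Ω → ℝ} {K : ℕ → ℕ}

lemma OrderGrowth.eventually_sq_le (hK : OrderGrowth K) :
    ∀ᶠ n in atTop, K n < n ∧ ((K n : ℝ) + 1) ^ 2 ≤ ((n - K n : ℕ) : ℝ) := by
  obtain ⟨ε, q₀, h0, h1, -, h2⟩ := hK.exists_rate
  filter_upwards [h0, h1.eventually_lt_const (zero_lt_one' ℝ), h2] with n hε hε1 hn
  have h3 : (K n : ℝ) + 1 ≤ √((n - K n : ℕ) : ℝ) := by
    refine hn.trans (mul_le_of_le_one_left (Real.sqrt_nonneg _) (pow_le_one₀ hε.le hε1.le))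
  have h4 := pow_le_pow_left₀ (by positivity) h3 2
  rw [Real.sq_sqrt (Nat.cast_nonneg _)] at h4
  refine ⟨?_, h4⟩
  by_contra! hle
  rw [Nat.sub_eq_zero_of_le hle, Nat.cast_zero] at h4
  nlinarith [(Nat.cast_nonneg (K n) : (0 : ℝ) ≤ K n)]

lemma OrderGrowth.tendsto_sub (hK : OrderGrowth K) :
    Tendsto (fun n => ((n - K n : ℕ) : ℝ)) atTop atTop := by
  refine tendsto_atTop_mono' atTop ?_ (tendsto_natCast_atTop_atTop.comp hK.tendsto)
  filter_upwards [hK.eventually_sq_le] with n hn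
  have : (0 : ℝ) ≤ K n := Nat.cast_nonneg _
  simp only [Function.comp_apply]
  nlinarith [hn.2]

lemma predErr_congr (h : ∀ᵐ ω ∂μ, ∀ t, x t ω = x' t ω) (k : ℕ) (c : Fin k → ℝ) :
    predErr μ x k c = predErr μ x' k c := by
  refine integral_congr_ae ?_
  filter_upwards [h] with ω hω
  simp only [hω]

/-- x equals its moving average only almost surely. The choice `bestCoef` is unaffected, because the
functions it minimizes coincide. -/
lemma L_congr (h : ∀ᵐ ω ∂μ, ∀ t, x t ω = x' t ω) (K n k : ℕ) :
    L μ σ a x K n k = L μ σ a x' K n k := by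
  have h1 : bestCoef μ x k = bestCoef μ x' k := by
    simp only [bestCoef, predErr_congr h]
  have h2 : coefDiff μ a x k = coefDiff μ a x' k := by
    funext i; simp only [coefDiff, h1]
  have h3 : ∀ i j : ℕ, ∫ ω, x ((i : ℤ) + 1) ω * x ((j : ℤ) + 1) ω ∂μ =
      ∫ ω, x' ((i : ℤ) + 1) ω * x' ((j : ℤ) + 1) ω ∂μ := by
    intro i j
    refine integral_congr_ae ?_
    filter_upwards [h] with ω hω
    simp only [hω]
  simp only [L, normRSq, h2, h3]

lemma IsIndepCopy.congr (hy : IsIndepCopy μ x y) (hx : ∀ t, Measurable (x t))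
    (h : ∀ᵐ ω ∂μ, ∀ t, x t ω = x' t ω) : IsIndepCopy μ x' y := by
  have hpath : (fun ω t => x t ω) =ᵐ[μ] fun ω t => x' t ω := by
    filter_upwards [h] with ω hω
    exact funext hω
  exact ⟨hy.1.trans (IdentDistrib.of_ae_eq (measurable_pi_iff.2 hx).aemeasurable hpath),
    hy.2.congr hpath (ae_eq_refl _)⟩

variable [IsProbabilityMeasure μ]

lemma CausalModel.integral_predictor_eq (M : CausalModel μ σ a b e x)
    (hymeas : ∀ t, Measurable (y t)) (hy : IsIndepCopy μ x y) (K n : ℕ) {κ : (ℤ → ℝ) → ℕ}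
    (hκ : Measurable κ) (hi : Integrable (fun ω => predErr μ x (κ fun t => x t ω)
      (ahat (fun t => x t ω) K n (κ fun t => x t ω))) μ) :
    Integrable (fun ω => (y ((n : ℤ) + 1) ω - predictor (fun t => x t ω) (fun t => y t ω) K n
      (κ fun t => x t ω)) ^ 2) μ ∧
    ∫ ω, (y ((n : ℤ) + 1) ω - predictor (fun t => x t ω) (fun t => y t ω) K n
      (κ fun t => x t ω)) ^ 2 ∂μ =
      ∫ ω, predErr μ x (κ fun t => x t ω) (ahat (fun t => x t ω) K n (κ fun t => x t ω)) ∂μ := by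
  have hm : Measurable fun ω => (y ((n : ℤ) + 1) ω -
      predictor (fun t => x t ω) (fun t => y t ω) K n (κ fun t => x t ω)) ^ 2 := by
    refine ((hymeas _).sub ?_).pow_const 2
    refine measurable_select (hκ.comp (measurable_pi_iff.2 M.measurable))
      (G := fun k ω => predictor (fun t => x t ω) (fun t => y t ω) K n k) fun k => ?_
    exact (measurable_dotProduct (fun i => hymeas _)
      fun i => measurable_ahat (fun t => M.measurable t) K n k i).neg
  have hl := M.lintegral_predictor_sq hymeas hy K n hκ
  have hnn : 0 ≤ᵐ[μ] fun ω => predErr μ x (κ fun t => x t ω)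
      (ahat (fun t => x t ω) K n (κ fun t => x t ω)) := ae_of_all _ fun _ => predErr_nonneg _ _
  have hnn' : 0 ≤ᵐ[μ] fun ω => (y ((n : ℤ) + 1) ω -
      predictor (fun t => x t ω) (fun t => y t ω) K n (κ fun t => x t ω)) ^ 2 :=
    ae_of_all _ fun _ => sq_nonneg _
  refine ⟨(lintegral_ofReal_ne_top_iff_integrable hm.aestronglyMeasurable hnn').1 ?_, ?_⟩
  · rw [hl]
    exact (lintegral_ofReal_ne_top_iff_integrable hi.1 hnn).2 hi
  · rw [integral_eq_lintegral_of_nonneg_ae hnn' hm.aestronglyMeasurable, hl,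
      integral_eq_lintegral_of_nonneg_ae hnn hi.1]

/-- Asymptotic efficiency of the selected order for a causal model. -/
theorem CausalModel.tendsto_loss_ratio (M : CausalModel μ σ a b e x) (hF : UniformHolderCDF μ e)
    (hK : OrderGrowth K) (hinf : {i : ℕ | a i ≠ 0}.Infinite) (kstar : ℕ → ℕ)
    (hkstar : ∀ᶠ n in atTop, IsArgmin (fun k => L μ σ a x (K n) n k) (K n) (kstar n))
    (crit : Criterion) (κ : ℕ → (ℤ → ℝ) → ℕ) (hκ : ∀ n, Measurable (κ n))
    (hsel : ∀ᶠ n in atTop, ∀ᵐ ω ∂μ,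
      IsArgmin (fun k => crit.value (fun t => x t ω) (K n) n k) (K n) (κ n fun t => x t ω)) :
    (∀ᶠ n in atTop, Integrable (fun ω => predErr μ x (κ n fun t => x t ω)
      (ahat (fun t => x t ω) (K n) n (κ n fun t => x t ω))) μ) ∧
    Tendsto (fun n => ((∫ ω, predErr μ x (κ n fun t => x t ω)
      (ahat (fun t => x t ω) (K n) n (κ n fun t => x t ω)) ∂μ) - σ ^ 2) /
        L μ σ a x (K n) n (kstar n)) atTop (𝓝 1) := by
  have hmin : ∀ᶠ n in atTop, K n < n ∧
      IsArgmin (scaledLoss μ σ a b x ((n - K n : ℕ) : ℝ)) (K n) (kstar n) := by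
    filter_upwards [hkstar, hK.eventually_sq_le] with n hn hKn
    refine ⟨hKn.1, hn.1, fun l hl => ?_⟩
    have h1 := hn.2 l hl
    have hN : (0 : ℝ) < ((n - K n : ℕ) : ℝ) := Nat.cast_pos.2 (by omega)
    simp only [M.scaledLoss_eq hKn.1] at h1
    exact (div_le_div_iff_of_pos_right hN).1 h1
  constructor
  · obtain ⟨C, -, hC⟩ := M.exists_mean_loss_bound hF hK (η := 1 / 4) (by norm_num) le_rfl
    filter_upwards [hC, hmin, hsel] with n hn hm hs
    exact (hn crit (κ n) (kstar n) (hκ n) hm.2 hs).1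
  rw [Metric.tendsto_nhds]
  intro δ hδ
  -- The relative error is at most 5η + C/D. Here 5η ≤ δ/4, and C/D < δ/2 as soon as D ≥ 4C/δ + 1,
  -- which holds for large n whatever the minimizing order.
  obtain ⟨C, hC0, hC⟩ := M.exists_mean_loss_bound hF hK (η := min (1 / 4) (δ / 20))
    (by positivity) (min_le_left _ _)
  obtain ⟨N₀, hN₀⟩ := M.exists_scaledLoss_ge hinf (4 * C / δ + 1)
  filter_upwards [hC, hmin, hsel, hK.tendsto_sub.eventually_ge_atTop N₀] with n hn hm hs hN
  have h1 := (hn crit (κ n) (kstar n) (hκ n) hm.2 hs).2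
  have hD := hN₀ _ hN (Nat.cast_nonneg _) (kstar n)
  have hNpos : (0 : ℝ) < ((n - K n : ℕ) : ℝ) := Nat.cast_pos.2 (by omega)
  rw [M.scaledLoss_eq hm.1]
  set N : ℝ := ((n - K n : ℕ) : ℝ)
  set D := scaledLoss μ σ a b x N (kstar n)
  set I := (∫ ω, predErr μ x (κ n fun t => x t ω)
      (ahat (fun t => x t ω) (K n) n (κ n fun t => x t ω)) ∂μ) - σ ^ 2
  have hD0 : 0 < D := lt_of_lt_of_le (by positivity) hD
  have hCD : C < δ / 2 * D := by
    have h2 : 4 * C / δ * δ = 4 * C := by field_simp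
    nlinarith
  have h3 : min (1 / 4) (δ / 20) * D ≤ δ / 20 * D :=
    mul_le_mul_of_nonneg_right (min_le_right _ _) hD0.le
  have h4 : I / (D / N) - 1 = (N * I - D) / D := by field_simp
  rw [Real.dist_eq, h4, abs_div, abs_of_pos hD0, div_lt_iff₀ hD0]
  nlinarith

end Efficiency

end InfAR

theorem theorem1 {Ω : Type*} [MeasurableSpace Ω] (μ : Measure Ω) [IsProbabilityMeasure μ]
    (a : ℕ → ℝ) (σ : ℝ) (e x y : ℤ → Ω → ℝ) (K : ℕ → ℕ)
    (he : InfAR.IsNoise μ σ e)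
    (hx : InfAR.IsStationary μ x)
    (hAR : InfAR.IsAutoregression μ a x e)
    (hA : ∀ z : ℂ, ‖z‖ ≤ 1 → InfAR.arSeries a z ≠ 0)
    (ha : Summable fun i : ℕ => √(i : ℝ) * |a i|)
    (hF : InfAR.UniformHolderCDF μ e)
    (hmom : InfAR.UniformMoments μ e)
    (hK : InfAR.OrderGrowth K)
    (hinf : {i : ℕ | a i ≠ 0}.Infinite)
    (hymeas : ∀ t, Measurable (y t))
    (hy : InfAR.IsIndepCopy μ x y)
    -- a minimizer of `L_n` over `{1, …, K_n}`
    (kstar : ℕ → ℕ)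
    (hkstar : ∀ᶠ n in atTop, InfAR.IsArgmin (fun k => InfAR.L μ σ a x (K n) n k) (K n) (kstar n))
    -- the selected order, a function of `x_1, …, x_n` that minimizes the criterion
    (crit : InfAR.Criterion)
    (khat : (n : ℕ) → (Fin n → ℝ) → ℕ)
    (hkhat_meas : ∀ n, Measurable (khat n))
    (hkhat : ∀ᶠ n in atTop, ∀ᵐ ω ∂μ,
      InfAR.IsArgmin (fun k => crit.value (fun t => x t ω) (K n) n k) (K n)
        (khat n fun i => x (((i : ℕ) : ℤ) + 1) ω)) :
    (∀ᶠ n : ℕ in atTop, Integrable (fun ω => (y ((n : ℤ) + 1) ω -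
        InfAR.predictor (fun t => x t ω) (fun t => y t ω) (K n) n
          (khat n fun i => x (((i : ℕ) : ℤ) + 1) ω)) ^ 2) μ) ∧
    Tendsto (fun n : ℕ =>
      ((∫ ω, (y ((n : ℤ) + 1) ω -
          InfAR.predictor (fun t => x t ω) (fun t => y t ω) (K n) n
            (khat n fun i => x (((i : ℕ) : ℤ) + 1) ω)) ^ 2 ∂μ) - σ ^ 2) /
        InfAR.L μ σ a x (K n) n (kstar n))
      atTop (𝓝 1) := by
  obtain ⟨b, M, hX⟩ := InfAR.exists_causal he hmom (hF.sigma_pos he) hx hAR hA ha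
  -- The process is replaced by its moving average version, equal to it at all times off one null
  -- set. The selected order becomes a function of the whole path that reads only the coordinates 1,
  -- …, n; indices of `Fin n` start at 0, hence the shift by one.
  set X := InfAR.filt b e
  set κ : ℕ → (ℤ → ℝ) → ℕ := fun n p => khat n fun i => p (((i : ℕ) : ℤ) + 1) with hκdef
  have hκ : ∀ n, Measurable (κ n) := fun n =>
    (hkhat_meas n).comp (measurable_pi_iff.2 fun i => measurable_pi_apply _)
  have hyX := hy.congr hx.measurable hX
  have hLX := fun n k => InfAR.L_congr (σ := σ) (a := a) hX (K n) n k
  have hsel : ∀ᶠ n in atTop, ∀ᵐ ω ∂μ,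
      InfAR.IsArgmin (fun k => crit.value (fun t => X t ω) (K n) n k) (K n)
        (κ n fun t => X t ω) := by
    filter_upwards [hkhat] with n hn
    filter_upwards [hn, hX] with ω hω hXω
    simpa only [hXω] using hω
  have hstar : ∀ᶠ n in atTop, InfAR.IsArgmin (fun k => InfAR.L μ σ a X (K n) n k) (K n)
      (kstar n) := by
    filter_upwards [hkstar] with n hn
    simpa only [hLX] using hn
  obtain ⟨hint, hlim⟩ := M.tendsto_loss_ratio hF hK hinf kstar hstar crit κ hκ hsel
  have hae : ∀ n : ℕ, (fun ω => (y ((n : ℤ) + 1) ω -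
      InfAR.predictor (fun t => x t ω) (fun t => y t ω) (K n) n
        (khat n fun i => x (((i : ℕ) : ℤ) + 1) ω)) ^ 2) =ᵐ[μ] fun ω => (y ((n : ℤ) + 1) ω -
      InfAR.predictor (fun t => X t ω) (fun t => y t ω) (K n) n (κ n fun t => X t ω)) ^ 2 := by
    intro n
    filter_upwards [hX] with ω hω
    simp only [hω, hκdef]
  constructor
  · filter_upwards [hint] with n hn
    exact (M.integral_predictor_eq hymeas hyX (K n) n (hκ n) hn).1.congr (hae n).symm
  · refine hlim.congr' ?_
    filter_upwards [hint] with n hn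
    rw [integral_congr_ae (hae n), (M.integral_predictor_eq hymeas hyX (K n) n (hκ n) hn).2, hLX]
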